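/- \textbf{Setting.} Let $Q$ be a smooth compact oriented manifold with boundary, of dimension $n\ge 1$, with a fixed compatible metric. Let $\mathscr P$ be a finite smooth triangulation of $Q$ with totally ordered vertices, for which $\partial Q$ is a subcomplex. Let $\check{\mathscr P}$ be a smooth cellular subdivision of $Q$ dual to $\mathscr P$. This means: each $k$-simplex $\sigma=[v_0<\dots<v_k]$ has a dual cell $\check\sigma$ of codimension $k$, a closed ball, which is the intersection of the top-dimensional cells dual to $v_0,\dots,v_k$; near the points that lie in exactly these top-dimensional cells, $\check{\mathscr P}$ is modelled, transversely to $\partial Q$, on the product of $\check\sigma$ with the subdivision $\Pi^k$ of $\mathbb R^k$ into the cells $\{x_j=\max(x_0,\dots,x_k)\}$, $x_0:=0$, dual to $v_j$; $\check\sigma$ meets $\sigma$ transversely in one point and meets no simplex that does not contain $\sigma$. Let $\Pi^k(r)$ be the translate of $\Pi^k$ by $(-r/k,\dots,-r/2,-r)$. \emph{Close subdivisions.} A subdivision is $C^1$-close to $\check{\mathscr P}$ if it is the image of $\check{\mathscr P}$ under a diffeomorphism of $Q$ in a fixed sufficiently small $C^1$-neighbourhood of the identity; the cell corresponding to $\check\sigma$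 is still called dual to $\sigma$. For a fixed sufficiently small $\epsilon>0$, two such subdivisions $(\check{\mathscr P}_0,\check{\mathscr P}_1)$ are in simplicial position if, for every cell $C$ of $\check{\mathscr P}$, of codimension $d$, there are an open subset $U$ of the set of points of $C$ that lie in no smaller dual cell, a number $r>0$, and a chart $U\times\mathbb R^d\to Q$ whose domain and image both contain the part of $C$ at distance at least $\epsilon$ from $\partial C$, taking $U\times\Pi^d$ to $\check{\mathscr P}_0$ and $U\times\Pi^d(r)$ to $\check{\mathscr P}_1$ compatibly with the labelling by vertices, such that the images of these charts cover $Q$. \emph{Chains and products.} $C_*(\check{\mathscr P}_0)$ is the complex generated by the orientation lines of the cells dual to simplices of $\mathscr P$, with the boundary operator given by restriction of orientations to those facets that are dual to simplices. If $(\check{\mathscr P}_0,\check{\mathscr P}_1)$ are in simplicial position, the oriented intersection of cells is a product $C_{n-i}(\check{\mathscr P}_0)\otimes C_{n-j}(\check{\mathscr P}_1)\to C_{n-i-j}(\check{\mathscr P}_0\Cap\check{\mathscr P}_1)$, where $\check{\mathscr P}_0\Cap\check{\mathscr P}_1$ consists of the intersections of cells; the collapse $\mathrm{coll}: C_*(\check{\mathscr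 P}_0\Cap\check{\mathscr P}_1)\to C_*(\check{\mathscr P}_1)$ takes the intersection of the cells dual to $\sigma$ and $\tau$ to the cell of $\check{\mathscr P}_1$ dual to the simplex spanned by $\sigma\cup\tau$, with the orientation obtained by translation in the charts, and to $0$ if that cell has smaller dimension. \emph{The two pre-categories.} For $H:\partial Q\to\mathbb R$ let $\partial^+_H\mathscr P$ be the subcomplex formed by the simplices of $\partial Q$ on which $H$ takes some positive value, and their faces. For a close subdivision $\check{\mathscr P}_1$ let $\partial^+_H\check{\mathscr P}_1$ be the set of its cells which meet a simplex of $\partial^+_H\mathscr P$. \begin{itemize} \item $\mathrm{Simp}(\mathscr P)$: the objects are the functions $H:\partial Q\to\mathbb R$. A sequence is transverse if, for $i<j$ and $H=H_j-H_i$, the set $H^{-1}([0,\infty))$ is a deformation retract of $\partial^+_H\mathscr P$. The morphisms $H_0\to H_1$ are the cochains $C^*(\mathscr P,\partial^+_{H_1-H_0}\mathscr P)$ with values in $\mathbb Z$. The products are $\mu_1=\delta$, $\mu_2(b,a)=(-1)^{\deg a}\,a\cup b$ and $\mu_d=0$ for $d\ge3$. \item $\mathrm{Cell}(\check{\mathscr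 P})$: the objects are the pairs $(\check{\mathscr P}_0,H_0)$ of a subdivision $C^1$-close to $\check{\mathscr P}$ and a function $H_0:\partial Q\to\mathbb R$. A sequence is transverse if $(\check{\mathscr P}_i,\check{\mathscr P}_j)$ is in simplicial position for all $i<j$ and $(H_i)$ is transverse in $\mathrm{Simp}(\mathscr P)$. The morphisms from $(\check{\mathscr P}_0,H_0)$ to $(\check{\mathscr P}_1,H_1)$ of degree $k$ are $C_{n-k}(\check{\mathscr P}_1-\partial^+_{H_1-H_0}\check{\mathscr P}_1)$, the chains of dimension $n-k$ without cells of $\partial^+_{H_1-H_0}\check{\mathscr P}_1$. The products are $\mu_1a=(-1)^{\deg a+1}\partial a$, $\mu_2(b,a)=(-1)^{\deg a}\,\mathrm{coll}(a\cap b)$ and $\mu_d=0$ for $d\ge3$. \end{itemize} \textbf{Proposition.} $\mathrm{Simp}(\mathscr P)$ and $\mathrm{Cell}(\check{\mathscr P})$ are $A_\infty$ pre-categories, and the forgetful map $(\check{\mathscr P}_0,H_0)\mapsto H_0$ extends to an $A_\infty$ functor $F:\mathrm{Cell}(\check{\mathscr P})\to\mathrm{Simp}(\mathscr P)$ which is a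 quasi-equivalence: it induces isomorphisms on the homology of the morphisms between transverse objects, and every object of $\mathrm{Simp}(\mathscr P)$ is quasi-isomorphic to one in its image. More precisely, $F^d=0$ for $d\ge2$, and $F^1$ takes a cellular chain to the dual cochain, whose value on $\sigma$ is the coefficient of the cell dual to $\sigma$, oriented by the orientation of $Q$ and the ordering of the vertices of $\sigma$. $F^1$ is bijective on the morphisms of each degree between transverse objects. For a transverse triple and homogeneous morphisms $a$ from the first object to the second and $b$ from the second to the third, $F^1(\mathrm{coll}(a\cap b))=F^1(a)\cup F^1(b)$. -/

import Mathlib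

open Set Filter Topology
open scoped Manifold ContDiff

noncomputable section

set_option linter.checkUnivs false
set_option linter.unusedSectionVars false

/-! ### A∞ pre-categories -/

universe u v u' v'

/-- The data of an A∞ pre-category.  The graded group of morphisms from `X` to `Y` is the sum of
the subgroups `gr X Y k` (morphisms of degree `k`) of the group `Hom X Y`.  Only its values on
transverse sequences carry information.  Composable morphisms are listed as
`a₁ : X₀ ⟶ X₁, …, a_d : X_{d-1} ⟶ X_d`, and `μ (a₁, …, a_d)` is the product which is usually
written `μ_d (a_d, …, a₁)`. -/
structure AInftyHoms where
  Ob : Type u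
  Hom : Ob → Ob → Type v
  grp : ∀ X Y, AddCommGroup (Hom X Y)
  gr : ∀ X Y, ℤ → AddSubgroup (Hom X Y)
  Transverse : List Ob → Prop

instance (A : AInftyHoms.{u, v}) (X Y : A.Ob) : AddCommGroup (A.Hom X Y) := A.grp X Y

/-- Finite sequences of composable morphisms. -/
inductive Comp (A : AInftyHoms.{u, v}) : A.Ob → A.Ob → Type (max u v)
  | nil (X : A.Ob) : Comp A X X
  | cons {X Y Z : A.Ob} (f : A.Hom X Y) (p : Comp A Y Z) : Comp A X Z

namespace Comp

variable {A : AInftyHoms.{u, v}}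

def length : ∀ {X Y : A.Ob}, Comp A X Y → ℕ
  | _, _, nil _ => 0
  | _, _, cons _ p => p.length + 1

/-- The sequence `(X₀, …, X_d)` of objects. -/
def verts : ∀ {X Y : A.Ob}, Comp A X Y → List A.Ob
  | _, _, nil X => [X]
  | X, _, cons _ p => X :: p.verts

def append : ∀ {X Y Z : A.Ob}, Comp A X Y → Comp A Y Z → Comp A X Z
  | _, _, _, nil _, q => q
  | _, _, _, cons f p, q => cons f (p.append q)

/-- The `i`-th entry is homogeneous of degree the `i`-th entry of the list. -/
def HasDegrees : ∀ {X Y : A.Ob}, Comp A X Y → List ℤ → Prop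
  | _, _, nil _, ks => ks = []
  | _, _, cons _ _, [] => False
  | _, _, cons f p, k :: ks => f ∈ A.gr _ _ k ∧ p.HasDegrees ks

/-- All entries are morphisms, i.e. sums of homogeneous morphisms. -/
def IsMor : ∀ {X Y : A.Ob}, Comp A X Y → Prop
  | _, _, nil _ => True
  | _, _, cons f p => f ∈ (⨆ k, A.gr _ _ k) ∧ p.IsMor

/-- All ways to cut a sequence in two (possibly empty) pieces. -/
def splits : ∀ {X Z : A.Ob}, Comp A X Z → List (Σ Y : A.Ob, Comp A X Y × Comp A Y Z)
  | _, _, nil X => [⟨X, nil X, nil X⟩]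
  | X, _, cons f p =>
      ⟨X, nil X, cons f p⟩ :: p.splits.map fun s => ⟨s.1, cons f s.2.1, s.2.2⟩

/-- `(-1)` to the power `∑_{j ≤ i} (deg a_j + 1)`, for the list of degrees. -/
def sign (ks : List ℤ) (i : ℕ) : ℤ := (((ks.take i).map (· + 1)).sum.negOnePow : ℤˣ)

/-- For operations `μ` and `T` on sequences of composable morphisms, the sum
`∑ (-1)^{✠_i} T (1 ⊗ ⋯ ⊗ μ ⊗ ⋯ ⊗ 1)` over all insertions of `μ` in a non-empty block of
consecutive entries, evaluated on a sequence `w` with degrees `ks`. -/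
def insertSum {G : Type*} [AddCommGroup G] (μ : ∀ {X Y : A.Ob}, Comp A X Y → A.Hom X Y)
    {X Z : A.Ob} (T : Comp A X Z → G) (w : Comp A X Z) (ks : List ℤ) : G :=
  (w.splits.map fun s =>
    (s.2.2.splits.map fun t =>
      if t.2.1.length = 0 then 0
      else sign ks s.2.1.length • T (s.2.1.append (cons (μ t.2.1) t.2.2))).sum).sum

end Comp

/-- The data of an A∞ pre-category: objects, transverse sequences, graded morphisms, products.
The value of `μ` on an empty sequence is irrelevant. -/
structure AInftyData extends AInftyHoms.{u, v} where
  μ : ∀ {X Y : Ob}, Comp toAInftyHoms X Y → Hom X Y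

/-- The conditions for the data to form an A∞ pre-category. -/
structure AInftyData.IsPrecategory (A : AInftyData.{u, v}) : Prop where
  transverse_sublist : ∀ l l' : List A.Ob, A.Transverse l → l'.Sublist l → A.Transverse l'
  direct : ∀ X Y : A.Ob, A.Transverse [X, Y] → iSupIndep (A.gr X Y)
  multilinear : ∀ {X Y Z W : A.Ob} (p : Comp A.toAInftyHoms X Y) (f g : A.Hom Y Z)
    (q : Comp A.toAInftyHoms Z W), A.Transverse (p.append (.cons f q)).verts →
    (p.append (.cons f q)).IsMor → (p.append (.cons g q)).IsMor →
    A.μ (p.append (.cons (f + g) q)) = A.μ (p.append (.cons f q)) + A.μ (p.append (.cons g q))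
  degree : ∀ {X Y : A.Ob} (w : Comp A.toAInftyHoms X Y) (ks : List ℤ), A.Transverse w.verts →
    0 < w.length → w.HasDegrees ks → A.μ w ∈ A.gr X Y (ks.sum + 2 - w.length)
  ainfty : ∀ {X Y : A.Ob} (w : Comp A.toAInftyHoms X Y) (ks : List ℤ), A.Transverse w.verts →
    0 < w.length → w.HasDegrees ks → Comp.insertSum A.μ A.μ w ks = 0

/-- The differential `μ₁`. -/
def AInftyData.d (A : AInftyData.{u, v}) {X Y : A.Ob} (a : A.Hom X Y) : A.Hom X Y :=
  A.μ (.cons a (.nil Y))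

/-- A map `f` from the morphisms `X ⟶ Y` of `A` to the morphisms `X' ⟶ Y'` of `B` induces an
isomorphism in every degree of homology. -/
def InducesIsoOnHomology (A : AInftyData.{u, v}) (B : AInftyData.{u', v'}) {X Y : A.Ob}
    {X' Y' : B.Ob} (f : A.Hom X Y → B.Hom X' Y') : Prop :=
  ∀ k : ℤ,
    (∀ a ∈ A.gr X Y k, A.d a = 0 → (∃ b ∈ B.gr X' Y' (k - 1), B.d b = f a) →
      ∃ c ∈ A.gr X Y (k - 1), A.d c = a) ∧
    (∀ b ∈ B.gr X' Y' k, B.d b = 0 →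
      ∃ a ∈ A.gr X Y k, A.d a = 0 ∧ ∃ c ∈ B.gr X' Y' (k - 1), B.d c = f a - b)

/-- A quasi-isomorphism `X ⟶ Y`: a closed morphism of degree `0` between transverse objects,
composition with which on either side induces isomorphisms on homology. -/
def AInftyData.IsQuasiIso (A : AInftyData.{u, v}) {X Y : A.Ob} (f : A.Hom X Y) : Prop :=
  A.Transverse [X, Y] ∧ f ∈ A.gr X Y 0 ∧ A.d f = 0 ∧
  (∀ Z, A.Transverse [X, Y, Z] →
    InducesIsoOnHomology A A fun g : A.Hom Y Z => A.μ (.cons f (.cons g (.nil Z)))) ∧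
  (∀ Z, A.Transverse [Z, X, Y] →
    InducesIsoOnHomology A A fun g : A.Hom Z X => A.μ (.cons g (.cons f (.nil Y))))

/-- Objects are quasi-isomorphic if they are related by a chain of quasi-isomorphisms. -/
def AInftyData.QuasiIsomorphic (A : AInftyData.{u, v}) : A.Ob → A.Ob → Prop :=
  Relation.EqvGen fun X Y => ∃ f : A.Hom X Y, A.IsQuasiIso f

/-- The full sub-pre-category on a set of objects. -/
def AInftyHoms.full (A : AInftyHoms.{u, v}) (S : Set A.Ob) : AInftyHoms.{u, v} where
  Ob := S
  Hom X Y := A.Hom X Y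
  grp X Y := A.grp X Y
  gr X Y := A.gr X Y
  Transverse l := A.Transverse (l.map Subtype.val)

def Comp.forget {A : AInftyHoms.{u, v}} {S : Set A.Ob} :
    ∀ {X Y : (A.full S).Ob}, Comp (A.full S) X Y → Comp A X.1 Y.1
  | _, _, .nil X => .nil X.1
  | _, _, .cons f p => .cons (A := A) f p.forget

def AInftyData.full (A : AInftyData.{u, v}) (S : Set A.Ob) : AInftyData.{u, v} where
  toAInftyHoms := A.toAInftyHoms.full S
  μ w := A.μ w.forget

/-- A map of objects together with operations `map (a₁, …, a_d) = F^d (a_d, …, a₁)`. -/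
structure AInftyMap (A : AInftyData.{u, v}) (B : AInftyData.{u', v'}) where
  obj : A.Ob → B.Ob
  map : ∀ {X Y : A.Ob}, Comp A.toAInftyHoms X Y → B.Hom (obj X) (obj Y)

namespace AInftyMap

variable {A : AInftyData.{u, v}} {B : AInftyData.{u', v'}} (F : AInftyMap A B)

/-- All sequences `(F (b₁), …, F (b_k))`, where `(b₁, …, b_k)` is a decomposition of `acc ++ p`
into non-empty consecutive blocks, the first of which contains `acc`. -/
def blocksFrom : ∀ {X Y Z : A.Ob}, Comp A.toAInftyHoms X Y → Comp A.toAInftyHoms Y Z →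
    List (Comp B.toAInftyHoms (F.obj X) (F.obj Z))
  | _, _, _, acc, .nil _ => [.cons (F.map acc) (.nil _)]
  | _, _, _, acc, .cons f p =>
      blocksFrom (acc.append (.cons f (.nil _))) p ++
        (blocksFrom (.cons f (.nil _)) p).map (.cons (F.map acc))

/-- All sequences `(F (b₁), …, F (b_k))` for decompositions of a non-empty sequence `w` into
non-empty blocks. -/
def blocks : ∀ {X Y : A.Ob}, Comp A.toAInftyHoms X Y →
    List (Comp B.toAInftyHoms (F.obj X) (F.obj Y))
  | _, _, .nil _ => []
  | _, _, .cons f p => F.blocksFrom (.cons f (.nil _)) p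

/-- The conditions on the data of an A∞ functor which is defined on all objects. -/
structure IsFunctor : Prop where
  transverse : ∀ l : List A.Ob, A.Transverse l → B.Transverse (l.map F.obj)
  multilinear : ∀ {X Y Z W : A.Ob} (p : Comp A.toAInftyHoms X Y) (f g : A.Hom Y Z)
    (q : Comp A.toAInftyHoms Z W), A.Transverse (p.append (.cons f q)).verts →
    (p.append (.cons f q)).IsMor → (p.append (.cons g q)).IsMor →
    F.map (p.append (.cons (f + g) q)) = F.map (p.append (.cons f q)) + F.map (p.append (.cons g q))
  degree : ∀ {X Y : A.Ob} (w : Comp A.toAInftyHoms X Y) (ks : List ℤ), A.Transverse w.verts →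
    0 < w.length → w.HasDegrees ks →
    F.map w ∈ B.gr (F.obj X) (F.obj Y) (ks.sum + 1 - w.length)
  ainfty : ∀ {X Y : A.Ob} (w : Comp A.toAInftyHoms X Y) (ks : List ℤ), A.Transverse w.verts →
    0 < w.length → w.HasDegrees ks →
    ((F.blocks w).map B.μ).sum = Comp.insertSum A.μ F.map w ks

end AInftyMap

/-- The data of an A∞ functor from `A` to `B`, defined on the full sub-pre-category with set of
objects `dom`. -/
structure AInftyFunctorData (A : AInftyData.{u, v}) (B : AInftyData.{u', v'}) where
  dom : Set A.Ob
  toMap : AInftyMap (A.full dom) B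

/-- An A∞ functor: the inclusion of its domain is essentially surjective. -/
structure AInftyFunctorData.IsFunctor {A : AInftyData.{u, v}} {B : AInftyData.{u', v'}}
    (F : AInftyFunctorData A B) : Prop where
  essSurj_dom : ∀ X : A.Ob, ∃ Y ∈ F.dom, A.QuasiIsomorphic X Y
  isFunctor : F.toMap.IsFunctor

/-- A quasi-equivalence: an A∞ functor which induces an equivalence of homology categories,
i.e. isomorphisms on the homology of the morphisms between transverse objects, and whose image
meets every quasi-isomorphism class of objects. -/
structure AInftyFunctorData.IsQuasiEquivalence {A : AInftyData.{u, v}} {B : AInftyData.{u', v'}}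
    (F : AInftyFunctorData A B) : Prop extends F.IsFunctor where
  quasiIso : ∀ X Y : (A.full F.dom).Ob, (A.full F.dom).Transverse [X, Y] →
    InducesIsoOnHomology (A.full F.dom) B
      fun a : (A.full F.dom).Hom X Y => F.toMap.map (.cons a (.nil Y))
  essSurj : ∀ Y : B.Ob, ∃ X : (A.full F.dom).Ob, B.QuasiIsomorphic (F.toMap.obj X) Y

/-! ### Subsets of a manifold with boundary: tangent spaces and orientations -/

section Geometry

variable {n : ℕ} [NeZero n] {Q : Type u} [MetricSpace Q] [ChartedSpace (EuclideanHalfSpace n) Q]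

/-- The tangent space at `p` of a subset `S`: the common kernel of the differentials at `p` of the
smooth germs which vanish on `S`.  At points where `S` is a smooth submanifold (possibly with
boundary) this is its usual tangent space. -/
def tangentAt (n : ℕ) [NeZero n] [ChartedSpace (EuclideanHalfSpace n) Q] (S : Set Q) (p : Q) :
    Submodule ℝ (TangentSpace (𝓡∂ n) p) where
  carrier := {w | ∀ f : Q → ℝ, ContMDiffAt (𝓡∂ n) 𝓘(ℝ, ℝ) ∞ f p →
    (∀ᶠ q in 𝓝[S] p, f q = 0) → mfderiv (𝓡∂ n) 𝓘(ℝ, ℝ) f p w = 0}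
  add_mem' := fun ha hb f hf h0 => by rw [map_add, ha f hf h0, hb f hf h0, add_zero]
  zero_mem' := fun f _ _ => map_zero _
  smul_mem' := fun c w hw f hf h0 => by rw [map_smul, hw f hf h0, smul_zero]

/-- `w` points out of `S` at `p` (weakly): no smooth germ which is non-negative on `S` and zero at
`p` increases in the direction of `w`. -/
def PointsOutward (S : Set Q) (p : Q) (w : TangentSpace (𝓡∂ n) p) : Prop :=
  ∀ f : Q → ℝ, ContMDiffAt (𝓡∂ n) 𝓘(ℝ, ℝ) ∞ f p → (∀ᶠ q in 𝓝[S] p, 0 ≤ f q) → f p = 0 →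
    @LE.le ℝ _ (mfderiv (𝓡∂ n) 𝓘(ℝ, ℝ) f p w) 0

/-- The vectors `X 0, …, X (m - 1)` form a basis of `T` whose orientation is `s` times `o`. -/
def HasSign {p : Q} {T : Submodule ℝ (TangentSpace (𝓡∂ n) p)} {m : ℕ}
    (o : Orientation ℝ T (Fin m)) (X : ℕ → TangentSpace (𝓡∂ n) p) (s : ℤˣ) : Prop :=
  ∃ b : Module.Basis (Fin m) ℝ T, (∀ i, (b i : TangentSpace (𝓡∂ n) p) = X i) ∧
    b.orientation = if s = 1 then o else -o

variable [IsManifold (𝓡∂ n) ∞ Q]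

/-- The orientations of an `m`-dimensional cell `S` with interior `S'`: orientations of its tangent
spaces at the points of `S'` which, near every point, have constant sign on a continuous frame. -/
structure CellOrientation (n : ℕ) [NeZero n] [ChartedSpace (EuclideanHalfSpace n) Q]
    [IsManifold (𝓡∂ n) ∞ Q] (S S' : Set Q) (m : ℕ) where
  at' : ∀ p : S', Orientation ℝ (tangentAt n S p.1) (Fin m)
  coherent : ∀ p : S', ∃ s : ℤˣ, ∃ U ∈ 𝓝 p.1, ∃ X : ℕ → ∀ q : Q, TangentSpace (𝓡∂ n) q,
    (∀ i < m, ContinuousOn (fun q => (⟨q, X i q⟩ : TangentBundle (𝓡∂ n) Q)) (U ∩ S')) ∧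
    ∀ q : S', q.1 ∈ U → HasSign (at' q) (fun i => X i q) s


theorem HasSign.neg {p : Q} {T : Submodule ℝ (TangentSpace (𝓡∂ n) p)} {m : ℕ}
    {o : Orientation ℝ T (Fin m)} {X : ℕ → TangentSpace (𝓡∂ n) p} {s : ℤˣ}
    (h : HasSign o X s) : HasSign (-o) X (-s) := by
  obtain ⟨b, hb, ho⟩ := h
  refine ⟨b, hb, ?_⟩
  rcases Int.units_eq_one_or s with rfl | rfl
  · rw [ho, if_pos rfl, if_neg (by decide)]
    exact (neg_neg (G := Orientation ℝ T (Fin m)) o).symm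
  · rw [ho, if_neg (by decide), if_pos (by decide)]

/-- The opposite orientation. -/
instance {S S' : Set Q} {m : ℕ} : InvolutiveNeg (CellOrientation n S S' m) where
  neg o := ⟨fun p => -o.at' p, fun p => by
    obtain ⟨s, U, hU, X, hX, h⟩ := o.coherent p
    exact ⟨-s, U, hU, X, hX, fun q hq => (h q hq).neg⟩⟩
  neg_neg o := by
    cases o
    congr
    funext p
    exact neg_neg (G := Orientation ℝ (tangentAt n S p.1) (Fin m)) _

theorem CellOrientation.neg_at {S S' : Set Q} {m : ℕ} (o : CellOrientation n S S' m) (p : S') :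
    (-o).at' p = -o.at' p := rfl

/-- The orientation line `ℤ · Ω(C)` of a cell: the group generated by its orientations, subject to
the relation that opposite orientations are opposite to each other.  An element is recorded by its
coefficients with respect to all orientations. -/
def OrientationLine (n : ℕ) [NeZero n] [ChartedSpace (EuclideanHalfSpace n) Q]
    [IsManifold (𝓡∂ n) ∞ Q] (S S' : Set Q) (m : ℕ) :
    AddSubgroup (CellOrientation n S S' m → ℤ) where
  carrier := {f | ∀ o, f (-o) = -f o}
  add_mem' := fun ha hb o => by
    simp only [Pi.add_apply, ha o, hb o]; ring
  zero_mem' := fun o => by simp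
  neg_mem' := fun ha o => by simp only [Pi.neg_apply, ha o]

theorem finsum_odd {S S' : Set Q} {m : ℕ} (R R' : CellOrientation n S S' m → Prop)
    (hR : ∀ o, R' o ↔ R (-o)) (f : CellOrientation n S S' m → ℤ) (hf : ∀ o, f (-o) = -f o) :
    ∑ᶠ (o) (_ : R' o), f o = -∑ᶠ (o) (_ : R o), f o := by
  rw [← finsum_neg_distrib, ← finsum_comp_equiv (Equiv.neg (CellOrientation n S S' m))]
  refine finsum_congr fun o => ?_
  by_cases h : R o
  · have h' : R' (-o) := (hR _).2 (by rwa [neg_neg])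
    simp [h, h', hf]
  · have h' : ¬ R' (-o) := fun h' => h (by have := (hR _).1 h'; rwa [neg_neg] at this)
    simp [h, h']

/-! ### Triangulations and dual subdivisions -/

variable {V : Type v} [Fintype V] [LinearOrder V]

/-- The closed simplex with vertex set `σ` in the space of barycentric coordinates. -/
def stdCell (σ : Finset V) : Set (V → ℝ) :=
  {x | (∀ v, 0 ≤ x v) ∧ ∑ v, x v = 1 ∧ ∀ v ∉ σ, x v = 0}

/-- A smooth triangulation of `Q`, with vertices indexed by the totally ordered set `V`, for which
`∂Q` is a subcomplex: a bijection from the geometric realization of a simplicial complex, which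
is a smooth immersion of every closed simplex. -/
structure SmoothTriangulation (n : ℕ) [NeZero n] (Q : Type u) [MetricSpace Q]
    [ChartedSpace (EuclideanHalfSpace n) Q] (V : Type v) [Fintype V] [LinearOrder V] where
  complex : AbstractSimplicialComplex V
  real : (V → ℝ) → Q
  bijOn : BijOn real (⋃ σ ∈ complex.faces, stdCell σ) univ
  smooth : ∀ σ ∈ complex.faces, ContMDiffOn 𝓘(ℝ, V → ℝ) (𝓡∂ n) ∞ real (stdCell σ)
  immersion : ∀ σ ∈ complex.faces, ∀ x ∈ stdCell σ,
    ∀ L : TangentSpace 𝓘(ℝ, V → ℝ) x →L[ℝ] TangentSpace (𝓡∂ n) (real x),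
    HasMFDerivWithinAt 𝓘(ℝ, V → ℝ) (𝓡∂ n) real (stdCell σ) x L →
    ∀ w : V → ℝ, ∑ v, w v = 0 → (∀ v ∉ σ, w v = 0) → L w = 0 → w = 0
  boundary : ∀ p ∈ (𝓡∂ n).boundary Q, ∃ σ ∈ complex.faces,
    p ∈ real '' stdCell σ ∧ real '' stdCell σ ⊆ (𝓡∂ n).boundary Q

/-- The closed cell of the triangulation with vertex set `σ`. -/
def SmoothTriangulation.cell (P : SmoothTriangulation n Q V) (σ : Finset V) : Set Q :=
  P.real '' stdCell σ

/-- The dimension of the simplex `σ`, which is the codimension of the dual cell. -/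
def codim (σ : Finset V) : ℕ := σ.card - 1

/-- The position of the vertex `v` in the ordered simplex `σ = [v₀, …, v_d]`. -/
def position (σ : Finset V) (v : V) : ℕ := (σ.filter (· < v)).card

/-- The top-dimensional cells of the subdivision `Π^d` of `ℝ^d`: with the convention `x₀ = 0`, the
set of points where `x_j` is maximal among `x₀, x₁, …, x_d`. -/
def modelCell {d : ℕ} (j : Fin (d + 1)) : Set (Fin d → ℝ) :=
  {x | ∀ i : Fin (d + 1), (Fin.cons 0 x : Fin (d + 1) → ℝ) i ≤ (Fin.cons 0 x : Fin (d + 1) → ℝ) j}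

/-- The vector `(-r/d, …, -r/2, -r)`. -/
def modelShift (d : ℕ) (r : ℝ) : Fin d → ℝ := fun i => -r / ((d : ℝ) - (i : ℕ))

/-- The top-dimensional cells of the translate `Π^d(r)` of `Π^d`; for `r = 0` those of `Π^d`. -/
def shiftedModelCell {d : ℕ} (r : ℝ) (j : Fin (d + 1)) : Set (Fin d → ℝ) :=
  {x | x - modelShift d r ∈ modelCell j}

/-! A subdivision whose top-dimensional cells correspond to the vertices of a triangulation is
recorded by the family `D : V → Set Q` of its top-dimensional cells. -/

/-- The cell dual to the simplex `σ`. -/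
def dualCell (D : V → Set Q) (σ : Finset V) : Set Q := ⋂ v ∈ σ, D v

/-- The points which lie in the top-dimensional cells dual to the vertices of `σ` and in no other
top-dimensional cell. -/
def stratum (D : V → Set Q) (σ : Finset V) : Set Q := {p | ∀ v, p ∈ D v ↔ v ∈ σ}

/-- The interior of the cell dual to `σ`; its complement in the cell is the boundary of the cell,
which includes the points on `∂Q`. -/
def openCell (n : ℕ) [NeZero n] [ChartedSpace (EuclideanHalfSpace n) Q] (D : V → Set Q)
    (σ : Finset V) : Set Q := stratum D σ ∩ (𝓡∂ n).interior Q

/-- On `O`, the subdivision `D` is the preimage under `y` of the subdivision `Π^d(r)`, the cell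
where `x_j` is maximal corresponding to the `j`-th vertex of `σ`. -/
def IsModelledOn (D : V → Set Q) (σ : Finset V) (O : Set Q) (y : Q → Fin (codim σ) → ℝ)
    (r : ℝ) : Prop :=
  ∀ q ∈ O, ∀ v, q ∈ D v ↔ v ∈ σ ∧ ∃ j : Fin (codim σ + 1), (j : ℕ) = position σ v ∧
    y q ∈ shiftedModelCell r j

/-- A smooth map `y`, submersive at `p`, which exhibits `D` near `p` as the preimage of `Π^d`. -/
structure IsLocalModel (n : ℕ) [NeZero n] [ChartedSpace (EuclideanHalfSpace n) Q]
    (D : V → Set Q) (σ : Finset V) (p : Q) (O : Set Q) (y : Q → Fin (codim σ) → ℝ) : Prop where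
  isOpen : IsOpen O
  mem : p ∈ O
  smooth : ContMDiffOn (𝓡∂ n) 𝓘(ℝ, Fin (codim σ) → ℝ) ∞ y O
  submersion : Function.Surjective (mfderiv (𝓡∂ n) 𝓘(ℝ, Fin (codim σ) → ℝ) y p)
  model : IsModelledOn D σ O y 0

/-- `D` is (the family of top-dimensional cells of) a smooth cellular subdivision of `Q` dual to
the triangulation `P`. -/
structure IsDualSubdivision (P : SmoothTriangulation n Q V) (D : V → Set Q) : Prop where
  isClosed : ∀ v, IsClosed (D v)
  /-- every point lies in the open stratum of the cell dual to some simplex -/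
  exists_stratum : ∀ p, ∃ σ ∈ P.complex.faces, p ∈ stratum D σ
  /-- near the cell dual to a `d`-simplex, and transversely to `∂Q`, the subdivision is smoothly
  modelled on `Π^d` -/
  localModel : ∀ σ ∈ P.complex.faces, ∀ p ∈ stratum D σ, ∃ O y, IsLocalModel n D σ p O y ∧
    (p ∈ (𝓡∂ n).boundary Q → ∀ w, ∃ u ∈ tangentAt n ((𝓡∂ n).boundary Q) p,
      mfderiv (𝓡∂ n) 𝓘(ℝ, Fin (codim σ) → ℝ) y p u = w)
  /-- the cells are balls -/
  ball : ∀ σ ∈ P.complex.faces,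
    ∃ h : Metric.closedBall (0 : EuclideanSpace ℝ (Fin (n - codim σ))) 1 ≃ₜ dualCell D σ,
      ∀ x, (h x).1 ∈ openCell n D σ ↔ x.1 ∈ Metric.ball 0 1
  /-- a dual cell meets only those simplices which have the simplex dual to it as a face -/
  subset_of_meets : ∀ σ ∈ P.complex.faces, ∀ τ ∈ P.complex.faces,
    (dualCell D τ ∩ P.cell σ).Nonempty → τ ⊆ σ
  /-- a simplex meets the cell dual to it in one point, transversely -/
  transverse : ∀ σ ∈ P.complex.faces, ∃ x ∈ stdCell σ, dualCell D σ ∩ P.cell σ = {P.real x} ∧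
    ∀ L : TangentSpace 𝓘(ℝ, V → ℝ) x →L[ℝ] TangentSpace (𝓡∂ n) (P.real x),
    HasMFDerivWithinAt 𝓘(ℝ, V → ℝ) (𝓡∂ n) P.real (stdCell σ) x L →
    ∀ w : V → ℝ, ∑ v, w v = 0 → (∀ v ∉ σ, w v = 0) →
      L w ∈ tangentAt n (dualCell D σ) (P.real x) → w = 0

/-! ### The C¹ topology and simplicial position -/

/-- The `C¹` topology on the group of diffeomorphisms of `Q`: the compact-open topology on the
tangent maps of a diffeomorphism and of its inverse. -/
@[reducible]
def c1Topology (n : ℕ) [NeZero n] (Q : Type u) [MetricSpace Q]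
    [ChartedSpace (EuclideanHalfSpace n) Q] [IsManifold (𝓡∂ n) ∞ Q] :
    TopologicalSpace (Q ≃ₘ^∞⟮𝓡∂ n, 𝓡∂ n⟯ Q) :=
  TopologicalSpace.induced
    (fun φ : Q ≃ₘ^∞⟮𝓡∂ n, 𝓡∂ n⟯ Q =>
      ((⟨tangentMap (𝓡∂ n) (𝓡∂ n) φ, φ.contMDiff_toFun.continuous_tangentMap (by simp)⟩,
        ⟨tangentMap (𝓡∂ n) (𝓡∂ n) φ.symm,
          φ.symm.contMDiff_toFun.continuous_tangentMap (by simp)⟩) :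
        C(TangentBundle (𝓡∂ n) Q, TangentBundle (𝓡∂ n) Q) ×
          C(TangentBundle (𝓡∂ n) Q, TangentBundle (𝓡∂ n) Q)))
    inferInstance

/-- The filter of `C¹` neighbourhoods of the identity. -/
def c1Nhds (n : ℕ) [NeZero n] (Q : Type u) [MetricSpace Q]
    [ChartedSpace (EuclideanHalfSpace n) Q] [IsManifold (𝓡∂ n) ∞ Q] :
    Filter (Q ≃ₘ^∞⟮𝓡∂ n, 𝓡∂ n⟯ Q) :=
  @nhds _ (c1Topology n Q) (Diffeomorph.refl (𝓡∂ n) Q ∞)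

/-- The `ε`-essential part of the cell dual to `σ`: the complement in the cell of the
`ε`-neighbourhood of its boundary. -/
def essentialPart (n : ℕ) [NeZero n] [ChartedSpace (EuclideanHalfSpace n) Q] (ε : ℝ)
    (D : V → Set Q) (σ : Finset V) : Set Q :=
  {p ∈ dualCell D σ | ∀ q ∈ dualCell D σ \ openCell n D σ, ε ≤ dist p q}

/-- A chart `U × ℝ^d → Q`, where `U` is open in the open stratum of the cell of `D` dual to `κ`,
which takes `U × Π^d` to `D₀` and `U × Π^d(r)` to `D₁`.  It is recorded by the two components
`base` and `coord` of its inverse, a smooth embedding of an open subset of `Q` with image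
`U × ℝ^d`. -/
structure SimplicialChart (n : ℕ) [NeZero n] [ChartedSpace (EuclideanHalfSpace n) Q]
    (D D₀ D₁ : V → Set Q) (κ : Finset V) where
  source : Set Q
  base : Q → Q
  coord : Q → Fin (codim κ) → ℝ
  r : ℝ
  r_pos : 0 < r
  isOpen_source : IsOpen source
  smooth_base : ContMDiffOn (𝓡∂ n) (𝓡∂ n) ∞ base source
  smooth_coord : ContMDiffOn (𝓡∂ n) 𝓘(ℝ, Fin (codim κ) → ℝ) ∞ coord source
  embedding : IsEmbedding (source.domRestrict fun p => (base p, coord p))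
  image : (fun p => (base p, coord p)) '' source = (base '' source) ×ˢ univ
  base_open : ∃ W, IsOpen W ∧ base '' source = W ∩ stratum D κ
  immersion : ∀ p ∈ source, ∀ w, mfderiv (𝓡∂ n) (𝓡∂ n) base p w = 0 →
    mfderiv (𝓡∂ n) 𝓘(ℝ, Fin (codim κ) → ℝ) coord p w = 0 → w = 0
  boundary_iff : ∀ p ∈ source, base p ∈ (𝓡∂ n).boundary Q ↔ p ∈ (𝓡∂ n).boundary Q
  model₀ : IsModelledOn D₀ κ source coord 0
  model₁ : IsModelledOn D₁ κ source coord r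

/-- `(D₀, D₁)` are in simplicial position (with respect to the subdivision `D` dual to `P`): there
are charts as above near the `ε`-essential parts of all cells of `D`, which together cover `Q`. -/
def SimplicialPosition (P : SmoothTriangulation n Q V) (ε : ℝ) (D D₀ D₁ : V → Set Q) : Prop :=
  ∃ c : ∀ κ : P.complex.faces, SimplicialChart n D D₀ D₁ κ.1,
    (∀ κ, essentialPart n ε D κ.1 ⊆ (c κ).source ∩ (c κ).base '' (c κ).source) ∧
    ⋃ κ, (c κ).source = univ

/-! ### Cellular chains -/

/-- The orientations of the cell of `D` dual to `σ`. -/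
abbrev DualCellOrientation (n : ℕ) [NeZero n] [ChartedSpace (EuclideanHalfSpace n) Q]
    [IsManifold (𝓡∂ n) ∞ Q] (D : V → Set Q) (σ : Finset V) :=
  CellOrientation n (dualCell D σ) (openCell n D σ) (n - codim σ)

/-- The cellular chains of the subdivision `D`: sums of orientation lines of dual cells. -/
abbrev CellularChain (P : SmoothTriangulation n Q V) (D : V → Set Q) :=
  ∀ σ : P.complex.faces, OrientationLine n (dualCell D σ.1) (openCell n D σ.1) (n - codim σ.1)

/-- Multiplication by `(-1)^i` on the chains of codimension `i`. -/
def chainSign {P : SmoothTriangulation n Q V} {D : V → Set Q} (c : CellularChain P D) :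
    CellularChain P D := fun σ => (-1 : ℤ) ^ codim σ.1 • c σ

/-- The orientation `o` of the cell dual to `σ` restricts to the orientation `o'` of its facet
dual to `τ`: an outward pointing vector followed by a frame of the facet has the same sign with
respect to `o` as the frame with respect to `o'`. -/
def InducesOnFacet {D : V → Set Q} {σ τ : Finset V} (o : DualCellOrientation n D σ)
    (o' : DualCellOrientation n D τ) : Prop :=
  ∀ q : openCell n D τ, ∃ s : ℤˣ, ∃ U ∈ 𝓝 q.1, ∃ Y : ℕ → ∀ q' : Q, TangentSpace (𝓡∂ n) q',
    (∀ i < n - codim σ, ContinuousOn (fun q' => (⟨q', Y i q'⟩ : TangentBundle (𝓡∂ n) Q))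
      (U ∩ insert q.1 (openCell n D σ))) ∧
    (∀ q' : openCell n D σ, q'.1 ∈ U → HasSign (o.at' q') (fun i => Y i q') s) ∧
    PointsOutward (dualCell D σ) q.1 (Y 0 q) ∧ Y 0 q ∉ tangentAt n (dualCell D τ) q.1 ∧
    HasSign (o'.at' q) (fun i => Y (i + 1) q) s

theorem InducesOnFacet.neg {D : V → Set Q} {σ τ : Finset V} {o : DualCellOrientation n D σ}
    {o' : DualCellOrientation n D τ} (h : InducesOnFacet o o') : InducesOnFacet (-o) (-o') := by
  intro q
  obtain ⟨s, U, hU, Y, h1, h2, h3, h4, h5⟩ := h q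
  exact ⟨-s, U, hU, Y, h1, fun q' hq' => (h2 q' hq').neg, h3, h4, h5.neg⟩

/-- The cellular boundary operator. -/
def cellBoundary {P : SmoothTriangulation n Q V} {D : V → Set Q} (c : CellularChain P D) :
    CellularChain P D := fun τ =>
  ⟨fun o' => ∑ᶠ σ : P.complex.faces, ∑ᶠ (o : DualCellOrientation n D σ.1)
      (_ : σ.1 ⊆ τ.1 ∧ σ.1.card + 1 = τ.1.card ∧ InducesOnFacet o o'), (c σ).1 o, by
    intro o'
    dsimp only
    rw [← finsum_neg_distrib]
    refine finsum_congr fun σ => finsum_odd _ _ (fun o => ?_) _ (c σ).2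
    refine and_congr_right fun _ => and_congr_right fun _ => ⟨fun h => ?_, fun h => ?_⟩
    · simpa using h.neg
    · simpa using h.neg⟩

/-- The frame `(a 0, …, a (k - 1), t 0, t 1, …)`. -/
def catFrame {T : Type*} (k : ℕ) (a t : ℕ → T) : ℕ → T := fun i => if i < k then a i else t (i - k)

/-- Orientations of the cell of `D₀ ⋒ D₁` which is the intersection of the cell of `D₀` dual to
`σ` with the cell of `D₁` dual to `τ`. -/
abbrev MeetOrientation (n : ℕ) [NeZero n] [ChartedSpace (EuclideanHalfSpace n) Q]
    [IsManifold (𝓡∂ n) ∞ Q] (D₀ D₁ : V → Set Q) (σ τ : Finset V) :=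
  CellOrientation n (dualCell D₀ σ ∩ dualCell D₁ τ) (openCell n D₀ σ ∩ openCell n D₁ τ)
    (n - (codim σ + codim τ))

/-- The cellular chains of the subdivision `D₀ ⋒ D₁`, whose cells are the intersections of cells
of `D₀` and `D₁`. -/
abbrev MeetChain (P : SmoothTriangulation n Q V) (D₀ D₁ : V → Set Q) :=
  ∀ σ τ : P.complex.faces, OrientationLine n (dualCell D₀ σ.1 ∩ dualCell D₁ τ.1)
    (openCell n D₀ σ.1 ∩ openCell n D₁ τ.1) (n - (codim σ.1 + codim τ.1))

/-- `oM` is the orientation of the transverse intersection of the cell dual to `σ` in `D₀` and the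
cell dual to `τ` in `D₁`, oriented by `o` and `o'`.  Here, for the orientation `oQ` of `Q`, a normal
frame followed by a tangent frame of a cell is positive, and the normal orientation of an
intersection is the normal orientation of the first cell followed by that of the second.  In terms
of a frame `t` of the intersection, completed by `b` to a frame of the first cell and by `a` to a
frame of the second: the sign of `t` is the product of the signs of `(b, t)`, `(a, t)` and
`(b, a, t)`. -/
def IsMeetOrientation (oQ : CellOrientation n (univ : Set Q) ((𝓡∂ n).interior Q) n)
    {D₀ D₁ : V → Set Q} {σ τ : Finset V} (o : DualCellOrientation n D₀ σ)
    (o' : DualCellOrientation n D₁ τ) (oM : MeetOrientation n D₀ D₁ σ τ) : Prop :=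
  ∀ p : (openCell n D₀ σ ∩ openCell n D₁ τ : Set Q),
    ∃ (a b t : ℕ → TangentSpace (𝓡∂ n) p.1) (s s' sQ : ℤˣ),
      HasSign (o.at' ⟨p.1, p.2.1⟩) (catFrame (codim τ) b t) s ∧
      HasSign (o'.at' ⟨p.1, p.2.2⟩) (catFrame (codim σ) a t) s' ∧
      HasSign (oQ.at' ⟨p.1, p.2.1.2⟩) (catFrame (codim τ) b (catFrame (codim σ) a t)) sQ ∧
      HasSign (oM.at' p) t (s * s' * sQ)

theorem IsMeetOrientation.neg {oQ : CellOrientation n (univ : Set Q) ((𝓡∂ n).interior Q) n}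
    {D₀ D₁ : V → Set Q} {σ τ : Finset V} {o : DualCellOrientation n D₀ σ}
    {o' : DualCellOrientation n D₁ τ} {oM : MeetOrientation n D₀ D₁ σ τ}
    (h : IsMeetOrientation oQ o o' oM) : IsMeetOrientation oQ o (-o') (-oM) := by
  intro p
  obtain ⟨a, b, t, s, s', sQ, h1, h2, h3, h4⟩ := h p
  refine ⟨a, b, t, s, -s', sQ, h1, h2.neg, h3, ?_⟩
  have := h4.neg
  rwa [show s * -s' * sQ = -(s * s' * sQ) by simp]

open Classical in
/-- The intersection product `C_{n-i}(D₀) ⊗ C_{n-j}(D₁) → C_{n-i-j}(D₀ ⋒ D₁)`.  (It does not matter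
which of the two orientations of the first cell is used to compute it.) -/
def intersectionProduct (oQ : CellOrientation n (univ : Set Q) ((𝓡∂ n).interior Q) n)
    {P : SmoothTriangulation n Q V} {D₀ D₁ : V → Set Q} (c : CellularChain P D₀)
    (c' : CellularChain P D₁) : MeetChain P D₀ D₁ := fun σ τ =>
  ⟨fun oM => if h : Nonempty (DualCellOrientation n D₀ σ.1) then
      (c σ).1 h.some * ∑ᶠ (o' : DualCellOrientation n D₁ τ.1)
        (_ : IsMeetOrientation oQ h.some o' oM), (c' τ).1 o'
    else 0, by
    intro oM
    dsimp only
    split_ifs with h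
    · rw [← mul_neg]
      congr 1
      refine finsum_odd _ _ (fun o => ⟨fun h => ?_, fun h => ?_⟩) _ (c' τ).2
      · simpa using h.neg
      · simpa using h.neg
    · simp⟩

/-- The orientation `oM` of the intersection of the cells dual to `σ` and `τ` corresponds to the
orientation `o` of the cell of `D₁` dual to `ρ`, a cell which is parallel to this intersection in
every chart `U × ℝ^d`: translations in the direction of `ℝ^d` take one to the other. -/
def IsCollapseOrientation (D : V → Set Q) {P : SmoothTriangulation n Q V} {D₀ D₁ : V → Set Q}
    {σ τ ρ : Finset V} (oM : MeetOrientation n D₀ D₁ σ τ) (o : DualCellOrientation n D₁ ρ) : Prop :=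
  ∀ κ ∈ P.complex.faces, ∀ c : SimplicialChart n D D₀ D₁ κ,
    ∀ (p : (openCell n D₀ σ ∩ openCell n D₁ τ : Set Q)) (p' : openCell n D₁ ρ),
      p.1 ∈ c.source → p'.1 ∈ c.source → c.base p = c.base p' →
      ∃ (t : ℕ → TangentSpace (𝓡∂ n) p.1) (t' : ℕ → TangentSpace (𝓡∂ n) p'.1) (s : ℤˣ),
        HasSign (oM.at' p) t s ∧ HasSign (o.at' p') t' s ∧ ∀ i < n - codim ρ,
          tangentMap (𝓡∂ n) (𝓡∂ n) c.base ⟨p.1, t i⟩ =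
            tangentMap (𝓡∂ n) (𝓡∂ n) c.base ⟨p'.1, t' i⟩ ∧
          @Eq (Fin (codim κ) → ℝ)
            (mfderiv (𝓡∂ n) 𝓘(ℝ, Fin (codim κ) → ℝ) c.coord p.1 (t i))
            (mfderiv (𝓡∂ n) 𝓘(ℝ, Fin (codim κ) → ℝ) c.coord p'.1 (t' i))

theorem IsCollapseOrientation.neg {D : V → Set Q} {P : SmoothTriangulation n Q V}
    {D₀ D₁ : V → Set Q} {σ τ ρ : Finset V} {oM : MeetOrientation n D₀ D₁ σ τ}
    {o : DualCellOrientation n D₁ ρ} (h : IsCollapseOrientation D (P := P) oM o) :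
    IsCollapseOrientation D (P := P) (-oM) (-o) := by
  intro κ hκ c p p' hp hp' hb
  obtain ⟨t, t', s, h1, h2, h3⟩ := h κ hκ c p p' hp hp' hb
  exact ⟨t, t', -s, h1.neg, h2.neg, h3⟩

/-- The map `C_*(D₀ ⋒ D₁) → C_*(D₁)` induced by the collapse, which takes the intersection of the
cells dual to `σ` and `τ` to the cell dual to the simplex spanned by `σ` and `τ`.  Cells which are
collapsed to a cell of lower dimension do not contribute. -/
def collapse (D : V → Set Q) {P : SmoothTriangulation n Q V} {D₀ D₁ : V → Set Q}
    (e : MeetChain P D₀ D₁) : CellularChain P D₁ := fun ρ =>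
  ⟨fun o => ∑ᶠ (σ : P.complex.faces) (τ : P.complex.faces),
      ∑ᶠ (oM : MeetOrientation n D₀ D₁ σ.1 τ.1) (_ : σ.1 ∪ τ.1 = ρ.1 ∧
        codim σ.1 + codim τ.1 = codim ρ.1 ∧ IsCollapseOrientation D (P := P) oM o),
        (e σ τ).1 oM, by
    intro o
    dsimp only
    rw [← finsum_neg_distrib]
    refine finsum_congr fun σ => ?_
    rw [← finsum_neg_distrib]
    refine finsum_congr fun τ => finsum_odd _ _ (fun oM => ?_) _ (e σ τ).2
    refine and_congr_right fun _ => and_congr_right fun _ => ⟨fun h => ?_, fun h => ?_⟩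
    · simpa using h.neg
    · simpa using h.neg⟩

/-! ### Relative simplicial cochains -/

/-- Simplicial cochains with values in `ℤ`. -/
abbrev Cochain (P : SmoothTriangulation n Q V) := P.complex.faces → ℤ

open Classical in
/-- The value of a cochain on an ordered simplex, and `0` if the set is not a simplex. -/
def Cochain.eval {P : SmoothTriangulation n Q V} (φ : Cochain P) (σ : Finset V) : ℤ :=
  if h : σ ∈ P.complex.faces then φ ⟨σ, h⟩ else 0

/-- The coboundary `(δφ)[v₀, …, v_k] = ∑ (-1)^i φ[v₀, …, v̂_i, …, v_k]`. -/
def coboundary {P : SmoothTriangulation n Q V} (φ : Cochain P) : Cochain P := fun τ =>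
  ∑ v ∈ τ.1, (-1) ^ position τ.1 v * φ.eval (τ.1.erase v)

/-- The cup product `(φ ∪ ψ)[v₀, …, v_k] = ∑ φ[v₀, …, v_i] ψ[v_i, …, v_k]`. -/
def cup {P : SmoothTriangulation n Q V} (φ ψ : Cochain P) : Cochain P := fun τ =>
  ∑ v ∈ τ.1, φ.eval (τ.1.filter (· ≤ v)) * ψ.eval (τ.1.filter (v ≤ ·))

/-- Multiplication by `(-1)^i` on the cochains of degree `i`. -/
def cochainSign {P : SmoothTriangulation n Q V} (φ : Cochain P) : Cochain P :=
  fun σ => (-1) ^ codim σ.1 * φ σ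

/-- The simplices of the subcomplex `∂⁺_H P`, the union of all cells of `∂Q` on which `H` takes some
positive value. -/
def plusFaces (P : SmoothTriangulation n Q V) (H : (𝓡∂ n).boundary Q → ℝ) : Set (Finset V) :=
  {σ | σ ∈ P.complex.faces ∧ ∃ τ ∈ P.complex.faces, σ ⊆ τ ∧ P.cell τ ⊆ (𝓡∂ n).boundary Q ∧
    ∃ x, x.1 ∈ P.cell τ ∧ 0 < H x}

/-- `A` is a deformation retract of `B`. -/
def IsDeformationRetract (A B : Set Q) : Prop :=
  A ⊆ B ∧ ∃ h : C(unitInterval × B, B), (∀ x, h (0, x) = x) ∧ (∀ x, (h (1, x)).1 ∈ A) ∧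
    ∀ t, ∀ x : B, x.1 ∈ A → h (t, x) = x

/-- The transversality of a pair of functions on `∂Q`, in terms of their difference. -/
def IsTransversePair (P : SmoothTriangulation n Q V) (H₀ H₁ : (𝓡∂ n).boundary Q → ℝ) : Prop :=
  IsDeformationRetract (Subtype.val '' {x | 0 ≤ (H₁ - H₀) x})
    (⋃ σ ∈ plusFaces P (H₁ - H₀), P.cell σ)

/-! ### The pre-categories `Simp(P)` and `Cell(D)` -/

/-- The morphisms of `Simp(P)` of degree `k`: the `k`-cochains which vanish on `∂⁺ P`. -/
def simpHoms (P : SmoothTriangulation n Q V) : AInftyHoms.{u, v} where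
  Ob := (𝓡∂ n).boundary Q → ℝ
  Hom _ _ := Cochain P
  grp _ _ := inferInstance
  gr H₀ H₁ k :=
    { carrier := {φ | ∀ σ, (σ.1 ∈ plusFaces P (H₁ - H₀) ∨ (codim σ.1 : ℤ) ≠ k) → φ σ = 0}
      add_mem' := fun ha hb σ h => by simp [ha σ h, hb σ h]
      zero_mem' := fun _ _ => rfl
      neg_mem' := fun ha σ h => by simp [ha σ h] }
  Transverse l := l.Pairwise (IsTransversePair P)

/-- The pre-category `Simp(P)`: `μ₁` is the coboundary, and `μ₂ (b, a) = (-1)^{deg a} a ∪ b`. -/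
def Simp (P : SmoothTriangulation n Q V) : AInftyData.{u, v} where
  toAInftyHoms := simpHoms P
  μ := fun {X Y} (w : Comp (simpHoms P) X Y) =>
    match w with
    | .nil _ => (0 : Cochain P)
    | .cons a (.nil _) => coboundary (P := P) a
    | .cons a (.cons b (.nil _)) => cup (P := P) (cochainSign (P := P) a) b
    | .cons _ (.cons _ (.cons _ _)) => (0 : Cochain P)

/-- The objects of `Cell(D)`: subdivisions which are images of `D` under a diffeomorphism in the
`C¹` neighbourhood `𝒰` of the identity, together with a function on `∂Q`. -/
structure CellOb (D : V → Set Q) (𝒰 : Set (Q ≃ₘ^∞⟮𝓡∂ n, 𝓡∂ n⟯ Q)) where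
  sub : V → Set Q
  close : ∃ φ ∈ 𝒰, ∀ v, sub v = φ '' D v
  fn : (𝓡∂ n).boundary Q → ℝ

/-- The simplices dual to the cells of `∂⁺_H D`, the set of cells of the subdivision `D` which meet
some simplex of `∂⁺_H P`. -/
def plusCells (P : SmoothTriangulation n Q V) (D : V → Set Q) (H : (𝓡∂ n).boundary Q → ℝ) :
    Set (Finset V) :=
  {τ | ∃ σ ∈ plusFaces P H, (dualCell D τ ∩ P.cell σ).Nonempty}

/-- The morphisms of `Cell(D)` of degree `k`: the cellular chains of the second subdivision of
codimension `k` which do not involve the cells of `∂⁺`. -/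
def cellHoms (P : SmoothTriangulation n Q V) (D : V → Set Q) (ε : ℝ)
    (𝒰 : Set (Q ≃ₘ^∞⟮𝓡∂ n, 𝓡∂ n⟯ Q)) : AInftyHoms where
  Ob := CellOb D 𝒰
  Hom _ X₁ := CellularChain P X₁.sub
  grp _ _ := inferInstance
  gr X₀ X₁ k :=
    { carrier := {c | ∀ σ, (σ.1 ∈ plusCells P X₁.sub (X₁.fn - X₀.fn) ∨ (codim σ.1 : ℤ) ≠ k) →
        c σ = 0}
      add_mem' := fun ha hb σ h => by simp [ha σ h, hb σ h]
      zero_mem' := fun _ _ => rfl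
      neg_mem' := fun ha σ h => by simp [ha σ h] }
  Transverse l := l.Pairwise (fun X₀ X₁ => SimplicialPosition P ε D X₀.sub X₁.sub) ∧
    (simpHoms P).Transverse (l.map CellOb.fn)

/-- The pre-category `Cell(D)`: `μ₁ a = (-1)^{deg a + 1} ∂a`, and `μ₂ (b, a)` is `(-1)^{deg a}` times
the collapse of the intersection of `a` and `b`. -/
def Cell (oQ : CellOrientation n (univ : Set Q) ((𝓡∂ n).interior Q) n)
    (P : SmoothTriangulation n Q V) (D : V → Set Q) (ε : ℝ)
    (𝒰 : Set (Q ≃ₘ^∞⟮𝓡∂ n, 𝓡∂ n⟯ Q)) : AInftyData where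
  toAInftyHoms := cellHoms P D ε 𝒰
  μ := fun {X Y} (w : Comp (cellHoms P D ε 𝒰) X Y) =>
    match X, Y, w with
    | _, Y, .nil _ => (0 : CellularChain P Y.sub)
    | _, Y, .cons a (.nil _) =>
        (-cellBoundary (chainSign (a : CellularChain P Y.sub)) : CellularChain P Y.sub)
    | _, Y, .cons (Y := X₁) a (.cons b (.nil _)) =>
        (collapse D (intersectionProduct oQ (chainSign (a : CellularChain P X₁.sub))
          (b : CellularChain P Y.sub)) : CellularChain P Y.sub)
    | _, Y, .cons _ (.cons _ (.cons _ _)) => (0 : CellularChain P Y.sub)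

/-- The orientation of the cell dual to `σ = [v₀, …, v_k]` which corresponds to the ordering of
`σ`: a normal frame which is positive in the coordinates of the local model `Π^k`, followed by a
positive frame of the cell, is positive in `Q`. -/
def IsDualOrientation (oQ : CellOrientation n (univ : Set Q) ((𝓡∂ n).interior Q) n)
    {D : V → Set Q} {σ : Finset V} (o : DualCellOrientation n D σ) : Prop :=
  ∀ p : openCell n D σ, ∃ O y, IsLocalModel n D σ p.1 O y ∧
    ∃ (a t : ℕ → TangentSpace (𝓡∂ n) p.1) (s : ℤˣ),
      (∀ i : Fin (codim σ), @Eq (Fin (codim σ) → ℝ)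
        (mfderiv (𝓡∂ n) 𝓘(ℝ, Fin (codim σ) → ℝ) y p.1 (a i)) (Pi.single i 1)) ∧
      HasSign (o.at' p) t s ∧ HasSign (oQ.at' ⟨p.1, p.2.2⟩) (catFrame (codim σ) a t) s

/-- The simplicial cochain dual to a cellular chain: its value on `σ` is the coefficient of the
cell dual to `σ`. -/
def dualCochain (oQ : CellOrientation n (univ : Set Q) ((𝓡∂ n).interior Q) n)
    {P : SmoothTriangulation n Q V} {D : V → Set Q} (c : CellularChain P D) : Cochain P := fun σ =>
  ∑ᶠ (o : DualCellOrientation n D σ.1) (_ : IsDualOrientation oQ o), (c σ).1 o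

end Geometry

end

/-! The point is that `dualCochain` is an isomorphism which carries all the structure of `Cell` to
that of `Simp`. The interior of a dual cell is a connected manifold, cooriented by the ordering of
the vertices of its simplex, and `Q` is oriented. So it has exactly two orientations, one of them
distinguished (`IsRegularSubdivision.exists_dualOriented`), its orientation line is a copy of `ℤ`,
and a chain is the same thing as a cochain (`IsRegularSubdivision.dualCochain_bijective`). Three
compatibilities remain. The `A∞` relations of `Cell` then follow from those of `Simp` by
injectivity, those of `Simp` are the usual identities of the cochain algebra with signs, and a
bijective chain map which is onto on objects is a quasi-equivalence.

The subdivisions are handled through `HModel`: near a point of the open cell dual to `σ` there are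
smooth functions `f v`, one for each vertex, such that the cell dual to `v` is the set where `f v`
is the largest; their differences are the normal coordinates. The choice of such functions is
irrelevant for orientations, because at a point of the cell the differentials of two choices are
positive multiples of each other (`HModel.compare`).

Differentials. The cell dual to `τ` is a facet of the one dual to `τ.erase v`, and a vector which
points outward is one that raises `f v` above the other functions. Adding it to a normal frame of
the cell gives a normal frame of the facet, and expanding a determinant along its column produces
the sign `facetSign` (`frameMatrix_det_facet`). With the sign in `μ₁` this becomes the sign of the
simplicial coboundary (`IsRegularSubdivision.dualCochain_boundary`).

Products. In a chart of a pair in simplicial position, the second subdivision is given by the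
functions `f v - g v`, where `g` is strictly decreasing in `v`. A point common to the cell of `D₀`
dual to `σ` and the cell of `D₁` dual to `τ` therefore forces every vertex of `σ` to be at most
every vertex of `τ` (`PairModel.le`). If no dimension is lost in the collapse, `σ` and `τ` share
just one vertex, so they are a front face and a back face of the simplex they span: these are the
terms of the cup product. Each of these terms occurs, as one sees in the chart at the essential part
of a cell (`SimplicialChart.exists_meet`). Its sign is `+1`, because the normal coordinates of the
intersection are block triangular with respect to those of the two cells (`frameMatrix_det_filter`)
and because translation in a chart preserves the orientation of `Q`
(`SimplicialChart.translate_sign`). The result is `SimplicialPosition.dualCochain_collapse`.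

Supports. A cell of a close subdivision must belong to `∂⁺` exactly when its simplex does. A dual
cell meets only simplices which contain its own simplex; by compactness this persists under small
perturbations. Conversely a simplex of `∂Q` meets its dual cell transversely in a point, and such a
point persists under `C¹`-small perturbations by a quantitative inverse function theorem
(`eventually_exists_zero`). Together these give `IsDualSubdivision.eventually_mem_plusCells`, which
determines the neighbourhood; the bound on `ε` ensures that all essential parts are non-empty. -/

set_option linter.unusedSectionVars false

/-! ### The differential graded algebra of simplicial cochains. -/

section Cochains

variable {n : ℕ} [NeZero n] {Q : Type u} [MetricSpace Q] [ChartedSpace (EuclideanHalfSpace n) Q]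
  {V : Type v} [Fintype V] [LinearOrder V] {P : SmoothTriangulation n Q V}

theorem SmoothTriangulation.nonempty_of_mem {σ : Finset V} (h : σ ∈ P.complex.faces) :
    σ.Nonempty := (P.complex.isRelLowerSet_faces h).1

theorem SmoothTriangulation.mem_of_subset {σ τ : Finset V} (h : τ ∈ P.complex.faces)
    (hστ : σ ⊆ τ) (hσ : σ.Nonempty) : σ ∈ P.complex.faces :=
  (P.complex.isRelLowerSet_faces h).2 hστ hσ

theorem Cochain.eval_of_mem (φ : Cochain P) {σ : Finset V} (h : σ ∈ P.complex.faces) :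
    φ.eval σ = φ ⟨σ, h⟩ := dif_pos h

theorem Cochain.eval_empty (φ : Cochain P) : φ.eval ∅ = 0 :=
  dif_neg fun h => Finset.not_nonempty_empty (P.nonempty_of_mem h)

theorem Cochain.eval_add (φ ψ : Cochain P) (σ : Finset V) :
    Cochain.eval (φ + ψ) σ = φ.eval σ + ψ.eval σ := by
  unfold Cochain.eval
  split_ifs <;> simp

theorem Cochain.eval_cochainSign (φ : Cochain P) (σ : Finset V) :
    (cochainSign φ).eval σ = (-1) ^ codim σ * φ.eval σ := by
  unfold Cochain.eval cochainSign
  split_ifs <;> simp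

theorem eval_coboundary (φ : Cochain P) {τ σ : Finset V} (hτ : τ ∈ P.complex.faces)
    (h : σ ⊆ τ) :
    (coboundary φ).eval σ = ∑ v ∈ σ, (-1) ^ position σ v * φ.eval (σ.erase v) := by
  rcases σ.eq_empty_or_nonempty with rfl | hσ
  · simp [Cochain.eval_empty]
  · rw [Cochain.eval_of_mem _ (P.mem_of_subset hτ h hσ)]
    rfl

theorem eval_cup (φ ψ : Cochain P) {τ σ : Finset V} (hτ : τ ∈ P.complex.faces)
    (h : σ ⊆ τ) :
    (cup φ ψ).eval σ = ∑ v ∈ σ, φ.eval (σ.filter (· ≤ v)) * ψ.eval (σ.filter (v ≤ ·)) := by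
  rcases σ.eq_empty_or_nonempty with rfl | hσ
  · simp [Cochain.eval_empty]
  · rw [Cochain.eval_of_mem _ (P.mem_of_subset hτ h hσ)]
    rfl

theorem coboundary_add (φ ψ : Cochain P) : coboundary (φ + ψ) = coboundary φ + coboundary ψ := by
  funext τ
  simp only [coboundary, Cochain.eval_add, mul_add, Finset.sum_add_distrib, Pi.add_apply]

theorem cup_add (φ ψ ψ' : Cochain P) : cup φ (ψ + ψ') = cup φ ψ + cup φ ψ' := by
  funext τ
  simp only [cup, Cochain.eval_add, mul_add, Finset.sum_add_distrib, Pi.add_apply]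

theorem add_cup (φ φ' ψ : Cochain P) : cup (φ + φ') ψ = cup φ ψ + cup φ' ψ := by
  funext τ
  simp only [cup, Cochain.eval_add, add_mul, Finset.sum_add_distrib, Pi.add_apply]

theorem cochainSign_add (φ ψ : Cochain P) :
    cochainSign (φ + ψ) = cochainSign φ + cochainSign ψ := by
  funext τ
  simp only [cochainSign, Pi.add_apply, mul_add]

theorem coboundary_zero : coboundary (0 : Cochain P) = 0 := by
  simpa using coboundary_add (0 : Cochain P) 0

theorem cup_zero (φ : Cochain P) : cup φ 0 = 0 := by
  simpa using cup_add φ 0 0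

theorem zero_cup (φ : Cochain P) : cup 0 φ = 0 := by
  simpa using add_cup 0 0 φ

theorem cochainSign_zero : cochainSign (0 : Cochain P) = 0 := by
  simpa using cochainSign_add (0 : Cochain P) 0

theorem smul_cup (z : ℤ) (φ ψ : Cochain P) : cup (z • φ) ψ = z • cup φ ψ :=
  map_zsmul (⟨⟨fun a => cup a ψ, zero_cup ψ⟩, fun a b => add_cup a b ψ⟩ : Cochain P →+ Cochain P) z φ

theorem coboundary_smul (z : ℤ) (φ : Cochain P) : coboundary (z • φ) = z • coboundary φ :=
  map_zsmul (⟨⟨coboundary, coboundary_zero⟩, coboundary_add⟩ : Cochain P →+ Cochain P) z φ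

/-! Positions of vertices. -/

theorem position_lt_card {τ : Finset V} {v : V} (hv : v ∈ τ) : position τ v < τ.card :=
  Finset.card_lt_card ⟨Finset.filter_subset _ _, fun h => by
    have := h hv
    simp at this⟩

theorem position_lt_position {τ : Finset V} {u v : V} (hu : u ∈ τ) (h : u < v) :
    position τ u < position τ v := by
  refine Finset.card_lt_card ⟨fun x hx => ?_, fun hs => ?_⟩
  · simp only [Finset.mem_filter] at hx ⊢
    exact ⟨hx.1, hx.2.trans h⟩
  · have := hs (Finset.mem_filter.2 ⟨hu, h⟩)
    simp at this

theorem position_lt_position_iff {τ : Finset V} {u v : V} (hu : u ∈ τ) (hv : v ∈ τ) :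
    position τ u < position τ v ↔ u < v := by
  refine ⟨fun h => ?_, position_lt_position hu⟩
  by_contra hn
  rcases (not_lt.1 hn).lt_or_eq with h' | h'
  · exact (position_lt_position hv h').not_gt h
  · rw [h'] at h
    exact lt_irrefl _ h

theorem position_injOn (τ : Finset V) : InjOn (position τ) τ := by
  intro u hu v hv h
  by_contra hne
  rcases lt_or_gt_of_ne hne with h' | h'
  · exact (position_lt_position hu h').ne h
  · exact (position_lt_position hv h').ne' h

theorem image_position (τ : Finset V) : τ.image (position τ) = Finset.range τ.card := by
  refine Finset.eq_of_subset_of_card_le (fun i hi => ?_) ?_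
  · obtain ⟨v, hv, rfl⟩ := Finset.mem_image.1 hi
    exact Finset.mem_range.2 (position_lt_card hv)
  · rw [Finset.card_image_of_injOn (position_injOn τ), Finset.card_range]

theorem sum_position {M : Type*} [AddCommMonoid M] (τ : Finset V) (g : ℕ → M) :
    ∑ v ∈ τ, g (position τ v) = ∑ i ∈ Finset.range τ.card, g i := by
  rw [← image_position, Finset.sum_image (position_injOn τ)]

theorem position_erase_of_lt {τ : Finset V} {u v : V} (h : v < u) :
    position (τ.erase u) v = position τ v := by
  unfold position
  congr 1
  ext x
  simp only [Finset.mem_filter, Finset.mem_erase]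
  exact ⟨fun hx => ⟨hx.1.2, hx.2⟩, fun hx => ⟨⟨(hx.2.trans h).ne, hx.1⟩, hx.2⟩⟩

theorem position_erase_of_gt {τ : Finset V} {u v : V} (hu : u ∈ τ) (h : u < v) :
    position (τ.erase u) v + 1 = position τ v := by
  unfold position
  rw [Finset.filter_erase, Finset.card_erase_add_one (Finset.mem_filter.2 ⟨hu, h⟩)]

theorem codim_filter_le {τ : Finset V} {v : V} (hv : v ∈ τ) :
    codim (τ.filter (· ≤ v)) = position τ v := by
  have : τ.filter (· ≤ v) = insert v (τ.filter (· < v)) := by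
    ext x
    simp only [Finset.mem_filter, Finset.mem_insert, le_iff_lt_or_eq]
    constructor
    · rintro ⟨h, h' | h'⟩
      · exact Or.inr ⟨h, h'⟩
      · exact Or.inl h'
    · rintro (rfl | h)
      · exact ⟨hv, Or.inr rfl⟩
      · exact ⟨h.1, Or.inl h.2⟩
  rw [codim, this, Finset.card_insert_of_notMem (by simp)]
  rfl

theorem position_filter_le {τ : Finset V} {u v : V} (h : u ≤ v) :
    position (τ.filter (· ≤ v)) u = position τ u := by
  unfold position
  rw [Finset.filter_filter]
  congr 1
  refine Finset.filter_congr fun x _ => ⟨fun hx => hx.2, fun hx => ⟨hx.le.trans h, hx⟩⟩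

theorem position_filter_ge {τ : Finset V} {u v : V} (h : v ≤ u) :
    position τ v + position (τ.filter (v ≤ ·)) u = position τ u := by
  unfold position
  rw [Finset.filter_filter, ← Finset.card_union_of_disjoint]
  · congr 1
    ext x
    simp only [Finset.mem_union, Finset.mem_filter]
    constructor
    · rintro (hx | hx)
      · exact ⟨hx.1, hx.2.trans_le h⟩
      · exact ⟨hx.1, hx.2.2⟩
    · rintro hx
      rcases lt_or_ge x v with h' | h'
      · exact Or.inl ⟨hx.1, h'⟩
      · exact Or.inr ⟨hx.1, h', hx.2⟩
  · rw [Finset.disjoint_filter]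
    exact fun x _ hx hx' => hx.not_ge hx'.1

/-- Two vertices can be deleted in either order. Deleting the smaller one first lowers the position
of the larger one by one, and deleting the larger one first changes nothing, so the two
contributions cancel. -/
theorem coboundary_coboundary (φ : Cochain P) : coboundary (coboundary φ) = 0 := by
  funext τ
  change ∑ u ∈ τ.1, (-1) ^ position τ.1 u * (coboundary φ).eval (τ.1.erase u) = 0
  -- Setting the diagonal to `0` turns the sum over ordered pairs of distinct vertices into a sum of
  -- an antisymmetric function over a square.
  set h : V → V → ℤ := fun u v => if u = v then 0 else
    (-1) ^ position τ.1 u * ((-1) ^ position (τ.1.erase u) v * φ.eval ((τ.1.erase u).erase v))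
    with hh
  have h1 : ∑ u ∈ τ.1, (-1) ^ position τ.1 u * (coboundary φ).eval (τ.1.erase u) =
      ∑ u ∈ τ.1, ∑ v ∈ τ.1, h u v := by
    refine Finset.sum_congr rfl fun u hu => ?_
    rw [eval_coboundary φ τ.2 (Finset.erase_subset _ _), Finset.mul_sum,
      ← Finset.add_sum_erase _ _ hu]
    simp only [hh, if_true, zero_add]
    exact Finset.sum_congr rfl fun v hv => (if_neg (Finset.ne_of_mem_erase hv).symm).symm
  have h2 : ∀ u ∈ τ.1, ∀ v ∈ τ.1, h u v = - h v u := by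
    have key : ∀ u ∈ τ.1, ∀ v ∈ τ.1, u < v → h u v = - h v u := by
      intro u hu v hv huv
      simp only [hh, if_neg huv.ne, if_neg huv.ne']
      rw [position_erase_of_lt huv, ← position_erase_of_gt hu huv, Finset.erase_right_comm]
      ring
    intro u hu v hv
    rcases lt_trichotomy u v with h' | h' | h'
    · exact key u hu v hv h'
    · simp [hh, h']
    · rw [key v hv u hu h', neg_neg]
  rw [h1]
  have h3 : ∑ u ∈ τ.1, ∑ v ∈ τ.1, h u v = - ∑ u ∈ τ.1, ∑ v ∈ τ.1, h u v := by
    conv_lhs => rw [Finset.sum_comm]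
    rw [← Finset.sum_neg_distrib]
    refine Finset.sum_congr rfl fun u hu => ?_
    rw [← Finset.sum_neg_distrib]
    exact Finset.sum_congr rfl fun v hv => h2 v hv u hu
  change _ = (0 : ℤ)
  omega

theorem sum_alternating_telescope (c : ℕ → ℤ) (N : ℕ) :
    ∑ i ∈ Finset.range N, (-1) ^ i * (c i + c (i + 1)) = c 0 - (-1) ^ N * c N := by
  induction N with
  | zero => simp
  | succ N ih => rw [Finset.sum_range_succ, ih]; ring

/-- Each summand is an alternating sum of two neighbouring cuts of the ordered simplex into disjoint
pieces, so the sum telescopes. The two extreme cuts have an empty piece, on which cochains evaluate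
to `0`. -/
theorem sum_cut_eq_zero (φ ψ : Cochain P) (τ : Finset V) :
    ∑ v ∈ τ, (-1) ^ position τ v * (φ.eval (τ.filter (· < v)) * ψ.eval (τ.filter (v ≤ ·)) +
      φ.eval (τ.filter (· ≤ v)) * ψ.eval (τ.filter (v < ·))) = 0 := by
  set c : ℕ → ℤ := fun i => φ.eval (τ.filter (position τ · < i)) *
    ψ.eval (τ.filter (i ≤ position τ ·)) with hc
  have h1 : ∀ v ∈ τ, (-1) ^ position τ v * (φ.eval (τ.filter (· < v)) * ψ.eval (τ.filter (v ≤ ·)) +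
      φ.eval (τ.filter (· ≤ v)) * ψ.eval (τ.filter (v < ·))) =
      (-1) ^ position τ v * (c (position τ v) + c (position τ v + 1)) := by
    intro v hv
    have e1 : τ.filter (· < v) = τ.filter (position τ · < position τ v) :=
      Finset.filter_congr fun x hx => (position_lt_position_iff hx hv).symm
    have e2 : τ.filter (v ≤ ·) = τ.filter (position τ v ≤ position τ ·) :=
      Finset.filter_congr fun x hx => by
        rw [← not_lt, ← not_lt, position_lt_position_iff hx hv]
    have e3 : τ.filter (· ≤ v) = τ.filter (position τ · < position τ v + 1) :=
      Finset.filter_congr fun x hx => by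
        rw [← not_lt, Nat.lt_succ_iff, ← not_lt, position_lt_position_iff hv hx]
    have e4 : τ.filter (v < ·) = τ.filter (position τ v + 1 ≤ position τ ·) :=
      Finset.filter_congr fun x hx => by
        rw [Nat.succ_le_iff, position_lt_position_iff hv hx]
    simp only [hc, e1, e2, e3, e4]
  rw [Finset.sum_congr rfl h1, sum_position τ fun i => (-1) ^ i * (c i + c (i + 1)),
    sum_alternating_telescope]
  have h0 : c 0 = 0 := by simp [hc, Cochain.eval_empty]
  have hN : c τ.card = 0 := by
    have : τ.filter (τ.card ≤ position τ ·) = ∅ :=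
      Finset.filter_eq_empty_iff.2 fun x hx => not_le.2 (position_lt_card hx)
    simp [hc, this, Cochain.eval_empty]
  rw [h0, hN]
  simp

/-- Let `v` be the vertex where the simplex is split and `u` the one which is deleted. The terms
with `u < v` belong to the coboundary of `φ` and those with `u > v` to that of `ψ`. The terms with
`u = v` are present only on the right hand side, and they cancel by `sum_cut_eq_zero`. -/
theorem coboundary_cup (φ ψ : Cochain P) :
    coboundary (cup φ ψ) = cup (coboundary φ) ψ + cup (cochainSign φ) (coboundary ψ) := by
  funext τ
  have hL : coboundary (cup φ ψ) τ = ∑ u ∈ τ.1, ∑ v ∈ τ.1, if u = v then 0 else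
      (-1) ^ position τ.1 u * (φ.eval ((τ.1.erase u).filter (· ≤ v)) *
        ψ.eval ((τ.1.erase u).filter (v ≤ ·))) := by
    refine Finset.sum_congr rfl fun u hu => ?_
    rw [eval_cup _ _ τ.2 (Finset.erase_subset _ _), Finset.mul_sum, ← Finset.add_sum_erase _ _ hu]
    simp only [if_true, zero_add]
    exact Finset.sum_congr rfl fun v hv => (if_neg (Finset.ne_of_mem_erase hv).symm).symm
  have hR1 : cup (coboundary φ) ψ τ = ∑ v ∈ τ.1, ∑ u ∈ τ.1, if u ≤ v then
      (-1) ^ position τ.1 u * (φ.eval ((τ.1.filter (· ≤ v)).erase u) *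
        ψ.eval (τ.1.filter (v ≤ ·))) else 0 := by
    refine Finset.sum_congr rfl fun v hv => ?_
    rw [eval_coboundary _ τ.2 (Finset.filter_subset _ _), Finset.sum_mul, Finset.sum_filter]
    refine Finset.sum_congr rfl fun u hu => ?_
    split_ifs with h
    · rw [position_filter_le h, mul_assoc]
    · rfl
  have hR2 : cup (cochainSign φ) (coboundary ψ) τ = ∑ v ∈ τ.1, ∑ u ∈ τ.1, if v ≤ u then
      (-1) ^ position τ.1 u * (φ.eval (τ.1.filter (· ≤ v)) *
        ψ.eval ((τ.1.filter (v ≤ ·)).erase u)) else 0 := by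
    refine Finset.sum_congr rfl fun v hv => ?_
    rw [eval_coboundary _ τ.2 (Finset.filter_subset _ _), Finset.mul_sum, Finset.sum_filter,
      Cochain.eval_cochainSign, codim_filter_le hv]
    refine Finset.sum_congr rfl fun u hu => ?_
    split_ifs with h
    · rw [← position_filter_ge (τ := τ.1) h, pow_add]
      ring
    · rfl
  rw [Pi.add_apply, hL, hR1, hR2, Finset.sum_comm, ← Finset.sum_add_distrib, ← sub_eq_zero,
    ← Finset.sum_sub_distrib, ← neg_eq_zero, ← Finset.sum_neg_distrib]
  refine (Finset.sum_congr rfl fun v hv => ?_).trans (sum_cut_eq_zero φ ψ τ.1)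
  rw [← Finset.sum_add_distrib, ← Finset.sum_sub_distrib, ← Finset.sum_neg_distrib,
    Finset.sum_eq_single_of_mem v hv]
  · have e1 : (τ.1.filter (· ≤ v)).erase v = τ.1.filter (· < v) := by
      ext x; simp only [Finset.mem_erase, Finset.mem_filter, lt_iff_le_and_ne]; tauto
    have e2 : (τ.1.filter (v ≤ ·)).erase v = τ.1.filter (v < ·) := by
      ext x; simp only [Finset.mem_erase, Finset.mem_filter, lt_iff_le_and_ne, ne_comm]; tauto
    simp only [if_true, le_refl, e1, e2]
    ring
  · intro u hu huv
    rcases lt_or_gt_of_ne huv with h | h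
    · rw [if_neg huv, if_pos h.le, if_neg h.not_ge, Finset.filter_erase, Finset.filter_erase,
        Finset.erase_eq_of_notMem (s := Finset.filter (v ≤ ·) τ.1) (by simp [h])]
      ring
    · rw [if_neg huv, if_neg h.not_ge, if_pos h.le, Finset.filter_erase, Finset.filter_erase,
        Finset.erase_eq_of_notMem (s := Finset.filter (· ≤ v) τ.1) (by simp [h])]
      ring

theorem cup_assoc (φ ψ χ : Cochain P) : cup (cup φ ψ) χ = cup φ (cup ψ χ) := by
  funext τ
  have hL : cup (cup φ ψ) χ τ = ∑ v ∈ τ.1, ∑ u ∈ τ.1, if u ≤ v then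
      φ.eval (τ.1.filter (· ≤ u)) * ψ.eval (τ.1.filter (fun x => u ≤ x ∧ x ≤ v)) *
        χ.eval (τ.1.filter (v ≤ ·)) else 0 := by
    refine Finset.sum_congr rfl fun v hv => ?_
    rw [eval_cup _ _ τ.2 (Finset.filter_subset _ _), Finset.sum_mul, Finset.sum_filter]
    refine Finset.sum_congr rfl fun u hu => ?_
    split_ifs with h
    · rw [Finset.filter_filter, Finset.filter_filter]
      congr 2
      · congr 1
        exact Finset.filter_congr fun x _ => ⟨fun hx => hx.2, fun hx => ⟨hx.trans h, hx⟩⟩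
      · congr 1
        exact Finset.filter_congr fun x _ => and_comm
    · rfl
  have hR : cup φ (cup ψ χ) τ = ∑ u ∈ τ.1, ∑ v ∈ τ.1, if u ≤ v then
      φ.eval (τ.1.filter (· ≤ u)) * ψ.eval (τ.1.filter (fun x => u ≤ x ∧ x ≤ v)) *
        χ.eval (τ.1.filter (v ≤ ·)) else 0 := by
    refine Finset.sum_congr rfl fun u hu => ?_
    rw [eval_cup _ _ τ.2 (Finset.filter_subset _ _), Finset.mul_sum, Finset.sum_filter]
    refine Finset.sum_congr rfl fun v hv => ?_
    split_ifs with h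
    · rw [Finset.filter_filter, Finset.filter_filter, mul_assoc]
      congr 3
      exact Finset.filter_congr fun x _ => ⟨fun hx => hx.2, fun hx => ⟨h.trans hx, hx⟩⟩
    · rfl
  rw [hL, hR, Finset.sum_comm]

theorem cochainSign_cup (φ ψ : Cochain P) :
    cochainSign (cup φ ψ) = cup (cochainSign φ) (cochainSign ψ) := by
  funext τ
  simp only [cochainSign, cup, Finset.mul_sum]
  refine Finset.sum_congr rfl fun v hv => ?_
  rw [Cochain.eval_cochainSign, Cochain.eval_cochainSign, codim_filter_le hv]
  have : codim τ.1 = position τ.1 v + codim (τ.1.filter (v ≤ ·)) := by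
    unfold codim position
    have h1 := Finset.card_filter_add_card_filter_not (s := τ.1) (· < v)
    have h2 : 0 < (τ.1.filter (v ≤ ·)).card := Finset.card_pos.2 ⟨v, by simp [hv]⟩
    simp only [not_lt] at h1
    omega
  rw [this, pow_add]
  ring

theorem cochainSign_coboundary (φ : Cochain P) :
    cochainSign (coboundary φ) = -coboundary (cochainSign φ) := by
  funext τ
  simp only [cochainSign, coboundary, Finset.mul_sum, Pi.neg_apply, ← Finset.sum_neg_distrib]
  refine Finset.sum_congr rfl fun v hv => ?_
  change _ = -(_ * (cochainSign φ).eval _)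
  rw [Cochain.eval_cochainSign]
  -- For a vertex the codimension does not drop under deletion, since `codim ∅ = 0` by truncated
  -- subtraction; there the term itself is zero.
  by_cases h : τ.1.card = 1
  · have : τ.1.erase v = ∅ := by
      rw [← Finset.card_eq_zero, Finset.card_erase_of_mem hv, h]
    simp [this, Cochain.eval_empty]
  · have : codim τ.1 = codim (τ.1.erase v) + 1 := by
      unfold codim
      rw [Finset.card_erase_of_mem hv]
      have := Finset.card_pos.2 ⟨v, hv⟩
      omega
    rw [this, pow_succ]
    ring

theorem cochainSign_cochainSign (φ : Cochain P) : cochainSign (cochainSign φ) = φ := by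
  funext τ
  simp [cochainSign, ← mul_assoc, ← mul_pow]

end Cochains

/-! ### From differential graded data to an `A∞` pre-category. -/

section AInfty

namespace Comp

variable {A : AInftyHoms.{u, v}}

theorem length_append : ∀ {X Y Z : A.Ob} (p : Comp A X Y) (q : Comp A Y Z),
    (p.append q).length = p.length + q.length
  | _, _, _, nil _, q => by simp [append, length]
  | _, _, _, cons f p, q => by
    simp only [append, length, length_append p q]
    omega

theorem length_of_mem_splits : ∀ {X Z : A.Ob} (p : Comp A X Z), ∀ s ∈ p.splits,
    s.2.1.length + s.2.2.length = p.length
  | _, _, nil X, s, hs => by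
    simp only [splits, List.mem_singleton] at hs
    subst hs
    rfl
  | X, _, cons f p, s, hs => by
    simp only [splits, List.mem_cons, List.mem_map] at hs
    rcases hs with rfl | ⟨t, ht, rfl⟩
    · simp [length]
    · have := length_of_mem_splits p t ht
      simp only [length]
      omega

theorem insertSum_eq_zero {G : Type*} [AddCommGroup G]
    (μ : ∀ {X Y : A.Ob}, Comp A X Y → A.Hom X Y) {X Z : A.Ob} (T : Comp A X Z → G)
    (w : Comp A X Z) (ks : List ℤ)
    (h : ∀ {Y Y' : A.Ob} (p : Comp A X Y) (q : Comp A Y Y') (r : Comp A Y' Z), 0 < q.length →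
      p.length + q.length + r.length = w.length → T (p.append (cons (μ q) r)) = 0) :
    insertSum μ T w ks = 0 := by
  refine List.sum_eq_zero fun x hx => ?_
  obtain ⟨s, hs, rfl⟩ := List.mem_map.1 hx
  refine List.sum_eq_zero fun x hx => ?_
  obtain ⟨t, ht, rfl⟩ := List.mem_map.1 hx
  split_ifs with h0
  · rfl
  · have h1 := length_of_mem_splits w s hs
    have h2 := length_of_mem_splits _ t ht
    rw [h _ _ _ (by omega) (by omega), smul_zero]

theorem sign_zero (ks : List ℤ) : sign ks 0 = 1 := by simp [sign]

theorem sign_one (k : ℤ) (ks : List ℤ) : sign (k :: ks) 1 = ((k + 1).negOnePow : ℤˣ) := by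
  simp [sign]

section

variable {G : Type*} [AddCommGroup G] (μ : ∀ {X Y : A.Ob}, Comp A X Y → A.Hom X Y)

theorem insertSum_one {X Y : A.Ob} (T : Comp A X Y → G) (a : A.Hom X Y) (ks : List ℤ) :
    insertSum μ T (cons a (nil Y)) ks = T (cons (μ (cons a (nil Y))) (nil Y)) := by
  simp [insertSum, splits, length, append, sign_zero]

theorem insertSum_two {X Y Z : A.Ob} (T : Comp A X Z → G) (a : A.Hom X Y) (b : A.Hom Y Z)
    (k : ℤ) (ks : List ℤ) :
    insertSum μ T (cons a (cons b (nil Z))) (k :: ks) =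
      T (cons (μ (cons a (nil Y))) (cons b (nil Z))) +
        T (cons (μ (cons a (cons b (nil Z)))) (nil Z)) +
        ((k + 1).negOnePow : ℤˣ) • T (cons a (cons (μ (cons b (nil Z))) (nil Z))) := by
  simp [insertSum, splits, length, append, sign_zero, sign_one, Units.smul_def]

/-- An insertion of `μ₁` leaves three entries and is killed by `hT`, an insertion of `μ₃` is killed
by `hμ`; only the two insertions of `μ₂` survive. -/
theorem insertSum_three {X Y Z W : A.Ob} (T : Comp A X W → G) (a : A.Hom X Y) (b : A.Hom Y Z)
    (c : A.Hom Z W) (k : ℤ) (ks : List ℤ) (hT : ∀ w, 3 ≤ w.length → T w = 0)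
    (hμ : T (cons (μ (cons a (cons b (cons c (nil W))))) (nil W)) = 0) :
    insertSum μ T (cons a (cons b (cons c (nil W)))) (k :: ks) =
        T (cons (μ (cons a (cons b (nil Z)))) (cons c (nil W))) +
        ((k + 1).negOnePow : ℤˣ) • T (cons a (cons (μ (cons b (cons c (nil W)))) (nil W))) := by
  have h1 : ∀ {X' Y'} (a : A.Hom X X') (b : A.Hom X' Y') (c : A.Hom Y' W),
      T (cons a (cons b (cons c (nil W)))) = 0 := fun a b c => hT _ (by simp [length])
  simp [insertSum, splits, length, append, sign_zero, sign_one, h1, hμ, Units.smul_def]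

end

end Comp

open Comp

/-- A differential and an associative product satisfying the Leibniz rule, with suitable signs, form
an A∞ pre-category without higher products. -/
theorem AInftyData.isPrecategory_of_dg (A : AInftyData.{u, v})
    (sub : ∀ l l' : List A.Ob, A.Transverse l → l'.Sublist l → A.Transverse l')
    (direct : ∀ X Y : A.Ob, A.Transverse [X, Y] → iSupIndep (A.gr X Y))
    (higher : ∀ {X Y : A.Ob} (w : Comp A.toAInftyHoms X Y), 3 ≤ w.length → A.μ w = 0)
    (zero₁ : ∀ X Y : A.Ob, A.μ (cons (0 : A.Hom X Y) (nil Y)) = 0)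
    (zero_left : ∀ {X Y Z : A.Ob} (b : A.Hom Y Z),
      A.μ (cons (0 : A.Hom X Y) (cons b (nil Z))) = 0)
    (zero_right : ∀ {X Y Z : A.Ob} (a : A.Hom X Y),
      A.μ (cons a (cons (0 : A.Hom Y Z) (nil Z))) = 0)
    (add₁ : ∀ {X Y : A.Ob}, A.Transverse [X, Y] → ∀ f g : A.Hom X Y,
      A.μ (cons (f + g) (nil Y)) = A.μ (cons f (nil Y)) + A.μ (cons g (nil Y)))
    (add_left : ∀ {X Y Z : A.Ob}, A.Transverse [X, Y, Z] → ∀ (f g : A.Hom X Y) (b : A.Hom Y Z),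
      A.μ (cons (f + g) (cons b (nil Z))) =
        A.μ (cons f (cons b (nil Z))) + A.μ (cons g (cons b (nil Z))))
    (add_right : ∀ {X Y Z : A.Ob}, A.Transverse [X, Y, Z] → ∀ (a : A.Hom X Y) (f g : A.Hom Y Z),
      A.μ (cons a (cons (f + g) (nil Z))) =
        A.μ (cons a (cons f (nil Z))) + A.μ (cons a (cons g (nil Z))))
    (deg₁ : ∀ {X Y : A.Ob}, A.Transverse [X, Y] → ∀ k, ∀ a ∈ A.gr X Y k,
      A.μ (cons a (nil Y)) ∈ A.gr X Y (k + 1))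
    (deg₂ : ∀ {X Y Z : A.Ob}, A.Transverse [X, Y, Z] → ∀ k l, ∀ a ∈ A.gr X Y k, ∀ b ∈ A.gr Y Z l,
      A.μ (cons a (cons b (nil Z))) ∈ A.gr X Z (k + l))
    (rel₁ : ∀ {X Y : A.Ob}, A.Transverse [X, Y] → ∀ k, ∀ a ∈ A.gr X Y k,
      A.μ (cons (A.μ (cons a (nil Y))) (nil Y)) = 0)
    (rel₂ : ∀ {X Y Z : A.Ob}, A.Transverse [X, Y, Z] → ∀ k l, ∀ a ∈ A.gr X Y k, ∀ b ∈ A.gr Y Z l,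
      A.μ (cons (A.μ (cons a (nil Y))) (cons b (nil Z))) +
        A.μ (cons (A.μ (cons a (cons b (nil Z)))) (nil Z)) +
        ((k + 1).negOnePow : ℤˣ) • A.μ (cons a (cons (A.μ (cons b (nil Z))) (nil Z))) = 0)
    (rel₃ : ∀ {X Y Z W : A.Ob}, A.Transverse [X, Y, Z, W] → ∀ k l m, ∀ a ∈ A.gr X Y k,
      ∀ b ∈ A.gr Y Z l, ∀ c ∈ A.gr Z W m,
      A.μ (cons (A.μ (cons a (cons b (nil Z)))) (cons c (nil W))) +
        ((k + 1).negOnePow : ℤˣ) • A.μ (cons a (cons (A.μ (cons b (cons c (nil W)))) (nil W))) =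
        0) :
    A.IsPrecategory where
  transverse_sublist := sub
  direct := direct
  multilinear := by
    intro X Y Z W p f g q hT _ _
    by_cases h : 3 ≤ p.length + (q.length + 1)
    · rw [higher, higher, higher, add_zero] <;> simp only [length_append, length] <;> omega
    · rcases p with _ | ⟨a, _ | ⟨a', p⟩⟩
      · rcases q with _ | ⟨b, _ | ⟨b', q⟩⟩
        · exact add₁ hT f g
        · exact add_left hT f g b
        · simp only [length] at h; omega
      · rcases q with _ | ⟨b, q⟩
        · exact add_right hT a f g
        · simp only [length] at h; omega
      · simp only [length] at h; omega
  degree := by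
    intro X Y w ks hT h0 hks
    by_cases h : 3 ≤ w.length
    · rw [higher w h]
      exact zero_mem _
    · rcases w with _ | ⟨a, _ | ⟨b, _ | ⟨c, w⟩⟩⟩
      · simp [length] at h0
      · rcases ks with _ | ⟨k, ks⟩
        · exact hks.elim
        · obtain ⟨ha, hk⟩ := hks
          simp only [HasDegrees] at hk
          subst hk
          have := deg₁ hT k a ha
          convert this using 2
          simp [length]
          ring
      · rcases ks with _ | ⟨k, _ | ⟨l, ks⟩⟩
        · exact hks.elim
        · exact hks.2.elim
        · obtain ⟨ha, hb, hk⟩ := hks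
          simp only [HasDegrees] at hk
          subst hk
          have := deg₂ hT k l a ha b hb
          convert this using 2
          simp [length]
      · simp only [length] at h; omega
  ainfty := by
    intro X Y w ks hT h0 hks
    rcases w with _ | ⟨a, _ | ⟨b, _ | ⟨c, _ | ⟨d, w⟩⟩⟩⟩
    · simp [length] at h0
    · rcases ks with _ | ⟨k, ks⟩
      · exact hks.elim
      · rw [insertSum_one]
        exact rel₁ hT k a hks.1
    · rcases ks with _ | ⟨k, _ | ⟨l, ks⟩⟩
      · exact hks.elim
      · exact hks.2.elim
      · rw [insertSum_two]
        exact rel₂ hT k l a hks.1 b hks.2.1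
    · rcases ks with _ | ⟨k, _ | ⟨l, _ | ⟨m, ks⟩⟩⟩
      · exact hks.elim
      · exact hks.2.elim
      · exact hks.2.2.elim
      · rw [insertSum_three _ _ _ _ _ _ _ higher]
        · exact rel₃ hT k l m a hks.1 b hks.2.1 c hks.2.2.1
        · rw [higher (cons a (cons b (cons c (nil Y)))) (by simp [length]), zero₁]
    -- With at least four entries, either three or more remain after the insertion, or at most one
    -- lies outside the inserted block, which then has length at least three. A higher product
    -- vanishes in both cases.
    · refine insertSum_eq_zero _ _ _ _ fun p q r hq hl => ?_
      simp only [length] at hl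
      by_cases h : 3 ≤ p.length + (r.length + 1)
      · exact higher _ (by rw [length_append]; exact h)
      · rw [higher q (by omega)]
        rcases p with _ | ⟨a', _ | ⟨a'', p⟩⟩
        · rcases r with _ | ⟨b', _ | ⟨b'', r⟩⟩
          · exact zero₁ _ _
          · exact zero_left b'
          · simp only [length] at h; omega
        · rcases r with _ | ⟨b', r⟩
          · exact zero_right a'
          · simp only [length] at h; omega
        · simp only [length] at h; omega

end AInfty

/-! ### The pre-category `Simp`. -/

section Simp

variable {n : ℕ} [NeZero n] {Q : Type u} [MetricSpace Q] [ChartedSpace (EuclideanHalfSpace n) Q]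
  [IsManifold (𝓡∂ n) ∞ Q] {V : Type v} [Fintype V] [LinearOrder V] {P : SmoothTriangulation n Q V}

/-- Families of functions supported on the pieces of a grading are independent. -/
theorem iSupIndep_of_grading {ι : Type*} {M : ι → Type*} [∀ i, AddCommGroup (M i)] (c : ι → ℤ)
    (S : ℤ → AddSubgroup (∀ i, M i)) (hS : ∀ k, ∀ f ∈ S k, ∀ i, c i ≠ k → f i = 0) :
    iSupIndep S := by
  rw [iSupIndep_def]
  intro k
  rw [AddSubgroup.disjoint_def]
  intro f hf hf'
  have : ∀ g ∈ ⨆ j, ⨆ (_ : j ≠ k), S j, ∀ i, c i = k → g i = 0 := by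
    intro g hg
    let N : AddSubgroup (∀ i, M i) :=
      { carrier := {g | ∀ i, c i = k → g i = 0}
        add_mem' := fun ha hb i h => by simp [ha i h, hb i h]
        zero_mem' := fun _ _ => rfl
        neg_mem' := fun ha i h => by simp [ha i h] }
    have hN : ⨆ j, ⨆ (_ : j ≠ k), S j ≤ N :=
      iSup₂_le fun j hj g hg i hi => hS j g hg i (by rw [hi]; exact hj.symm)
    exact hN hg
  funext i
  by_cases h : c i = k
  · exact this f hf' i h
  · exact hS k f hf i h

theorem mem_plusFaces_of_subset {H : (𝓡∂ n).boundary Q → ℝ} {σ τ : Finset V}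
    (h : τ ∈ plusFaces P H) (hστ : σ ⊆ τ) (hσ : σ.Nonempty) : σ ∈ plusFaces P H := by
  obtain ⟨h1, κ, hκ, hτκ, h2⟩ := h
  exact ⟨P.mem_of_subset h1 hστ hσ, κ, hκ, hστ.trans hτκ, h2⟩

/-- A sum is positive at a point only if one of the summands is. This is why the cup product is
defined on relative cochains: each simplex of `∂⁺` for the composite lies in `∂⁺` for one of the two
factors. -/
theorem plusFaces_add {H H' : (𝓡∂ n).boundary Q → ℝ} :
    plusFaces P (H + H') ⊆ plusFaces P H ∪ plusFaces P H' := by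
  rintro σ ⟨h1, κ, hκ, hσκ, hb, x, hx, hpos⟩
  rcases lt_or_ge 0 (H x) with h | h
  · exact Or.inl ⟨h1, κ, hκ, hσκ, hb, x, hx, h⟩
  · refine Or.inr ⟨h1, κ, hκ, hσκ, hb, x, hx, ?_⟩
    rw [Pi.add_apply] at hpos
    linarith

theorem mem_simp_gr {H₀ H₁ : (𝓡∂ n).boundary Q → ℝ} {k : ℤ} {φ : Cochain P} :
    φ ∈ (Simp P).gr H₀ H₁ k ↔
      ∀ σ, (σ.1 ∈ plusFaces P (H₁ - H₀) ∨ (codim σ.1 : ℤ) ≠ k) → φ σ = 0 := Iff.rfl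

theorem eval_eq_zero_of_mem_gr {H₀ H₁ : (𝓡∂ n).boundary Q → ℝ} {k : ℤ} {φ : Cochain P}
    (h : φ ∈ (Simp P).gr H₀ H₁ k) {σ : Finset V}
    (hσ : σ ∈ plusFaces P (H₁ - H₀) ∨ (codim σ : ℤ) ≠ k) : φ.eval σ = 0 := by
  by_cases hm : σ ∈ P.complex.faces
  · rw [φ.eval_of_mem hm]
    exact h ⟨σ, hm⟩ hσ
  · exact dif_neg hm

/-- The products carry their sign through the operator `cochainSign`, which needs no degree, while
the `A∞` relations carry it through the degree `k`; on homogeneous cochains they are the same. -/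
theorem cochainSign_of_mem_gr {H₀ H₁ : (𝓡∂ n).boundary Q → ℝ} {k : ℤ} {φ : Cochain P}
    (h : φ ∈ (Simp P).gr H₀ H₁ k) : cochainSign φ = (k.negOnePow : ℤˣ) • φ := by
  funext σ
  by_cases hk : (codim σ.1 : ℤ) = k
  · subst hk
    simp [cochainSign, Int.negOnePow_def, Units.smul_def]
  · have : φ σ = 0 := h σ (Or.inr hk)
    simp [cochainSign, this]

theorem coboundary_mem_gr {H₀ H₁ : (𝓡∂ n).boundary Q → ℝ} {k : ℤ} {φ : Cochain P}
    (h : φ ∈ (Simp P).gr H₀ H₁ k) : coboundary φ ∈ (Simp P).gr H₀ H₁ (k + 1) := by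
  intro τ hτ
  refine Finset.sum_eq_zero fun v hv => ?_
  rcases (τ.1.erase v).eq_empty_or_nonempty with he | hne
  · rw [he, Cochain.eval_empty, mul_zero]
  · rw [eval_eq_zero_of_mem_gr h, mul_zero]
    refine hτ.imp (fun h => mem_plusFaces_of_subset h (Finset.erase_subset _ _) hne) fun h h' => h ?_
    unfold codim at h' ⊢
    have h1 := Finset.card_pos.2 hne
    rw [Finset.card_erase_of_mem hv] at h' h1
    omega

theorem cup_mem_gr {H₀ H₁ H₂ : (𝓡∂ n).boundary Q → ℝ} {k l : ℤ} {φ ψ : Cochain P}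
    (h : φ ∈ (Simp P).gr H₀ H₁ k) (h' : ψ ∈ (Simp P).gr H₁ H₂ l) :
    cup φ ψ ∈ (Simp P).gr H₀ H₂ (k + l) := by
  intro τ hτ
  refine Finset.sum_eq_zero fun v hv => ?_
  have n1 : (τ.1.filter (· ≤ v)).Nonempty := ⟨v, by simp [hv]⟩
  have n2 : (τ.1.filter (v ≤ ·)).Nonempty := ⟨v, by simp [hv]⟩
  rcases hτ with hτ | hτ
  · rw [show H₂ - H₀ = (H₁ - H₀) + (H₂ - H₁) by abel] at hτ
    rcases plusFaces_add hτ with hτ | hτ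
    · rw [eval_eq_zero_of_mem_gr h (Or.inl (mem_plusFaces_of_subset hτ (Finset.filter_subset _ _) n1)),
        zero_mul]
    · rw [eval_eq_zero_of_mem_gr h'
        (Or.inl (mem_plusFaces_of_subset hτ (Finset.filter_subset _ _) n2)), mul_zero]
  · by_cases hk : (codim (τ.1.filter (· ≤ v)) : ℤ) = k
    · rw [eval_eq_zero_of_mem_gr h' (Or.inr fun hl => hτ ?_), mul_zero]
      have e : codim τ.1 = position τ.1 v + codim (τ.1.filter (v ≤ ·)) := by
        unfold codim position
        have h1 := Finset.card_filter_add_card_filter_not (s := τ.1) (· < v)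
        have h2 := Finset.card_pos.2 n2
        simp only [not_lt] at h1
        omega
      rw [codim_filter_le hv] at hk
      rw [e]
      push_cast
      rw [hk, hl]
    · rw [eval_eq_zero_of_mem_gr h (Or.inr hk), zero_mul]

/-- The sign of an insertion behind `a` times the sign of `μ₂` at `a` is always `-1`; this turns the
Leibniz rule and associativity into the `A∞` relations. -/
theorem negOnePow_succ_mul_self (k : ℤ) :
    (((k + 1).negOnePow : ℤˣ) : ℤ) * ((k.negOnePow : ℤˣ) : ℤ) = -1 := by
  rw [Int.negOnePow_succ, ← Units.val_mul, neg_mul, ← Int.negOnePow_add,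
    Int.negOnePow_even _ (Even.add_self k)]
  rfl

theorem signed_cup_mem_gr {H₀ H₁ H₂ : (𝓡∂ n).boundary Q → ℝ} {k l : ℤ} {φ ψ : Cochain P}
    (h : φ ∈ (Simp P).gr H₀ H₁ k) (h' : ψ ∈ (Simp P).gr H₁ H₂ l) :
    cup (cochainSign φ) ψ ∈ (Simp P).gr H₀ H₂ (k + l) := by
  have : cup (cochainSign φ) ψ = ((k.negOnePow : ℤˣ) : ℤ) • cup φ ψ := by
    rw [cochainSign_of_mem_gr h, Units.smul_def, smul_cup]
  rw [this]
  exact AddSubgroup.zsmul_mem _ (cup_mem_gr h h') _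

theorem signed_leibniz {k : ℤ} {a : Cochain P} (ha : cochainSign a = (k.negOnePow : ℤˣ) • a)
    (b : Cochain P) :
    cup (cochainSign (coboundary a)) b + coboundary (cup (cochainSign a) b) +
      ((k + 1).negOnePow : ℤˣ) • cup (cochainSign a) (coboundary b) = 0 := by
  rw [cochainSign_coboundary, coboundary_cup, cochainSign_cochainSign, ha]
  simp only [Units.smul_def, smul_cup, smul_smul]
  rw [negOnePow_succ_mul_self, coboundary_smul, ← neg_one_zsmul, smul_cup, smul_cup]
  simp

theorem signed_assoc {k : ℤ} {a : Cochain P} (ha : cochainSign a = (k.negOnePow : ℤˣ) • a)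
    (b c : Cochain P) :
    cup (cochainSign (cup (cochainSign a) b)) c +
      ((k + 1).negOnePow : ℤˣ) • cup (cochainSign a) (cup (cochainSign b) c) = 0 := by
  rw [cochainSign_cup, cochainSign_cochainSign, cup_assoc, ha]
  simp only [Units.smul_def, smul_cup, smul_smul]
  rw [negOnePow_succ_mul_self]
  simp

theorem signed_zero_cup (b : Cochain P) : cup (cochainSign 0) b = 0 := by
  rw [cochainSign_zero, zero_cup]

theorem signed_add_cup (f g b : Cochain P) :
    cup (cochainSign (f + g)) b = cup (cochainSign f) b + cup (cochainSign g) b := by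
  rw [cochainSign_add, add_cup]

theorem simp_isPrecategory : (Simp P).IsPrecategory := by
  refine AInftyData.isPrecategory_of_dg _ ?_ ?_ ?_ ?_ ?_ ?_ ?_ ?_ ?_ ?_ ?_ ?_ ?_ ?_
  · intro l l' h hs
    exact List.Pairwise.sublist hs h
  · intro X Y _
    exact iSupIndep_of_grading (fun σ : P.complex.faces => (codim σ.1 : ℤ)) _
      fun k f hf i hi => hf i (Or.inr hi)
  · intro X Y w hw
    rcases w with _ | ⟨a, _ | ⟨b, _ | ⟨c, w⟩⟩⟩
    · simp [Comp.length] at hw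
    · simp [Comp.length] at hw
    · simp [Comp.length] at hw
    · rfl
  · intro X Y
    exact coboundary_zero
  · intro X Y Z b
    exact signed_zero_cup (P := P) b
  · intro X Y Z a
    exact cup_zero (P := P) _
  · intro X Y _ f g
    exact coboundary_add (P := P) f g
  · intro X Y Z _ f g b
    exact signed_add_cup (P := P) f g b
  · intro X Y Z _ a f g
    exact cup_add (P := P) _ f g
  · intro X Y _ k a ha
    exact coboundary_mem_gr ha
  · intro X Y Z _ k l a ha b hb
    exact signed_cup_mem_gr ha hb
  · intro X Y _ k a ha
    exact coboundary_coboundary (P := P) a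
  · intro X Y Z _ k l a ha b hb
    exact signed_leibniz (cochainSign_of_mem_gr ha) b
  · intro X Y Z W _ k l m a ha b hb c hc
    exact signed_assoc (cochainSign_of_mem_gr ha) b c

end Simp

/-! ### Linear algebra of orientations and coorientations. -/

noncomputable section

section LinearAlgebra

variable {T : Type*} [AddCommGroup T] [Module ℝ T] {K : Submodule ℝ T} {m n k : ℕ}

/-- The vectors `X 0, …, X (m - 1)` form a basis of `K` whose orientation is `s` times `o`. -/
def FrameSign (o : Orientation ℝ K (Fin m)) (X : ℕ → T) (s : ℤˣ) : Prop :=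
  ∃ b : Module.Basis (Fin m) ℝ K, (∀ i, (b i : T) = X i) ∧
    b.orientation = if s = 1 then o else -o

theorem FrameSign.neg {o : Orientation ℝ K (Fin m)} {X : ℕ → T} {s : ℤˣ} (h : FrameSign o X s) :
    FrameSign (-o) X (-s) := by
  obtain ⟨b, hb, ho⟩ := h
  refine ⟨b, hb, ?_⟩
  rcases Int.units_eq_one_or s with rfl | rfl
  · rw [ho, if_pos rfl, if_neg (by decide)]
    exact (neg_neg (G := Orientation ℝ K (Fin m)) o).symm
  · rw [ho, if_neg (by decide), if_pos (by decide)]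

theorem orientation_neg_neg (o : Orientation ℝ K (Fin m)) : - -o = o :=
  neg_neg (G := Orientation ℝ K (Fin m)) o

theorem frameSign_neg_iff {o : Orientation ℝ K (Fin m)} {X : ℕ → T} {s : ℤˣ} :
    FrameSign (-o) X s ↔ FrameSign o X (-s) :=
  ⟨fun h => by simpa only [orientation_neg_neg] using h.neg, fun h => by simpa using h.neg⟩

theorem FrameSign.mem {o : Orientation ℝ K (Fin m)} {X : ℕ → T} {s : ℤˣ} (h : FrameSign o X s)
    {i : ℕ} (hi : i < m) : X i ∈ K := by
  obtain ⟨b, hb, -⟩ := h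
  rw [← hb ⟨i, hi⟩]
  exact (b ⟨i, hi⟩).2

theorem FrameSign.orientation_eq {o o' : Orientation ℝ K (Fin m)} {X : ℕ → T} {s : ℤˣ}
    (h : FrameSign o X s) (h' : FrameSign o' X s) : o = o' := by
  obtain ⟨b, hb, ho⟩ := h
  obtain ⟨b', hb', ho'⟩ := h'
  have : b = b' := Module.Basis.eq_of_apply_eq fun i => Subtype.ext ((hb i).trans (hb' i).symm)
  subst this
  rw [ho] at ho'
  rcases Int.units_eq_one_or s with rfl | rfl
  · simpa using ho'
  · have : -o = -o' := by simpa using ho'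
    rw [← orientation_neg_neg o, this, orientation_neg_neg]

theorem frameSign_iff_det_pos (b : Module.Basis (Fin m) ℝ K) (X : ℕ → T) (s : ℤˣ) :
    FrameSign b.orientation X s ↔
      ∃ t : Fin m → K, (∀ i, (t i : T) = X i) ∧ 0 < ((s : ℤ) : ℝ) * b.det t := by
  constructor
  · rintro ⟨b', hb', ho⟩
    refine ⟨b', hb', ?_⟩
    rcases Int.units_eq_one_or s with rfl | rfl
    · rw [if_pos rfl] at ho
      simpa using (b.orientation_eq_iff_det_pos b').1 ho.symm
    · rw [if_neg (by decide)] at ho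
      have h1 : ¬ (0 < b.det b') := by
        rw [← b.orientation_eq_iff_det_pos b', ho]
        exact (Module.Ray.ne_neg_self _)
      have h2 : b.det b' ≠ 0 := (b.isUnit_det b').ne_zero
      have : b.det b' < 0 := lt_of_le_of_ne (not_lt.1 h1) h2
      simpa using this
  · rintro ⟨t, ht, hpos⟩
    have hne : b.det t ≠ 0 := by
      intro h
      simp [h] at hpos
    have hb := (b.is_basis_iff_det (v := t)).2 (isUnit_iff_ne_zero.2 hne)
    refine ⟨Module.Basis.mk hb.1 hb.2.ge, fun i => ?_, ?_⟩
    · rw [Module.Basis.mk_apply, ht]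
    · have hc : ⇑(Module.Basis.mk hb.1 hb.2.ge) = t := Module.Basis.coe_mk _ _
      rcases Int.units_eq_one_or s with rfl | rfl
      · rw [if_pos rfl, eq_comm, b.orientation_eq_iff_det_pos, hc]
        simpa using hpos
      · rw [if_neg (by decide), ← b.orientation_ne_iff_eq_neg, ne_comm, ne_eq,
          b.orientation_eq_iff_det_pos, hc]
        simp only [Units.val_neg, Units.val_one, Int.cast_neg, Int.cast_one, neg_mul, one_mul,
          Left.neg_pos_iff] at hpos
        exact hpos.not_gt

theorem units_sq_cast (s : ℤˣ) : ((s : ℤ) : ℝ) * ((s : ℤ) : ℝ) = 1 := by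
  rcases Int.units_eq_one_or s with rfl | rfl <;> simp

theorem FrameSign.iff_det_pos {o : Orientation ℝ K (Fin m)} {X : ℕ → T} {s : ℤˣ}
    (b : Module.Basis (Fin m) ℝ K) (hb : ∀ i, (b i : T) = X i) (h : FrameSign o X s) (Z : ℕ → T)
    (s' : ℤˣ) : FrameSign o Z s' ↔
      ∃ t : Fin m → K, (∀ i, (t i : T) = Z i) ∧ 0 < ((s : ℤ) : ℝ) * ((s' : ℤ) : ℝ) * b.det t := by
  obtain ⟨b', hb', ho⟩ := h
  have : b = b' := Module.Basis.eq_of_apply_eq fun i => Subtype.ext ((hb i).trans (hb' i).symm)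
  subst this
  rcases Int.units_eq_one_or s with rfl | rfl
  · rw [if_pos rfl] at ho
    rw [← ho, frameSign_iff_det_pos]
    simp
  · rw [if_neg (by decide)] at ho
    have : o = -b.orientation := by rw [ho, orientation_neg_neg]
    rw [this, frameSign_neg_iff, frameSign_iff_det_pos]
    simp

/-- `Ω` represents the orientation `o` of the full space. -/
def Represents (o : Orientation ℝ K (Fin n)) (Ω : T [⋀^Fin n]→ₗ[ℝ] ℝ) : Prop :=
  ∀ (X : ℕ → T) (s : ℤˣ), FrameSign o X s ↔ 0 < ((s : ℤ) : ℝ) * Ω fun i => X i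

theorem form_eq_mul_det (Ω : T [⋀^Fin n]→ₗ[ℝ] ℝ) (b : Module.Basis (Fin n) ℝ K) (t : Fin n → K) :
    (Ω fun i => (t i : T)) = (Ω fun i => (b i : T)) * b.det t := by
  have := congrArg (fun f => f t) ((Ω.compLinearMap K.subtype).eq_smul_basis_det b)
  simpa using this

/-- Top-degree forms have a well-defined sign on each orientation class of frames, so the sign on
one frame determines all. The factor `c` only has to have the sign of `Ω` on `X`: it will be the
value at a neighbouring point, so that one multiple of a form serves on a whole neighbourhood. -/
theorem FrameSign.represents (hK : K = ⊤) {o : Orientation ℝ K (Fin n)} {X : ℕ → T} {s : ℤˣ}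
    (h : FrameSign o X s) {Ω : T [⋀^Fin n]→ₗ[ℝ] ℝ} {c : ℝ} (hc : 0 < c * Ω fun i => X i) :
    Represents o ((((s : ℤ) : ℝ) * c) • Ω) := by
  intro Z s'
  obtain ⟨b, hb, ho⟩ := h
  rw [FrameSign.iff_det_pos b hb ⟨b, hb, ho⟩]
  simp only [AlternatingMap.smul_apply, smul_eq_mul]
  set Z' : Fin n → K := fun i => ⟨Z i, hK ▸ Submodule.mem_top⟩ with hZ'
  have h1 : (Ω fun i : Fin n => Z i) = (Ω fun i : Fin n => X i) * b.det Z' := by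
    have := form_eq_mul_det Ω b Z'
    simpa only [hb] using this
  have key : 0 < ((s : ℤ) : ℝ) * ((s' : ℤ) : ℝ) * b.det Z' ↔
      0 < ((s' : ℤ) : ℝ) * (((s : ℤ) : ℝ) * c * Ω fun i : Fin n => Z i) := by
    rw [h1, show ((s' : ℤ) : ℝ) * (((s : ℤ) : ℝ) * c * ((Ω fun i : Fin n => X i) * b.det Z')) =
      (c * (Ω fun i : Fin n => X i)) * (((s : ℤ) : ℝ) * ((s' : ℤ) : ℝ) * b.det Z') by ring]
    exact (mul_pos_iff_of_pos_left hc).symm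
  rw [← key]
  constructor
  · rintro ⟨t, ht, hp⟩
    have : t = Z' := funext fun i => Subtype.ext (ht i)
    rwa [← this]
  · exact fun h => ⟨Z', fun i => rfl, h⟩

/-- The matrix of the components `A (a j) i`. -/
def frameMatrix (A : T →ₗ[ℝ] Fin k → ℝ) (a : ℕ → T) : Matrix (Fin k) (Fin k) ℝ :=
  Matrix.of fun i j => A (a j) i

theorem frameMatrix_eq_one {A : T →ₗ[ℝ] Fin k → ℝ} {a : ℕ → T}
    (h : ∀ i : Fin k, A (a i) = Pi.single i 1) : frameMatrix A a = 1 := by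
  ext i j
  simp [frameMatrix, h, Matrix.one_apply, Pi.single_apply]

/-- In the basis made of `a₀` and `b`, the frame `(a, t)` has a block triangular matrix, whose
diagonal blocks are the components of `a` under `A` and the coordinates of `t`. The part of `a`
along `K` only enters the off-diagonal block. -/
theorem form_catFrame (h : k + m = n) {A : T →ₗ[ℝ] Fin k → ℝ} (hK : LinearMap.ker A = K)
    (b : Module.Basis (Fin m) ℝ K) {a₀ t₀ : ℕ → T} (ha₀ : ∀ i : Fin k, A (a₀ i) = Pi.single i 1)
    (ht₀ : ∀ i, (b i : T) = t₀ i) (Ω : T [⋀^Fin n]→ₗ[ℝ] ℝ) :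
    (Ω ≠ 0 → (Ω fun i => catFrame k a₀ t₀ i) ≠ 0) ∧
    ∀ (a t : ℕ → T) (t' : Fin m → K), (∀ i, (t' i : T) = t i) →
    (Ω fun i => catFrame k a t i) =
      (Ω fun i => catFrame k a₀ t₀ i) * (frameMatrix A a).det * b.det t' := by
  classical
  -- A section of `A`; it splits `T` as the sum of `ℝ^k` and `K`.
  set R : (Fin k → ℝ) →ₗ[ℝ] T := Fintype.linearCombination ℝ (fun i : Fin k => a₀ i) with hR
  have hAR : ∀ x, A (R x) = x := by
    intro x
    rw [hR, Fintype.linearCombination_apply, map_sum]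
    simp only [map_smul, ha₀]
    ext i
    simp [Finset.sum_apply, Pi.single_apply]
  have hmem : ∀ w, w - R (A w) ∈ K := fun w => by
    rw [← hK, LinearMap.mem_ker, map_sub, hAR, sub_self]
  let E : T ≃ₗ[ℝ] (Fin k → ℝ) × K :=
    { toFun := fun w => (A w, ⟨w - R (A w), hmem w⟩)
      invFun := fun x => R x.1 + x.2
      map_add' := fun x y => by
        ext1
        · simp
        · ext1
          simp only [map_add, Prod.snd_add, Submodule.coe_add]
          abel
      map_smul' := fun c x => by
        ext1
        · simp
        · ext1
          simp [smul_sub]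
      left_inv := fun w => by simp
      right_inv := fun x => by
        have hx : A (x.2 : T) = 0 := by
          rw [← LinearMap.mem_ker, hK]
          exact x.2.2
        ext1
        · simp [hAR, hx]
        · ext1
          simp [hAR, hx] }
  let B : Module.Basis (Fin k ⊕ Fin m) ℝ T := ((Pi.basisFun ℝ (Fin k)).prod b).map E.symm
  have hBl : ∀ w i, B.repr w (Sum.inl i) = A w i := fun w i => by
    simp [B, E]
  have hBr : ∀ w i, B.repr w (Sum.inr i) = b.repr ⟨w - R (A w), hmem w⟩ i := fun w i => by
    simp [B, E]
  let e : Fin k ⊕ Fin m ≃ Fin n := finSumFinEquiv.trans (finCongr h)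
  have hcat : ∀ a t : ℕ → T, (Ω fun i => catFrame k a t i) =
      Ω.domDomCongr e.symm (Sum.elim (fun i : Fin k => a i) (fun i : Fin m => t i)) := by
    intro a t
    rw [AlternatingMap.domDomCongr_apply]
    congr 1
    funext i
    obtain ⟨j, rfl⟩ := e.surjective i
    rw [Function.comp_apply, e.symm_apply_apply]
    rcases j with j | j
    · simp [e, catFrame]
    · simp [e, catFrame]
  have hBcoe : ⇑B = Sum.elim (fun i : Fin k => a₀ i) (fun i : Fin m => t₀ i) := by
    funext j
    rcases j with j | j
    · simp [B, E, hR]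
    · simp [B, E, ht₀]
  have hdet : ∀ (a t : ℕ → T) (t' : Fin m → K), (∀ i, (t' i : T) = t i) →
      B.det (Sum.elim (fun i : Fin k => a i) (fun i : Fin m => t i)) =
        (frameMatrix A a).det * b.det t' := by
    intro a t t' ht
    rw [Module.Basis.det_apply, Module.Basis.det_apply]
    have hAt : ∀ j, A (t' j : T) = 0 := fun j => by
      rw [← LinearMap.mem_ker, hK]
      exact (t' j).2
    have : B.toMatrix (Sum.elim (fun i : Fin k => a i) (fun i : Fin m => t i)) =
        Matrix.fromBlocks (frameMatrix A a) 0
          (Matrix.of fun i j => b.repr ⟨a j - R (A (a j)), hmem _⟩ i) (b.toMatrix t') := by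
      ext i j
      rcases i with i | i <;> rcases j with j | j
      · simp [Module.Basis.toMatrix_apply, hBl, frameMatrix]
      · simp [Module.Basis.toMatrix_apply, hBl, ← ht, hAt]
      · simp [Module.Basis.toMatrix_apply, hBr]
      · simp only [Module.Basis.toMatrix_apply, Sum.elim_inr, hBr, Matrix.fromBlocks_apply₂₂]
        congr 2
        ext1
        simp [← ht, hAt]
    rw [this, Matrix.det_fromBlocks_zero₁₂]
  have hΩ : ∀ w, Ω.domDomCongr e.symm w = Ω.domDomCongr e.symm B * B.det w := fun w => by
    have := congrArg (fun f => f w) ((Ω.domDomCongr e.symm).eq_smul_basis_det B)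
    simpa using this
  refine ⟨fun hne h0 => hne ?_, fun a t t' ht => ?_⟩
  · rw [hcat, ← hBcoe, AlternatingMap.map_basis_eq_zero_iff] at h0
    ext w
    have := congrArg (fun f => f (w ∘ e)) h0
    simpa [AlternatingMap.domDomCongr_apply, Function.comp_assoc] using this
  · rw [hcat, hcat a₀ t₀, hΩ, hdet a t t' ht, ← hBcoe]
    ring

/-- The orientation `o` of `K`, the kernel of `A`, is such that a normal frame which is positive with
respect to `A`, followed by a positive frame of `K`, is positive with respect to `Ω`. -/
def Cooriented (A : T →ₗ[ℝ] Fin k → ℝ) (Ω : T [⋀^Fin n]→ₗ[ℝ] ℝ) (o : Orientation ℝ K (Fin m)) :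
    Prop :=
  ∀ (t : ℕ → T) (s : ℤˣ) (a : ℕ → T), (frameMatrix A a).det ≠ 0 →
    (FrameSign o t s ↔ (∀ i < m, t i ∈ K) ∧
      0 < ((s : ℤ) : ℝ) * ((frameMatrix A a).det * Ω fun i => catFrame k a t i))

theorem exists_dual_frame {A : T →ₗ[ℝ] Fin k → ℝ} (hA : Function.Surjective A) :
    ∃ a : ℕ → T, ∀ i : Fin k, A (a i) = Pi.single i 1 := by
  choose g hg using hA
  exact ⟨fun i => if h : i < k then g (Pi.single ⟨i, h⟩ 1) else 0, fun i => by simp [hg]⟩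

theorem finrank_ker_of_surjective [FiniteDimensional ℝ T] (hT : Module.finrank ℝ T = n)
    (h : k + m = n) {A : T →ₗ[ℝ] Fin k → ℝ} (hA : Function.Surjective A)
    (hK : LinearMap.ker A = K) : Module.finrank ℝ K = m := by
  have := A.finrank_range_add_finrank_ker
  rw [LinearMap.range_eq_top.2 hA, finrank_top, hK, hT] at this
  simp at this
  omega

/-- By `form_catFrame` the quantity in the definition of `Cooriented` contains the determinant of
the normal frame squared, so its sign does not depend on that frame. -/
theorem exists_cooriented [FiniteDimensional ℝ T] (hT : Module.finrank ℝ T = n) (h : k + m = n)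
    {A : T →ₗ[ℝ] Fin k → ℝ} (hA : Function.Surjective A) (hK : LinearMap.ker A = K)
    {Ω : T [⋀^Fin n]→ₗ[ℝ] ℝ} (hΩ : Ω ≠ 0) : ∃ o : Orientation ℝ K (Fin m), Cooriented A Ω o := by
  obtain ⟨a₀, ha₀⟩ := exists_dual_frame hA
  let b : Module.Basis (Fin m) ℝ K :=
    Module.finBasisOfFinrankEq ℝ K (finrank_ker_of_surjective hT h hA hK)
  let t₀ : ℕ → T := fun i => if h : i < m then b ⟨i, h⟩ else 0
  have ht₀ : ∀ i, (b i : T) = t₀ i := fun i => by simp [t₀]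
  obtain ⟨hne, hform⟩ := form_catFrame h hK b ha₀ ht₀ Ω
  replace hne := hne hΩ
  set c := Ω fun i => catFrame k a₀ t₀ i with hc
  -- Here `ε` is the sign of `c`, the value of `Ω` on the reference frame; the required orientation
  -- is `ε` times that of `b`.
  have main : ∀ (t : ℕ → T) (s : ℤˣ) (a : ℕ → T), (frameMatrix A a).det ≠ 0 →
      ∀ ε : ℤˣ, 0 < ((ε : ℤ) : ℝ) * c → ((∃ t' : Fin m → K, (∀ i, (t' i : T) = t i) ∧
        0 < ((ε * s : ℤˣ) : ℤ) * b.det t') ↔ (∀ i < m, t i ∈ K) ∧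
      0 < ((s : ℤ) : ℝ) * ((frameMatrix A a).det * Ω fun i => catFrame k a t i)) := by
    intro t s a ha ε hε
    have key : ∀ t' : Fin m → K, (∀ i, (t' i : T) = t i) →
        (0 < ((ε * s : ℤˣ) : ℤ) * b.det t' ↔
        0 < ((s : ℤ) : ℝ) * ((frameMatrix A a).det * Ω fun i => catFrame k a t i)) := by
      intro t' ht'
      rw [hform a t t' ht']
      have e1 : ((s : ℤ) : ℝ) * ((frameMatrix A a).det * (c * (frameMatrix A a).det * b.det t')) =
          (((ε : ℤ) : ℝ) * c) * (frameMatrix A a).det ^ 2 *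
            (((ε : ℤ) : ℝ) * ((s : ℤ) : ℝ) * b.det t') := by
        have := units_sq_cast ε
        linear_combination
          -(((s : ℤ) : ℝ) * c * (frameMatrix A a).det ^ 2 * b.det t') * this
      have e2 : 0 < (((ε : ℤ) : ℝ) * c) * (frameMatrix A a).det ^ 2 := mul_pos hε (by positivity)
      rw [e1, mul_pos_iff_of_pos_left e2]
      push_cast
      rfl
    constructor
    · rintro ⟨t', ht', hp⟩
      exact ⟨fun i hi => ht' ⟨i, hi⟩ ▸ (t' ⟨i, hi⟩).2, (key t' ht').1 hp⟩
    · rintro ⟨hm, hp⟩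
      exact ⟨fun i => ⟨t i, hm i i.2⟩, fun i => rfl, (key (fun i => ⟨t i, hm i i.2⟩) fun i => rfl).2 hp⟩
  rcases lt_or_gt_of_ne hne with hneg | hpos
  · refine ⟨-b.orientation, fun t s a ha => ?_⟩
    rw [frameSign_neg_iff, frameSign_iff_det_pos, ← main t s a ha (-1) (by simpa using hneg)]
    simp
  · refine ⟨b.orientation, fun t s a ha => ?_⟩
    rw [frameSign_iff_det_pos, ← main t s a ha 1 (by simpa using hpos)]
    simp

theorem Cooriented.eq {A : T →ₗ[ℝ] Fin k → ℝ} {Ω : T [⋀^Fin n]→ₗ[ℝ] ℝ}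
    {o o' : Orientation ℝ K (Fin m)} (hA : Function.Surjective A) (hm : Module.finrank ℝ K = m)
    (h : Cooriented A Ω o) (h' : Cooriented A Ω o') [FiniteDimensional ℝ T] : o = o' := by
  obtain ⟨a₀, ha₀⟩ := exists_dual_frame hA
  have hd : (frameMatrix A a₀).det ≠ 0 := by simp [frameMatrix_eq_one ha₀]
  let b : Module.Basis (Fin m) ℝ K := Module.finBasisOfFinrankEq ℝ K hm
  let t₀ : ℕ → T := fun i => if h : i < m then b ⟨i, h⟩ else 0
  have ht₀ : ∀ i, (b i : T) = t₀ i := fun i => by simp [t₀]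
  have hs : ∃ s, FrameSign o t₀ s := by
    by_cases hb : b.orientation = o
    · exact ⟨1, b, ht₀, by rw [if_pos rfl, hb]⟩
    · exact ⟨-1, b, ht₀, by
        have : o = -b.orientation := (b.orientation_ne_iff_eq_neg o).1 fun h => hb h.symm
        rw [if_neg (by decide), this, orientation_neg_neg]⟩
  obtain ⟨s, hs⟩ := hs
  exact hs.orientation_eq ((h' t₀ s a₀ hd).2 ((h t₀ s a₀ hd).1 hs))

theorem Cooriented.matrix_mul {A A' : T →ₗ[ℝ] Fin k → ℝ} {Ω : T [⋀^Fin n]→ₗ[ℝ] ℝ}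
    {o : Orientation ℝ K (Fin m)} (h : Cooriented A Ω o) (B : Matrix (Fin k) (Fin k) ℝ)
    (hB : 0 < B.det) (hA' : ∀ w, A' w = B.mulVec (A w)) : Cooriented A' Ω o := by
  intro t s a ha
  have e : (frameMatrix A' a).det = B.det * (frameMatrix A a).det := by
    rw [← Matrix.det_mul]
    congr 1
    ext i j
    simp [frameMatrix, hA', Matrix.mulVec, dotProduct, Matrix.mul_apply]
  rw [e] at ha
  rw [h t s a (right_ne_zero_of_mul ha), e]
  refine and_congr_right fun _ => ?_
  rw [show ((s : ℤ) : ℝ) * (B.det * (frameMatrix A a).det * Ω fun i => catFrame k a t i) =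
    B.det * (((s : ℤ) : ℝ) * ((frameMatrix A a).det * Ω fun i => catFrame k a t i)) by ring,
    mul_pos_iff_of_pos_left hB]

theorem Cooriented.of_smul {A A' : T →ₗ[ℝ] Fin k → ℝ} {Ω : T [⋀^Fin n]→ₗ[ℝ] ℝ}
    {o : Orientation ℝ K (Fin m)} (h : Cooriented A Ω o) {c : ℝ} (hc : 0 < c)
    (hA' : ∀ w, A' w = c • A w) : Cooriented A' Ω o :=
  h.matrix_mul (c • 1) (by simp [hc]) fun w => by simp [hA', Matrix.smul_mulVec]

theorem Represents.cooriented_iff {K' : Submodule ℝ T} {oQ : Orientation ℝ K' (Fin n)}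
    {Ω Ω' : T [⋀^Fin n]→ₗ[ℝ] ℝ} (h : Represents oQ Ω) (h' : Represents oQ Ω')
    {A : T →ₗ[ℝ] Fin k → ℝ} {o : Orientation ℝ K (Fin m)} (ho : Cooriented A Ω o) :
    Cooriented A Ω' o := by
  have key : ∀ (d : ℝ) (X : ℕ → T), 0 < d * Ω (fun i => X i) → 0 < d * Ω' (fun i => X i) := by
    intro d X hd
    rcases lt_trichotomy d 0 with hd' | hd' | hd'
    · have h1 : Ω (fun i => X i) < 0 := by nlinarith
      have h2 := (h' X (-1)).1 ((h X (-1)).2 (by simpa using h1))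
      simp only [Units.val_neg, Units.val_one, Int.cast_neg, Int.cast_one, neg_mul, one_mul,
        Left.neg_pos_iff] at h2
      exact mul_pos_of_neg_of_neg hd' h2
    · simp [hd'] at hd
    · have h1 : 0 < Ω (fun i => X i) := by nlinarith
      have h2 := (h' X 1).1 ((h X 1).2 (by simpa using h1))
      simp only [Units.val_one, Int.cast_one, one_mul] at h2
      exact mul_pos hd' h2
  have key' : ∀ (d : ℝ) (X : ℕ → T), 0 < d * Ω' (fun i => X i) → 0 < d * Ω (fun i => X i) := by
    intro d X hd
    rcases lt_trichotomy d 0 with hd' | hd' | hd'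
    · have h1 : Ω' (fun i => X i) < 0 := by nlinarith
      have h2 := (h X (-1)).1 ((h' X (-1)).2 (by simpa using h1))
      simp only [Units.val_neg, Units.val_one, Int.cast_neg, Int.cast_one, neg_mul, one_mul,
        Left.neg_pos_iff] at h2
      exact mul_pos_of_neg_of_neg hd' h2
    · simp [hd'] at hd
    · have h1 : 0 < Ω' (fun i => X i) := by nlinarith
      have h2 := (h X 1).1 ((h' X 1).2 (by simpa using h1))
      simp only [Units.val_one, Int.cast_one, one_mul] at h2
      exact mul_pos hd' h2
  intro t s a ha
  rw [ho t s a ha]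
  refine and_congr_right fun _ => ?_
  rw [← mul_assoc, ← mul_assoc]
  exact ⟨key _ _, key' _ _⟩

theorem orientation_eq_or_neg [FiniteDimensional ℝ T] (hm : Module.finrank ℝ K = m)
    (o o' : Orientation ℝ K (Fin m)) : o = o' ∨ o = -o' := by
  let b : Module.Basis (Fin m) ℝ K := Module.finBasisOfFinrankEq ℝ K hm
  have h : ∀ x : Orientation ℝ K (Fin m), x = b.orientation ∨ x = -b.orientation := fun x => by
    rw [← b.orientation_ne_iff_eq_neg]
    exact em _
  rcases h o with h1 | h1 <;> rcases h o' with h2 | h2 <;> simp [h1, h2, orientation_neg_neg]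

theorem orientation_ne_neg (o : Orientation ℝ K (Fin m)) : o ≠ -o := Module.Ray.ne_neg_self o

/-- It suffices to test one frame: the orientation which exists by `exists_cooriented` has the same
sign on it, and the sign on one frame determines an orientation. -/
theorem Cooriented.of_frame [FiniteDimensional ℝ T] (hT : Module.finrank ℝ T = n) (h : k + m = n)
    {A : T →ₗ[ℝ] Fin k → ℝ} (hA : Function.Surjective A) (hK : LinearMap.ker A = K)
    {Ω : T [⋀^Fin n]→ₗ[ℝ] ℝ} {o : Orientation ℝ K (Fin m)} {t a : ℕ → T} {s : ℤˣ}
    (hd : (frameMatrix A a).det ≠ 0) (ht : FrameSign o t s)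
    (hp : 0 < ((s : ℤ) : ℝ) * ((frameMatrix A a).det * Ω fun i => catFrame k a t i)) :
    Cooriented A Ω o := by
  have hΩ : Ω ≠ 0 := by
    rintro rfl
    simp at hp
  obtain ⟨o', ho'⟩ := exists_cooriented hT h hA hK hΩ
  have h1 : FrameSign o' t s := (ho' t s a hd).2 ⟨fun i hi => ht.mem hi, hp⟩
  rw [ht.orientation_eq h1]
  exact ho'

/-- Vectors of the kernel of `A` complete a normal frame to a frame only if that frame is normal. -/
theorem frameMatrix_det_ne_zero [FiniteDimensional ℝ T] (hT : Module.finrank ℝ T = n)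
    (h : k + m = n) {A : T →ₗ[ℝ] Fin k → ℝ} (hA : Function.Surjective A)
    {Ω : T [⋀^Fin n]→ₗ[ℝ] ℝ} {t a : ℕ → T} (ht : ∀ i < m, A (t i) = 0)
    (hp : (Ω fun i => catFrame k a t i) ≠ 0) : (frameMatrix A a).det ≠ 0 := by
  obtain ⟨a₀, ha₀⟩ := exists_dual_frame hA
  let b : Module.Basis (Fin m) ℝ (LinearMap.ker A) :=
    Module.finBasisOfFinrankEq ℝ _ (finrank_ker_of_surjective hT h hA rfl)
  let t₀ : ℕ → T := fun i => if h : i < m then b ⟨i, h⟩ else 0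
  have ht₀ : ∀ i, (b i : T) = t₀ i := fun i => by simp [t₀]
  have := (form_catFrame h rfl b ha₀ ht₀ Ω).2 a t (fun i => ⟨t i, ht i i.2⟩) fun i => rfl
  rw [this] at hp
  exact right_ne_zero_of_mul (left_ne_zero_of_mul hp)

/-- A normal frame and a frame of the kernel of `A` form a frame. -/
theorem form_catFrame_ne_zero (h : k + m = n) {A : T →ₗ[ℝ] Fin k → ℝ} (hA : Function.Surjective A)
    {Ω : T [⋀^Fin n]→ₗ[ℝ] ℝ} (hΩ : Ω ≠ 0) {a t : ℕ → T} (hd : (frameMatrix A a).det ≠ 0)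
    (hK : LinearMap.ker A = K) (b : Module.Basis (Fin m) ℝ K) (hb : ∀ i, (b i : T) = t i) :
    (Ω fun i => catFrame k a t i) ≠ 0 := by
  obtain ⟨a₀, ha₀⟩ := exists_dual_frame hA
  obtain ⟨h1, h2⟩ := form_catFrame h hK b ha₀ hb Ω
  rw [h2 a t b hb, Module.Basis.det_self, mul_one]
  exact mul_ne_zero (h1 hΩ) hd

end LinearAlgebra

end

/-! ### Curves adapted to a submersion, and tangent spaces of level sets. -/

noncomputable section

section Curves

variable {E F : Type*} [NormedAddCommGroup E] [NormedSpace ℝ E] [CompleteSpace E]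
  [NormedAddCommGroup F] [NormedSpace ℝ F]

/-- Along a suitable curve with a given velocity, a submersion is an affine function. -/
theorem HasStrictFDerivAt.exists_curve {f : E → F} {f' : E →L[ℝ] F} {x₀ : E}
    (hf : HasStrictFDerivAt f f' x₀) (R : F →L[ℝ] E) (hR : ∀ z, f' (R z) = z) (w : E) :
    ∃ γ : ℝ → E, γ 0 = x₀ ∧ HasDerivAt γ w 0 ∧ ∀ᶠ t in 𝓝 (0 : ℝ), f (γ t) = f x₀ + t • f' w := by
  -- A local diffeomorphism with derivative the identity, chosen so that `f' (Ψ x)` is `f x` up to a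
  -- constant. Hence `f` is affine along the preimage of a straight line.
  set Ψ : E → E := fun x => x + R (f x - f x₀ - f' (x - x₀)) with hΨ
  have h1 : HasStrictFDerivAt Ψ ((ContinuousLinearEquiv.refl ℝ E : E ≃L[ℝ] E) : E →L[ℝ] E) x₀ := by
    have h2 : HasStrictFDerivAt (fun x => f x - f x₀ - f' (x - x₀)) (f' - f') x₀ := by
      refine (hf.sub_const _).sub ?_
      exact f'.hasStrictFDerivAt.comp x₀ ((hasStrictFDerivAt_id x₀).sub_const x₀)
    have h3 := (hasStrictFDerivAt_id x₀).add (R.hasStrictFDerivAt.comp x₀ h2)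
    rw [sub_self, ContinuousLinearMap.comp_zero, add_zero] at h3
    exact h3
  have hΨ₀ : Ψ x₀ = x₀ := by simp [hΨ]
  set g := h1.localInverse with hg
  have hg₀ : g x₀ = x₀ := by
    have := h1.localInverse_apply_image
    rwa [hΨ₀] at this
  have hg' : HasFDerivAt g (ContinuousLinearMap.id ℝ E) x₀ := by
    have := h1.to_localInverse.hasFDerivAt
    rwa [hΨ₀] at this
  have hline : HasDerivAt (fun t : ℝ => x₀ + t • w) w 0 := by
    simpa using ((hasDerivAt_id (0 : ℝ)).smul_const w).const_add x₀
  refine ⟨fun t => g (x₀ + t • w), by simp [hg₀], ?_, ?_⟩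
  · have : HasFDerivAt g (ContinuousLinearMap.id ℝ E) (x₀ + (0 : ℝ) • w) := by simpa using hg'
    exact this.comp_hasDerivAt (0 : ℝ) hline
  · have h4 := h1.eventually_right_inverse
    rw [hΨ₀] at h4
    have h5 : Tendsto (fun t : ℝ => x₀ + t • w) (𝓝 0) (𝓝 x₀) := by
      simpa using hline.continuousAt.tendsto
    filter_upwards [h5.eventually h4] with t ht
    have h6 := congrArg f' ht
    change f' (Ψ (g (x₀ + t • w))) = _ at h6
    simp only [hΨ, map_add, map_sub, hR, map_smul] at h6
    have h7 : f (g (x₀ + t • w)) = f x₀ + t • f' w := by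
      rw [← sub_eq_zero] at h6 ⊢
      rw [← h6]
      abel
    exact h7

end Curves

section Derivatives

variable {n : ℕ} [NeZero n] {Q : Type u} [MetricSpace Q] [ChartedSpace (EuclideanHalfSpace n) Q]
  {F : Type*} [NormedAddCommGroup F] [NormedSpace ℝ F] {G : Type*} [NormedAddCommGroup G]
  [NormedSpace ℝ G]

/-- The derivative of a function with values in a vector space. -/
def der (n : ℕ) [NeZero n] [ChartedSpace (EuclideanHalfSpace n) Q] (y : Q → F) (q : Q) :
    TangentSpace (𝓡∂ n) q →L[ℝ] F :=
  mfderiv (𝓡∂ n) 𝓘(ℝ, F) y q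

instance (q : Q) : FiniteDimensional ℝ (TangentSpace (𝓡∂ n) q) :=
  inferInstanceAs (FiniteDimensional ℝ (EuclideanSpace ℝ (Fin n)))

theorem finrank_tangentSpace (q : Q) : Module.finrank ℝ (TangentSpace (𝓡∂ n) q) = n :=
  (finrank_euclideanSpace_fin : Module.finrank ℝ (EuclideanSpace ℝ (Fin n)) = n)

theorem hasMFDerivAt_der {y : Q → F} {q : Q} (h : MDifferentiableAt (𝓡∂ n) 𝓘(ℝ, F) y q) :
    HasMFDerivAt (𝓡∂ n) 𝓘(ℝ, F) y q (der n y q) := h.hasMFDerivAt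

theorem der_eq {y : Q → F} {q : Q} {L : TangentSpace (𝓡∂ n) q →L[ℝ] F}
    (h : HasMFDerivAt (𝓡∂ n) 𝓘(ℝ, F) y q L) : der n y q = L := h.mfderiv

theorem der_clm_comp (L : F →L[ℝ] G) {y : Q → F} {q : Q}
    (h : MDifferentiableAt (𝓡∂ n) 𝓘(ℝ, F) y q) :
    der n (fun q => L (y q)) q = L.comp (der n y q) :=
  der_eq (HasMFDerivAt.comp q (L.hasMFDerivAt (x := y q)) (hasMFDerivAt_der h))

theorem der_sub {y z : Q → F} {q : Q} (hy : MDifferentiableAt (𝓡∂ n) 𝓘(ℝ, F) y q)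
    (hz : MDifferentiableAt (𝓡∂ n) 𝓘(ℝ, F) z q) :
    der n (fun q => y q - z q) q = der n y q - der n z q :=
  der_eq ((hasMFDerivAt_der hy).sub (hasMFDerivAt_der hz))

theorem der_add_const {y : Q → F} {q : Q} (hy : MDifferentiableAt (𝓡∂ n) 𝓘(ℝ, F) y q) (c : F) :
    der n (fun q => y q + c) q = der n y q := by
  have := (hasMFDerivAt_der hy).add (hasMFDerivAt_const (I := 𝓡∂ n) (I' := 𝓘(ℝ, F)) c q)
  have h0 : der n y q + (0 : TangentSpace (𝓡∂ n) q →L[ℝ] F) = der n y q := add_zero _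
  exact (der_eq this).trans h0

theorem der_congr {y z : Q → F} {q : Q} (h : y =ᶠ[𝓝 q] z) : der n y q = der n z q := by
  unfold der
  exact h.mfderiv_eq

theorem der_const (c : F) (q : Q) : der n (fun _ : Q => c) q = 0 :=
  der_eq (hasMFDerivAt_const (I := 𝓡∂ n) (I' := 𝓘(ℝ, F)) c q)

theorem der_apply_apply {k : ℕ} {y : Q → Fin k → ℝ} {q : Q}
    (h : MDifferentiableAt (𝓡∂ n) 𝓘(ℝ, Fin k → ℝ) y q) (w : TangentSpace (𝓡∂ n) q) (i : Fin k) :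
    der n y q w i = der n (fun q => y q i) q w := by
  have := der_clm_comp (n := n) (ContinuousLinearMap.proj (R := ℝ) (φ := fun _ : Fin k => ℝ) i) h
  exact (congrArg (fun L => L w) this).symm

theorem mdifferentiableAt_pi {k : ℕ} {y : Fin k → Q → ℝ} {q : Q}
    (h : ∀ i, MDifferentiableAt (𝓡∂ n) 𝓘(ℝ, ℝ) (y i) q) :
    MDifferentiableAt (𝓡∂ n) 𝓘(ℝ, Fin k → ℝ) (fun q i => y i q) q := by
  rw [mdifferentiableAt_iff]
  refine ⟨continuousAt_pi.2 fun i => (h i).continuousAt, ?_⟩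
  exact differentiableWithinAt_pi.2 fun i => ((mdifferentiableAt_iff _ _).1 (h i)).2

theorem hasFDerivAt_chart {p : Q} (hp : p ∈ (𝓡∂ n).interior Q) {g : Q → F}
    (hg : MDifferentiableAt (𝓡∂ n) 𝓘(ℝ, F) g p) :
    HasFDerivAt (g ∘ (extChartAt (𝓡∂ n) p).symm) (der n g p : EuclideanSpace ℝ (Fin n) →L[ℝ] F)
      (extChartAt (𝓡∂ n) p p) :=
  (hasMFDerivAt_der hg).2.hasFDerivAt (range_mem_nhds_isInteriorPoint hp)

/-- Near an interior point, there is a curve with given velocity along which a given submersion is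
an affine function. -/
theorem exists_curve [FiniteDimensional ℝ F] {p : Q} (hp : p ∈ (𝓡∂ n).interior Q) {y : Q → F}
    (hy : ContMDiffAt (𝓡∂ n) 𝓘(ℝ, F) ∞ y p) (hs : Function.Surjective (der n y p))
    (w : TangentSpace (𝓡∂ n) p) :
    ∃ γ : ℝ → Q, γ 0 = p ∧ ContinuousAt γ 0 ∧ (∀ᶠ t in 𝓝 (0 : ℝ), y (γ t) = y p + t • der n y p w) ∧
      ∀ g : Q → ℝ, MDifferentiableAt (𝓡∂ n) 𝓘(ℝ, ℝ) g p → HasDerivAt (g ∘ γ) (der n g p w) 0 := by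
  have hr : range (𝓡∂ n) ∈ 𝓝 (extChartAt (𝓡∂ n) p p) := range_mem_nhds_isInteriorPoint hp
  set x₀ := extChartAt (𝓡∂ n) p p with hx₀
  have hcd : ContDiffAt ℝ ∞ (y ∘ (extChartAt (𝓡∂ n) p).symm) x₀ :=
    (contMDiffAt_iff.1 hy).2.contDiffAt hr
  have hstr : HasStrictFDerivAt (y ∘ (extChartAt (𝓡∂ n) p).symm)
      (der n y p : EuclideanSpace ℝ (Fin n) →L[ℝ] F) x₀ :=
    hcd.hasStrictFDerivAt' (hasFDerivAt_chart hp (hy.mdifferentiableAt (by simp))) (by simp)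
  let L : EuclideanSpace ℝ (Fin n) →L[ℝ] F := der n y p
  obtain ⟨R, hR⟩ := (L : EuclideanSpace ℝ (Fin n) →ₗ[ℝ] F).exists_rightInverse_of_surjective
    (LinearMap.range_eq_top.2 hs)
  obtain ⟨γ, h0, h1, h2⟩ := hstr.exists_curve (LinearMap.toContinuousLinearMap R)
    (fun z => LinearMap.congr_fun hR z) w
  have hsymm : (extChartAt (𝓡∂ n) p).symm x₀ = p := extChartAt_to_inv p
  refine ⟨fun t => (extChartAt (𝓡∂ n) p).symm (γ t), by simp only [h0, hsymm], ?_, ?_, ?_⟩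
  · refine ContinuousAt.comp (g := (extChartAt (𝓡∂ n) p).symm) ?_ h1.continuousAt
    rw [h0]
    exact continuousAt_extChartAt_symm p
  · filter_upwards [h2] with t ht
    have : (y ∘ (extChartAt (𝓡∂ n) p).symm) x₀ = y p := congrArg y hsymm
    rw [this] at ht
    exact ht
  · intro g hg
    have h3 := hasFDerivAt_chart hp hg
    rw [← hx₀, ← h0] at h3
    exact h3.comp_hasDerivAt 0 h1

variable [IsManifold (𝓡∂ n) ∞ Q]

theorem mem_tangentAt {S : Set Q} {p : Q} {w : TangentSpace (𝓡∂ n) p} :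
    w ∈ tangentAt n S p ↔ ∀ f : Q → ℝ, ContMDiffAt (𝓡∂ n) 𝓘(ℝ, ℝ) ∞ f p →
      (∀ᶠ q in 𝓝[S] p, f q = 0) → der n f p w = 0 := Iff.rfl

/-- The tangent space of a submanifold which is defined by a submersion. -/
theorem tangentAt_eq_ker {k : ℕ} {p : Q} (hp : p ∈ (𝓡∂ n).interior Q) {y : Q → Fin k → ℝ}
    (hy : ContMDiffAt (𝓡∂ n) 𝓘(ℝ, Fin k → ℝ) ∞ y p) (hs : Function.Surjective (der n y p))
    {S : Set Q} (hpS : p ∈ S) (hS : ∀ᶠ q in 𝓝 p, q ∈ S ↔ y q = 0) :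
    tangentAt n S p = LinearMap.ker (der n y p : TangentSpace (𝓡∂ n) p →ₗ[ℝ] Fin k → ℝ) := by
  have hyp : y p = 0 := hS.self_of_nhds.1 hpS
  ext w
  rw [LinearMap.mem_ker]
  constructor
  · intro hw
    funext i
    have hyi : ContMDiffAt (𝓡∂ n) 𝓘(ℝ, ℝ) ∞ (fun q => y q i) p := contMDiffAt_pi_space.1 hy i
    have := mem_tangentAt.1 hw (fun q => y q i) hyi ?_
    · exact (der_apply_apply (hy.mdifferentiableAt (by simp)) w i).trans this
    · filter_upwards [nhdsWithin_le_nhds hS, self_mem_nhdsWithin] with q h1 h2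
      rw [h1.1 h2]
      rfl
  · intro hw
    change der n y p w = 0 at hw
    rw [mem_tangentAt]
    intro f hf h0
    -- The map `y` vanishes along this curve since `w` is in the kernel, so the curve stays in `S`,
    -- and `f` vanishes along it.
    obtain ⟨γ, g0, gc, gy, gd⟩ := exists_curve hp hy hs w
    have h1 := gd f (hf.mdifferentiableAt (by simp))
    have h2 : f ∘ γ =ᶠ[𝓝 0] fun _ => (0 : ℝ) := by
      have h3 : Tendsto γ (𝓝 0) (𝓝 p) := by simpa [g0] using gc.tendsto
      rw [eventually_nhdsWithin_iff] at h0
      filter_upwards [gy, h3.eventually hS, h3.eventually h0] with t h4 h5 h6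
      refine h6 (h5.2 ?_)
      rw [h4, hyp, hw, smul_zero, add_zero]
    exact (h1.unique ((hasDerivAt_const (0 : ℝ) (0 : ℝ)).congr_of_eventuallyEq h2))

theorem tangentAt_univ (p : Q) : tangentAt n (univ : Set Q) p = ⊤ := by
  rw [eq_top_iff]
  intro w _
  rw [mem_tangentAt]
  intro f _ h0
  rw [nhdsWithin_univ] at h0
  rw [der_congr (z := fun _ => (0 : ℝ)) h0, der_const]
  rfl

end Derivatives

/-! ### Continuous vector fields and volume forms in charts. -/

section VectorFields

variable {n : ℕ} [NeZero n] {Q : Type u} [MetricSpace Q] [ChartedSpace (EuclideanHalfSpace n) Q]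
  [IsManifold (𝓡∂ n) ∞ Q]

instance isManifold_one : IsManifold (𝓡∂ n) 1 Q :=
  IsManifold.of_le (n := ∞) (by simp)

/-- A vector field is continuous on a set. -/
def ContVF (Y : ∀ q : Q, TangentSpace (𝓡∂ n) q) (s : Set Q) : Prop :=
  ContinuousOn (fun q => (⟨q, Y q⟩ : TangentBundle (𝓡∂ n) Q)) s

/-- Coordinates of tangent vectors in the chart at `p`. -/
def tcoord (n : ℕ) [NeZero n] [ChartedSpace (EuclideanHalfSpace n) Q]
    [IsManifold (𝓡∂ n) ∞ Q] (p q : Q) : TangentSpace (𝓡∂ n) q →L[ℝ] EuclideanSpace ℝ (Fin n) :=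
  (trivializationAt (EuclideanSpace ℝ (Fin n)) (TangentSpace (𝓡∂ n)) p).continuousLinearMapAt ℝ q

/-- The tangent vector with given coordinates in the chart at `p`. -/
def tvec (n : ℕ) [NeZero n] [ChartedSpace (EuclideanHalfSpace n) Q]
    [IsManifold (𝓡∂ n) ∞ Q] (p q : Q) : EuclideanSpace ℝ (Fin n) →L[ℝ] TangentSpace (𝓡∂ n) q :=
  (trivializationAt (EuclideanSpace ℝ (Fin n)) (TangentSpace (𝓡∂ n)) p).symmL ℝ q

theorem tcoord_tvec {p q : Q} (hq : q ∈ (chartAt (EuclideanHalfSpace n) p).source)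
    (x : EuclideanSpace ℝ (Fin n)) : tcoord n p q (tvec n p q x) = x :=
  (trivializationAt (EuclideanSpace ℝ (Fin n)) (TangentSpace (𝓡∂ n)) p).continuousLinearMapAt_symmL
    (R := ℝ) (b := q) hq x

theorem tvec_tcoord {p q : Q} (hq : q ∈ (chartAt (EuclideanHalfSpace n) p).source)
    (w : TangentSpace (𝓡∂ n) q) : tvec n p q (tcoord n p q w) = w :=
  (trivializationAt (EuclideanSpace ℝ (Fin n)) (TangentSpace (𝓡∂ n)) p).symmL_continuousLinearMapAt
    (R := ℝ) (b := q) hq w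

theorem ContVF.tcoord {Y : ∀ q : Q, TangentSpace (𝓡∂ n) q} {s : Set Q} (h : ContVF Y s) (p : Q)
    (hs : s ⊆ (chartAt (EuclideanHalfSpace n) p).source) :
    ContinuousOn (fun q => tcoord n p q (Y q)) s := by
  set e := trivializationAt (EuclideanSpace ℝ (Fin n)) (TangentSpace (𝓡∂ n)) p with he
  have h1 : ContinuousOn (fun q => (e ⟨q, Y q⟩).2) s :=
    continuous_snd.comp_continuousOn
      (e.continuousOn.comp (t := e.source) h fun q hq => e.mem_source.2 (hs hq))
  refine h1.congr fun q hq => ?_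
  exact congrFun (e.coe_linearMapAt_of_mem (R := ℝ) (b := q) (hs hq)) (Y q)

theorem contVF_tvec {Y : Q → EuclideanSpace ℝ (Fin n)} {s : Set Q} (h : ContinuousOn Y s) (p : Q)
    (hs : s ⊆ (chartAt (EuclideanHalfSpace n) p).source) :
    ContVF (fun q => tvec n p q (Y q)) s := by
  set e := trivializationAt (EuclideanSpace ℝ (Fin n)) (TangentSpace (𝓡∂ n)) p with he
  have h1 : ContinuousOn (fun q => e.toOpenPartialHomeomorph.symm (q, Y q)) s :=
    e.toOpenPartialHomeomorph.continuousOn_symm.comp (continuousOn_id.prodMk h)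
      fun q hq => e.mem_target.2 (hs hq)
  refine h1.congr fun q hq => ?_
  have h2 := e.mk_symm (b := q) (hs hq) (Y q)
  rw [← e.symmL_apply (R := ℝ) (b := q) (hs hq)] at h2
  exact h2

theorem ContVF.mono {Y : ∀ q : Q, TangentSpace (𝓡∂ n) q} {s t : Set Q} (h : ContVF Y t)
    (hst : s ⊆ t) : ContVF Y s := ContinuousOn.mono h hst

theorem ContVF.der {F : Type*} [NormedAddCommGroup F] [NormedSpace ℝ F] {y : Q → F} {O s : Set Q}
    (hO : IsOpen O) (hy : ContMDiffOn (𝓡∂ n) 𝓘(ℝ, F) ∞ y O) (hs : s ⊆ O)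
    {Y : ∀ q : Q, TangentSpace (𝓡∂ n) q} (h : ContVF Y s) :
    ContinuousOn (fun q => der n y q (Y q)) s := by
  have h1 := hy.continuousOn_tangentMapWithin (by simp) hO.uniqueMDiffOn
  have h2 : ContinuousOn (fun q => tangentMapWithin (𝓡∂ n) 𝓘(ℝ, F) y O ⟨q, Y q⟩) s :=
    h1.comp h fun q hq => hs hq
  have h3 : Continuous (fun v : TangentBundle 𝓘(ℝ, F) F => (v.2 : F)) :=
    (contMDiff_snd_tangentBundle_modelSpace (n := 0) F 𝓘(ℝ, F)).continuous
  refine (h3.comp_continuousOn h2).congr fun q hq => ?_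
  have : tangentMapWithin (𝓡∂ n) 𝓘(ℝ, F) y O (⟨q, Y q⟩ : TangentBundle (𝓡∂ n) Q) =
      tangentMap (𝓡∂ n) 𝓘(ℝ, F) y ⟨q, Y q⟩ :=
    tangentMapWithin_eq_tangentMap (hO.uniqueMDiffOn q (hs hq))
      ((hy.contMDiffAt (hO.mem_nhds (hs hq))).mdifferentiableAt (by simp))
  exact (congrArg (fun v : TangentBundle 𝓘(ℝ, F) F => (v.2 : F)) this).symm

/-- The volume form of the chart at `p`. -/
def volForm (n : ℕ) [NeZero n] [ChartedSpace (EuclideanHalfSpace n) Q]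
    [IsManifold (𝓡∂ n) ∞ Q] (p q : Q) : TangentSpace (𝓡∂ n) q [⋀^Fin n]→ₗ[ℝ] ℝ :=
  (EuclideanSpace.basisFun (Fin n) ℝ).toBasis.det.compLinearMap (tcoord n p q).toLinearMap

theorem volForm_continuousOn {Y : ℕ → ∀ q : Q, TangentSpace (𝓡∂ n) q} {s : Set Q} (p : Q)
    (hs : s ⊆ (chartAt (EuclideanHalfSpace n) p).source) (h : ∀ i < n, ContVF (Y i) s) :
    ContinuousOn (fun q => volForm n p q fun i => Y i q) s := by
  have h1 : ContinuousOn (fun q => (Matrix.of fun i j : Fin n => tcoord n p q (Y j q) i).det) s := by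
    refine Continuous.comp_continuousOn (g := Matrix.det) continuous_id.matrix_det ?_
    refine continuousOn_pi.2 fun i => continuousOn_pi.2 fun j => ?_
    exact (EuclideanSpace.proj i).continuous.comp_continuousOn ((h j j.2).tcoord p hs)
  refine h1.congr fun q hq => ?_
  simp only [volForm, AlternatingMap.compLinearMap_apply, Module.Basis.det_apply]
  congr 1

theorem volForm_ne_zero {p q : Q} (hq : q ∈ (chartAt (EuclideanHalfSpace n) p).source) :
    volForm n p q ≠ 0 := by
  intro h
  have h1 := congrArg (fun f => f fun i => tvec n p q (EuclideanSpace.basisFun (Fin n) ℝ i)) h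
  simp only [volForm, AlternatingMap.compLinearMap_apply, AlternatingMap.zero_apply] at h1
  have h2 : (fun i => (tcoord n p q).toLinearMap (tvec n p q (EuclideanSpace.basisFun (Fin n) ℝ i))) =
      ⇑(EuclideanSpace.basisFun (Fin n) ℝ).toBasis := by
    funext i
    simpa using tcoord_tvec hq _
  rw [h2, Module.Basis.det_self] at h1
  exact one_ne_zero h1

theorem hasSign_iff_frameSign {p : Q} {T : Submodule ℝ (TangentSpace (𝓡∂ n) p)} {m : ℕ}
    {o : Orientation ℝ T (Fin m)} {X : ℕ → TangentSpace (𝓡∂ n) p} {s : ℤˣ} :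
    HasSign o X s ↔ FrameSign o X s := Iff.rfl

theorem isOpen_interior_manifold : IsOpen ((𝓡∂ n).interior Q) :=
  ModelWithCorners.isOpen_interior (n := ∞) (by simp)

/-- Near an interior point, an orientation of `Q` is represented by a constant multiple of the
volume form of a chart. -/
theorem exists_represents (oQ : CellOrientation n (univ : Set Q) ((𝓡∂ n).interior Q) n) {p : Q}
    (hp : p ∈ (𝓡∂ n).interior Q) : ∃ c : ℝ, c ≠ 0 ∧ ∀ᶠ q in 𝓝 p, ∀ hq : q ∈ (𝓡∂ n).interior Q,
      Represents (oQ.at' ⟨q, hq⟩) (c • volForm n p q) := by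
  obtain ⟨s, U, hU, X, hX, hs⟩ := oQ.coherent ⟨p, hp⟩
  set N := interior U ∩ (𝓡∂ n).interior Q ∩ (chartAt (EuclideanHalfSpace n) p).source with hN
  have hNo : IsOpen N :=
    (isOpen_interior.inter isOpen_interior_manifold).inter (chartAt _ p).open_source
  have hpN : p ∈ N := ⟨⟨mem_interior_iff_mem_nhds.2 hU, hp⟩, mem_chart_source _ p⟩
  have hcont : ContinuousOn (fun q => volForm n p q fun i => X i q) N :=
    volForm_continuousOn p (fun q hq => hq.2) fun i hi =>
      (hX i hi).mono fun q hq => ⟨interior_subset hq.1.1, hq.1.2⟩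
  have hne : ∀ q ∈ N, (volForm n p q fun i => X i q) ≠ 0 := by
    intro q hq h0
    obtain ⟨b, hb, -⟩ := hs ⟨q, hq.1.2⟩ (interior_subset hq.1.1)
    refine volForm_ne_zero hq.2 ?_
    ext Z
    have := form_eq_mul_det (volForm n p q) b
      (fun i => ⟨Z i, by rw [tangentAt_univ]; exact Submodule.mem_top⟩)
    simp only [hb, h0, zero_mul] at this
    simpa using this
  -- The continuous frame has the same sign with respect to the volume form at nearby points as at
  -- `p`, so this single constant works for all of them.
  set c := volForm n p p fun i => X i p with hc
  have hc0 : c ≠ 0 := hne p hpN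
  have hpos : ∀ᶠ q in 𝓝 p, 0 < c * volForm n p q fun i => X i q := by
    have h1 : ContinuousAt (fun q => c * volForm n p q fun i => X i q) p :=
      continuousAt_const.mul (hcont.continuousAt (hNo.mem_nhds hpN))
    exact h1.eventually (lt_mem_nhds (mul_self_pos.2 hc0))
  refine ⟨((s : ℤ) : ℝ) * c, mul_ne_zero (by simp) hc0, ?_⟩
  filter_upwards [hpos, hNo.mem_nhds hpN] with q h1 h2 hq
  have h3 : FrameSign (oQ.at' ⟨q, hq⟩) (fun i => X i q) s := hs ⟨q, hq⟩ (interior_subset h2.1.1)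
  exact h3.represents (tangentAt_univ q) h1

end VectorFields

end

/-! ### Orientations of cells which are determined by normal coordinates. -/

noncomputable section

section Orientations

variable {n : ℕ} [NeZero n] {Q : Type u} [MetricSpace Q] [ChartedSpace (EuclideanHalfSpace n) Q]
  [IsManifold (𝓡∂ n) ∞ Q]

theorem HasSign.mem {p : Q} {T : Submodule ℝ (TangentSpace (𝓡∂ n) p)} {m : ℕ}
    {o : Orientation ℝ T (Fin m)} {X : ℕ → TangentSpace (𝓡∂ n) p} {s : ℤˣ} (h : HasSign o X s)
    {i : ℕ} (hi : i < m) : X i ∈ T :=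
  FrameSign.mem (hasSign_iff_frameSign.1 h) hi

theorem HasSign.orientation_eq {p : Q} {T : Submodule ℝ (TangentSpace (𝓡∂ n) p)} {m : ℕ}
    {o o' : Orientation ℝ T (Fin m)} {X : ℕ → TangentSpace (𝓡∂ n) p} {s : ℤˣ} (h : HasSign o X s)
    (h' : HasSign o' X s) : o = o' :=
  FrameSign.orientation_eq (hasSign_iff_frameSign.1 h) (hasSign_iff_frameSign.1 h')

/-- The vector field with constant coordinates in the chart at `p` and value `w` at `p`. -/
def constVF (p : Q) (w : TangentSpace (𝓡∂ n) p) (q : Q) : TangentSpace (𝓡∂ n) q :=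
  tvec n p q (tcoord n p p w)

theorem constVF_self (p : Q) (w : TangentSpace (𝓡∂ n) p) : constVF p w p = w :=
  tvec_tcoord (mem_chart_source _ p) w

theorem contVF_constVF (p : Q) (w : TangentSpace (𝓡∂ n) p) :
    ContVF (constVF p w) (chartAt (EuclideanHalfSpace n) p).source :=
  contVF_tvec continuousOn_const p Subset.rfl

theorem frameMatrix_continuousOn {k : ℕ} {y : Q → Fin k → ℝ} {O s : Set Q} (hO : IsOpen O)
    (hy : ContMDiffOn (𝓡∂ n) 𝓘(ℝ, Fin k → ℝ) ∞ y O) (hs : s ⊆ O)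
    {a : ℕ → ∀ q : Q, TangentSpace (𝓡∂ n) q} (ha : ∀ i < k, ContVF (a i) s) :
    ContinuousOn (fun q => frameMatrix (der n y q).toLinearMap (fun i => a i q)) s := by
  refine continuousOn_pi.2 fun i => continuousOn_pi.2 fun j => ?_
  exact (continuous_apply i).comp_continuousOn ((ha j j.2).der hO hy hs)

theorem frameMatrix_det_continuousOn {k : ℕ} {y : Q → Fin k → ℝ} {O s : Set Q} (hO : IsOpen O)
    (hy : ContMDiffOn (𝓡∂ n) 𝓘(ℝ, Fin k → ℝ) ∞ y O) (hs : s ⊆ O)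
    {a : ℕ → ∀ q : Q, TangentSpace (𝓡∂ n) q} (ha : ∀ i < k, ContVF (a i) s) :
    ContinuousOn (fun q => (frameMatrix (der n y q).toLinearMap (fun i => a i q)).det) s :=
  Continuous.comp_continuousOn (g := Matrix.det) continuous_id.matrix_det
    (frameMatrix_continuousOn hO hy hs ha)

/-- A frame which is normal with respect to a map stays so near a point. -/
theorem eventually_frameMatrix_det_pos {k : ℕ} {y : Q → Fin k → ℝ} {O : Set Q} (hO : IsOpen O)
    (hy : ContMDiffOn (𝓡∂ n) 𝓘(ℝ, Fin k → ℝ) ∞ y O) {p : Q} (hp : p ∈ O)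
    {a : ℕ → TangentSpace (𝓡∂ n) p} {c : ℝ}
    (ha : 0 < c * (frameMatrix (der n y p).toLinearMap a).det) :
    ∀ᶠ q in 𝓝 p, 0 < c * (frameMatrix (der n y q).toLinearMap (fun i => constVF p (a i) q)).det := by
  set N := O ∩ (chartAt (EuclideanHalfSpace n) p).source with hN
  have hNo : IsOpen N := hO.inter (chartAt _ p).open_source
  have hpN : p ∈ N := ⟨hp, mem_chart_source _ p⟩
  have h1 := frameMatrix_det_continuousOn hO hy (s := N) inter_subset_left
    (a := fun i => constVF p (a i)) fun i _ => (contVF_constVF p (a i)).mono inter_subset_right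
  have h2 : ContinuousAt (fun q => c * (frameMatrix (der n y q).toLinearMap
      (fun i => constVF p (a i) q)).det) p :=
    continuousAt_const.mul (h1.continuousAt (hNo.mem_nhds hpN))
  refine h2.eventually (lt_mem_nhds ?_)
  simpa only [constVF_self] using ha

theorem ContinuousOn.matrix_mulVec_vec {X : Type*} [TopologicalSpace X] {k : ℕ}
    {M : X → Matrix (Fin k) (Fin k) ℝ} {v : X → Fin k → ℝ} {s : Set X} (hM : ContinuousOn M s)
    (hv : ContinuousOn v s) : ContinuousOn (fun x => (M x).mulVec (v x)) s := by
  rw [continuousOn_iff_continuous_domRestrict] at hM hv ⊢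
  exact Continuous.matrix_mulVec hM hv

/-- Vectors in the kernel of the derivative of a submersion extend to vector fields with values in
its kernel. -/
theorem exists_kernel_fields {k : ℕ} {y : Q → Fin k → ℝ} {O : Set Q} (hO : IsOpen O)
    (hy : ContMDiffOn (𝓡∂ n) 𝓘(ℝ, Fin k → ℝ) ∞ y O) {p : Q} (hp : p ∈ O)
    (hs : Function.Surjective (der n y p)) (Z : ℕ → TangentSpace (𝓡∂ n) p) :
    ∃ (N : Set Q) (Y : ℕ → ∀ q : Q, TangentSpace (𝓡∂ n) q), IsOpen N ∧ p ∈ N ∧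
      (∀ i, ContVF (Y i) N) ∧ (∀ i, der n y p (Z i) = 0 → Y i p = Z i) ∧
      ∀ q ∈ N, ∀ i, der n y q (Y i q) = 0 := by
  obtain ⟨a, ha⟩ := exists_dual_frame (A := (der n y p).toLinearMap) hs
  have hdet : 0 < (1 : ℝ) * (frameMatrix (der n y p).toLinearMap a).det := by
    simp [frameMatrix_eq_one ha]
  have hev := eventually_frameMatrix_det_pos hO hy hp hdet
  obtain ⟨N₀, hN₀, hN₀o, hpN₀⟩ := eventually_nhds_iff.1 hev
  set N := O ∩ (chartAt (EuclideanHalfSpace n) p).source ∩ N₀ with hN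
  have hNo : IsOpen N := (hO.inter (chartAt _ p).open_source).inter hN₀o
  have hpN : p ∈ N := ⟨⟨hp, mem_chart_source _ p⟩, hpN₀⟩
  have hNO : N ⊆ O := fun q hq => hq.1.1
  have hNc : N ⊆ (chartAt (EuclideanHalfSpace n) p).source := fun q hq => hq.1.2
  set M : Q → Matrix (Fin k) (Fin k) ℝ :=
    fun q => frameMatrix (der n y q).toLinearMap (fun i => constVF p (a i) q) with hM
  have hMc : ContinuousOn M N := frameMatrix_continuousOn hO hy hNO
    (a := fun i => constVF p (a i)) fun i _ => (contVF_constVF p (a i)).mono hNc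
  have hMne : ∀ q ∈ N, (M q).det ≠ 0 := fun q hq => by
    have := hN₀ q hq.2
    rw [one_mul] at this
    exact this.ne'
  -- The coordinates, with respect to the normal frame, of the normal component of the constant
  -- extension of `Z i`; subtracting this component leaves a vector of the kernel. The inverse of
  -- `M` is written with the adjugate so that its continuity is evident.
  set c : ℕ → Q → Fin k → ℝ := fun i q =>
    (M q).det⁻¹ • (M q).adjugate.mulVec (der n y q (constVF p (Z i) q)) with hc
  have hcc : ∀ i, ContinuousOn (c i) N := by
    intro i
    have h1 : ContinuousOn (fun q => (M q).det⁻¹) N :=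
      ContinuousOn.inv₀ (Continuous.comp_continuousOn (g := Matrix.det) continuous_id.matrix_det hMc)
        hMne
    have h2 : ContinuousOn (fun q => (M q).adjugate) N :=
      Continuous.comp_continuousOn (g := Matrix.adjugate) continuous_id.matrix_adjugate hMc
    have h3 : ContinuousOn (fun q => der n y q (constVF p (Z i) q)) N :=
      ((contVF_constVF p (Z i)).mono hNc).der hO hy hNO
    have h4 : ContinuousOn (fun q => (M q).adjugate.mulVec (der n y q (constVF p (Z i) q))) N :=
      h2.matrix_mulVec_vec h3
    exact h1.smul h4
  refine ⟨N, fun i q => tvec n p q (tcoord n p p (Z i) -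
    ∑ j : Fin k, c i q j • tcoord n p p (a j)), hNo, hpN, fun i => ?_, fun i hi => ?_,
    fun q hq i => ?_⟩
  · refine contVF_tvec (continuousOn_const.sub ?_) p hNc
    exact continuousOn_finsetSum _ fun j _ =>
      ((continuous_apply j).comp_continuousOn (hcc i)).smul continuousOn_const
  · have : c i p = 0 := by simp [hc, constVF_self, hi]
    simp only [this, Pi.zero_apply, zero_smul, Finset.sum_const_zero, sub_zero]
    exact constVF_self p (Z i)
  · beta_reduce
    rw [map_sub, map_sub, map_sum, map_sum]
    have h1 : ∑ j : Fin k, der n y q (tvec n p q (c i q j • tcoord n p p (a j))) =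
        (M q).mulVec (c i q) := by
      funext l
      rw [Finset.sum_apply]
      simp only [Matrix.mulVec, dotProduct, map_smul, Pi.smul_apply, smul_eq_mul]
      exact Finset.sum_congr rfl fun j _ => mul_comm _ _
    rw [h1]
    simp only [hc, Matrix.mulVec_smul, Matrix.mulVec_mulVec, Matrix.mul_adjugate,
      Matrix.smul_mulVec, Matrix.one_mulVec, smul_smul, inv_mul_cancel₀ (hMne q hq), one_smul]
    exact sub_self _

/-- A family of surjections with kernels the tangent spaces of `S` at the points of `S'`, which
locally is the derivative of a smooth map, up to positive changes of coordinates. -/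
structure NormalFamily (S S' : Set Q) (k : ℕ)
    (A : ∀ q : Q, TangentSpace (𝓡∂ n) q →ₗ[ℝ] Fin k → ℝ) : Prop where
  interior : S' ⊆ (𝓡∂ n).interior Q
  ker : ∀ q ∈ S', LinearMap.ker (A q) = tangentAt n S q
  surj : ∀ q ∈ S', Function.Surjective (A q)
  loc : ∀ p ∈ S', ∃ (O : Set Q) (y : Q → Fin k → ℝ), IsOpen O ∧ p ∈ O ∧
    ContMDiffOn (𝓡∂ n) 𝓘(ℝ, Fin k → ℝ) ∞ y O ∧ ∀ q ∈ O ∩ S',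
      ∃ B : Matrix (Fin k) (Fin k) ℝ, 0 < B.det ∧ ∀ w, A q w = B.mulVec (der n y q w)

/-- The orientations `o` of the tangent spaces of `S` are induced by the normal orientations given
by `A` and the orientation of `Q`. -/
def OrientedBy (oQ : CellOrientation n (univ : Set Q) ((𝓡∂ n).interior Q) n) {S S' : Set Q}
    {k m : ℕ} (A : ∀ q : Q, TangentSpace (𝓡∂ n) q →ₗ[ℝ] Fin k → ℝ)
    (o : ∀ q : S', Orientation ℝ (tangentAt n S q.1) (Fin m)) : Prop :=
  ∀ (q : S') (hq : q.1 ∈ (𝓡∂ n).interior Q) (Ω : TangentSpace (𝓡∂ n) q.1 [⋀^Fin n]→ₗ[ℝ] ℝ),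
    Represents (oQ.at' ⟨q.1, hq⟩) Ω → Cooriented (A q.1) Ω (o q)

theorem frameMatrix_mulVec {T : Type*} [AddCommGroup T] [Module ℝ T] {k : ℕ}
    {A A' : T →ₗ[ℝ] Fin k → ℝ} {B : Matrix (Fin k) (Fin k) ℝ} (h : ∀ w, A' w = B.mulVec (A w))
    (a : ℕ → T) : frameMatrix A' a = B * frameMatrix A a := by
  ext i j
  simp [frameMatrix, h, Matrix.mulVec, dotProduct, Matrix.mul_apply]

theorem contVF_catFrame {k m : ℕ} {a X : ℕ → ∀ q : Q, TangentSpace (𝓡∂ n) q} {s : Set Q}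
    (h : k + m = n) (ha : ∀ i < k, ContVF (a i) s) (hX : ∀ i < m, ContVF (X i) s) :
    ∀ i < n, ContVF (fun q => catFrame k (fun i => a i q) (fun i => X i q) i) s := by
  intro i hi
  by_cases hk : i < k
  · simpa only [catFrame, if_pos hk] using ha i hk
  · simpa only [catFrame, if_neg hk] using hX (i - k) (by omega)

variable {oQ : CellOrientation n (univ : Set Q) ((𝓡∂ n).interior Q) n} {S S' : Set Q} {k m : ℕ}
  {A : ∀ q : Q, TangentSpace (𝓡∂ n) q →ₗ[ℝ] Fin k → ℝ}

theorem NormalFamily.surj_der (hA : NormalFamily S S' k A) {p : Q} (hp : p ∈ S') {y : Q → Fin k → ℝ}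
    {B : Matrix (Fin k) (Fin k) ℝ} (hB : 0 < B.det) (h : ∀ w, A p w = B.mulVec (der n y p w)) :
    Function.Surjective (der n y p) := by
  intro z
  obtain ⟨w, hw⟩ := hA.surj p hp (B.mulVec z)
  refine ⟨w, ?_⟩
  rw [h] at hw
  exact Matrix.mulVec_injective_of_isUnit ((Matrix.isUnit_iff_isUnit_det B).2
    (isUnit_iff_ne_zero.2 hB.ne')) hw

/-- The sign of a continuous frame with respect to an orientation given by a normal family is
locally constant. -/
theorem NormalFamily.eventually_hasSign (hA : NormalFamily S S' k A) (hkm : k + m = n)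
    {o : ∀ q : S', Orientation ℝ (tangentAt n S q.1) (Fin m)} (ho : OrientedBy oQ A o)
    (p : S') {U : Set Q} (hU : U ∈ 𝓝 p.1) {X : ℕ → ∀ q : Q, TangentSpace (𝓡∂ n) q}
    (hX : ∀ i < m, ContVF (X i) (U ∩ S'))
    (hXt : ∀ q ∈ U ∩ S', ∀ i < m, X i q ∈ tangentAt n S q) {s : ℤˣ}
    (hs : HasSign (o p) (fun i => X i p) s) :
    ∀ᶠ q in 𝓝 p.1, ∀ hq : q ∈ S', HasSign (o ⟨q, hq⟩) (fun i => X i q) s := by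
  obtain ⟨O, y, hO, hpO, hy, hB⟩ := hA.loc p p.2
  obtain ⟨B, hBd, hBA⟩ := hB p ⟨hpO, p.2⟩
  obtain ⟨a, ha⟩ := exists_dual_frame (A := (der n y p).toLinearMap) (hA.surj_der p.2 hBd hBA)
  have hdet : 0 < (1 : ℝ) * (frameMatrix (der n y p).toLinearMap a).det := by
    simp [frameMatrix_eq_one ha]
  have hev := eventually_frameMatrix_det_pos hO hy hpO hdet
  obtain ⟨c, hc, hrep⟩ := exists_represents oQ (hA.interior p.2)
  have hcoo := ho p (hA.interior p.2) _ (hrep.self_of_nhds (hA.interior p.2))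
  have hdp : 0 < (frameMatrix (A p.1) a).det := by
    rw [frameMatrix_mulVec (A := (der n y p).toLinearMap) hBA, Matrix.det_mul]
    exact mul_pos hBd (by simpa using hdet)
  have h1 := ((hcoo (fun i => X i p.1) s a hdp.ne').1 hs).2
  -- The normal frame stays positive near `p`, so positivity of this continuous function says that
  -- `X` has sign `s` there.
  set f : Q → ℝ := fun q => ((s : ℤ) : ℝ) * (c * volForm n p.1 q
    fun i => catFrame k (fun i => constVF p.1 (a i) q) (fun i => X i q) i) with hf
  have hfp : 0 < f p := by
    simp only [hf, constVF_self]
    simp only [AlternatingMap.smul_apply, smul_eq_mul] at h1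
    have : ((s : ℤ) : ℝ) * ((frameMatrix (A p.1) a).det * (c * volForm n p.1 p.1 fun i =>
        catFrame k a (fun i => X i p.1) i)) = (frameMatrix (A p.1) a).det * (((s : ℤ) : ℝ) *
          (c * volForm n p.1 p.1 fun i => catFrame k a (fun i => X i p.1) i)) := by ring
    rw [this] at h1
    exact (mul_pos_iff_of_pos_left hdp).1 h1
  set N := U ∩ S' ∩ (chartAt (EuclideanHalfSpace n) p.1).source with hN
  have hpN : p.1 ∈ N := ⟨⟨mem_of_mem_nhds hU, p.2⟩, mem_chart_source _ p.1⟩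
  have hfc : ContinuousOn f N := by
    refine continuousOn_const.mul (continuousOn_const.mul ?_)
    refine volForm_continuousOn p.1 inter_subset_right
      (Y := fun i q => catFrame k (fun i => constVF p.1 (a i) q) (fun i => X i q) i) ?_
    exact contVF_catFrame hkm (fun i _ => (contVF_constVF p.1 (a i)).mono inter_subset_right)
      fun i hi => (hX i hi).mono inter_subset_left
  have hfe : ∀ᶠ q in 𝓝[N] p.1, 0 < f q := (hfc p.1 hpN).eventually (lt_mem_nhds hfp)
  rw [eventually_nhdsWithin_iff] at hfe
  filter_upwards [hfe, hU, (chartAt (EuclideanHalfSpace n) p.1).open_source.mem_nhds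
    (mem_chart_source _ p.1), hev, hrep, hO.mem_nhds hpO] with q h2 h3 h4 h5 h6 h7 hq
  obtain ⟨B', hB'd, hB'A⟩ := hB q ⟨h7, hq⟩
  have hdq : 0 < (frameMatrix (A q) fun i => constVF p.1 (a i) q).det := by
    rw [frameMatrix_mulVec (A := (der n y q).toLinearMap) hB'A, Matrix.det_mul]
    exact mul_pos hB'd (by simpa using h5)
  have hcoq := ho ⟨q, hq⟩ (hA.interior hq) _ (h6 (hA.interior hq))
  refine (hcoq (fun i => X i q) s _ hdq.ne').2 ⟨fun i hi => hXt q ⟨h3, hq⟩ i hi, ?_⟩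
  have h8 := h2 ⟨⟨h3, hq⟩, h4⟩
  simp only [AlternatingMap.smul_apply, smul_eq_mul]
  have : ((s : ℤ) : ℝ) * ((frameMatrix (A q) fun i => constVF p.1 (a i) q).det *
      (c * volForm n p.1 q fun i => catFrame k (fun i => constVF p.1 (a i) q) (fun i => X i q) i)) =
      (frameMatrix (A q) fun i => constVF p.1 (a i) q).det * f q := by
    simp only [hf]
    ring
  rw [this]
  exact mul_pos hdq h8

theorem exists_hasSign {p : Q} {T : Submodule ℝ (TangentSpace (𝓡∂ n) p)} {m : ℕ}
    (hm : Module.finrank ℝ T = m) (o : Orientation ℝ T (Fin m)) :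
    ∃ (t : ℕ → TangentSpace (𝓡∂ n) p) (s : ℤˣ), HasSign o t s := by
  let b : Module.Basis (Fin m) ℝ T := Module.finBasisOfFinrankEq ℝ T hm
  refine ⟨fun i => if h : i < m then b ⟨i, h⟩ else 0, ?_⟩
  have ht : ∀ i : Fin m, (b i : TangentSpace (𝓡∂ n) p) =
      (fun i => if h : i < m then (b ⟨i, h⟩ : TangentSpace (𝓡∂ n) p) else 0) i := fun i => by simp
  by_cases hb : b.orientation = o
  · exact ⟨1, b, ht, by rw [if_pos rfl, hb]⟩
  · refine ⟨-1, b, ht, ?_⟩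
    have : o = -b.orientation := (b.orientation_ne_iff_eq_neg o).1 fun h => hb h.symm
    rw [if_neg (by decide), this, orientation_neg_neg]

theorem NormalFamily.finrank (hA : NormalFamily S S' k A) (hkm : k + m = n) {q : Q} (hq : q ∈ S') :
    Module.finrank ℝ (tangentAt n S q) = m :=
  finrank_ker_of_surjective (finrank_tangentSpace q) hkm (hA.surj q hq) (hA.ker q hq)

theorem exists_represents_at (oQ : CellOrientation n (univ : Set Q) ((𝓡∂ n).interior Q) n) {p : Q}
    (hp : p ∈ (𝓡∂ n).interior Q) : ∃ Ω : TangentSpace (𝓡∂ n) p [⋀^Fin n]→ₗ[ℝ] ℝ, Ω ≠ 0 ∧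
      Represents (oQ.at' ⟨p, hp⟩) Ω := by
  obtain ⟨c, hc, h⟩ := exists_represents oQ hp
  exact ⟨_, smul_ne_zero hc (volForm_ne_zero (mem_chart_source _ p)), h.self_of_nhds hp⟩

/-- A normal family and an orientation of `Q` determine an orientation. -/
theorem NormalFamily.exists_orientation (hA : NormalFamily S S' k A) (hkm : k + m = n)
    (oQ : CellOrientation n (univ : Set Q) ((𝓡∂ n).interior Q) n) :
    ∃ o : CellOrientation n S S' m, OrientedBy oQ A o.at' := by
  have hex : ∀ q : S', ∃ o : Orientation ℝ (tangentAt n S q.1) (Fin m),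
      ∀ (hq : q.1 ∈ (𝓡∂ n).interior Q) (Ω : TangentSpace (𝓡∂ n) q.1 [⋀^Fin n]→ₗ[ℝ] ℝ),
        Represents (oQ.at' ⟨q.1, hq⟩) Ω → Cooriented (A q.1) Ω o := by
    intro q
    obtain ⟨Ω, hΩ, hrep⟩ := exists_represents_at oQ (hA.interior q.2)
    obtain ⟨o, ho⟩ := exists_cooriented (finrank_tangentSpace q.1) hkm (hA.surj q q.2)
      (hA.ker q q.2) hΩ
    exact ⟨o, fun hq Ω' hΩ' => hrep.cooriented_iff hΩ' ho⟩
  choose o ho using hex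
  refine ⟨⟨o, fun p => ?_⟩, ho⟩
  obtain ⟨t, s, hts⟩ := exists_hasSign (hA.finrank hkm p.2) (o p)
  obtain ⟨O, y, hO, hpO, hy, hB⟩ := hA.loc p p.2
  obtain ⟨B, hBd, hBA⟩ := hB p ⟨hpO, p.2⟩
  have hsurj := hA.surj_der p.2 hBd hBA
  have hker : ∀ q ∈ O ∩ S', ∀ w, der n y q w = 0 → w ∈ tangentAt n S q := by
    intro q hq w hw
    obtain ⟨B', -, hB'A⟩ := hB q hq
    rw [← hA.ker q hq.2, LinearMap.mem_ker, hB'A, hw, Matrix.mulVec_zero]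
  -- Coherence of the pointwise orientations: a frame at `p` extends to continuous fields tangent to
  -- `S`, and their sign is locally constant by `NormalFamily.eventually_hasSign`.
  obtain ⟨N, Y, hN, hpN, hYc, hYp, hYk⟩ := exists_kernel_fields hO hy hpO hsurj t
  have ht0 : ∀ i < m, der n y p.1 (t i) = 0 := by
    intro i hi
    have h1 : t i ∈ tangentAt n S p.1 := hts.mem hi
    rw [← hA.ker p p.2, LinearMap.mem_ker, hBA] at h1
    exact Matrix.mulVec_injective_of_isUnit ((Matrix.isUnit_iff_isUnit_det B).2
      (isUnit_iff_ne_zero.2 hBd.ne')) (h1.trans (Matrix.mulVec_zero B).symm)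
  have hYs : HasSign (o p) (fun i => Y i p.1) s := by
    obtain ⟨b, hb, hbo⟩ := hts
    exact ⟨b, fun i => (hb i).trans (hYp i (ht0 i i.2)).symm, hbo⟩
  have hev := hA.eventually_hasSign hkm ho p (U := N ∩ O) ((hN.inter hO).mem_nhds ⟨hpN, hpO⟩)
    (X := Y) (fun i _ => (hYc i).mono fun q hq => hq.1.1)
    (fun q hq i _ => hker q ⟨hq.1.2, hq.2⟩ _ (hYk q hq.1.1 i)) hYs
  refine ⟨s, N ∩ {q | ∀ hq : q ∈ S', HasSign (o ⟨q, hq⟩) (fun i => Y i q) s},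
    inter_mem (hN.mem_nhds hpN) hev, Y, fun i _ => (hYc i).mono fun q hq => hq.1.1, ?_⟩
  exact fun q hq => hq.2 q.2

/-- Two orientations of a connected submanifold agree up to sign. -/
theorem NormalFamily.orientation_eq_or_neg (hA : NormalFamily S S' k A) (hkm : k + m = n)
    (hconn : IsPreconnected S') {o : CellOrientation n S S' m} (ho : OrientedBy oQ A o.at')
    (o' : CellOrientation n S S' m) : o' = o ∨ o' = -o := by
  have hloc : ∀ (o' : CellOrientation n S S' m) (p : S'), o'.at' p = o.at' p →
      ∀ᶠ q in 𝓝 p, o'.at' q = o.at' q := by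
    intro o' p hp
    obtain ⟨s, U, hU, X, hX, hs⟩ := o'.coherent p
    have h1 := hs p (mem_of_mem_nhds hU)
    rw [hp] at h1
    have hev := hA.eventually_hasSign hkm ho p hU hX
      (fun q hq i hi => (hs ⟨q, hq.2⟩ hq.1).mem hi) h1
    rw [nhds_subtype_eq_comap, eventually_comap]
    filter_upwards [hev, hU] with q h2 h3 q' hq'
    subst hq'
    exact (hs q' h3).orientation_eq (h2 q'.2)
  have hor : ∀ p : S', o'.at' p = o.at' p ∨ o'.at' p = -o.at' p := fun p =>
    _root_.orientation_eq_or_neg (hA.finrank hkm p.2) _ _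
  -- This set is open, and so is its complement, where the opposite of `o'` agrees with `o`. Since
  -- `S'` is connected, one of the two is everything.
  set C : Set S' := {p | o'.at' p = o.at' p} with hC
  have hCo : IsOpen C := isOpen_iff_mem_nhds.2 fun p hp => hloc o' p hp
  have hCc : IsClosed C := by
    rw [← isOpen_compl_iff, isOpen_iff_mem_nhds]
    intro p hp
    have hp' : (-o').at' p = o.at' p := by
      rw [CellOrientation.neg_at, (hor p).resolve_left hp]
      exact orientation_neg_neg (o.at' p)
    filter_upwards [hloc (-o') p hp'] with q hq
    intro hq'
    rw [CellOrientation.neg_at] at hq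
    rw [show o'.at' q = o.at' q from hq'] at hq
    exact orientation_ne_neg _ hq.symm
  have : PreconnectedSpace S' := isPreconnected_iff_preconnectedSpace.1 hconn
  have hext : ∀ o₁ o₂ : CellOrientation n S S' m, o₁.at' = o₂.at' → o₁ = o₂ := by
    rintro ⟨_, _⟩ ⟨_, _⟩ h
    cases h
    rfl
  rcases isClopen_iff.1 ⟨hCc, hCo⟩ with h | h
  · refine Or.inr (hext _ _ (funext fun p => ?_))
    refine (hor p).resolve_left fun hp => ?_
    have : p ∈ C := hp
    rw [h] at this
    exact this
  · refine Or.inl (hext _ _ (funext fun p => ?_))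
    have : p ∈ C := h ▸ mem_univ p
    exact this

theorem CellOrientation.ext' {o₁ o₂ : CellOrientation n S S' m} (h : ∀ p, o₁.at' p = o₂.at' p) :
    o₁ = o₂ := by
  obtain ⟨_, _⟩ := o₁
  obtain ⟨_, _⟩ := o₂
  cases funext h
  rfl

theorem CellOrientation.ne_neg (o : CellOrientation n S S' m) (h : S'.Nonempty) : o ≠ -o := by
  intro ho
  obtain ⟨p, hp⟩ := h
  have := congrArg (fun o => CellOrientation.at' o ⟨p, hp⟩) ho
  exact orientation_ne_neg _ this

end Orientations

end

/-! ### Ordered vertices and homogeneous coordinates on `Π^k`. -/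

noncomputable section

section Vertices

variable {V : Type v} [Fintype V] [LinearOrder V]

theorem card_eq_codim_add_one {σ : Finset V} (hσ : σ.Nonempty) : σ.card = codim σ + 1 := by
  have := Finset.card_pos.2 hσ
  unfold codim
  omega

/-- The vertices of a simplex, in increasing order. -/
def vtx (σ : Finset V) (hσ : σ.Nonempty) : Fin (codim σ + 1) ↪o V :=
  σ.orderEmbOfFin (card_eq_codim_add_one hσ)

theorem vtx_mem {σ : Finset V} (hσ : σ.Nonempty) (i : Fin (codim σ + 1)) : vtx σ hσ i ∈ σ :=
  Finset.orderEmbOfFin_mem _ _ _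

theorem exists_vtx {σ : Finset V} (hσ : σ.Nonempty) {v : V} (hv : v ∈ σ) :
    ∃ i, vtx σ hσ i = v := by
  have : v ∈ Set.range (σ.orderEmbOfFin (card_eq_codim_add_one hσ)) := by
    rw [Finset.range_orderEmbOfFin]
    exact hv
  exact this

theorem position_vtx {σ : Finset V} (hσ : σ.Nonempty) (i : Fin (codim σ + 1)) :
    position σ (vtx σ hσ i) = i := by
  have : σ.filter (· < vtx σ hσ i) = (Finset.Iio i).map (vtx σ hσ).toEmbedding := by
    ext v
    simp only [Finset.mem_filter, Finset.mem_map, Finset.mem_Iio]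
    constructor
    · rintro ⟨hv, h⟩
      obtain ⟨j, rfl⟩ := exists_vtx hσ hv
      exact ⟨j, (vtx σ hσ).lt_iff_lt.1 h, rfl⟩
    · rintro ⟨j, hj, rfl⟩
      exact ⟨vtx_mem hσ j, (vtx σ hσ).lt_iff_lt.2 hj⟩
  rw [position, this, Finset.card_map, Fin.card_Iio]

theorem vtx_eq_of_position {σ : Finset V} (hσ : σ.Nonempty) {v : V} (hv : v ∈ σ)
    {i : Fin (codim σ + 1)} (h : position σ v = i) : vtx σ hσ i = v :=
  position_injOn σ (vtx_mem hσ i) hv (by rw [position_vtx, h])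

/-- Homogeneous coordinates, indexed by the vertices of a simplex, on the local model. -/
def homog (σ : Finset V) (x : Fin (codim σ) → ℝ) (v : V) : ℝ :=
  if h : position σ v < codim σ + 1 then (Fin.cons 0 x : Fin (codim σ + 1) → ℝ) ⟨position σ v, h⟩
  else 0

theorem homog_vtx {σ : Finset V} (hσ : σ.Nonempty) (x : Fin (codim σ) → ℝ)
    (i : Fin (codim σ + 1)) :
    homog σ x (vtx σ hσ i) = (Fin.cons 0 x : Fin (codim σ + 1) → ℝ) i := by
  rw [homog, dif_pos (by rw [position_vtx]; exact i.2)]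
  congr 1
  exact Fin.ext (position_vtx hσ i)

theorem homog_sub (σ : Finset V) (x z : Fin (codim σ) → ℝ) (v : V) :
    homog σ (x - z) v = homog σ x v - homog σ z v := by
  unfold homog
  split_ifs with h
  · have : ∀ i, (Fin.cons 0 (x - z) : Fin (codim σ + 1) → ℝ) i =
        (Fin.cons 0 x : Fin (codim σ + 1) → ℝ) i - (Fin.cons 0 z : Fin (codim σ + 1) → ℝ) i := by
      intro i
      refine Fin.cases ?_ (fun j => ?_) i <;> simp
    rw [this]
  · simp

/-- Indexing the coordinates of the model by vertices instead of positions removes the need to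
renumber them when one passes to a face. -/
theorem isModelledOn_iff {Q : Type u} {D : V → Set Q} {σ : Finset V} (hσ : σ.Nonempty) {O : Set Q}
    {y : Q → Fin (codim σ) → ℝ} {r : ℝ} :
    IsModelledOn D σ O y r ↔ ∀ q ∈ O, ∀ v, q ∈ D v ↔ v ∈ σ ∧ ∀ u ∈ σ,
      homog σ (y q - modelShift (codim σ) r) u ≤ homog σ (y q - modelShift (codim σ) r) v := by
  refine forall₂_congr fun q _ => forall_congr' fun v => ?_
  refine iff_congr Iff.rfl (and_congr_right fun hv => ?_)
  obtain ⟨j, rfl⟩ := exists_vtx hσ hv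
  rw [homog_vtx, position_vtx]
  constructor
  · rintro ⟨j', hj', h⟩ u hu
    obtain rfl : j' = j := Fin.ext hj'
    obtain ⟨i, rfl⟩ := exists_vtx hσ hu
    rw [homog_vtx]
    exact h i
  · intro h
    refine ⟨j, rfl, fun i => ?_⟩
    have := h _ (vtx_mem hσ i)
    rwa [homog_vtx] at this

theorem modelShift_zero (d : ℕ) : modelShift d 0 = 0 := by
  funext i
  simp [modelShift]

end Vertices

/-! ### Models of a subdivision by functions indexed by vertices. -/

section Models

variable {n : ℕ} [NeZero n] {Q : Type u} [MetricSpace Q] [ChartedSpace (EuclideanHalfSpace n) Q]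
  {V : Type v} [Fintype V] [LinearOrder V]

/-- The differences of the functions `f v` at the vertices of `σ`. -/
def modelY (f : V → Q → ℝ) (σ : Finset V) (hσ : σ.Nonempty) (q : Q) : Fin (codim σ) → ℝ :=
  fun i => f (vtx σ hσ i.succ) q - f (vtx σ hσ 0) q

/-- On `O`, the cell dual to `v` is the set where `f v` is the largest of the functions `f u`, for
vertices `u` of `κ`; the differences of these functions are independent. -/
structure HModel (n : ℕ) [NeZero n] [ChartedSpace (EuclideanHalfSpace n) Q] (D : V → Set Q)
    (κ : Finset V) (O : Set Q) (f : V → Q → ℝ) : Prop where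
  isOpen : IsOpen O
  smooth : ∀ v ∈ κ, ContMDiffOn (𝓡∂ n) 𝓘(ℝ, ℝ) ∞ (f v) O
  model : ∀ q ∈ O, ∀ v, q ∈ D v ↔ v ∈ κ ∧ ∀ u ∈ κ, f u q ≤ f v q
  surj : ∀ q ∈ O, ∀ g : V → ℝ, ∃ w : TangentSpace (𝓡∂ n) q, ∀ u ∈ κ, ∀ v ∈ κ,
    der n (f v) q w - der n (f u) q w = g v - g u

variable {D : V → Set Q} {κ σ : Finset V} {O O' : Set Q} {f f' : V → Q → ℝ}

theorem HModel.contMDiffAt (h : HModel n D κ O f) {q : Q} (hq : q ∈ O) {v : V} (hv : v ∈ κ) :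
    ContMDiffAt (𝓡∂ n) 𝓘(ℝ, ℝ) ∞ (f v) q :=
  (h.smooth v hv).contMDiffAt (h.isOpen.mem_nhds hq)

theorem HModel.mdifferentiableAt (h : HModel n D κ O f) {q : Q} (hq : q ∈ O) {v : V} (hv : v ∈ κ) :
    MDifferentiableAt (𝓡∂ n) 𝓘(ℝ, ℝ) (f v) q :=
  (h.contMDiffAt hq hv).mdifferentiableAt (by simp)

theorem contMDiffOn_modelY (hσ : σ.Nonempty) (hf : ∀ v ∈ σ, ContMDiffOn (𝓡∂ n) 𝓘(ℝ, ℝ) ∞ (f v) O) :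
    ContMDiffOn (𝓡∂ n) 𝓘(ℝ, Fin (codim σ) → ℝ) ∞ (modelY f σ hσ) O :=
  contMDiffOn_pi_space.2 fun i => (hf _ (vtx_mem hσ i.succ)).sub (hf _ (vtx_mem hσ 0))

theorem der_modelY (hσ : σ.Nonempty) {q : Q}
    (hf : ∀ v ∈ σ, MDifferentiableAt (𝓡∂ n) 𝓘(ℝ, ℝ) (f v) q) (w : TangentSpace (𝓡∂ n) q)
    (i : Fin (codim σ)) :
    der n (modelY f σ hσ) q w i = der n (f (vtx σ hσ i.succ)) q w - der n (f (vtx σ hσ 0)) q w := by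
  have h1 : ∀ i : Fin (codim σ), MDifferentiableAt (𝓡∂ n) 𝓘(ℝ, ℝ)
      (fun q => f (vtx σ hσ i.succ) q - f (vtx σ hσ 0) q) q := fun i =>
    (hf _ (vtx_mem hσ i.succ)).sub (hf _ (vtx_mem hσ 0))
  refine (der_apply_apply (y := modelY f σ hσ) (mdifferentiableAt_pi h1) w i).trans ?_
  exact congrArg (fun L => L w) (der_sub (hf _ (vtx_mem hσ i.succ)) (hf _ (vtx_mem hσ 0)))

theorem HModel.der_modelY (h : HModel n D κ O f) (hκ : κ.Nonempty) {q : Q} (hq : q ∈ O)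
    (w : TangentSpace (𝓡∂ n) q) (i : Fin (codim κ)) :
    der n (modelY f κ hκ) q w i = der n (f (vtx κ hκ i.succ)) q w - der n (f (vtx κ hκ 0)) q w :=
  _root_.der_modelY hκ (fun _ hv => h.mdifferentiableAt hq hv) w i

theorem HModel.surjective (h : HModel n D κ O f) (hκ : κ.Nonempty) {q : Q} (hq : q ∈ O) :
    Function.Surjective (der n (modelY f κ hκ) q) := by
  intro z
  obtain ⟨w, hw⟩ := h.surj q hq (homog κ z)
  refine ⟨w, funext fun i => ?_⟩
  rw [h.der_modelY hκ hq, hw _ (vtx_mem hκ 0) _ (vtx_mem hκ i.succ), homog_vtx, homog_vtx]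
  simp

theorem HModel.mem_dualCell_iff (h : HModel n D κ O f) (hκ : κ.Nonempty) {q : Q} (hq : q ∈ O) :
    q ∈ dualCell D κ ↔ modelY f κ hκ q = 0 := by
  have h1 : q ∈ dualCell D κ ↔ ∀ v ∈ κ, ∀ u ∈ κ, f u q ≤ f v q := by
    simp only [dualCell, mem_iInter, h.model q hq]
    exact ⟨fun h' v hv => (h' v hv).2, fun h' v hv => ⟨hv, h' v hv⟩⟩
  rw [h1]
  constructor
  · intro h'
    funext i
    exact sub_eq_zero.2 (le_antisymm (h' _ (vtx_mem hκ 0) _ (vtx_mem hκ _))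
      (h' _ (vtx_mem hκ _) _ (vtx_mem hκ 0)))
  · intro h' v hv u hu
    have h2 : ∀ v ∈ κ, f v q = f (vtx κ hκ 0) q := by
      intro v hv
      obtain ⟨i, rfl⟩ := exists_vtx hκ hv
      refine Fin.cases rfl (fun j => ?_) i
      exact sub_eq_zero.1 (congrFun h' j)
    rw [h2 v hv, h2 u hu]

theorem stratum_subset_dualCell : stratum D κ ⊆ dualCell D κ := by
  intro q hq
  simp only [dualCell, mem_iInter]
  exact fun v hv => (hq v).2 hv

theorem HModel.subset (h : HModel n D κ O f) {p : Q} (hp : p ∈ O) (hps : p ∈ stratum D σ) :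
    σ ⊆ κ := fun v hv => ((h.model p hp v).1 ((hps v).2 hv)).1

/-- A model near the cell dual to `κ` is also one near the larger cells which contain it. -/
theorem HModel.restrict (h : HModel n D κ O f) (hσ : σ.Nonempty) {p : Q} (hp : p ∈ O)
    (hps : p ∈ stratum D σ) : ∃ O' ⊆ O, p ∈ O' ∧ HModel n D σ O' f := by
  have hσκ := h.subset hp hps
  -- Near a point of the stratum of `σ` the functions at the other vertices of `κ` stay strictly
  -- below those at `σ`, so they have no influence on which function is the largest.
  set O' := O ∩ ⋂ u ∈ κ \ σ, ⋂ v ∈ σ, {q ∈ O | f u q < f v q} with hO'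
  have hopen : IsOpen O' := by
    refine h.isOpen.inter (isOpen_biInter_finset fun u hu => isOpen_biInter_finset fun v hv => ?_)
    have h1 : ContinuousOn (fun q => f v q - f u q) O :=
      (h.smooth v (hσκ hv)).continuousOn.sub (h.smooth u (Finset.mem_sdiff.1 hu).1).continuousOn
    have := h1.isOpen_inter_preimage h.isOpen (isOpen_Ioi (a := (0 : ℝ)))
    convert this using 1
    ext q
    simp [sub_pos]
  have hlt : ∀ u ∈ κ \ σ, ∀ v ∈ σ, f u p < f v p := by
    intro u hu v hv
    rw [Finset.mem_sdiff] at hu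
    by_contra hn
    refine hu.2 ((hps u).1 ((h.model p hp u).2 ⟨hu.1, fun x hx => ?_⟩))
    exact (((h.model p hp v).1 ((hps v).2 hv)).2 x hx).trans (not_lt.1 hn)
  refine ⟨O', inter_subset_left, ⟨hp, ?_⟩, hopen, fun v hv => (h.smooth v (hσκ hv)).mono
    inter_subset_left, fun q hq v => ?_, fun q hq g => ?_⟩
  · simp only [mem_iInter]
    exact fun u hu v hv => ⟨hp, hlt u hu v hv⟩
  · obtain ⟨hqO, hq'⟩ := hq
    simp only [mem_iInter] at hq'
    rw [h.model q hqO]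
    constructor
    · rintro ⟨hv, hmax⟩
      refine ⟨?_, fun u hu => hmax u (hσκ hu)⟩
      by_contra hvσ
      obtain ⟨u, hu⟩ := hσ
      exact (hmax u (hσκ hu)).not_gt (hq' v (Finset.mem_sdiff.2 ⟨hv, hvσ⟩) u hu).2
    · rintro ⟨hv, hmax⟩
      refine ⟨hσκ hv, fun u hu => ?_⟩
      by_cases huσ : u ∈ σ
      · exact hmax u huσ
      · exact (hq' u (Finset.mem_sdiff.2 ⟨hu, huσ⟩) v hv).2.le
  · obtain ⟨w, hw⟩ := h.surj q hq.1 g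
    exact ⟨w, fun u hu v hv => hw u (hσκ hu) v (hσκ hv)⟩

variable [IsManifold (𝓡∂ n) ∞ Q]

theorem HModel.tangentAt_eq (h : HModel n D κ O f) (hκ : κ.Nonempty) {p : Q} (hp : p ∈ O)
    (hpD : p ∈ dualCell D κ) (hpi : p ∈ (𝓡∂ n).interior Q) :
    tangentAt n (dualCell D κ) p = LinearMap.ker (der n (modelY f κ hκ) p).toLinearMap :=
  tangentAt_eq_ker hpi ((contMDiffOn_modelY hκ h.smooth).contMDiffAt (h.isOpen.mem_nhds hp))
    (h.surjective hκ hp) hpD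
    (by filter_upwards [h.isOpen.mem_nhds hp] with q hq using h.mem_dualCell_iff hκ hq)

/-- Along a suitable curve through a point of a dual cell, the differences of the functions of a
model are linear. -/
theorem HModel.exists_curve (h : HModel n D κ O f) (hκ : κ.Nonempty) {p : Q} (hp : p ∈ O)
    (hpD : p ∈ dualCell D κ) (hpi : p ∈ (𝓡∂ n).interior Q) (w : TangentSpace (𝓡∂ n) p) :
    ∃ γ : ℝ → Q, γ 0 = p ∧ Tendsto γ (𝓝 0) (𝓝 p) ∧
      (∀ᶠ t in 𝓝 (0 : ℝ), γ t ∈ O ∧ ∀ u ∈ κ, ∀ v ∈ κ,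
        f v (γ t) - f u (γ t) = t * (der n (f v) p w - der n (f u) p w)) ∧
      ∀ g : Q → ℝ, MDifferentiableAt (𝓡∂ n) 𝓘(ℝ, ℝ) g p → HasDerivAt (g ∘ γ) (der n g p w) 0 := by
  obtain ⟨γ, h0, hc, hy, hd⟩ := _root_.exists_curve hpi
    ((contMDiffOn_modelY hκ h.smooth).contMDiffAt (h.isOpen.mem_nhds hp)) (h.surjective hκ hp) w
  have ht : Tendsto γ (𝓝 0) (𝓝 p) := by simpa [h0] using hc.tendsto
  refine ⟨γ, h0, ht, ?_, hd⟩
  filter_upwards [hy, ht.eventually (h.isOpen.mem_nhds hp)] with t h1 h2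
  refine ⟨h2, ?_⟩
  have h3 : ∀ v ∈ κ, f v (γ t) - f (vtx κ hκ 0) (γ t) =
      t * (der n (f v) p w - der n (f (vtx κ hκ 0)) p w) := by
    intro v hv
    obtain ⟨i, rfl⟩ := exists_vtx hκ hv
    refine Fin.cases (by simp) (fun j => ?_) i
    have h4 := congrFun h1 j
    rw [(h.mem_dualCell_iff hκ hp).1 hpD, zero_add] at h4
    rw [Pi.smul_apply, smul_eq_mul, h.der_modelY hκ hp] at h4
    exact h4
  intro u hu v hv
  linear_combination h3 v hv - h3 u hu

/-- Two models of the same cell agree to first order, up to a positive factor. -/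
theorem HModel.compare (h : HModel n D σ O f) (h' : HModel n D σ O' f') (hσ : σ.Nonempty) {p : Q}
    (hp : p ∈ O) (hp' : p ∈ O') (hpD : p ∈ dualCell D σ) (hpi : p ∈ (𝓡∂ n).interior Q) :
    ∃ c : ℝ, 0 < c ∧ ∀ w, der n (modelY f' σ hσ) p w = c • der n (modelY f σ hσ) p w := by
  classical
  -- Along a curve which lowers `f u` and keeps the other functions equal, the point stays in the
  -- cells dual to all `v ≠ u`. By the second model the functions `f' v`, `v ≠ u`, agree there and
  -- are at least `f' u`; the derivatives inherit this.
  have hray : ∀ u ∈ σ, ∀ w : TangentSpace (𝓡∂ n) p,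
      (∀ v ∈ σ, ∀ v' ∈ σ, der n (f v) p w - der n (f v') p w =
        (if v = u then -1 else 0) - (if v' = u then -1 else 0)) →
      (∀ v ∈ σ, ∀ v' ∈ σ, v ≠ u → v' ≠ u → der n (f' v) p w = der n (f' v') p w) ∧
      ∀ v ∈ σ, v ≠ u → der n (f' u) p w ≤ der n (f' v) p w := by
    intro u hu w hw
    obtain ⟨γ, h0, ht, hγ, hd⟩ := h.exists_curve hσ hp hpD hpi w
    have hmem : ∀ᶠ t in 𝓝[>] (0 : ℝ), ∀ v ∈ σ, v ≠ u → ∀ v' ∈ σ, f' v' (γ t) ≤ f' v (γ t) := by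
      filter_upwards [nhdsWithin_le_nhds hγ, self_mem_nhdsWithin,
        nhdsWithin_le_nhds (ht.eventually (h'.isOpen.mem_nhds hp'))] with t h1 h2 h3 v hv hvu v' hv'
      have h4 : γ t ∈ D v := (h.model _ h1.1 v).2 ⟨hv, fun x hx => by
        have h5 := h1.2 x hx v hv
        rw [hw v hv x hx, if_neg hvu] at h5
        have h2' : (0 : ℝ) < t := h2
        have : (0 : ℝ) ≤ t * (0 - if x = u then -1 else 0) := by
          refine mul_nonneg h2'.le ?_
          split_ifs <;> norm_num
        linarith⟩
      exact ((h'.model _ h3 v).1 h4).2 v' hv'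
    have hp0 : ∀ v ∈ σ, ∀ v' ∈ σ, f' v p = f' v' p := by
      intro v hv v' hv'
      simp only [dualCell, mem_iInter] at hpD
      exact le_antisymm (((h'.model p hp' v').1 (hpD v' hv')).2 v hv)
        (((h'.model p hp' v).1 (hpD v hv)).2 v' hv')
    have hle : ∀ v ∈ σ, v ≠ u → ∀ v' ∈ σ, der n (f' v') p w ≤ der n (f' v) p w := by
      intro v hv hvu v' hv'
      have h1 := (hd (f' v) (h'.mdifferentiableAt hp' hv)).sub
        (hd (f' v') (h'.mdifferentiableAt hp' hv'))
      have h2 := h1.hasDerivWithinAt (s := Ioi 0)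
      rw [hasDerivWithinAt_iff_tendsto_slope' (by simp)] at h2
      refine sub_nonneg.1 (ge_of_tendsto h2 ?_)
      filter_upwards [hmem, self_mem_nhdsWithin] with t h3 h4
      have h4' : (0 : ℝ) < t := h4
      rw [slope_def_field]
      simp only [Pi.sub_apply, Function.comp_apply, h0, hp0 v hv v' hv', sub_self, sub_zero]
      exact div_nonneg (sub_nonneg.2 (h3 v hv hvu v' hv')) h4'.le
    exact ⟨fun v hv v' hv' hvu hvu' => le_antisymm (hle v' hv' hvu' v hv) (hle v hv hvu v' hv'),
      fun v hv hvu => hle v hv hvu u hu⟩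
  -- Both differentials have the same kernel, the tangent space of the dual cell, which depends only
  -- on the subdivision.
  have hker : ∀ w : TangentSpace (𝓡∂ n) p,
      (∀ v ∈ σ, ∀ v' ∈ σ, der n (f v) p w = der n (f v') p w) →
      ∀ v ∈ σ, ∀ v' ∈ σ, der n (f' v) p w = der n (f' v') p w := by
    intro w hw
    have h1 : w ∈ tangentAt n (dualCell D σ) p := by
      rw [h.tangentAt_eq hσ hp hpD hpi, LinearMap.mem_ker]
      funext i
      refine (h.der_modelY hσ hp w i).trans ?_
      rw [hw _ (vtx_mem hσ i.succ) _ (vtx_mem hσ 0), sub_self]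
      rfl
    rw [h'.tangentAt_eq hσ hp' hpD hpi, LinearMap.mem_ker] at h1
    have h2 : ∀ v ∈ σ, der n (f' v) p w = der n (f' (vtx σ hσ 0)) p w := by
      intro v hv
      obtain ⟨i, rfl⟩ := exists_vtx hσ hv
      refine Fin.cases rfl (fun j => ?_) i
      have h3 := (h'.der_modelY hσ hp' w j).symm.trans (congrFun h1 j)
      exact sub_eq_zero.1 h3
    intro v hv v' hv'
    rw [h2 v hv, h2 v' hv']
  -- The vectors `W u` point along the edges of the fan `Π^k`, and span the normal directions.
  choose W hW using fun u : V => h.surj p hp fun v => if v = u then -1 else 0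
  have hWray := fun u hu => hray u hu (W u) fun v hv v' hv' => hW u v' hv' v hv
  have hl : ∀ u ∈ σ, ∃ l : ℝ, 0 ≤ l ∧ ∀ v ∈ σ, ∀ v' ∈ σ,
      der n (f' v) p (W u) - der n (f' v') p (W u) =
        (if v = u then -l else 0) - (if v' = u then -l else 0) := by
    intro u hu
    by_cases hex : ∃ v₀ ∈ σ, v₀ ≠ u
    · obtain ⟨v₀, hv₀, hne⟩ := hex
      refine ⟨der n (f' v₀) p (W u) - der n (f' u) p (W u),
        sub_nonneg.2 ((hWray u hu).2 v₀ hv₀ hne), ?_⟩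
      have h1 : ∀ v ∈ σ, der n (f' v) p (W u) = der n (f' v₀) p (W u) +
          (if v = u then -(der n (f' v₀) p (W u) - der n (f' u) p (W u)) else 0) := by
        intro v hv
        split_ifs with hvu
        · subst hvu
          ring
        · rw [(hWray u hu).1 v hv v₀ hv₀ hvu hne, add_zero]
      intro v hv v' hv'
      rw [h1 v hv, h1 v' hv']
      ring
    · push Not at hex
      refine ⟨0, le_rfl, fun v hv v' hv' => ?_⟩
      rw [hex v hv, hex v' hv']
      simp
  choose! l hl0 hl using hl
  -- Modulo the common kernel `w` is `-∑ g u • W u`. So in homogeneous coordinates the change of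
  -- model is diagonal, with non-negative entries `l v`.
  have hgen : ∀ (g : V → ℝ) (w : TangentSpace (𝓡∂ n) p),
      (∀ v ∈ σ, ∀ v' ∈ σ, der n (f v) p w - der n (f v') p w = g v - g v') →
      ∀ v ∈ σ, ∀ v' ∈ σ, der n (f' v) p w - der n (f' v') p w = l v * g v - l v' * g v' := by
    intro g w hw
    have h1 := hker (w + ∑ u ∈ σ, g u • W u) ?_
    · intro v hv v' hv'
      have h2 := h1 v hv v' hv'
      simp only [map_add, map_sum, map_smul, smul_eq_mul] at h2
      have h3 : ∑ u ∈ σ, g u * der n (f' v) p (W u) - ∑ u ∈ σ, g u * der n (f' v') p (W u) =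
          -(l v * g v) + l v' * g v' := by
        rw [← Finset.sum_sub_distrib]
        have : ∀ u ∈ σ, g u * der n (f' v) p (W u) - g u * der n (f' v') p (W u) =
            (if v = u then -(l u * g u) else 0) - (if v' = u then -(l u * g u) else 0) := by
          intro u hu
          rw [← mul_sub, hl u hu v hv v' hv']
          split_ifs <;> ring
        rw [Finset.sum_congr rfl this, Finset.sum_sub_distrib, Finset.sum_ite_eq,
          Finset.sum_ite_eq, if_pos hv, if_pos hv']
        ring
      linarith
    · intro v hv v' hv'
      simp only [map_add, map_sum, map_smul, smul_eq_mul]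
      have h3 : ∑ u ∈ σ, g u * der n (f v) p (W u) - ∑ u ∈ σ, g u * der n (f v') p (W u) =
          -(g v) + g v' := by
        rw [← Finset.sum_sub_distrib]
        have : ∀ u ∈ σ, g u * der n (f v) p (W u) - g u * der n (f v') p (W u) =
            (if v = u then -(g u) else 0) - (if v' = u then -(g u) else 0) := by
          intro u hu
          rw [← mul_sub, hW u v' hv' v hv]
          split_ifs <;> ring
        rw [Finset.sum_congr rfl this, Finset.sum_sub_distrib, Finset.sum_ite_eq,
          Finset.sum_ite_eq, if_pos hv, if_pos hv']
        ring
      have := hw v hv v' hv'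
      linarith
  -- Homogeneous coordinates are defined up to a common constant, so `g = 1` represents the zero
  -- vector; its image must be constant as well, which makes all the `l v` equal.
  have hconst : ∀ v ∈ σ, ∀ v' ∈ σ, l v = l v' := by
    intro v hv v' hv'
    have := hgen (fun _ => 1) 0 (by simp) v hv v' hv'
    simp only [map_zero, sub_self, mul_one] at this
    linarith
  set c := l (vtx σ hσ 0) with hc
  have hfin : ∀ w, der n (modelY f' σ hσ) p w = c • der n (modelY f σ hσ) p w := by
    intro w
    funext i
    rw [Pi.smul_apply, smul_eq_mul, h.der_modelY hσ hp, h'.der_modelY hσ hp',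
      hgen (fun v => der n (f v) p w) w (fun _ _ _ _ => rfl) _ (vtx_mem hσ i.succ) _ (vtx_mem hσ 0),
      hconst _ (vtx_mem hσ i.succ) _ (vtx_mem hσ 0)]
    ring
  -- The factor can vanish only in codimension `0`, by surjectivity of the second differential; then
  -- there are no coordinates and any positive factor will do.
  by_cases h0 : c = 0
  · have hcod : codim σ = 0 := by
      by_contra hne
      obtain ⟨w, hw⟩ := h'.surjective hσ hp' (fun _ => 1)
      have := congrFun ((hfin w).symm.trans hw) ⟨0, Nat.pos_of_ne_zero hne⟩
      simp [h0] at this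
    refine ⟨1, one_pos, fun w => funext fun i => ?_⟩
    exact absurd i.2 (by omega)
  · exact ⟨c, lt_of_le_of_ne (hl0 _ (vtx_mem hσ 0)) (Ne.symm h0), hfin⟩

end Models

end

/-! ### Passing between local models and functions indexed by vertices. -/

noncomputable section

section LocalModels

variable {n : ℕ} [NeZero n] {Q : Type u} [MetricSpace Q] [ChartedSpace (EuclideanHalfSpace n) Q]
  {V : Type v} [Fintype V] [LinearOrder V] {D : V → Set Q} {σ : Finset V} {O : Set Q}
  {y : Q → Fin (codim σ) → ℝ} {p : Q} {f : V → Q → ℝ}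

theorem modelY_homog (hσ : σ.Nonempty) (y : Q → Fin (codim σ) → ℝ) :
    modelY (fun v q => homog σ (y q) v) σ hσ = y := by
  funext q i
  simp only [modelY, homog_vtx]
  simp

theorem homog_modelY (hσ : σ.Nonempty) (q : Q) {v : V} (hv : v ∈ σ) :
    homog σ (modelY f σ hσ q) v = f v q - f (vtx σ hσ 0) q := by
  obtain ⟨i, rfl⟩ := exists_vtx hσ hv
  rw [homog_vtx]
  refine Fin.cases (by simp) (fun j => ?_) i
  simp [modelY]

theorem contMDiffOn_homog (hσ : σ.Nonempty) (hy : ContMDiffOn (𝓡∂ n) 𝓘(ℝ, Fin (codim σ) → ℝ) ∞ y O)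
    {v : V} (hv : v ∈ σ) : ContMDiffOn (𝓡∂ n) 𝓘(ℝ, ℝ) ∞ (fun q => homog σ (y q) v) O := by
  obtain ⟨i, rfl⟩ := exists_vtx hσ hv
  simp only [homog_vtx]
  refine Fin.cases ?_ (fun j => ?_) i
  · simp only [Fin.cons_zero]
    exact contMDiffOn_const
  · simp only [Fin.cons_succ]
    exact contMDiffOn_pi_space.1 hy j

theorem der_homog_sub (hσ : σ.Nonempty) (hy : ContMDiffOn (𝓡∂ n) 𝓘(ℝ, Fin (codim σ) → ℝ) ∞ y O)
    (hO : IsOpen O) {q : Q} (hq : q ∈ O) {u v : V} (hu : u ∈ σ) (hv : v ∈ σ)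
    (w : TangentSpace (𝓡∂ n) q) :
    der n (fun q => homog σ (y q) v) q w - der n (fun q => homog σ (y q) u) q w =
      homog σ (der n y q w) v - homog σ (der n y q w) u := by
  have hmd : MDifferentiableAt (𝓡∂ n) 𝓘(ℝ, Fin (codim σ) → ℝ) y q :=
    (hy.contMDiffAt (hO.mem_nhds hq)).mdifferentiableAt (by simp)
  have key : ∀ v ∈ σ, der n (fun q => homog σ (y q) v) q w = homog σ (der n y q w) v := by
    intro v hv
    obtain ⟨i, rfl⟩ := exists_vtx hσ hv
    simp only [homog_vtx]
    refine Fin.cases ?_ (fun j => ?_) i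
    · simp only [Fin.cons_zero]
      rw [der_const]
      rfl
    · simp only [Fin.cons_succ]
      exact (der_apply_apply hmd w j).symm
  rw [key v hv, key u hu]

theorem hModel_of_surjective (hσ : σ.Nonempty) (hO : IsOpen O)
    (hy : ContMDiffOn (𝓡∂ n) 𝓘(ℝ, Fin (codim σ) → ℝ) ∞ y O) {r : ℝ} (hm : IsModelledOn D σ O y r)
    (hs : ∀ q ∈ O, Function.Surjective (der n y q)) :
    HModel n D σ O (fun v q => homog σ (y q - modelShift (codim σ) r) v) := by
  have hy' : ContMDiffOn (𝓡∂ n) 𝓘(ℝ, Fin (codim σ) → ℝ) ∞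
      (fun q => y q - modelShift (codim σ) r) O := hy.sub contMDiffOn_const
  refine ⟨hO, fun v hv => contMDiffOn_homog hσ hy' hv, (isModelledOn_iff hσ).1 hm,
    fun q hq g => ?_⟩
  obtain ⟨w, hw⟩ := hs q hq fun i => g (vtx σ hσ i.succ) - g (vtx σ hσ 0)
  have hw' : der n (fun q => y q - modelShift (codim σ) r) q w = der n y q w := by
    have hmd : MDifferentiableAt (𝓡∂ n) 𝓘(ℝ, Fin (codim σ) → ℝ) y q :=
      (hy.contMDiffAt (hO.mem_nhds hq)).mdifferentiableAt (by simp)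
    simp only [sub_eq_add_neg]
    rw [der_add_const hmd]
  refine ⟨w, fun u hu v hv => ?_⟩
  rw [der_homog_sub hσ hy' hO hq hu hv, hw', hw]
  have key : ∀ v ∈ σ, homog σ (fun i => g (vtx σ hσ i.succ) - g (vtx σ hσ 0)) v =
      g v - g (vtx σ hσ 0) := by
    intro v hv
    obtain ⟨i, rfl⟩ := exists_vtx hσ hv
    rw [homog_vtx]
    refine Fin.cases (by simp) (fun j => ?_) i
    simp
  rw [key v hv, key u hu]
  ring

theorem HModel.isLocalModel (h : HModel n D σ O f) (hσ : σ.Nonempty) (hp : p ∈ O) :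
    IsLocalModel n D σ p O (modelY f σ hσ) where
  isOpen := h.isOpen
  mem := hp
  smooth := contMDiffOn_modelY hσ h.smooth
  submersion := h.surjective hσ hp
  model := (isModelledOn_iff hσ).2 fun q hq v => by
    rw [h.model q hq, modelShift_zero, sub_zero]
    refine and_congr_right fun hv => forall₂_congr fun u hu => ?_
    rw [homog_modelY hσ q hv, homog_modelY hσ q hu]
    simp

variable [IsManifold (𝓡∂ n) ∞ Q]

/-- A frame which is mapped to the standard basis at `p` extends with constant coordinates, and the
determinant of its image remains positive nearby. -/
theorem eventually_surjective_der {k : ℕ} {y : Q → Fin k → ℝ} (hO : IsOpen O)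
    (hy : ContMDiffOn (𝓡∂ n) 𝓘(ℝ, Fin k → ℝ) ∞ y O) (hp : p ∈ O)
    (hs : Function.Surjective (der n y p)) : ∀ᶠ q in 𝓝 p, Function.Surjective (der n y q) := by
  obtain ⟨a, ha⟩ := exists_dual_frame (A := (der n y p).toLinearMap) hs
  have hdet : 0 < (1 : ℝ) * (frameMatrix (der n y p).toLinearMap a).det := by
    simp [frameMatrix_eq_one ha]
  filter_upwards [eventually_frameMatrix_det_pos hO hy hp hdet] with q hq z
  rw [one_mul] at hq
  set M := frameMatrix (der n y q).toLinearMap (fun i => constVF p (a i) q) with hM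
  refine ⟨∑ j : Fin k, (M⁻¹.mulVec z) j • constVF p (a j) q, ?_⟩
  have h1 : der n y q (∑ j : Fin k, (M⁻¹.mulVec z) j • constVF p (a j) q) =
      M.mulVec (M⁻¹.mulVec z) := by
    rw [map_sum]
    funext l
    rw [Finset.sum_apply]
    simp only [map_smul, Pi.smul_apply, smul_eq_mul]
    exact Finset.sum_congr rfl fun j _ => mul_comm _ _
  rw [h1, Matrix.mulVec_mulVec, Matrix.mul_nonsing_inv _ (isUnit_iff_ne_zero.2 hq.ne'),
    Matrix.one_mulVec]

/-- `IsLocalModel` requires a submersion at the point `p` only, while `HModel` requires one on its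
whole domain, hence the smaller neighbourhood. -/
theorem IsLocalModel.exists_hModel (h : IsLocalModel n D σ p O y) (hσ : σ.Nonempty) :
    ∃ O' ⊆ O, p ∈ O' ∧ HModel n D σ O' (fun v q => homog σ (y q) v) := by
  obtain ⟨N, hN, hNo, hpN⟩ := eventually_nhds_iff.1
    (eventually_surjective_der h.isOpen h.smooth h.mem h.submersion)
  refine ⟨O ∩ N, inter_subset_left, ⟨h.mem, hpN⟩, ?_⟩
  have := hModel_of_surjective (D := D) (r := 0) hσ (h.isOpen.inter hNo)
    (h.smooth.mono inter_subset_left) (fun q hq => h.model q hq.1) fun q hq => hN q hq.2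
  simpa only [modelShift_zero, sub_zero] using this

end LocalModels

/-! ### The orientation of a cell dual to an ordered simplex, and the bijection between chains and
cochains. -/

section DualOrientation

variable {n : ℕ} [NeZero n] {Q : Type u} [MetricSpace Q] [ChartedSpace (EuclideanHalfSpace n) Q]
  [IsManifold (𝓡∂ n) ∞ Q] {V : Type v} [Fintype V] [LinearOrder V]

/-- The properties of a subdivision on which the algebra of its cellular chains depends. -/
structure IsRegularSubdivision (P : SmoothTriangulation n Q V) (D : V → Set Q) : Prop where
  model : ∀ σ ∈ P.complex.faces, ∀ p ∈ openCell n D σ, ∃ O f, p ∈ O ∧ HModel n D σ O f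
  preconnected : ∀ σ ∈ P.complex.faces, IsPreconnected (openCell n D σ)
  nonempty : ∀ σ ∈ P.complex.faces, (openCell n D σ).Nonempty

/-- The orientations `o` of the tangent spaces of a dual cell are those which correspond to the
ordering of the vertices and the orientation of `Q`. -/
def DualOriented (oQ : CellOrientation n (univ : Set Q) ((𝓡∂ n).interior Q) n) {D : V → Set Q}
    {σ : Finset V} (hσ : σ.Nonempty) (o : DualCellOrientation n D σ) : Prop :=
  ∀ (q : openCell n D σ) (O : Set Q) (f : V → Q → ℝ), HModel n D σ O f → q.1 ∈ O →
    ∀ Ω : TangentSpace (𝓡∂ n) q.1 [⋀^Fin n]→ₗ[ℝ] ℝ, Represents (oQ.at' ⟨q.1, q.2.2⟩) Ω →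
      Cooriented (der n (modelY f σ hσ) q.1).toLinearMap Ω (o.at' q)

variable {oQ : CellOrientation n (univ : Set Q) ((𝓡∂ n).interior Q) n}
  {P : SmoothTriangulation n Q V} {D : V → Set Q} {σ : Finset V} {O : Set Q} {f : V → Q → ℝ}

theorem HModel.codim_le (h : HModel n D σ O f) (hσ : σ.Nonempty) {p : Q} (hp : p ∈ O) :
    codim σ ≤ n := by
  have := LinearMap.finrank_le_finrank_of_surjective
    (f := (der n (modelY f σ hσ) p).toLinearMap) (h.surjective hσ hp)
  rw [finrank_tangentSpace] at this
  simpa using this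

theorem IsRegularSubdivision.codim_le (h : IsRegularSubdivision P D) (hσ : σ ∈ P.complex.faces) :
    codim σ ≤ n := by
  obtain ⟨p, hp⟩ := h.nonempty σ hσ
  obtain ⟨O, f, hpO, hf⟩ := h.model σ hσ p hp
  exact hf.codim_le (P.nonempty_of_mem hσ) hpO

/-- The models may be chosen independently at each point, with no continuity: by `HModel.compare`
the differential of any model near `p` is a positive multiple of the chosen one at every nearby
point of the cell. -/
theorem IsRegularSubdivision.exists_normalFamily (h : IsRegularSubdivision P D)
    (hσ : σ ∈ P.complex.faces) :
    ∃ A : ∀ q : Q, TangentSpace (𝓡∂ n) q →ₗ[ℝ] Fin (codim σ) → ℝ,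
      NormalFamily (dualCell D σ) (openCell n D σ) (codim σ) A ∧
      ∀ q ∈ openCell n D σ, ∀ O f, HModel n D σ O f → q ∈ O → ∃ c : ℝ, 0 < c ∧
        ∀ w, der n (modelY f σ (P.nonempty_of_mem hσ)) q w = c • A q w := by
  classical
  have hne := P.nonempty_of_mem hσ
  choose! O f hO hf using h.model σ hσ
  set A : ∀ q : Q, TangentSpace (𝓡∂ n) q →ₗ[ℝ] Fin (codim σ) → ℝ :=
    fun q => (der n (modelY (f q) σ hne) q).toLinearMap with hA
  have hcmp : ∀ q ∈ openCell n D σ, ∀ O f, HModel n D σ O f → q ∈ O → ∃ c : ℝ, 0 < c ∧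
      ∀ w, der n (modelY f σ hne) q w = c • A q w := fun q hq O' f' hf' hq' =>
    (hf q hq).compare hf' hne (hO q hq) hq' (stratum_subset_dualCell hq.1) hq.2
  refine ⟨A, ⟨fun q hq => hq.2, fun q hq => ?_, fun q hq => (hf q hq).surjective hne (hO q hq),
    fun p hp => ?_⟩, hcmp⟩
  · exact ((hf q hq).tangentAt_eq hne (hO q hq) (stratum_subset_dualCell hq.1) hq.2).symm
  · refine ⟨O p, modelY (f p) σ hne, (hf p hp).isOpen, hO p hp,
      contMDiffOn_modelY hne (hf p hp).smooth, fun q hq => ?_⟩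
    obtain ⟨c, hc, hcA⟩ := hcmp q hq.2 _ _ (hf p hp) hq.1
    refine ⟨c⁻¹ • 1, ?_, fun w => ?_⟩
    · rw [Matrix.det_smul, Matrix.det_one, mul_one]
      positivity
    · rw [hcA, Matrix.smul_mulVec, Matrix.one_mulVec, smul_smul, inv_mul_cancel₀ hc.ne', one_smul]

theorem IsRegularSubdivision.finrank (h : IsRegularSubdivision P D) (hσ : σ ∈ P.complex.faces)
    {q : Q} (hq : q ∈ openCell n D σ) :
    Module.finrank ℝ (tangentAt n (dualCell D σ) q) = n - codim σ := by
  obtain ⟨A, hA, -⟩ := h.exists_normalFamily hσ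
  exact hA.finrank (Nat.add_sub_cancel' (h.codim_le hσ)) hq

/-- A dual cell has an orientation which corresponds to the ordering of the vertices, and this is
its only orientation, up to sign. -/
theorem IsRegularSubdivision.exists_dualOriented (h : IsRegularSubdivision P D)
    (hσ : σ ∈ P.complex.faces)
    (oQ : CellOrientation n (univ : Set Q) ((𝓡∂ n).interior Q) n) :
    ∃ o : DualCellOrientation n D σ, DualOriented oQ (P.nonempty_of_mem hσ) o ∧
      ∀ o', o' = o ∨ o' = -o := by
  obtain ⟨A, hA, hcmp⟩ := h.exists_normalFamily hσ
  have hkm := Nat.add_sub_cancel' (h.codim_le hσ)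
  obtain ⟨o, ho⟩ := hA.exists_orientation hkm oQ
  refine ⟨o, fun q O f hf hq Ω hΩ => ?_, hA.orientation_eq_or_neg hkm (h.preconnected σ hσ) ho⟩
  obtain ⟨c, hc, hcA⟩ := hcmp q q.2 O f hf hq
  exact (ho q q.2.2 Ω hΩ).of_smul hc hcA

theorem IsRegularSubdivision.dualOriented_unique (h : IsRegularSubdivision P D)
    (hσ : σ ∈ P.complex.faces) {hσ' : σ.Nonempty} {o o' : DualCellOrientation n D σ}
    (ho : DualOriented oQ hσ' o) (ho' : DualOriented oQ hσ' o') : o = o' := by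
  refine CellOrientation.ext' fun q => ?_
  obtain ⟨O, f, hqO, hf⟩ := h.model σ hσ q q.2
  obtain ⟨Ω, -, hΩ⟩ := exists_represents_at oQ q.2.2
  exact (ho q O f hf hqO Ω hΩ).eq (hf.surjective hσ' hqO) (h.finrank hσ q.2)
    (ho' q O f hf hqO Ω hΩ)

/-- `IsDualOrientation` speaks of one model and one frame at each point, `DualOriented` of all of
them. The change of model is covered by `HModel.compare` and the change of frame by
`Cooriented.of_frame`. -/
theorem IsRegularSubdivision.isDualOrientation_iff (h : IsRegularSubdivision P D)
    (hσ : σ ∈ P.complex.faces) {o : DualCellOrientation n D σ} :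
    IsDualOrientation oQ o ↔ DualOriented oQ (P.nonempty_of_mem hσ) o := by
  have hne := P.nonempty_of_mem hσ
  have hkm := Nat.add_sub_cancel' (h.codim_le hσ)
  constructor
  · intro ho q O' f' hf' hq' Ω hΩ
    obtain ⟨O, y, hy, a, t, s, ha, ht, hat⟩ := ho q
    obtain ⟨O₁, hO₁, hqO₁, hf⟩ := hy.exists_hModel hne
    obtain ⟨c, hc, hcA⟩ := hf.compare hf' hne hqO₁ hq' (stratum_subset_dualCell q.2.1) q.2.2
    refine Cooriented.of_smul (A := (der n (modelY (fun v q => homog σ (y q) v) σ hne) q).toLinearMap)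
      ?_ hc hcA
    have hker := hf.tangentAt_eq hne hqO₁ (stratum_subset_dualCell q.2.1) q.2.2
    have hsurj := hf.surjective hne hqO₁
    rw [modelY_homog] at hker hsurj ⊢
    have hfm : frameMatrix (der n y q.1).toLinearMap a = 1 := frameMatrix_eq_one ha
    refine Cooriented.of_frame (finrank_tangentSpace q.1) hkm hsurj hker.symm (a := a) (t := t)
      (s := s) ?_ ht ?_
    · rw [hfm]
      simp
    · rw [hfm, Matrix.det_one, one_mul]
      exact (hΩ _ s).1 hat
  · intro ho p
    obtain ⟨O, f, hpO, hf⟩ := h.model σ hσ p p.2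
    refine ⟨O, modelY f σ hne, hf.isLocalModel hne hpO, ?_⟩
    obtain ⟨a, ha⟩ := exists_dual_frame (A := (der n (modelY f σ hne) p.1).toLinearMap)
      (hf.surjective hne hpO)
    obtain ⟨t, s, hts⟩ := exists_hasSign (h.finrank hσ p.2) (o.at' p)
    obtain ⟨Ω, -, hΩ⟩ := exists_represents_at oQ p.2.2
    refine ⟨a, t, s, ha, hts, (hΩ _ s).2 ?_⟩
    have hfm := frameMatrix_eq_one ha
    have h1 := ((ho p O f hf hpO Ω hΩ t s a (by rw [hfm]; simp)).1 hts).2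
    rwa [hfm, Matrix.det_one, one_mul] at h1

theorem finsum_mem_eq_of_unique {α M : Type*} [AddCommMonoid M] {R : α → Prop} {a : α}
    (h : ∀ b, R b ↔ b = a) (g : α → M) : ∑ᶠ (b) (_ : R b), g b = g a := by
  simp only [h]
  exact finsum_cond_eq_left

theorem IsRegularSubdivision.dualCochain_apply (h : IsRegularSubdivision P D)
    (c : CellularChain P D) (σ : P.complex.faces) {o : DualCellOrientation n D σ.1}
    (ho : DualOriented oQ (P.nonempty_of_mem σ.2) o) : dualCochain oQ c σ = (c σ).1 o := by
  refine finsum_mem_eq_of_unique (fun o' => ?_) _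
  rw [h.isDualOrientation_iff σ.2]
  exact ⟨fun ho' => h.dualOriented_unique σ.2 ho' ho, fun e => e ▸ ho⟩

theorem IsRegularSubdivision.dualCochain_add (h : IsRegularSubdivision P D)
    (c c' : CellularChain P D) :
    dualCochain oQ (c + c') = dualCochain oQ c + dualCochain oQ c' := by
  funext σ
  obtain ⟨o, ho, -⟩ := h.exists_dualOriented σ.2 oQ
  rw [Pi.add_apply, h.dualCochain_apply _ σ ho, h.dualCochain_apply _ σ ho,
    h.dualCochain_apply _ σ ho]
  rfl

theorem IsRegularSubdivision.dualCochain_apply_eq_zero_iff (h : IsRegularSubdivision P D)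
    (c : CellularChain P D) (σ : P.complex.faces) : dualCochain oQ c σ = 0 ↔ c σ = 0 := by
  obtain ⟨o, ho, hall⟩ := h.exists_dualOriented σ.2 oQ
  rw [h.dualCochain_apply _ σ ho]
  constructor
  · intro h0
    refine Subtype.ext (funext fun o' => ?_)
    rcases hall o' with rfl | rfl
    · exact h0
    · rw [(c σ).2 o, h0]
      rfl
  · intro h0
    rw [h0]
    rfl

theorem IsRegularSubdivision.dualCochain_chainSign (h : IsRegularSubdivision P D)
    (c : CellularChain P D) : dualCochain oQ (chainSign c) = cochainSign (dualCochain oQ c) := by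
  funext σ
  obtain ⟨o, ho, -⟩ := h.exists_dualOriented σ.2 oQ
  rw [cochainSign, h.dualCochain_apply _ σ ho, h.dualCochain_apply _ σ ho]
  simp [chainSign]

/-- The two orientations of a cell are distinct because the open cell is non-empty, so the
coefficient of the distinguished one can be prescribed, and it determines the other. -/
theorem IsRegularSubdivision.dualCochain_bijective (h : IsRegularSubdivision P D) :
    Function.Bijective (dualCochain oQ : CellularChain P D → Cochain P) := by
  classical
  constructor
  · intro c c' hc
    have hsub : ∀ σ, dualCochain oQ (c - c') σ = 0 := by
      intro σ
      have h1 := h.dualCochain_add (oQ := oQ) (c - c') c'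
      rw [sub_add_cancel, hc] at h1
      have := congrFun h1 σ
      rw [Pi.add_apply] at this
      omega
    funext σ
    exact sub_eq_zero.1 ((h.dualCochain_apply_eq_zero_iff _ σ).1 (hsub σ))
  · intro φ
    choose o ho hall using fun σ : P.complex.faces => h.exists_dualOriented σ.2 oQ
    refine ⟨fun σ => ⟨fun o' => if o' = o σ then φ σ else -φ σ, fun o' => ?_⟩, ?_⟩
    · have hne := (o σ).ne_neg (h.nonempty σ.1 σ.2)
      beta_reduce
      rcases hall σ o' with rfl | rfl
      · rw [if_neg hne.symm, if_pos rfl]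
      · rw [neg_neg, if_pos rfl, if_neg hne.symm, neg_neg]
    · funext σ
      rw [h.dualCochain_apply _ σ (ho σ)]
      simp

end DualOrientation

end

/-! ### Normal frames of facets, and the sign of an incidence. -/

noncomputable section

/-- The determinant of the differences of the rows of a matrix, when the last column is constant
but for one row. -/
theorem det_sub_row_zero {k : ℕ} (F : Fin (k + 2) → Fin (k + 1) → ℝ) (j : Fin (k + 2)) {c d : ℝ}
    (hF : ∀ i, F i (Fin.last k) = d + if i = j then c else 0) :
    (Matrix.of fun i l : Fin (k + 1) => F i.succ l - F 0 l).det =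
      (-1) ^ ((j : ℕ) + k + 1) * c *
        (Matrix.of fun i l : Fin k => F (j.succAbove i.succ) l.castSucc -
          F (j.succAbove 0) l.castSucc).det := by
  induction j using Fin.cases with
  | zero =>
    -- Here the exceptional row is the one which is subtracted from all others. Subtracting the
    -- first difference from the remaining ones replaces it by row `1`, and leaves `-c` as the only
    -- non-zero entry of the last column.
    have h1 : (Matrix.of fun i l : Fin (k + 1) => F i.succ l - F 0 l).det =
        (Matrix.of fun i l : Fin (k + 1) => if i = 0 then F 1 l - F 0 l
          else F i.succ l - F 1 l).det := by
      refine Matrix.det_eq_of_forall_row_eq_smul_add_const (fun i => if i = 0 then 0 else 1) 0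
        (by simp) fun i l => ?_
      by_cases h : i = 0
      · subst h
        simp
      · simp [h]
    rw [h1, Matrix.det_succ_column _ (Fin.last k), Finset.sum_eq_single 0]
    · simp only [Matrix.of_apply, if_true, hF, Fin.val_zero, Fin.val_last]
      have h2 : (Matrix.of fun i l : Fin (k + 1) => if i = 0 then F 1 l - F 0 l
          else F i.succ l - F 1 l).submatrix (Fin.succAbove 0) (Fin.last k).succAbove =
          Matrix.of fun i l : Fin k => F ((0 : Fin (k + 2)).succAbove i.succ) l.castSucc -
            F ((0 : Fin (k + 2)).succAbove 0) l.castSucc := by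
        ext i l
        simp [Fin.succ_ne_zero]
      rw [h2]
      have h3 : (1 : Fin (k + 2)) ≠ 0 := by simp
      rw [if_neg h3]
      ring
    · intro i _ hi
      have h3 : i.succ ≠ 0 := Fin.succ_ne_zero i
      have h4 : (1 : Fin (k + 2)) ≠ 0 := by simp
      simp [hi, hF, h3]
    · simp
  | succ j =>
    rw [Matrix.det_succ_column _ (Fin.last k), Finset.sum_eq_single j]
    · have h2 : (Matrix.of fun i l : Fin (k + 1) => F i.succ l - F 0 l).submatrix j.succAbove
          (Fin.last k).succAbove =
          Matrix.of fun i l : Fin k => F (j.succ.succAbove i.succ) l.castSucc -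
            F (j.succ.succAbove 0) l.castSucc := by
        ext i l
        simp
      rw [h2]
      have h3 : (0 : Fin (k + 2)) ≠ j.succ := (Fin.succ_ne_zero j).symm
      simp only [Matrix.of_apply, hF, if_true, if_neg h3, Fin.val_last, Fin.val_succ]
      ring
    · intro i _ hi
      have h3 : (0 : Fin (k + 2)) ≠ j.succ := (Fin.succ_ne_zero j).symm
      simp [hF, h3, hi]
    · simp

section Vertices

variable {V : Type v} [Fintype V] [LinearOrder V]

theorem codim_erase {τ : Finset V} {v : V} (hv : v ∈ τ) (h : (τ.erase v).Nonempty) :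
    codim τ = codim (τ.erase v) + 1 := by
  have h1 := Finset.card_erase_of_mem hv
  have h2 := Finset.card_pos.2 h
  unfold codim
  omega

theorem vtx_erase {τ : Finset V} {v : V} (hv : v ∈ τ) (h : (τ.erase v).Nonempty)
    (hτ : τ.Nonempty) {j : Fin (codim (τ.erase v) + 2)} (hj : (j : ℕ) = position τ v)
    (i : Fin (codim (τ.erase v) + 1)) :
    vtx (τ.erase v) h i = vtx τ hτ (Fin.cast (by rw [codim_erase hv h]) (j.succAbove i)) := by
  have hc : codim (τ.erase v) + 2 = codim τ + 1 := by rw [codim_erase hv h]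
  have key := Finset.orderEmbOfFin_unique (s := τ.erase v) (card_eq_codim_add_one h)
    (f := fun i => vtx τ hτ (Fin.cast hc (j.succAbove i))) ?_ ?_
  · exact (congrFun key i).symm
  · intro i
    refine Finset.mem_erase.2 ⟨fun e => ?_, vtx_mem hτ _⟩
    have h1 := position_vtx hτ (Fin.cast hc (j.succAbove i))
    rw [e, ← hj] at h1
    exact Fin.succAbove_ne j i (Fin.ext h1.symm)
  · intro i i' hii
    refine (vtx τ hτ).lt_iff_lt.2 ?_
    have := (Fin.strictMono_succAbove j) hii
    exact this

end Vertices

section Facets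

variable {n : ℕ} [NeZero n] {Q : Type u} [MetricSpace Q] [ChartedSpace (EuclideanHalfSpace n) Q]
  [IsManifold (𝓡∂ n) ∞ Q] {V : Type v} [Fintype V] [LinearOrder V]

/-- The orientation `o` or its opposite. -/
def CellOrientation.twist {S S' : Set Q} {m : ℕ} (e : ℤˣ) (o : CellOrientation n S S' m) :
    CellOrientation n S S' m := if e = 1 then o else -o

theorem CellOrientation.hasSign_twist {S S' : Set Q} {m : ℕ} (e : ℤˣ)
    (o : CellOrientation n S S' m) (q : S') (X : ℕ → TangentSpace (𝓡∂ n) q.1) (s : ℤˣ) :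
    HasSign ((o.twist e).at' q) X s ↔ HasSign (o.at' q) X (e * s) := by
  rcases Int.units_eq_one_or e with rfl | rfl
  · simp [twist]
  · rw [twist, if_neg (by decide), CellOrientation.neg_at, neg_one_mul]
    exact frameSign_neg_iff (o := o.at' q) (X := X)

variable {oQ : CellOrientation n (univ : Set Q) ((𝓡∂ n).interior Q) n}
  {P : SmoothTriangulation n Q V} {D : V → Set Q} {σ τ κ : Finset V} {O : Set Q} {f : V → Q → ℝ}

theorem HModel.surjective_of_subset (h : HModel n D κ O f) (hσ : σ.Nonempty) (hs : σ ⊆ κ) {q : Q}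
    (hq : q ∈ O) : Function.Surjective (der n (modelY f σ hσ) q) := by
  intro z
  obtain ⟨w, hw⟩ := h.surj q hq (homog σ z)
  refine ⟨w, funext fun i => ?_⟩
  rw [_root_.der_modelY hσ (fun v hv => h.mdifferentiableAt hq (hs hv)),
    hw _ (hs (vtx_mem hσ 0)) _ (hs (vtx_mem hσ i.succ)), homog_vtx, homog_vtx]
  simp

theorem HModel.tangentAt_eq_of_stratum (h : HModel n D κ O f) (hσ : σ.Nonempty) {p : Q}
    (hp : p ∈ O) (hps : p ∈ openCell n D σ) :
    tangentAt n (dualCell D σ) p = LinearMap.ker (der n (modelY f σ hσ) p).toLinearMap := by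
  obtain ⟨O', -, hpO', h'⟩ := h.restrict hσ hp hps.1
  exact h'.tangentAt_eq hσ hpO' (stratum_subset_dualCell hps.1) hps.2

theorem DualOriented.cooriented {hσ : σ.Nonempty} {o : DualCellOrientation n D σ}
    (ho : DualOriented oQ hσ o) (h : HModel n D κ O f) (q : openCell n D σ) (hq : q.1 ∈ O)
    {Ω : TangentSpace (𝓡∂ n) q.1 [⋀^Fin n]→ₗ[ℝ] ℝ} (hΩ : Represents (oQ.at' ⟨q.1, q.2.2⟩) Ω) :
    Cooriented (der n (modelY f σ hσ) q.1).toLinearMap Ω (o.at' q) := by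
  obtain ⟨O', -, hpO', h'⟩ := h.restrict hσ hq q.2.1
  exact ho q O' f h' hpO' Ω hΩ

theorem mem_ker_der_modelY_iff (hσ : σ.Nonempty) {q : Q}
    (hf : ∀ v ∈ σ, MDifferentiableAt (𝓡∂ n) 𝓘(ℝ, ℝ) (f v) q) (w : TangentSpace (𝓡∂ n) q) :
    der n (modelY f σ hσ) q w = 0 ↔ ∀ u ∈ σ, ∀ v ∈ σ, der n (f u) q w = der n (f v) q w := by
  constructor
  · intro h
    have h2 : ∀ v ∈ σ, der n (f v) q w = der n (f (vtx σ hσ 0)) q w := by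
      intro v hv
      obtain ⟨i, rfl⟩ := exists_vtx hσ hv
      refine Fin.cases rfl (fun j => ?_) i
      exact sub_eq_zero.1 ((der_modelY hσ hf w j).symm.trans (congrFun h j))
    intro u hu v hv
    rw [h2 v hv, h2 u hu]
  · intro h
    funext i
    rw [der_modelY hσ hf, h _ (vtx_mem hσ i.succ) _ (vtx_mem hσ 0), sub_self]
    rfl

/-- The determinant of a normal frame of a facet, in terms of one of the cell. -/
theorem frameMatrix_det_facet {v : V} (hv : v ∈ τ) (h : (τ.erase v).Nonempty) (hτ : τ.Nonempty)
    {q : Q} (hf : ∀ v ∈ τ, MDifferentiableAt (𝓡∂ n) 𝓘(ℝ, ℝ) (f v) q)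
    (a Y : ℕ → TangentSpace (𝓡∂ n) q) {c : ℝ}
    (hY : ∀ u ∈ τ.erase v, der n (f v) q (Y 0) - der n (f u) q (Y 0) = c) :
    (frameMatrix (der n (modelY f τ hτ) q).toLinearMap (catFrame (codim (τ.erase v)) a Y)).det =
      (-1) ^ (position τ v + codim (τ.erase v) + 1) * c *
        (frameMatrix (der n (modelY f (τ.erase v) h) q).toLinearMap a).det := by
  set k := codim (τ.erase v) with hk
  have hc : k + 1 = codim τ := (codim_erase hv h).symm
  have hc2 : k + 2 = codim τ + 1 := by omega
  have hpos : position τ v < k + 2 := by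
    have := position_lt_card hv
    have h2 := card_eq_codim_add_one hτ
    omega
  set j : Fin (k + 2) := ⟨position τ v, hpos⟩ with hj
  set F : Fin (k + 2) → Fin (k + 1) → ℝ := fun i l =>
    der n (f (vtx τ hτ (Fin.cast hc2 i))) q (catFrame k a Y l) with hF
  have hlast : catFrame k a Y (Fin.last k : ℕ) = Y 0 := by simp [catFrame]
  have hcast : ∀ l : Fin k, catFrame k a Y (l.castSucc : ℕ) = a l := fun l => by
    simp [catFrame]
  obtain ⟨u₀, hu₀⟩ := h
  have hvj : vtx τ hτ (Fin.cast hc2 j) = v := vtx_eq_of_position hτ hv rfl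
  -- The last vector `Y 0` raises all functions at the same rate, except the one at `v`, which it
  -- raises faster by `c`.
  have hd : ∀ i, F i (Fin.last k) = der n (f u₀) q (Y 0) + if i = j then c else 0 := by
    intro i
    simp only [hF, hlast]
    split_ifs with hij
    · subst hij
      rw [hvj]
      have := hY u₀ hu₀
      linarith
    · have hne : vtx τ hτ (Fin.cast hc2 i) ≠ v := by
        rw [← hvj]
        intro e
        have := (vtx τ hτ).injective e
        exact hij (Fin.ext (by simpa using congrArg Fin.val this))
      have h1 := hY _ (Finset.mem_erase.2 ⟨hne, vtx_mem hτ (Fin.cast hc2 i)⟩)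
      have h2 := hY u₀ hu₀
      linarith
  have h1 := det_sub_row_zero F j hd
  rw [← Matrix.det_submatrix_equiv_self (finCongr hc)]
  refine Eq.trans (congrArg Matrix.det ?_) (h1.trans ?_)
  · ext i l
    simp only [frameMatrix, Matrix.submatrix_apply, Matrix.of_apply, finCongr_apply]
    refine (der_modelY hτ hf _ _).trans ?_
    rfl
  · congr 2
    ext i l
    simp only [frameMatrix, Matrix.of_apply, hF, hcast]
    refine Eq.symm ((der_modelY _ (fun v hv => hf v (Finset.mem_of_mem_erase hv)) _ _).trans ?_)
    rw [vtx_erase hv ⟨u₀, hu₀⟩ hτ (j := j) rfl, vtx_erase hv ⟨u₀, hu₀⟩ hτ (j := j) rfl]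

/-- Near a point of `Q`, the sign of a frame which is completed by a normal frame is the sign of a
continuous function. -/
theorem exists_sign_function (oQ : CellOrientation n (univ : Set Q) ((𝓡∂ n).interior Q) n)
    {k m : ℕ} (hkm : k + m = n) {q : Q} (hq : q ∈ (𝓡∂ n).interior Q) (hO : IsOpen O) (hqO : q ∈ O)
    {y : Q → Fin k → ℝ} (hy : ContMDiffOn (𝓡∂ n) 𝓘(ℝ, Fin k → ℝ) ∞ y O)
    {a : ℕ → TangentSpace (𝓡∂ n) q} (ha : (frameMatrix (der n y q).toLinearMap a).det ≠ 0)
    {U S : Set Q} (hU : U ∈ 𝓝 q) (hqS : q ∈ S) {Y : ℕ → ∀ q : Q, TangentSpace (𝓡∂ n) q}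
    (hY : ∀ i < m, ContVF (Y i) (U ∩ S)) :
    ∃ G : Q → ℝ, ContinuousWithinAt G S q ∧
      (∃ Ω, Represents (oQ.at' ⟨q, hq⟩) Ω ∧ G q = (frameMatrix (der n y q).toLinearMap a).det *
        Ω fun i => catFrame k a (fun i => Y i q) i) ∧
      ∀ᶠ q' in 𝓝 q, ∀ hq' : q' ∈ (𝓡∂ n).interior Q, ∃ Ω a', Represents (oQ.at' ⟨q', hq'⟩) Ω ∧
        (frameMatrix (der n y q').toLinearMap a').det ≠ 0 ∧
        G q' = (frameMatrix (der n y q').toLinearMap a').det *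
          Ω fun i => catFrame k a' (fun i => Y i q') i := by
  obtain ⟨c, -, hrep⟩ := exists_represents oQ hq
  set N := O ∩ (chartAt (EuclideanHalfSpace n) q).source with hN
  have hNo : IsOpen N := hO.inter (chartAt _ q).open_source
  have hqN : q ∈ N := ⟨hqO, mem_chart_source _ q⟩
  refine ⟨fun q' => (frameMatrix (der n y q').toLinearMap fun i => constVF q (a i) q').det *
    (c • volForm n q q') fun i => catFrame k (fun i => constVF q (a i) q') (fun i => Y i q') i,
    ?_, ⟨_, hrep.self_of_nhds hq, ?_⟩, ?_⟩
  · have h1 : ContinuousOn (fun q' => (frameMatrix (der n y q').toLinearMap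
        fun i => constVF q (a i) q').det) N :=
      frameMatrix_det_continuousOn hO hy inter_subset_left (a := fun i => constVF q (a i))
        fun i _ => (contVF_constVF q (a i)).mono inter_subset_right
    have h2 : ContinuousOn (fun q' => volForm n q q' fun i =>
        catFrame k (fun i => constVF q (a i) q') (fun i => Y i q') i) (U ∩ S ∩ N) := by
      refine volForm_continuousOn q (fun x hx => hx.2.2)
        (Y := fun i q' => catFrame k (fun i => constVF q (a i) q') (fun i => Y i q') i) ?_
      exact contVF_catFrame hkm (fun i _ => (contVF_constVF q (a i)).mono fun x hx => hx.2.2)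
        fun i hi => (hY i hi).mono fun x hx => hx.1
    have h3 := (h1.mono (fun x hx => hx.2 : U ∩ S ∩ N ⊆ N)).mul
      ((continuousOn_const (c := c)).mul h2)
    have h4 := h3 q ⟨⟨mem_of_mem_nhds hU, hqS⟩, hqN⟩
    refine h4.mono_of_mem_nhdsWithin ?_
    refine inter_mem (inter_mem (mem_nhdsWithin_of_mem_nhds hU) self_mem_nhdsWithin)
      (mem_nhdsWithin_of_mem_nhds (hNo.mem_nhds hqN))
  · simp only [constVF_self]
  · set d := (frameMatrix (der n y q).toLinearMap a).det with hd
    have hev := eventually_frameMatrix_det_pos hO hy hqO (a := a) (c := d) (mul_self_pos.2 ha)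
    filter_upwards [hrep, hev] with q' h1 h2 hq'
    exact ⟨_, _, h1 hq', right_ne_zero_of_mul h2.ne', rfl⟩

/-- The sign which relates the orientation of a cell, restricted to a facet, and that of the
facet. -/
def facetSign (τ : Finset V) (v : V) : ℤˣ := (-1) ^ (position τ v + codim (τ.erase v) + 1)

theorem facetSign_cast (τ : Finset V) (v : V) :
    ((facetSign τ v : ℤ) : ℝ) = (-1) ^ (position τ v + codim (τ.erase v) + 1) := by
  simp [facetSign]

theorem facetSign_sq (e : ℤˣ) : e * e = 1 := by
  rcases Int.units_eq_one_or e with rfl | rfl <;> rfl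

theorem catFrame_catFrame_succ {T : Type*} (k : ℕ) (a Y : ℕ → T) :
    catFrame (k + 1) (catFrame k a Y) (fun i => Y (i + 1)) = catFrame k a Y := by
  funext i
  simp only [catFrame]
  split_ifs with h1 h2 h2
  · rfl
  · rfl
  · omega
  · congr 1
    omega

/-- A normal frame of the cell followed by the outward vector `Y 0` is a normal frame of the facet.
The full frame `(a, Y 0, Y 1, …)` is the same from both points of view, so only the determinants of
the two normal frames differ, by `facetSign` times a positive number. -/
theorem cooriented_facet_iff {v : V} (hv : v ∈ τ) (h : (τ.erase v).Nonempty) (hτ : τ.Nonempty)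
    {q : Q} (hf : ∀ v ∈ τ, MDifferentiableAt (𝓡∂ n) 𝓘(ℝ, ℝ) (f v) q)
    {a Y : ℕ → TangentSpace (𝓡∂ n) q} {c : ℝ} (hc : 0 < c)
    (hY : ∀ u ∈ τ.erase v, der n (f v) q (Y 0) - der n (f u) q (Y 0) = c) {m : ℕ}
    {K : Submodule ℝ (TangentSpace (𝓡∂ n) q)} {o : Orientation ℝ K (Fin m)}
    {Ω : TangentSpace (𝓡∂ n) q [⋀^Fin n]→ₗ[ℝ] ℝ}
    (ha : (frameMatrix (der n (modelY f (τ.erase v) h) q).toLinearMap a).det ≠ 0)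
    (ho : Cooriented (der n (modelY f τ hτ) q).toLinearMap Ω o) (s : ℤˣ) :
    FrameSign o (fun i => Y (i + 1)) s ↔ (∀ i < m, Y (i + 1) ∈ K) ∧
      0 < ((facetSign τ v * s : ℤˣ) : ℤ) *
        ((frameMatrix (der n (modelY f (τ.erase v) h) q).toLinearMap a).det *
          Ω fun i => catFrame (codim (τ.erase v)) a Y i) := by
  have hdet := frameMatrix_det_facet hv h hτ hf a Y hY
  rw [ho (fun i => Y (i + 1)) s (catFrame (codim (τ.erase v)) a Y)]
  · refine and_congr_right fun _ => ?_
    rw [hdet, ← facetSign_cast, codim_erase hv h, catFrame_catFrame_succ]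
    push_cast
    have : ((s : ℤ) : ℝ) * (((facetSign τ v : ℤ) : ℝ) * c *
        (frameMatrix (der n (modelY f (τ.erase v) h) q).toLinearMap a).det *
          Ω fun i => catFrame (codim (τ.erase v)) a Y i) = c * (((facetSign τ v : ℤ) : ℝ) *
        ((s : ℤ) : ℝ) * ((frameMatrix (der n (modelY f (τ.erase v) h) q).toLinearMap a).det *
          Ω fun i => catFrame (codim (τ.erase v)) a Y i)) := by ring
    rw [this, mul_pos_iff_of_pos_left hc]
  · rw [hdet]
    exact mul_ne_zero (mul_ne_zero (pow_ne_zero _ (by norm_num)) hc.ne') ha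

end Facets

end

/-! ### The cellular boundary operator is dual to the simplicial coboundary. -/

noncomputable section

section Facets

variable {n : ℕ} [NeZero n] {Q : Type u} [MetricSpace Q] [ChartedSpace (EuclideanHalfSpace n) Q]
  [IsManifold (𝓡∂ n) ∞ Q] {V : Type v} [Fintype V] [LinearOrder V]
  {oQ : CellOrientation n (univ : Set Q) ((𝓡∂ n).interior Q) n}
  {P : SmoothTriangulation n Q V} {D : V → Set Q} {σ τ κ : Finset V} {O : Set Q} {f : V → Q → ℝ}

/-- A curve which starts at a point of a facet and points into the cell. -/
theorem HModel.exists_curve_facet (h : HModel n D τ O f) {v : V} (hv : v ∈ τ)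
    (hσ : (τ.erase v).Nonempty) {q : Q} (hq : q ∈ openCell n D τ) (hqO : q ∈ O) {c : ℝ} (hc : 0 < c)
    {w : TangentSpace (𝓡∂ n) q}
    (hw : ∀ u ∈ τ.erase v, der n (f v) q w - der n (f u) q w = -c) :
    ∃ γ : ℝ → Q, γ 0 = q ∧ Tendsto γ (𝓝 0) (𝓝 q) ∧
      (∀ᶠ t in 𝓝[>] (0 : ℝ), γ t ∈ openCell n D (τ.erase v)) ∧
      ∀ g : Q → ℝ, MDifferentiableAt (𝓡∂ n) 𝓘(ℝ, ℝ) g q → HasDerivAt (g ∘ γ) (der n g q w) 0 := by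
  obtain ⟨γ, h0, ht, hγ, hd⟩ := h.exists_curve ⟨v, hv⟩ hqO (stratum_subset_dualCell hq.1) hq.2 w
  refine ⟨γ, h0, ht, ?_, hd⟩
  filter_upwards [nhdsWithin_le_nhds hγ, self_mem_nhdsWithin,
    nhdsWithin_le_nhds (ht.eventually (isOpen_interior_manifold.mem_nhds hq.2))] with t h1 h2 h3
  have h2' : (0 : ℝ) < t := h2
  refine ⟨fun x => ?_, h3⟩
  rw [h.model _ h1.1]
  have hvu : ∀ u ∈ τ.erase v, f v (γ t) < f u (γ t) := by
    intro u hu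
    have h4 := h1.2 u (Finset.mem_of_mem_erase hu) v hv
    rw [hw u hu] at h4
    nlinarith
  constructor
  · rintro ⟨hx, hmax⟩
    refine Finset.mem_erase.2 ⟨?_, hx⟩
    rintro rfl
    obtain ⟨u, hu⟩ := hσ
    exact (hmax u (Finset.mem_of_mem_erase hu)).not_gt (hvu u hu)
  · intro hx
    refine ⟨Finset.mem_of_mem_erase hx, fun u hu => ?_⟩
    by_cases huv : u = v
    · subst huv
      exact (hvu x hx).le
    · have hu' : u ∈ τ.erase v := Finset.mem_erase.2 ⟨huv, hu⟩
      have h4 := h1.2 u hu x (Finset.mem_of_mem_erase hx)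
      have h5 := hw u hu'
      have h6 := hw x hx
      have : der n (f x) q w - der n (f u) q w = 0 := by linarith
      rw [this, mul_zero] at h4
      linarith

theorem HModel.exists_inward (h : HModel n D τ O f) {v : V} (hv : v ∈ τ) {q : Q} (hqO : q ∈ O)
    (c : ℝ) : ∃ w : TangentSpace (𝓡∂ n) q,
      ∀ u ∈ τ.erase v, der n (f v) q w - der n (f u) q w = c := by
  classical
  obtain ⟨w, hw⟩ := h.surj q hqO fun x => if x = v then c else 0
  refine ⟨w, fun u hu => ?_⟩
  rw [hw u (Finset.mem_of_mem_erase hu) v hv, if_pos rfl, if_neg (Finset.ne_of_mem_erase hu),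
    sub_zero]

theorem HModel.mem_closure (h : HModel n D τ O f) {v : V} (hv : v ∈ τ)
    (hσ : (τ.erase v).Nonempty) {q : Q} (hq : q ∈ openCell n D τ) (hqO : q ∈ O) :
    q ∈ closure (openCell n D (τ.erase v)) := by
  obtain ⟨w, hw⟩ := h.exists_inward hv hqO (-1)
  obtain ⟨γ, -, ht, hγ, -⟩ := h.exists_curve_facet hv hσ hq hqO one_pos hw
  exact mem_closure_of_tendsto (ht.mono_left nhdsWithin_le_nhds) hγ

/-- The frame `Y` lives on the open cell and on one point of the facet, so the comparison is made in
the limit. The vector `Y 0` is tangent to the cell in the limit, and being outward and not tangent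
to the facet it raises `f v` strictly. The sign of the frame is then carried to the facet by
continuity. -/
theorem InducesOnFacet.eq_twist (hD : IsRegularSubdivision P D) (hτ : τ ∈ P.complex.faces) {v : V}
    (hv : v ∈ τ) (hσ : (τ.erase v).Nonempty) {o : DualCellOrientation n D (τ.erase v)}
    (ho : DualOriented oQ hσ o) {oτ : DualCellOrientation n D τ}
    (hoτ : DualOriented oQ (P.nonempty_of_mem hτ) oτ) {o' : DualCellOrientation n D τ}
    (hind : InducesOnFacet o o') : o' = oτ.twist (facetSign τ v) := by
  have hτne := P.nonempty_of_mem hτ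
  refine CellOrientation.ext' fun q => ?_
  obtain ⟨s, U, hU, Y, hYc, hYs, hYout, hYnot, hY'⟩ := hind q
  obtain ⟨O, f, hqO, hf⟩ := hD.model τ hτ q q.2
  have hsub : τ.erase v ⊆ τ := Finset.erase_subset v τ
  have hfd : ∀ x ∈ τ, MDifferentiableAt (𝓡∂ n) 𝓘(ℝ, ℝ) (f x) q := fun x hx =>
    hf.mdifferentiableAt hqO hx
  have hcod := codim_erase hv hσ
  have hle := hD.codim_le hτ
  have hkm : codim (τ.erase v) + (n - codim (τ.erase v)) = n := by omega
  have hysm := contMDiffOn_modelY hσ fun x hx => hf.smooth x (hsub hx)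
  have hqcl := hf.mem_closure hv hσ q.2 hqO
  have hker : ∀ q' : openCell n D (τ.erase v), q'.1 ∈ O → tangentAt n (dualCell D (τ.erase v)) q' =
      LinearMap.ker (der n (modelY f (τ.erase v) hσ) q').toLinearMap := fun q' hq' =>
    hf.tangentAt_eq_of_stratum hσ hq' q'.2
  have hcl : (𝓝[openCell n D (τ.erase v)] q.1).NeBot := mem_closure_iff_nhdsWithin_neBot.1 hqcl
  -- the vector `Y 0` is tangent to the cell
  have hY0 : der n (modelY f (τ.erase v) hσ) q (Y 0 q) = 0 := by
    have h1 : ContinuousOn (fun q' => der n (modelY f (τ.erase v) hσ) q' (Y 0 q'))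
        (U ∩ insert q.1 (openCell n D (τ.erase v)) ∩ O) :=
      ContVF.der hf.isOpen hysm inter_subset_right
        (ContVF.mono (hYc 0 (by omega)) inter_subset_left)
    have h2 := h1 q ⟨⟨mem_of_mem_nhds hU, mem_insert _ _⟩, hqO⟩
    have h3 : Tendsto (fun q' => der n (modelY f (τ.erase v) hσ) q' (Y 0 q'))
        (𝓝[openCell n D (τ.erase v)] q.1) (𝓝 (der n (modelY f (τ.erase v) hσ) q (Y 0 q))) := by
      refine (h2.mono_of_mem_nhdsWithin ?_ : ContinuousWithinAt _ (openCell n D (τ.erase v)) _)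
      refine inter_mem (inter_mem (mem_nhdsWithin_of_mem_nhds hU) ?_)
        (mem_nhdsWithin_of_mem_nhds (hf.isOpen.mem_nhds hqO))
      exact mem_of_superset self_mem_nhdsWithin (subset_insert _ _)
    refine tendsto_nhds_unique_of_eventuallyEq h3 tendsto_const_nhds ?_
    filter_upwards [self_mem_nhdsWithin, mem_nhdsWithin_of_mem_nhds hU,
      mem_nhdsWithin_of_mem_nhds (hf.isOpen.mem_nhds hqO)] with q' h4 h5 h6
    have h7 := (hYs ⟨q', h4⟩ h5).mem (i := 0) (by omega)
    rw [hker ⟨q', h4⟩ h6] at h7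
    exact h7
  have hY0' := (mem_ker_der_modelY_iff hσ (fun x hx => hfd x (hsub hx)) _).1 hY0
  -- the vector `Y 0` is transverse to the facet
  obtain ⟨u₀, hu₀⟩ := id hσ
  set c := der n (f v) q (Y 0 q) - der n (f u₀) q (Y 0 q) with hc
  have hcu : ∀ u ∈ τ.erase v, der n (f v) q (Y 0 q) - der n (f u) q (Y 0 q) = c := by
    intro u hu
    rw [hc, hY0' u hu u₀ hu₀]
  have hc0 : 0 ≤ c := by
    have h1 := hYout (fun q' => f u₀ q' - f v q')
      ((hf.contMDiffAt hqO (hsub hu₀)).sub (hf.contMDiffAt hqO hv)) ?_ ?_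
    · have h2 := congrArg (fun L => L (Y 0 q)) (der_sub (hfd u₀ (hsub hu₀)) (hfd v hv))
      have h3 : der n (fun q' => f u₀ q' - f v q') q (Y 0 q) ≤ 0 := h1
      rw [show der n (fun q' => f u₀ q' - f v q') q (Y 0 q) =
        der n (f u₀) q (Y 0 q) - der n (f v) q (Y 0 q) from h2] at h3
      linarith
    · filter_upwards [self_mem_nhdsWithin, mem_nhdsWithin_of_mem_nhds (hf.isOpen.mem_nhds hqO)]
        with q' h2 h3
      simp only [dualCell, mem_iInter] at h2
      exact sub_nonneg.2 (((hf.model q' h3 u₀).1 (h2 u₀ hu₀)).2 v hv)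
    · have h2 := stratum_subset_dualCell q.2.1
      simp only [dualCell, mem_iInter] at h2
      exact sub_eq_zero.2 (le_antisymm (((hf.model q hqO v).1 (h2 v hv)).2 u₀ (hsub hu₀))
        (((hf.model q hqO u₀).1 (h2 u₀ (hsub hu₀))).2 v hv))
  have hkerτ := hf.tangentAt_eq_of_stratum hτne hqO q.2
  have hcpos : 0 < c := by
    refine lt_of_le_of_ne hc0 fun h0 => hYnot ?_
    rw [hkerτ, LinearMap.mem_ker]
    refine (mem_ker_der_modelY_iff hτne hfd _).2 ?_
    have h1 : ∀ u ∈ τ, der n (f u) q (Y 0 q) = der n (f v) q (Y 0 q) := by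
      intro u hu
      by_cases huv : u = v
      · rw [huv]
      · have := hcu u (Finset.mem_erase.2 ⟨huv, hu⟩)
        linarith
    intro u hu x hx
    rw [h1 u hu, h1 x hx]
  obtain ⟨a, ha⟩ := exists_dual_frame
    (A := (der n (modelY f (τ.erase v) hσ) q).toLinearMap) (hf.surjective_of_subset hσ hsub hqO)
  have had : (frameMatrix (der n (modelY f (τ.erase v) hσ) q).toLinearMap a).det ≠ 0 := by
    rw [frameMatrix_eq_one ha]
    simp
  obtain ⟨G, hGc, ⟨Ω, hΩ, hGq⟩, hG⟩ := exists_sign_function oQ hkm q.2.2 hf.isOpen hqO hysm had hU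
    (mem_insert q.1 (openCell n D (τ.erase v))) hYc
  have hΩ0 : Ω ≠ 0 := by
    obtain ⟨Ω', hΩ', hr⟩ := exists_represents_at oQ q.2.2
    rintro rfl
    obtain ⟨t, s', hts⟩ := exists_hasSign (p := q.1) (T := tangentAt n univ q.1) (m := n)
      (by rw [tangentAt_univ, finrank_top, finrank_tangentSpace]) (oQ.at' ⟨q, q.2.2⟩)
    have := (hΩ t s').1 hts
    simp at this
  -- At points of the open cell this function is positive; in the limit only the weak inequality
  -- remains.
  have hge : 0 ≤ ((s : ℤ) : ℝ) * G q := by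
    have h1 : Tendsto (fun q' => ((s : ℤ) : ℝ) * G q') (𝓝[openCell n D (τ.erase v)] q.1)
        (𝓝 (((s : ℤ) : ℝ) * G q)) := (hGc.mono (subset_insert _ _)).tendsto.const_mul _
    refine ge_of_tendsto h1 ?_
    filter_upwards [self_mem_nhdsWithin, mem_nhdsWithin_of_mem_nhds hU,
      mem_nhdsWithin_of_mem_nhds (hf.isOpen.mem_nhds hqO), nhdsWithin_le_nhds hG] with q' h4 h5 h6 h7
    obtain ⟨Ω', a', hr, had', hGq'⟩ := h7 h4.2
    rw [hGq']
    exact ((ho.cooriented hf ⟨q', h4⟩ h6 hr (fun i => Y i q') s a' had').1 (hYs ⟨q', h4⟩ h5)).2.le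
  have hdetτ := frameMatrix_det_facet hv hσ hτne hfd a (fun i => Y i q) hcu
  -- The frame does not degenerate at the facet, since `a` and `Y 0` form a normal frame of the
  -- facet and the remaining vectors are a basis of its tangent space.
  have hne : G q ≠ 0 := by
    rw [hGq]
    refine mul_ne_zero had ?_
    obtain ⟨b, hb, -⟩ := hY'
    have h1 := form_catFrame_ne_zero (k := codim τ) (m := n - codim τ) (n := n) (by omega)
      (A := (der n (modelY f τ hτne) q).toLinearMap) (hf.surjective hτne hqO) hΩ0
      (a := catFrame (codim (τ.erase v)) a (fun i => Y i q)) (t := fun i => Y (i + 1) q) ?_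
      hkerτ.symm b hb
    · rw [hcod] at h1
      rwa [catFrame_catFrame_succ] at h1
    · rw [hdetτ]
      exact mul_ne_zero (mul_ne_zero (pow_ne_zero _ (by norm_num)) hcpos.ne') had
  have hpos : 0 < ((s : ℤ) : ℝ) * G q := by
    refine lt_of_le_of_ne hge (Ne.symm (mul_ne_zero ?_ hne))
    rcases Int.units_eq_one_or s with rfl | rfl <;> simp
  refine hY'.orientation_eq ?_
  rw [CellOrientation.hasSign_twist]
  refine (cooriented_facet_iff hv hσ hτne hfd (Y := fun i => Y i q) hcpos hcu had
    (hoτ.cooriented hf q hqO hΩ) _).2 ⟨fun i hi => hY'.mem hi, ?_⟩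
  rw [← mul_assoc (facetSign τ v), facetSign_sq, one_mul, ← hGq]
  exact hpos

theorem inducesOnFacet_twist (hD : IsRegularSubdivision P D) (hτ : τ ∈ P.complex.faces) {v : V}
    (hv : v ∈ τ) (hσ : (τ.erase v).Nonempty) {o : DualCellOrientation n D (τ.erase v)}
    (ho : DualOriented oQ hσ o) {oτ : DualCellOrientation n D τ}
    (hoτ : DualOriented oQ (P.nonempty_of_mem hτ) oτ) :
    InducesOnFacet o (oτ.twist (facetSign τ v)) := by
  have hτne := P.nonempty_of_mem hτ
  intro q
  obtain ⟨O, f, hqO, hf⟩ := hD.model τ hτ q q.2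
  have hsub : τ.erase v ⊆ τ := Finset.erase_subset v τ
  have hfd : ∀ x ∈ τ, MDifferentiableAt (𝓡∂ n) 𝓘(ℝ, ℝ) (f x) q := fun x hx =>
    hf.mdifferentiableAt hqO hx
  have hcod := codim_erase hv hσ
  have hle := hD.codim_le hτ
  have hkm : codim (τ.erase v) + (n - codim (τ.erase v)) = n := by omega
  have hysm := contMDiffOn_modelY hσ fun x hx => hf.smooth x (hsub hx)
  have hker : ∀ q' : openCell n D (τ.erase v), q'.1 ∈ O → tangentAt n (dualCell D (τ.erase v)) q' =
      LinearMap.ker (der n (modelY f (τ.erase v) hσ) q').toLinearMap := fun q' hq' =>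
    hf.tangentAt_eq_of_stratum hσ hq' q'.2
  have hkerτ := hf.tangentAt_eq_of_stratum hτne hqO q.2
  obtain ⟨w, hw⟩ := hf.exists_inward hv hqO 1
  obtain ⟨t, s, hts⟩ := exists_hasSign (hD.finrank hτ q.2) (oτ.at' q)
  -- An outward vector followed by a frame of the facet. These are tangent to the cell, and are
  -- extended to fields tangent to the cell.
  set Z : ℕ → TangentSpace (𝓡∂ n) q.1 := fun i => if i = 0 then w else t (i - 1) with hZ
  have hZ0 : Z 0 = w := by simp [hZ]
  have hZs : (fun i => Z (i + 1)) = t := by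
    funext i
    simp [hZ]
  have hZker : ∀ i < n - codim (τ.erase v), der n (modelY f (τ.erase v) hσ) q (Z i) = 0 := by
    intro i hi
    rw [mem_ker_der_modelY_iff hσ fun x hx => hfd x (hsub hx)]
    rcases Nat.eq_zero_or_pos i with rfl | hi0
    · intro u hu x hx
      rw [hZ0]
      have h1 := hw u hu
      have h2 := hw x hx
      linarith
    · have h1 : t (i - 1) ∈ tangentAt n (dualCell D τ) q.1 := hts.mem (by omega)
      rw [hkerτ, LinearMap.mem_ker] at h1
      have h2 := (mem_ker_der_modelY_iff hτne hfd _).1 h1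
      intro u hu x hx
      have h3 : Z i = t (i - 1) := if_neg (by omega)
      rw [h3]
      exact h2 u (hsub hu) x (hsub hx)
  obtain ⟨N, Y, hN, hqN, hYc, hYq, hYk⟩ := exists_kernel_fields hf.isOpen hysm hqO
    (hf.surjective_of_subset hσ hsub hqO) Z
  have hYZ : ∀ i < n - codim (τ.erase v), Y i q = Z i := fun i hi => hYq i (hZker i hi)
  have hY0 : Y 0 q = w := (hYZ 0 (by omega)).trans hZ0
  obtain ⟨a, ha⟩ := exists_dual_frame
    (A := (der n (modelY f (τ.erase v) hσ) q).toLinearMap) (hf.surjective_of_subset hσ hsub hqO)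
  have had : (frameMatrix (der n (modelY f (τ.erase v) hσ) q).toLinearMap a).det ≠ 0 := by
    rw [frameMatrix_eq_one ha]
    simp
  obtain ⟨G, hGc, ⟨Ω, hΩ, hGq⟩, hG⟩ := exists_sign_function oQ hkm q.2.2 hf.isOpen hqO hysm had
    (hN.mem_nhds hqN) (mem_univ q.1) (Y := Y) fun i _ => (hYc i).mono inter_subset_left
  have hYs : HasSign (oτ.at' q) (fun i => Y (i + 1) q) s := by
    obtain ⟨b, hb, hbo⟩ := hts
    refine ⟨b, fun i => (hb i).trans ?_, hbo⟩
    beta_reduce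
    rw [hYZ (i + 1) (by have := i.2; omega)]
    exact (congrFun hZs i).symm
  have hpos := ((cooriented_facet_iff hv hσ hτne hfd (Y := fun i => Y i q) one_pos
    (by rw [hY0]; exact hw) had (hoτ.cooriented hf q hqO hΩ) s).1 hYs).2
  rw [← hGq] at hpos
  set s' := facetSign τ v * s with hs'
  have hev : ∀ᶠ q' in 𝓝 q.1, 0 < ((s' : ℤ) : ℝ) * G q' := by
    have h1 : Tendsto (fun q' => ((s' : ℤ) : ℝ) * G q') (𝓝 q.1) (𝓝 (((s' : ℤ) : ℝ) * G q)) := by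
      have h2 := hGc.tendsto
      rw [nhdsWithin_univ] at h2
      exact h2.const_mul _
    exact h1.eventually (lt_mem_nhds hpos)
  refine ⟨s', N ∩ {q' | ∀ h : q' ∈ openCell n D (τ.erase v),
    HasSign (o.at' ⟨q', h⟩) (fun i => Y i q') s'}, ?_, Y, fun i _ => ?_, ?_, ?_, ?_, ?_⟩
  · refine inter_mem (hN.mem_nhds hqN) ?_
    filter_upwards [hev, hG, hf.isOpen.mem_nhds hqO, hN.mem_nhds hqN] with q' h1 h2 h3 h4 h5
    obtain ⟨Ω', a', hr, had', hGq'⟩ := h2 h5.2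
    rw [hGq'] at h1
    refine (ho.cooriented hf ⟨q', h5⟩ h3 hr (fun i => Y i q') s' a' had').2 ⟨fun i _ => ?_, h1⟩
    rw [hker ⟨q', h5⟩ h3]
    exact hYk q' h4 i
  · exact (hYc i).mono fun x hx => hx.1.1
  · exact fun q' hq' => hq'.2 q'.2
  -- A curve with velocity `-w` enters the cell, where `g` is non-negative, so the derivative of `g`
  -- along `-w` is non-negative.
  · intro g hg hg0 hgq
    have hw' : ∀ u ∈ τ.erase v, der n (f v) q (-w) - der n (f u) q (-w) = -1 := by
      intro u hu
      rw [map_neg, map_neg]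
      have := hw u hu
      linarith
    obtain ⟨γ, h0, ht, hγ, hd⟩ := hf.exists_curve_facet hv hσ q.2 hqO one_pos hw'
    have h1 := (hd g (hg.mdifferentiableAt (by simp))).hasDerivWithinAt (s := Ioi 0)
    rw [hasDerivWithinAt_iff_tendsto_slope' (by simp)] at h1
    have h2 : 0 ≤ der n g q (-w) := by
      refine ge_of_tendsto h1 ?_
      have h3 : Tendsto γ (𝓝[>] 0) (𝓝[dualCell D (τ.erase v)] q.1) := by
        refine tendsto_nhdsWithin_iff.2 ⟨ht.mono_left nhdsWithin_le_nhds, ?_⟩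
        filter_upwards [hγ] with x hx using stratum_subset_dualCell hx.1
      filter_upwards [h3.eventually hg0, self_mem_nhdsWithin] with x hx hx0
      have hx0' : (0 : ℝ) < x := hx0
      rw [slope_def_field]
      simp only [Function.comp_apply, h0, hgq, sub_zero]
      exact div_nonneg hx hx0'.le
    rw [map_neg] at h2
    have h3 : der n g q (Y 0 q) ≤ 0 := by
      rw [hY0]
      linarith
    exact h3
  · rw [hY0, hkerτ, LinearMap.mem_ker]
    intro h0
    have h1 := (mem_ker_der_modelY_iff hτne hfd _).1 h0
    obtain ⟨u, hu⟩ := hσ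
    have h2 := hw u hu
    have h3 := h1 v hv u (hsub hu)
    linarith
  · rw [CellOrientation.hasSign_twist, hs', ← mul_assoc, facetSign_sq, one_mul]
    exact hYs

theorem inducesOnFacet_neg_iff {o : DualCellOrientation n D σ} {o' : DualCellOrientation n D τ} :
    InducesOnFacet (-o) o' ↔ InducesOnFacet o (-o') :=
  ⟨fun h => by simpa using h.neg, fun h => by simpa using h.neg⟩

theorem CellOrientation.eq_twist_iff {S S' : Set Q} {m : ℕ} (o : CellOrientation n S S' m)
    (h : S'.Nonempty) (e : ℤˣ) : o = o.twist e ↔ e = 1 := by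
  rcases Int.units_eq_one_or e with rfl | rfl
  · simp [twist]
  · simp [twist, o.ne_neg h]

/-- With only two orientations, a relation which singles out one of them picks the coefficient of
`o` up to the corresponding sign. -/
theorem finsum_orientation {S S' : Set Q} {m : ℕ} {o : CellOrientation n S S' m}
    (hall : ∀ o', o' = o ∨ o' = -o) {R : CellOrientation n S S' m → Prop} {e : ℤˣ}
    (h1 : R o ↔ e = 1) (h2 : R (-o) ↔ e = -1) (g : OrientationLine n S S' m) :
    ∑ᶠ (o') (_ : R o'), g.1 o' = e * g.1 o := by
  rcases Int.units_eq_one_or e with rfl | rfl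
  · rw [finsum_mem_eq_of_unique (a := o), Units.val_one, one_mul]
    intro o'
    rcases hall o' with rfl | rfl
    · simpa using h1
    · have h3 : ¬ R (-o) := fun h => absurd (h2.1 h) (by decide)
      refine ⟨fun h => absurd h h3, fun h => ?_⟩
      rw [h]
      exact h1.2 rfl
  · rw [finsum_mem_eq_of_unique (a := -o), Units.val_neg, Units.val_one, neg_one_mul, g.2 o]
    intro o'
    rcases hall o' with rfl | rfl
    · have h3 : ¬ R o' := fun h => absurd (h1.1 h) (by decide)
      refine ⟨fun h => absurd h h3, fun h => ?_⟩
      rw [h]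
      exact h2.2 rfl
    · simpa using h2

theorem CellOrientation.neg_eq_twist_iff {S S' : Set Q} {m : ℕ} (o : CellOrientation n S S' m)
    (h : S'.Nonempty) (e : ℤˣ) : -o = o.twist e ↔ e = -1 := by
  rcases Int.units_eq_one_or e with rfl | rfl
  · simp only [twist, if_true]
    exact ⟨fun h' => absurd h'.symm (o.ne_neg h), fun h' => absurd h' (by decide)⟩
  · simp [twist]

theorem inducesOnFacet_iff (hD : IsRegularSubdivision P D) (hτ : τ ∈ P.complex.faces) {v : V}
    (hv : v ∈ τ) (hσ : (τ.erase v).Nonempty) {o : DualCellOrientation n D (τ.erase v)}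
    (ho : DualOriented oQ hσ o) {oτ : DualCellOrientation n D τ}
    (hoτ : DualOriented oQ (P.nonempty_of_mem hτ) oτ) (o' : DualCellOrientation n D τ) :
    InducesOnFacet o o' ↔ o' = oτ.twist (facetSign τ v) := by
  constructor
  · exact fun h => h.eq_twist hD hτ hv hσ ho hoτ
  · rintro rfl
    exact inducesOnFacet_twist hD hτ hv hσ ho hoτ

theorem finsum_inducesOnFacet (hD : IsRegularSubdivision P D) {τ : P.complex.faces} {v : V}
    (hv : v ∈ τ.1) (hσ : τ.1.erase v ∈ P.complex.faces) (c : CellularChain P D)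
    {oτ : DualCellOrientation n D τ.1} (hoτ : DualOriented oQ (P.nonempty_of_mem τ.2) oτ) :
    ∑ᶠ (o : DualCellOrientation n D (τ.1.erase v)) (_ : τ.1.erase v ⊆ τ.1 ∧
      (τ.1.erase v).card + 1 = τ.1.card ∧ InducesOnFacet o oτ), (c ⟨τ.1.erase v, hσ⟩).1 o =
      facetSign τ.1 v * dualCochain oQ c ⟨τ.1.erase v, hσ⟩ := by
  obtain ⟨o, ho, hall⟩ := hD.exists_dualOriented hσ oQ
  have hne := P.nonempty_of_mem hσ
  have hsub := Finset.erase_subset v τ.1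
  have hcard := Finset.card_erase_add_one hv
  have hiff := inducesOnFacet_iff hD τ.2 hv hne ho hoτ
  have hdc := hD.dualCochain_apply (oQ := oQ) c ⟨τ.1.erase v, hσ⟩ ho
  refine Eq.trans ?_ (congrArg (fun z : ℤ => (facetSign τ.1 v : ℤ) * z) hdc).symm
  refine finsum_orientation hall ?_ ?_ (c ⟨τ.1.erase v, hσ⟩)
  · refine Iff.trans ⟨fun h => h.2.2, fun h => ⟨hsub, hcard, h⟩⟩ ?_
    rw [hiff]
    exact oτ.eq_twist_iff (hD.nonempty τ.1 τ.2) _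
  · refine Iff.trans ⟨fun h => h.2.2, fun h => ⟨hsub, hcard, h⟩⟩ ?_
    rw [inducesOnFacet_neg_iff, hiff]
    exact oτ.neg_eq_twist_iff (hD.nonempty τ.1 τ.2) _

theorem IsRegularSubdivision.dualCochain_cellBoundary (hD : IsRegularSubdivision P D)
    (c : CellularChain P D) (τ : P.complex.faces) : dualCochain oQ (cellBoundary c) τ =
      ∑ v ∈ τ.1, facetSign τ.1 v * (dualCochain oQ c).eval (τ.1.erase v) := by
  classical
  obtain ⟨oτ, hoτ, -⟩ := hD.exists_dualOriented τ.2 oQ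
  rw [hD.dualCochain_apply _ τ hoτ]
  have : Fintype P.complex.faces := Fintype.ofFinite _
  have hterm : ∀ σ : P.complex.faces,
      ∑ᶠ (o : DualCellOrientation n D σ.1) (_ : σ.1 ⊆ τ.1 ∧ σ.1.card + 1 = τ.1.card ∧
        InducesOnFacet o oτ), (c σ).1 o =
      ∑ v ∈ τ.1, if σ.1 = τ.1.erase v then facetSign τ.1 v * dualCochain oQ c σ else 0 := by
    intro σ
    by_cases h : σ.1 ⊆ τ.1 ∧ σ.1.card + 1 = τ.1.card
    · obtain ⟨v, hv, hσv⟩ : ∃ v ∈ τ.1, σ.1 = τ.1.erase v := by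
        have h1 : (τ.1 \ σ.1).card = 1 := by
          rw [Finset.card_sdiff_of_subset h.1]
          omega
        obtain ⟨v, hv⟩ := Finset.card_eq_one.1 h1
        refine ⟨v, (Finset.mem_sdiff.1 (hv ▸ Finset.mem_singleton_self v)).1, ?_⟩
        rw [Finset.erase_eq, ← hv, Finset.sdiff_sdiff_eq_self h.1]
      obtain ⟨σ, hσ⟩ := σ
      dsimp only at hσv
      subst hσv
      have hσv : τ.1.erase v = τ.1.erase v := rfl
      rw [finsum_inducesOnFacet hD hv hσ c hoτ, Finset.sum_eq_single v]
      · rw [if_pos hσv]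
      · intro u hu huv
        rw [if_neg]
        intro e
        have h1 := hσv.symm.trans e
        have h2 : u ∈ τ.1.erase v := Finset.mem_erase.2 ⟨huv, hu⟩
        rw [h1] at h2
        simp at h2
      · exact fun h => absurd hv h
    · rw [Finset.sum_eq_zero]
      · refine finsum_eq_zero_of_forall_eq_zero fun o => ?_
        rw [finsum_eq_if, if_neg fun h' => h ⟨h'.1, h'.2.1⟩]
      · intro v hv
        rw [if_neg]
        intro e
        refine h ⟨e ▸ Finset.erase_subset v τ.1, ?_⟩
        rw [e]
        exact Finset.card_erase_add_one hv
  calc (cellBoundary c τ).1 oτ = ∑ᶠ σ : P.complex.faces, ∑ᶠ (o : DualCellOrientation n D σ.1)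
        (_ : σ.1 ⊆ τ.1 ∧ σ.1.card + 1 = τ.1.card ∧ InducesOnFacet o oτ), (c σ).1 o := rfl
    _ = ∑ σ : P.complex.faces, ∑ v ∈ τ.1,
        if σ.1 = τ.1.erase v then facetSign τ.1 v * dualCochain oQ c σ else 0 := by
      rw [finsum_eq_sum_of_fintype]
      exact Finset.sum_congr rfl fun σ _ => hterm σ
    _ = _ := by
      rw [Finset.sum_comm]
      refine Finset.sum_congr rfl fun v _ => ?_
      by_cases h : τ.1.erase v ∈ P.complex.faces
      · rw [Finset.sum_eq_single ⟨τ.1.erase v, h⟩]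
        · rw [if_pos rfl, Cochain.eval_of_mem]
        · intro σ _ hσ
          rw [if_neg fun e => hσ (Subtype.ext e)]
        · simp
      · rw [Finset.sum_eq_zero]
        · simp [Cochain.eval, h]
        · intro σ _
          rw [if_neg]
          intro e
          exact h (e ▸ σ.2)

theorem IsRegularSubdivision.dualCochain_neg (hD : IsRegularSubdivision P D)
    (c : CellularChain P D) : dualCochain oQ (-c) = -dualCochain oQ c := by
  funext σ
  obtain ⟨o, ho, -⟩ := hD.exists_dualOriented σ.2 oQ
  rw [Pi.neg_apply, hD.dualCochain_apply _ σ ho, hD.dualCochain_apply _ σ ho]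
  rfl

/-- The cellular boundary operator corresponds to the simplicial coboundary. -/
theorem IsRegularSubdivision.dualCochain_boundary (hD : IsRegularSubdivision P D)
    (c : CellularChain P D) :
    dualCochain oQ (-cellBoundary (chainSign c)) = coboundary (dualCochain oQ c) := by
  funext τ
  rw [hD.dualCochain_neg, Pi.neg_apply, hD.dualCochain_cellBoundary, hD.dualCochain_chainSign,
    coboundary, ← Finset.sum_neg_distrib]
  refine Finset.sum_congr rfl fun v _ => ?_
  -- The sign of `chainSign` cancels the codimension in the exponent of `facetSign`, and the minus
  -- sign in front cancels its `+ 1`. What is left is the sign of the simplicial coboundary.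
  rw [Cochain.eval_cochainSign, facetSign, Units.val_pow_eq_pow_val, Units.val_neg, Units.val_one,
    pow_succ, pow_add]
  have h1 : ((-1 : ℤ) ^ codim (τ.1.erase v)) * (-1) ^ codim (τ.1.erase v) = 1 := by
    rw [← mul_pow]
    simp
  linear_combination ((-1 : ℤ) ^ position τ.1 v * (dualCochain oQ c).eval (τ.1.erase v)) * h1

end Facets

end

/-! ### Images of a dual subdivision under diffeomorphisms; essential parts. -/

noncomputable section

section Transport

variable {n : ℕ} [NeZero n] {Q : Type u} [MetricSpace Q] [ChartedSpace (EuclideanHalfSpace n) Q]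
  [IsManifold (𝓡∂ n) ∞ Q] {V : Type v} [Fintype V] [LinearOrder V]
  {P : SmoothTriangulation n Q V} {D : V → Set Q} {σ : Finset V} {O : Set Q} {f : V → Q → ℝ}

theorem mem_image_diffeomorph_iff (φ : Q ≃ₘ^∞⟮𝓡∂ n, 𝓡∂ n⟯ Q) {S : Set Q} {q : Q} :
    q ∈ φ '' S ↔ φ.symm q ∈ S := by
  rw [φ.image_eq_preimage_symm]
  rfl

theorem mem_interior_diffeomorph_iff (φ : Q ≃ₘ^∞⟮𝓡∂ n, 𝓡∂ n⟯ Q) {q : Q} :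
    φ q ∈ (𝓡∂ n).interior Q ↔ q ∈ (𝓡∂ n).interior Q := by
  have h : φ ⁻¹' (𝓡∂ n).interior Q = (𝓡∂ n).interior Q := φ.preimage_interior (by simp)
  exact (iff_of_eq (congrArg (fun S : Set Q => q ∈ S) h))

theorem dualCell_image (φ : Q ≃ₘ^∞⟮𝓡∂ n, 𝓡∂ n⟯ Q) (σ : Finset V) :
    dualCell (fun v => φ '' D v) σ = φ '' dualCell D σ := by
  ext q
  simp only [dualCell, mem_iInter, mem_image_diffeomorph_iff]

theorem stratum_image (φ : Q ≃ₘ^∞⟮𝓡∂ n, 𝓡∂ n⟯ Q) (σ : Finset V) :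
    stratum (fun v => φ '' D v) σ = φ '' stratum D σ := by
  ext q
  rw [mem_image_diffeomorph_iff]
  refine forall_congr' fun v => ?_
  rw [mem_image_diffeomorph_iff]

theorem openCell_image (φ : Q ≃ₘ^∞⟮𝓡∂ n, 𝓡∂ n⟯ Q) (σ : Finset V) :
    openCell n (fun v => φ '' D v) σ = φ '' openCell n D σ := by
  ext q
  rw [mem_image_diffeomorph_iff, openCell, stratum_image]
  refine and_congr (mem_image_diffeomorph_iff φ) ?_
  have := mem_interior_diffeomorph_iff φ (q := φ.symm q)
  rwa [φ.apply_symm_apply] at this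

theorem der_comp_diffeomorph {F : Type*} [NormedAddCommGroup F] [NormedSpace ℝ F]
    (φ : Q ≃ₘ^∞⟮𝓡∂ n, 𝓡∂ n⟯ Q) {g : Q → F} {q : Q}
    (hg : MDifferentiableAt (𝓡∂ n) 𝓘(ℝ, F) g (φ q)) (w : TangentSpace (𝓡∂ n) q) :
    der n (fun x => g (φ x)) q w = der n g (φ q) (mfderiv (𝓡∂ n) (𝓡∂ n) φ q w) := by
  have := der_eq (HasMFDerivAt.comp q (hasMFDerivAt_der hg)
    (φ.mdifferentiable (by simp) q).hasMFDerivAt)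
  exact congrArg (fun L => L w) this

theorem surjective_mfderiv_diffeomorph (φ : Q ≃ₘ^∞⟮𝓡∂ n, 𝓡∂ n⟯ Q) (q : Q) :
    Function.Surjective (mfderiv (𝓡∂ n) (𝓡∂ n) φ q) :=
  (φ.mfderivToContinuousLinearEquiv (x := q) (by simp)).surjective

theorem HModel.image (h : HModel n D σ O f) (φ : Q ≃ₘ^∞⟮𝓡∂ n, 𝓡∂ n⟯ Q) :
    HModel n (fun v => φ '' D v) σ (φ '' O) (fun v q => f v (φ.symm q)) where
  isOpen := φ.toHomeomorph.isOpenMap O h.isOpen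
  smooth v hv := (h.smooth v hv).comp φ.symm.contMDiff.contMDiffOn
    fun q hq => (mem_image_diffeomorph_iff φ).1 hq
  model q hq v := by
    rw [mem_image_diffeomorph_iff]
    exact h.model _ ((mem_image_diffeomorph_iff φ).1 hq) v
  surj q hq g := by
    have hq' := (mem_image_diffeomorph_iff φ).1 hq
    obtain ⟨w, hw⟩ := h.surj _ hq' g
    obtain ⟨w', hw'⟩ := surjective_mfderiv_diffeomorph φ.symm q w
    refine ⟨w', fun u hu v hv => ?_⟩
    rw [der_comp_diffeomorph φ.symm (h.mdifferentiableAt hq' hv),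
      der_comp_diffeomorph φ.symm (h.mdifferentiableAt hq' hu), hw']
    exact hw u hu v hv

theorem IsDualSubdivision.openCell_eq (hD : IsDualSubdivision P D) (hσ : σ ∈ P.complex.faces) :
    ∃ h : Metric.closedBall (0 : EuclideanSpace ℝ (Fin (n - codim σ))) 1 ≃ₜ dualCell D σ,
      openCell n D σ = range fun x : Metric.ball (0 : EuclideanSpace ℝ (Fin (n - codim σ))) 1 =>
        (h ⟨x.1, Metric.ball_subset_closedBall x.2⟩).1 := by
  obtain ⟨h, hh⟩ := hD.ball σ hσ
  refine ⟨h, ?_⟩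
  ext q
  constructor
  · intro hq
    have h1 : (h (h.symm ⟨q, stratum_subset_dualCell hq.1⟩)).1 = q := by simp
    have h2 := (hh (h.symm ⟨q, stratum_subset_dualCell hq.1⟩)).1 (by rw [h1]; exact hq)
    exact ⟨⟨_, h2⟩, h1⟩
  · rintro ⟨x, rfl⟩
    exact (hh _).2 x.2

/-- The image of a dual subdivision under a diffeomorphism is regular. -/
theorem IsDualSubdivision.isRegular_image (hD : IsDualSubdivision P D)
    (φ : Q ≃ₘ^∞⟮𝓡∂ n, 𝓡∂ n⟯ Q) : IsRegularSubdivision P (fun v => φ '' D v) where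
  model σ hσ q hq := by
    rw [openCell_image, mem_image_diffeomorph_iff] at hq
    obtain ⟨O, y, hy, -⟩ := hD.localModel σ hσ _ hq.1
    obtain ⟨O', -, hqO', hf⟩ := hy.exists_hModel (P.nonempty_of_mem hσ)
    exact ⟨_, _, (mem_image_diffeomorph_iff φ).2 hqO', hf.image φ⟩
  preconnected σ hσ := by
    rw [openCell_image]
    refine IsPreconnected.image ?_ _ φ.continuous.continuousOn
    obtain ⟨h, hh⟩ := hD.openCell_eq hσ
    rw [hh]
    have : PreconnectedSpace (Metric.ball (0 : EuclideanSpace ℝ (Fin (n - codim σ))) 1) :=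
      isPreconnected_iff_preconnectedSpace.1 (convex_ball _ _).isPreconnected
    refine isPreconnected_range ?_
    exact continuous_subtype_val.comp (h.continuous.comp (by fun_prop))
  nonempty σ hσ := by
    rw [openCell_image]
    obtain ⟨h, hh⟩ := hD.openCell_eq hσ
    rw [hh]
    have : Nonempty (Metric.ball (0 : EuclideanSpace ℝ (Fin (n - codim σ))) 1) :=
      ⟨⟨0, Metric.mem_ball_self one_pos⟩⟩
    exact (range_nonempty _).image _

theorem IsDualSubdivision.isRegular (hD : IsDualSubdivision P D) : IsRegularSubdivision P D := by
  have := hD.isRegular_image (Diffeomorph.refl (𝓡∂ n) Q ∞)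
  simpa using this

/-- The essential parts of all dual cells are non-empty, for small `ε`. -/
theorem IsDualSubdivision.exists_essentialPart (hD : IsDualSubdivision P D) [CompactSpace Q] :
    ∃ ε₀ > (0 : ℝ), ∀ ε < ε₀, ∀ σ ∈ P.complex.faces, (essentialPart n ε D σ).Nonempty := by
  have h1 : ∀ σ : P.complex.faces, ∃ δ > (0 : ℝ), ∃ p ∈ dualCell D σ.1,
      ∀ q ∈ dualCell D σ.1 \ openCell n D σ.1, δ ≤ dist p q := by
    intro σ
    obtain ⟨h, hh⟩ := hD.ball σ.1 σ.2
    -- The image of the boundary sphere is compact and does not contain the image `p` of the centre,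
    -- so `p` has positive distance from it.
    set C := (fun x : Metric.closedBall (0 : EuclideanSpace ℝ (Fin (n - codim σ.1))) 1 => (h x).1) ''
      {x | x.1 ∉ Metric.ball (0 : EuclideanSpace ℝ (Fin (n - codim σ.1))) 1} with hC
    have hCeq : dualCell D σ.1 \ openCell n D σ.1 ⊆ C := by
      rintro q ⟨hq, hq'⟩
      refine ⟨h.symm ⟨q, hq⟩, ?_, by simp⟩
      intro hx
      have := (hh (h.symm ⟨q, hq⟩)).2 hx
      rw [h.apply_symm_apply] at this
      exact hq' this
    have hCc : IsClosed C := by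
      have : CompactSpace (Metric.closedBall (0 : EuclideanSpace ℝ (Fin (n - codim σ.1))) 1) :=
        isCompact_iff_compactSpace.1 (isCompact_closedBall _ _)
      refine IsCompact.isClosed (IsCompact.image ?_ (continuous_subtype_val.comp h.continuous))
      exact (Metric.isOpen_ball.isClosed_compl.preimage continuous_subtype_val).isCompact
    set p := (h ⟨0, Metric.mem_closedBall_self zero_le_one⟩).1 with hp
    have hpC : p ∉ C := by
      rintro ⟨x, hx, hxp⟩
      have : x = ⟨0, Metric.mem_closedBall_self zero_le_one⟩ := h.injective (Subtype.ext hxp)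
      subst this
      exact hx (Metric.mem_ball_self one_pos)
    obtain ⟨δ, hδ, hball⟩ := Metric.isOpen_iff.1 hCc.isOpen_compl p hpC
    refine ⟨δ, hδ, p, (h _).2, fun q hq => ?_⟩
    by_contra hlt
    have : q ∈ Metric.ball p δ := by
      rw [Metric.mem_ball, dist_comm]
      exact not_le.1 hlt
    exact hball this (hCeq hq)
  choose δ hδ p hp hpq using h1
  have h2 : ∀ᶠ ε in 𝓝[>] (0 : ℝ), ∀ σ, ε ≤ δ σ :=
    eventually_all.2 fun σ => nhdsWithin_le_nhds (eventually_le_nhds (hδ σ))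
  obtain ⟨ε₀, hε₀, hpos⟩ := (h2.and self_mem_nhdsWithin).exists
  refine ⟨ε₀, hpos, fun ε hε σ hσ => ⟨p ⟨σ, hσ⟩, hp ⟨σ, hσ⟩, fun q hq => ?_⟩⟩
  exact (hε.le.trans (hε₀ ⟨σ, hσ⟩)).trans (hpq ⟨σ, hσ⟩ q hq)

end Transport

end

/-! ### Differentials of the charts of a pair in simplicial position. -/

noncomputable section

/-- The values of a top-degree form, in terms of an isomorphism with the standard space. -/
theorem form_eq_mul_frameMatrix_det {T : Type*} [AddCommGroup T] [Module ℝ T]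
    [FiniteDimensional ℝ T] {n : ℕ} (hT : Module.finrank ℝ T = n) {A : T →ₗ[ℝ] Fin n → ℝ}
    (hA : Function.Injective A) {Ω : T [⋀^Fin n]→ₗ[ℝ] ℝ} (hΩ : Ω ≠ 0) :
    ∃ c : ℝ, c ≠ 0 ∧ ∀ a : ℕ → T, (Ω fun i => a i) = c * (frameMatrix A a).det := by
  have hs : Function.Surjective A :=
    (LinearMap.injective_iff_surjective_of_finrank_eq_finrank (by simp [hT])).1 hA
  obtain ⟨a₀, ha₀⟩ := exists_dual_frame hs
  have hk := finrank_ker_of_surjective (m := 0) hT (by omega) hs rfl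
  let b : Module.Basis (Fin 0) ℝ (LinearMap.ker A) := Module.finBasisOfFinrankEq ℝ _ hk
  obtain ⟨h1, h2⟩ := form_catFrame (m := 0) (by omega) rfl b ha₀ (t₀ := fun _ => 0)
    (fun i => i.elim0) Ω
  have h3 : ∀ a : ℕ → T, (fun i : Fin n => catFrame n a (fun _ => 0) i) = fun i : Fin n => a i := by
    intro a
    funext i
    simp [catFrame]
  refine ⟨Ω fun i => catFrame n a₀ (fun _ => 0) i, h1 hΩ, fun a => ?_⟩
  have h4 := h2 a (fun _ => 0) (fun i => i.elim0) fun i => i.elim0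
  rw [h3 a] at h4
  rw [h4]
  have : b.det (fun i => i.elim0) = 1 := by
    rw [Module.Basis.det_apply, Matrix.det_fin_zero]
  rw [this, mul_one]

theorem Represents.pos_of_pos {T : Type*} [AddCommGroup T] [Module ℝ T] {K : Submodule ℝ T} {n : ℕ}
    {o : Orientation ℝ K (Fin n)} {Ω Ω' : T [⋀^Fin n]→ₗ[ℝ] ℝ} (h : Represents o Ω)
    (h' : Represents o Ω') {X : ℕ → T} {d : ℝ} (hd : 0 < d * Ω fun i => X i) :
    0 < d * Ω' fun i => X i := by
  rcases lt_trichotomy (Ω fun i => X i) 0 with h0 | h0 | h0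
  · have h1 := (h' X (-1)).1 ((h X (-1)).2 (by simpa using h0))
    have h2 : (Ω' fun i => X i) < 0 := by simpa using h1
    nlinarith
  · rw [h0, mul_zero] at hd
    exact absurd hd (lt_irrefl 0)
  · have h1 := (h' X 1).1 ((h X 1).2 (by simpa using h0))
    have h2 : 0 < Ω' fun i => X i := by simpa using h1
    have h3 : 0 < d := by
      by_contra h3
      nlinarith
    positivity

section Charts

variable {n : ℕ} [NeZero n] {Q : Type u} [MetricSpace Q] [ChartedSpace (EuclideanHalfSpace n) Q]
  [IsManifold (𝓡∂ n) ∞ Q] {V : Type v} [Fintype V] [LinearOrder V]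
  {P : SmoothTriangulation n Q V} {D D₀ D₁ : V → Set Q} {κ : Finset V}

/-- The derivative of a map to `Q`, in the coordinates of the tangent spaces. -/
def mder (n : ℕ) [NeZero n] [ChartedSpace (EuclideanHalfSpace n) Q] (β : Q → Q) (q : Q) :
    TangentSpace (𝓡∂ n) q →L[ℝ] EuclideanSpace ℝ (Fin n) :=
  mfderiv (𝓡∂ n) (𝓡∂ n) β q

/-- All tangent spaces are copies of one Euclidean space, so equality in the tangent bundle over a
common base point can be tested there, without transport along `h`. -/
theorem tangentMap_eq_iff {β : Q → Q} {p p' : Q} (h : β p = β p') (w : TangentSpace (𝓡∂ n) p)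
    (w' : TangentSpace (𝓡∂ n) p') :
    tangentMap (𝓡∂ n) (𝓡∂ n) β ⟨p, w⟩ = tangentMap (𝓡∂ n) (𝓡∂ n) β ⟨p', w'⟩ ↔
      mder n β p w = mder n β p' w' := by
  constructor
  · intro h'
    exact congrArg (fun x : TangentBundle (𝓡∂ n) Q => (x.2 : EuclideanSpace ℝ (Fin n))) h'
  · intro h'
    have key : ∀ (b b' : Q) (x x' : EuclideanSpace ℝ (Fin n)), b = b' → x = x' →
        (⟨b, x⟩ : TangentBundle (𝓡∂ n) Q) = ⟨b', x'⟩ := by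
      rintro b _ x _ rfl rfl
      rfl
    exact key _ _ _ _ h h'

/-- The derivative of a map to `Q` is by definition computed in the preferred chart at the image
point, so composing with that chart does not change it. -/
theorem der_extChartAt_comp {β : Q → Q} {q b : Q} (hb : β q = b)
    (h : MDifferentiableAt (𝓡∂ n) (𝓡∂ n) β q) :
    HasMFDerivAt (𝓡∂ n) 𝓘(ℝ, EuclideanSpace ℝ (Fin n)) (fun x => extChartAt (𝓡∂ n) b (β x)) q
      (mder n β q) := by
  subst hb
  have h1 := h.hasMFDerivAt
  refine ⟨(continuousAt_extChartAt (β q)).comp h1.1, ?_⟩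
  have h2 := h1.2
  simp only [writtenInExtChartAt, extChartAt_model_space_eq_id, PartialEquiv.refl_coe,
    Function.id_comp]
  exact h2

variable (c : SimplicialChart n D D₀ D₁ κ)

theorem SimplicialChart.mdifferentiableAt_base {q : Q} (hq : q ∈ c.source) :
    MDifferentiableAt (𝓡∂ n) (𝓡∂ n) c.base q :=
  (c.smooth_base.contMDiffAt (c.isOpen_source.mem_nhds hq)).mdifferentiableAt (by simp)

theorem SimplicialChart.mdifferentiableAt_coord {q : Q} (hq : q ∈ c.source) :
    MDifferentiableAt (𝓡∂ n) 𝓘(ℝ, Fin (codim κ) → ℝ) c.coord q :=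
  (c.smooth_coord.contMDiffAt (c.isOpen_source.mem_nhds hq)).mdifferentiableAt (by simp)

theorem SimplicialChart.base_mem_stratum {q : Q} (hq : q ∈ c.source) :
    c.base q ∈ stratum D κ := by
  obtain ⟨W, -, hW⟩ := c.base_open
  have : c.base q ∈ W ∩ stratum D κ := hW ▸ mem_image_of_mem _ hq
  exact this.2

theorem SimplicialChart.base_mem_interior_iff {q : Q} (hq : q ∈ c.source) :
    c.base q ∈ (𝓡∂ n).interior Q ↔ q ∈ (𝓡∂ n).interior Q := by
  have h := c.boundary_iff q hq
  rw [← ModelWithCorners.compl_interior] at h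
  exact not_iff_not.1 h

theorem SimplicialChart.base_mem_openCell {q : Q} (hq : q ∈ c.source)
    (hqi : q ∈ (𝓡∂ n).interior Q) : c.base q ∈ openCell n D κ :=
  ⟨c.base_mem_stratum hq, (c.base_mem_interior_iff hq).2 hqi⟩

theorem SimplicialChart.mfderiv_base_mem {q : Q} (hq : q ∈ c.source) (w : TangentSpace (𝓡∂ n) q) :
    mfderiv (𝓡∂ n) (𝓡∂ n) c.base q w ∈ tangentAt n (dualCell D κ) (c.base q) := by
  rw [mem_tangentAt]
  intro g hg h0
  have h1 := der_eq (HasMFDerivAt.comp q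
    (hasMFDerivAt_der (hg.mdifferentiableAt (by simp))) (c.mdifferentiableAt_base hq).hasMFDerivAt)
  have h2 : (g ∘ c.base) =ᶠ[𝓝 q] fun _ => (0 : ℝ) := by
    have h3 : Tendsto c.base (𝓝 q) (𝓝[dualCell D κ] c.base q) := by
      refine tendsto_nhdsWithin_iff.2 ⟨(c.mdifferentiableAt_base hq).continuousAt, ?_⟩
      filter_upwards [c.isOpen_source.mem_nhds hq] with x hx
      exact stratum_subset_dualCell (c.base_mem_stratum hx)
    exact h3.eventually h0
  rw [der_congr h2, der_const] at h1
  exact (congrArg (fun L => L w) h1).symm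

/-- The derivative of a chart at an interior point is an isomorphism. -/
theorem SimplicialChart.exists_lift (hD : IsRegularSubdivision P D) (hκ : κ ∈ P.complex.faces)
    {q : Q} (hq : q ∈ c.source) (hqi : q ∈ (𝓡∂ n).interior Q)
    {x : TangentSpace (𝓡∂ n) (c.base q)} (hx : x ∈ tangentAt n (dualCell D κ) (c.base q))
    (z : Fin (codim κ) → ℝ) :
    ∃ w : TangentSpace (𝓡∂ n) q, mfderiv (𝓡∂ n) (𝓡∂ n) c.base q w = x ∧ der n c.coord q w = z := by
  set K := tangentAt n (dualCell D κ) (c.base q) with hK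
  let Θ : TangentSpace (𝓡∂ n) q →ₗ[ℝ] K × (Fin (codim κ) → ℝ) :=
    LinearMap.prod (LinearMap.codRestrict K (mfderiv (𝓡∂ n) (𝓡∂ n) c.base q).toLinearMap
      fun w => c.mfderiv_base_mem hq w) (der n c.coord q).toLinearMap
  have hinj : Function.Injective Θ := by
    rw [← LinearMap.ker_eq_bot, LinearMap.ker_eq_bot']
    intro w hw
    refine c.immersion q hq w ?_ ?_
    · exact congrArg Subtype.val (congrArg Prod.fst hw)
    · exact congrArg Prod.snd hw
  have hfin : Module.finrank ℝ K = n - codim κ := hD.finrank hκ (c.base_mem_openCell hq hqi)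
  have hle := hD.codim_le hκ
  -- Dimensions agree: the cell has dimension `n - codim κ` and the fibre has dimension `codim κ`.
  have hsurj : Function.Surjective Θ := by
    refine (LinearMap.injective_iff_surjective_of_finrank_eq_finrank ?_).1 hinj
    rw [Module.finrank_prod, hfin, finrank_tangentSpace]
    simp
    omega
  obtain ⟨w, hw⟩ := hsurj (⟨x, hx⟩, z)
  exact ⟨w, congrArg Subtype.val (congrArg Prod.fst hw), congrArg Prod.snd hw⟩

theorem SimplicialChart.surjective_coord (hD : IsRegularSubdivision P D)
    (hκ : κ ∈ P.complex.faces) {q : Q} (hq : q ∈ c.source) (hqi : q ∈ (𝓡∂ n).interior Q) :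
    Function.Surjective (der n c.coord q) := by
  intro z
  obtain ⟨w, -, hw⟩ := c.exists_lift hD hκ hq hqi (Submodule.zero_mem _) z
  exact ⟨w, hw⟩

/-- Translation of tangent vectors along the fibres of a chart. -/
theorem SimplicialChart.exists_translate (hD : IsRegularSubdivision P D)
    (hκ : κ ∈ P.complex.faces) {p p' : Q} (hp : p ∈ c.source) (hp' : p' ∈ c.source)
    (hpi' : p' ∈ (𝓡∂ n).interior Q) (hb : c.base p = c.base p') (w : TangentSpace (𝓡∂ n) p) :
    ∃ w' : TangentSpace (𝓡∂ n) p', mder n c.base p w = mder n c.base p' w' ∧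
      der n c.coord p w = der n c.coord p' w' := by
  have key : ∀ x : TangentBundle (𝓡∂ n) Q, x.1 = c.base p' → x.2 ∈ tangentAt n (dualCell D κ) x.1 →
      ∃ w' : TangentSpace (𝓡∂ n) p', tangentMap (𝓡∂ n) (𝓡∂ n) c.base ⟨p', w'⟩ = x ∧
        der n c.coord p' w' = der n c.coord p w := by
    rintro ⟨b, x⟩ h hx
    dsimp only at h hx
    subst h
    obtain ⟨w', h1, h2⟩ := c.exists_lift hD hκ hp' hpi' hx (der n c.coord p w)
    refine ⟨w', ?_, h2⟩
    rw [← h1]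
    rfl
  obtain ⟨w', h1, h2⟩ := key (tangentMap (𝓡∂ n) (𝓡∂ n) c.base ⟨p, w⟩) hb (c.mfderiv_base_mem hp w)
  exact ⟨w', ((tangentMap_eq_iff hb w w').1 h1.symm), h2.symm⟩

/-- A top-degree form is a multiple of the determinant of `A`, so its product with this determinant
is that multiple times a square; the sign is the same for all frames. -/
theorem Represents.sign_frame {T : Type*} [AddCommGroup T] [Module ℝ T] [FiniteDimensional ℝ T]
    {K : Submodule ℝ T} {n : ℕ} (hT : Module.finrank ℝ T = n) {o : Orientation ℝ K (Fin n)}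
    {Ω Ω' : T [⋀^Fin n]→ₗ[ℝ] ℝ} (h : Represents o Ω) (h' : Represents o Ω')
    {A : T →ₗ[ℝ] Fin n → ℝ} (hA : Function.Injective A) {a a' : ℕ → T} {s : ℝ}
    (hs : 0 < s * ((frameMatrix A a).det * Ω fun i => a i)) (ha' : (frameMatrix A a').det ≠ 0) :
    0 < s * ((frameMatrix A a').det * Ω' fun i => a' i) := by
  rw [← mul_assoc] at hs
  have h1 := h.pos_of_pos h' hs
  have hΩ' : Ω' ≠ 0 := by
    rintro rfl
    simp at h1
  obtain ⟨k, -, hk⟩ := form_eq_mul_frameMatrix_det hT hA hΩ'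
  rw [hk] at h1 ⊢
  have h2 : 0 < s * k := by
    have h3 : s * (frameMatrix A a).det * (k * (frameMatrix A a).det) =
        s * k * (frameMatrix A a).det ^ 2 := by ring
    rw [h3] at h1
    exact (pos_iff_pos_of_mul_pos h1).2 (lt_of_le_of_ne (sq_nonneg _)
      (right_ne_zero_of_mul h1.ne').symm)
  have h3 : s * ((frameMatrix A a').det * (k * (frameMatrix A a').det)) =
      s * k * (frameMatrix A a').det ^ 2 := by ring
  rw [h3]
  exact mul_pos h2 (sq_pos_of_ne_zero ha')

end Charts

end

/-! ### Translation along the fibres of a chart preserves orientations. -/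

noncomputable section

section Fibres

variable {n : ℕ} [NeZero n] {Q : Type u} [MetricSpace Q] [ChartedSpace (EuclideanHalfSpace n) Q]
  [IsManifold (𝓡∂ n) ∞ Q] {V : Type v} [Fintype V] [LinearOrder V]
  {P : SmoothTriangulation n Q V} {D D₀ D₁ : V → Set Q} {κ : Finset V}
  (c : SimplicialChart n D D₀ D₁ κ)

/-- The fibres of a chart are parametrized by `coord`. -/
theorem SimplicialChart.exists_fibre {b : Q} (hb : b ∈ c.base '' c.source) :
    ∃ j : (Fin (codim κ) → ℝ) → Q, Continuous j ∧ ∀ z, j z ∈ c.source ∧ c.base (j z) = b ∧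
      c.coord (j z) = z := by
  have h1 : ∀ z : Fin (codim κ) → ℝ, ∃ q ∈ c.source, (c.base q, c.coord q) = (b, z) := by
    intro z
    have : (b, z) ∈ (fun p => (c.base p, c.coord p)) '' c.source := by
      rw [c.image]
      exact ⟨hb, mem_univ z⟩
    exact this
  choose j hj hjz using h1
  refine ⟨j, ?_, fun z => ⟨hj z, congrArg Prod.fst (hjz z), congrArg Prod.snd (hjz z)⟩⟩
  have h2 : Continuous fun z => (⟨j z, hj z⟩ : c.source) := by
    rw [c.embedding.continuous_iff]
    have : (c.source.domRestrict fun p => (c.base p, c.coord p)) ∘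
        (fun z => (⟨j z, hj z⟩ : c.source)) = fun z => (b, z) := funext fun z => hjz z
    rw [this]
    fun_prop
  exact continuous_subtype_val.comp h2

theorem SimplicialChart.eq_of_eq {p q : Q} (hp : p ∈ c.source) (hq : q ∈ c.source)
    (hb : c.base p = c.base q) (hc : c.coord p = c.coord q) : p = q := by
  have := c.embedding.injective (a₁ := ⟨p, hp⟩) (a₂ := ⟨q, hq⟩) (Prod.ext hb hc)
  exact congrArg Subtype.val this

/-- In a neighbourhood of a fibre over an interior point, there is a map to the standard space which
is a local diffeomorphism at the points of the fibre, and whose derivatives at these points are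
invariant under translation. -/
theorem SimplicialChart.exists_straightening (hD : IsRegularSubdivision P D)
    (hκ : κ ∈ P.complex.faces) {p : Q} (hp : p ∈ c.source) (hpi : p ∈ (𝓡∂ n).interior Q) :
    ∃ (N : Set Q) (ψ : Q → Fin n → ℝ), IsOpen N ∧ ContMDiffOn (𝓡∂ n) 𝓘(ℝ, Fin n → ℝ) ∞ ψ N ∧
      ∀ q ∈ c.source, c.base q = c.base p → q ∈ N ∧ Function.Injective (der n ψ q) ∧
        ∀ q' ∈ c.source, c.base q' = c.base p → ∀ (w : TangentSpace (𝓡∂ n) q)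
          (w' : TangentSpace (𝓡∂ n) q'), mder n c.base q w = mder n c.base q' w' →
          der n c.coord q w = der n c.coord q' w' → der n ψ q w = der n ψ q' w' := by
  set b := c.base p with hb
  set N := c.source ∩ c.base ⁻¹' (chartAt (EuclideanHalfSpace n) b).source with hN
  have hNo : IsOpen N := c.smooth_base.continuousOn.isOpen_inter_preimage c.isOpen_source
    (chartAt _ b).open_source
  let Θ : TangentSpace (𝓡∂ n) p →ₗ[ℝ] EuclideanSpace ℝ (Fin n) × (Fin (codim κ) → ℝ) :=
    LinearMap.prod (mder n c.base p).toLinearMap (der n c.coord p).toLinearMap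
  have hinj : ∀ q ∈ c.source, ∀ w : TangentSpace (𝓡∂ n) q, mder n c.base q w = 0 →
      der n c.coord q w = 0 → w = 0 := fun q hq w h1 h2 => c.immersion q hq w h1 h2
  have hΘ : LinearMap.ker Θ = ⊥ := by
    rw [LinearMap.ker_eq_bot']
    intro w hw
    exact hinj p hp w (congrArg Prod.fst hw) (congrArg Prod.snd hw)
  -- The base coordinates and the fibre coordinates together are redundant, as the base takes values
  -- in a cell of positive codimension in general. A left inverse at `p` combines them into `n`
  -- functions; the same linear combination works along the fibre, since translation identifies the
  -- differentials.
  obtain ⟨g, hg⟩ := Θ.exists_leftInverse_of_injective hΘ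
  let e : TangentSpace (𝓡∂ n) p ≃ₗ[ℝ] (Fin n → ℝ) :=
    LinearEquiv.ofFinrankEq _ _ (by rw [finrank_tangentSpace]; simp)
  let R₁ : EuclideanSpace ℝ (Fin n) →L[ℝ] (Fin n → ℝ) :=
    LinearMap.toContinuousLinearMap (e.toLinearMap ∘ₗ g ∘ₗ LinearMap.inl ℝ _ _)
  let R₂ : (Fin (codim κ) → ℝ) →L[ℝ] (Fin n → ℝ) :=
    LinearMap.toContinuousLinearMap (e.toLinearMap ∘ₗ g ∘ₗ LinearMap.inr ℝ _ _)
  have hR : ∀ w, R₁ (mder n c.base p w) + R₂ (der n c.coord p w) = e w := by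
    intro w
    have h1 : g (Θ w) = w := congrArg (fun L => L w) hg
    have h2 : Θ w = LinearMap.inl ℝ _ _ (mder n c.base p w) +
        LinearMap.inr ℝ _ _ (der n c.coord p w) := by
      simp [Θ]
    rw [h2, map_add] at h1
    calc R₁ (mder n c.base p w) + R₂ (der n c.coord p w) =
        e (g (LinearMap.inl ℝ _ _ (mder n c.base p w)) +
          g (LinearMap.inr ℝ _ _ (der n c.coord p w))) := by rw [map_add]; rfl
      _ = e w := by rw [h1]
  set ψ : Q → Fin n → ℝ := fun q => R₁ (extChartAt (𝓡∂ n) b (c.base q)) + R₂ (c.coord q) with hψ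
  have hψs : ContMDiffOn (𝓡∂ n) 𝓘(ℝ, Fin n → ℝ) ∞ ψ N := by
    have h1 : ContMDiffOn (𝓡∂ n) 𝓘(ℝ, EuclideanSpace ℝ (Fin n)) ∞
        (fun q => extChartAt (𝓡∂ n) b (c.base q)) N :=
      contMDiffOn_extChartAt.comp (c.smooth_base.mono inter_subset_left) fun q hq => hq.2
    exact (R₁.contMDiff.comp_contMDiffOn h1).add
      (R₂.contMDiff.comp_contMDiffOn (c.smooth_coord.mono inter_subset_left))
  have hder : ∀ q ∈ c.source, c.base q = b → ∀ w : TangentSpace (𝓡∂ n) q,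
      der n ψ q w = R₁ (mder n c.base q w) + R₂ (der n c.coord q w) := by
    intro q hq hqb w
    have h1 := HasMFDerivAt.comp q (R₁.hasMFDerivAt)
      (der_extChartAt_comp hqb (c.mdifferentiableAt_base hq))
    have h2 := HasMFDerivAt.comp q (R₂.hasMFDerivAt)
      (hasMFDerivAt_der (c.mdifferentiableAt_coord hq))
    have h3 := der_eq (h1.add h2)
    exact congrArg (fun L => L w) h3
  refine ⟨N, ψ, hNo, hψs, fun q hq hqb => ⟨⟨hq, ?_⟩, ?_, ?_⟩⟩
  · change c.base q ∈ (chartAt (EuclideanHalfSpace n) b).source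
    rw [hqb]
    exact mem_chart_source _ b
  · rw [injective_iff_map_eq_zero]
    intro w hw
    obtain ⟨w', h1, h2⟩ := c.exists_translate hD hκ hq hp hpi hqb w
    rw [hder q hq hqb, h1, h2, hR] at hw
    have hw' : w' = 0 := by simpa using hw
    subst hw'
    exact hinj q hq w (h1.trans (map_zero _)) (h2.trans (map_zero _))
  · intro q' hq' hqb' w w' h1 h2
    rw [hder q hq hqb, hder q' hq' hqb', h1, h2]

/-- Translations along the fibres of a chart preserve the orientation of `Q`. -/
theorem SimplicialChart.translate_sign (oQ : CellOrientation n (univ : Set Q) ((𝓡∂ n).interior Q) n)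
    (hD : IsRegularSubdivision P D) (hκ : κ ∈ P.complex.faces) {p p' : Q} (hp : p ∈ c.source)
    (hp' : p' ∈ c.source) (hpi : p ∈ (𝓡∂ n).interior Q) (hpi' : p' ∈ (𝓡∂ n).interior Q)
    (hb : c.base p = c.base p') {X : ℕ → TangentSpace (𝓡∂ n) p} {X' : ℕ → TangentSpace (𝓡∂ n) p'}
    (h₁ : ∀ i < n, mder n c.base p (X i) = mder n c.base p' (X' i))
    (h₂ : ∀ i < n, der n c.coord p (X i) = der n c.coord p' (X' i))
    {Ω : TangentSpace (𝓡∂ n) p [⋀^Fin n]→ₗ[ℝ] ℝ} {Ω' : TangentSpace (𝓡∂ n) p' [⋀^Fin n]→ₗ[ℝ] ℝ}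
    (hΩ : Represents (oQ.at' ⟨p, hpi⟩) Ω) (hΩ' : Represents (oQ.at' ⟨p', hpi'⟩) Ω') {d : ℝ}
    (hd : 0 < d * Ω fun i => X i) : 0 < d * Ω' fun i => X' i := by
  obtain ⟨N, ψ, hN, hψ, hF⟩ := c.exists_straightening hD hκ hp hpi
  obtain ⟨j, hj, hjz⟩ := c.exists_fibre (mem_image_of_mem c.base hp)
  have hji : ∀ z, j z ∈ (𝓡∂ n).interior Q := fun z => by
    rw [← c.base_mem_interior_iff (hjz z).1, (hjz z).2.1, c.base_mem_interior_iff hp]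
    exact hpi
  have hjp : j (c.coord p) = p := c.eq_of_eq (hjz _).1 hp (hjz _).2.1 (hjz _).2.2
  have hjp' : j (c.coord p') = p' := c.eq_of_eq (hjz _).1 hp' ((hjz _).2.1.trans hb) (hjz _).2.2
  have hinj : ∀ z, Function.Injective (der n ψ (j z)).toLinearMap := fun z =>
    (hF _ (hjz z).1 (hjz z).2.1).2.1
  have hbij : ∀ z, Function.Surjective (der n ψ (j z)).toLinearMap := fun z =>
    (LinearMap.injective_iff_surjective_of_finrank_eq_finrank
      (by rw [finrank_tangentSpace]; simp)).1 (hinj z)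
  -- The points of the fibre at which the coordinates `ψ` have sign `s` with respect to the
  -- orientation of `Q`. For the two values of `s` these sets are open, disjoint and cover the
  -- fibre, which is connected.
  set Z : ℤˣ → Set (Fin (codim κ) → ℝ) := fun s => {z | ∀ Ω, Represents (oQ.at' ⟨j z, hji z⟩) Ω →
    ∀ a, (frameMatrix (der n ψ (j z)).toLinearMap a).det ≠ 0 →
      0 < ((s : ℤ) : ℝ) * ((frameMatrix (der n ψ (j z)).toLinearMap a).det * Ω fun i => a i)} with hZ
  have hmem : ∀ (s : ℤˣ) z Ω a, Represents (oQ.at' ⟨j z, hji z⟩) Ω →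
      0 < ((s : ℤ) : ℝ) * ((frameMatrix (der n ψ (j z)).toLinearMap a).det * Ω fun i => a i) →
      z ∈ Z s := fun s z Ω a h h' Ω' hr a' ha' =>
    h.sign_frame (finrank_tangentSpace _) hr (hinj z) h' ha'
  have hcat : ∀ {q : Q} (a t : ℕ → TangentSpace (𝓡∂ n) q),
      (fun i : Fin n => catFrame n a t i) = fun i : Fin n => a i := fun a t => by
    funext i
    simp [catFrame]
  have hopen : ∀ s, IsOpen (Z s) := by
    intro s
    rw [isOpen_iff_mem_nhds]
    intro z hz
    obtain ⟨a, ha⟩ := exists_dual_frame (hbij z)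
    have had : (frameMatrix (der n ψ (j z)).toLinearMap a).det ≠ 0 := by
      rw [frameMatrix_eq_one ha]
      simp
    obtain ⟨G, hGc, ⟨Ω, hΩ, hGq⟩, hG⟩ := exists_sign_function oQ (m := 0) (add_zero n) (hji z) hN
      (hF _ (hjz z).1 (hjz z).2.1).1 hψ had univ_mem (mem_univ (j z)) (Y := fun _ _ => 0)
      (fun i hi => absurd hi (by omega))
    rw [hcat] at hGq
    have h1 : 0 < ((s : ℤ) : ℝ) * G (j z) := by
      rw [hGq]
      exact hz Ω hΩ a had
    rw [continuousWithinAt_univ] at hGc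
    have h2 : ∀ᶠ q in 𝓝 (j z), 0 < ((s : ℤ) : ℝ) * G q :=
      (hGc.tendsto.const_mul _).eventually (lt_mem_nhds h1)
    filter_upwards [hj.continuousAt.eventually h2, hj.continuousAt.eventually hG] with z' h3 h4
    obtain ⟨Ω', a', hr, -, hGq'⟩ := h4 (hji z')
    rw [hcat] at hGq'
    rw [hGq'] at h3
    exact hmem s z' Ω' a' hr h3
  have hcover : ∀ z, z ∈ Z 1 ∨ z ∈ Z (-1) := by
    intro z
    obtain ⟨a, ha⟩ := exists_dual_frame (hbij z)
    obtain ⟨Ω, hΩ0, hΩ⟩ := exists_represents_at oQ (hji z)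
    obtain ⟨k, hk, hka⟩ := form_eq_mul_frameMatrix_det (finrank_tangentSpace _) (hinj z) hΩ0
    rcases lt_or_gt_of_ne hk with h | h
    · refine Or.inr (hmem (-1) z Ω a hΩ ?_)
      rw [hka, frameMatrix_eq_one ha]
      simpa using h
    · refine Or.inl (hmem 1 z Ω a hΩ ?_)
      rw [hka, frameMatrix_eq_one ha]
      simpa using h
  have hdisj : ∀ z, z ∈ Z 1 → z ∉ Z (-1) := by
    intro z h1 h2
    obtain ⟨a, ha⟩ := exists_dual_frame (hbij z)
    obtain ⟨Ω, -, hΩ⟩ := exists_represents_at oQ (hji z)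
    have had : (frameMatrix (der n ψ (j z)).toLinearMap a).det ≠ 0 := by
      rw [frameMatrix_eq_one ha]
      simp
    have h3 := h1 Ω hΩ a had
    have h4 := h2 Ω hΩ a had
    simp only [Units.val_neg, Units.val_one, Int.cast_neg, Int.cast_one, neg_mul, one_mul] at h3 h4
    linarith
  have hclosed : IsClosed (Z 1) := by
    have : Z 1 = (Z (-1))ᶜ := by
      ext z
      exact ⟨hdisj z, fun h => (hcover z).resolve_right h⟩
    rw [this]
    exact (hopen (-1)).isClosed_compl
  obtain ⟨s, hs⟩ : ∃ s, ∀ z, z ∈ Z s := by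
    rcases isClopen_iff.1 ⟨hclosed, hopen 1⟩ with h | h
    · exact ⟨-1, fun z => (hcover z).resolve_left (by simp [h])⟩
    · exact ⟨1, fun z => by simp [h]⟩
  have hkey : ∀ q (hq : q ∈ c.source) (hqi : q ∈ (𝓡∂ n).interior Q), c.base q = c.base p →
      ∀ Ω, Represents (oQ.at' ⟨q, hqi⟩) Ω → ∀ a, (frameMatrix (der n ψ q).toLinearMap a).det ≠ 0 →
      0 < ((s : ℤ) : ℝ) * ((frameMatrix (der n ψ q).toLinearMap a).det * Ω fun i => a i) := by
    intro q hq hqi hqb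
    have h1 : j (c.coord q) = q := c.eq_of_eq (hjz _).1 hq ((hjz _).2.1.trans hqb.symm) (hjz _).2.2
    have h2 := hs (c.coord q)
    simp only [hZ] at h2
    revert hqi
    rw [← h1]
    intro hqi
    exact h2
  -- Translated frames have the same components in the coordinates `ψ`, and `ψ` has the same sign at
  -- both points.
  have hmat : frameMatrix (der n ψ p').toLinearMap X' = frameMatrix (der n ψ p).toLinearMap X := by
    ext i l
    have := (hF p hp rfl).2.2 p' hp' hb.symm (X l) (X' l) (h₁ l l.2) (h₂ l l.2)
    exact (congrFun this i).symm
  have hdet : (frameMatrix (der n ψ p).toLinearMap X).det ≠ 0 := by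
    intro h0
    have hΩ0 : Ω ≠ 0 := by
      rintro rfl
      simp at hd
    obtain ⟨k, -, hk⟩ := form_eq_mul_frameMatrix_det (finrank_tangentSpace p)
      (A := (der n ψ p).toLinearMap) (hF p hp rfl).2.1 hΩ0
    rw [hk, h0] at hd
    simp at hd
  have e1 := hkey p hp hpi rfl Ω hΩ X hdet
  have e2 := hkey p' hp' hpi' hb.symm Ω' hΩ' X' (by rw [hmat]; exact hdet)
  rw [hmat] at e2
  set δ := (frameMatrix (der n ψ p).toLinearMap X).det
  set x := Ω fun i => X i
  set x' := Ω' fun i => X' i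
  have e3 := mul_pos e1 e2
  have e4 : ((s : ℤ) : ℝ) * (δ * x) * (((s : ℤ) : ℝ) * (δ * x')) = δ ^ 2 * (x * x') := by
    have := units_sq_cast s
    linear_combination (δ ^ 2 * x * x') * this
  rw [e4] at e3
  have e5 : 0 < x * x' := (pos_iff_pos_of_mul_pos e3).1 (by positivity)
  have e6 : 0 < x ^ 2 * (d * x') := by
    have := mul_pos hd e5
    nlinarith
  exact (pos_iff_pos_of_mul_pos e6).1 (lt_of_le_of_ne (sq_nonneg x) (left_ne_zero_of_mul e6.ne').symm)

end Fibres

end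

/-! ### Two subdivisions which are translates of each other in a chart. -/

noncomputable section

section Vertices

variable {V : Type v} [Fintype V] [LinearOrder V] {ρ : Finset V} {v₀ : V}

theorem filter_le_nonempty (hv : v₀ ∈ ρ) : (ρ.filter (· ≤ v₀)).Nonempty :=
  ⟨v₀, Finset.mem_filter.2 ⟨hv, le_rfl⟩⟩

theorem filter_ge_nonempty (hv : v₀ ∈ ρ) : (ρ.filter (v₀ ≤ ·)).Nonempty :=
  ⟨v₀, Finset.mem_filter.2 ⟨hv, le_rfl⟩⟩

theorem codim_filter_add (hv : v₀ ∈ ρ) :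
    codim (ρ.filter (· ≤ v₀)) + codim (ρ.filter (v₀ ≤ ·)) = codim ρ := by
  have h1 : ρ.filter (· ≤ v₀) ∪ ρ.filter (v₀ ≤ ·) = ρ := by
    rw [← Finset.filter_or]
    exact Finset.filter_true_of_mem fun x _ => le_total x v₀
  have h2 : ρ.filter (· ≤ v₀) ∩ ρ.filter (v₀ ≤ ·) = {v₀} := by
    rw [← Finset.filter_and]
    ext x
    simp only [Finset.mem_filter, Finset.mem_singleton]
    exact ⟨fun h => le_antisymm h.2.1 h.2.2, by rintro rfl; exact ⟨hv, le_rfl, le_rfl⟩⟩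
  have h3 := Finset.card_union_add_card_inter (ρ.filter (· ≤ v₀)) (ρ.filter (v₀ ≤ ·))
  rw [h1, h2, Finset.card_singleton] at h3
  have h4 := Finset.card_pos.2 (filter_le_nonempty hv)
  have h5 := Finset.card_pos.2 (filter_ge_nonempty hv)
  unfold codim
  omega

theorem vtx_filter_le (hv : v₀ ∈ ρ) (hρ : ρ.Nonempty) (i : Fin (codim (ρ.filter (· ≤ v₀)) + 1))
    {l : Fin (codim ρ + 1)} (hl : (l : ℕ) = i) :
    vtx ρ hρ l = vtx (ρ.filter (· ≤ v₀)) (filter_le_nonempty hv) i := by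
  have h1 := Finset.mem_filter.1 (vtx_mem (filter_le_nonempty hv) i)
  refine vtx_eq_of_position hρ h1.1 ?_
  rw [hl, ← position_filter_le h1.2, position_vtx]

theorem vtx_filter_ge (hv : v₀ ∈ ρ) (hρ : ρ.Nonempty) (i : Fin (codim (ρ.filter (v₀ ≤ ·)) + 1))
    {l : Fin (codim ρ + 1)} (hl : (l : ℕ) = codim (ρ.filter (· ≤ v₀)) + i) :
    vtx ρ hρ l = vtx (ρ.filter (v₀ ≤ ·)) (filter_ge_nonempty hv) i := by
  have h1 := Finset.mem_filter.1 (vtx_mem (filter_ge_nonempty hv) i)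
  refine vtx_eq_of_position hρ h1.1 ?_
  rw [hl, ← position_filter_ge h1.2, position_vtx, codim_filter_le hv]

/-- The displacement `modelShift` is strictly monotone in the vertices. -/
theorem homog_modelShift_lt {κ : Finset V} (hκ : κ.Nonempty) {r : ℝ} (hr : 0 < r) {u v : V}
    (hu : u ∈ κ) (hv : v ∈ κ) (huv : u < v) :
    homog κ (modelShift (codim κ) r) v < homog κ (modelShift (codim κ) r) u := by
  obtain ⟨i, rfl⟩ := exists_vtx hκ hu
  obtain ⟨j, rfl⟩ := exists_vtx hκ hv
  have hij : i < j := (vtx κ hκ).lt_iff_lt.1 huv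
  rw [homog_vtx, homog_vtx]
  have hpos : ∀ l : Fin (codim κ), (0 : ℝ) < (codim κ : ℝ) - (l : ℕ) := fun l => by
    have : ((l : ℕ) : ℝ) < (codim κ : ℝ) := by exact_mod_cast l.2
    linarith
  obtain ⟨j', rfl⟩ : ∃ j' : Fin (codim κ), j = j'.succ :=
    ⟨j.pred (Fin.pos_iff_ne_zero.1 (lt_of_le_of_lt (Fin.zero_le i) hij)), by simp⟩
  induction i using Fin.cases with
  | zero =>
    simp only [Fin.cons_zero, Fin.cons_succ, modelShift]
    exact div_neg_of_neg_of_pos (by linarith) (hpos j')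
  | succ i' =>
    simp only [Fin.cons_succ, modelShift]
    have h1 : ((i' : ℕ) : ℝ) < ((j' : ℕ) : ℝ) := by
      exact_mod_cast Fin.succ_lt_succ_iff.1 hij
    rw [neg_div, neg_div, neg_lt_neg_iff]
    exact div_lt_div_of_pos_left hr (hpos j') (by linarith)

end Vertices

section PairModels

variable {n : ℕ} [NeZero n] {Q : Type u} [MetricSpace Q] [ChartedSpace (EuclideanHalfSpace n) Q]
  {V : Type v} [Fintype V] [LinearOrder V] {f : V → Q → ℝ} {ρ σ : Finset V} {v₀ : V}

theorem modelY_eq_zero_iff (hσ : σ.Nonempty) {q : Q} :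
    modelY f σ hσ q = 0 ↔ ∀ u ∈ σ, ∀ v ∈ σ, f u q = f v q := by
  constructor
  · intro h
    have h2 : ∀ v ∈ σ, f v q = f (vtx σ hσ 0) q := by
      intro v hv
      obtain ⟨i, rfl⟩ := exists_vtx hσ hv
      refine Fin.cases rfl (fun j => ?_) i
      exact sub_eq_zero.1 (congrFun h j)
    intro u hu v hv
    rw [h2 u hu, h2 v hv]
  · intro h
    funext i
    exact sub_eq_zero.2 (h _ (vtx_mem hσ _) _ (vtx_mem hσ _))

theorem der_modelY_sub_const (hσ : σ.Nonempty) {q : Q}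
    (hf : ∀ v ∈ σ, MDifferentiableAt (𝓡∂ n) 𝓘(ℝ, ℝ) (f v) q) (g : V → ℝ) :
    der n (modelY (fun v q => f v q - g v) σ hσ) q = der n (modelY f σ hσ) q := by
  have h1 : modelY (fun v q => f v q - g v) σ hσ =
      fun q => modelY f σ hσ q + fun i => g (vtx σ hσ 0) - g (vtx σ hσ i.succ) := by
    funext q i
    simp only [modelY, Pi.add_apply]
    ring
  rw [h1]
  exact der_add_const (mdifferentiableAt_pi fun i =>
    (hf _ (vtx_mem hσ i.succ)).sub (hf _ (vtx_mem hσ 0))) _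

theorem der_modelY_filter_le (hv : v₀ ∈ ρ) (hρ : ρ.Nonempty) {q : Q}
    (hf : ∀ v ∈ ρ, MDifferentiableAt (𝓡∂ n) 𝓘(ℝ, ℝ) (f v) q) (w : TangentSpace (𝓡∂ n) q)
    (i : Fin (codim (ρ.filter (· ≤ v₀)))) {l : Fin (codim ρ)} (hl : (l : ℕ) = i) :
    der n (modelY f ρ hρ) q w l =
      der n (modelY f (ρ.filter (· ≤ v₀)) (filter_le_nonempty hv)) q w i := by
  rw [der_modelY hρ hf, der_modelY _ fun v hv => hf v (Finset.mem_filter.1 hv).1,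
    vtx_filter_le hv hρ i.succ (l := l.succ) (by simp [hl]), vtx_filter_le hv hρ 0 (l := 0) rfl]

variable [IsManifold (𝓡∂ n) ∞ Q]

/-- The determinant of a normal frame of an intersection of cells. -/
theorem frameMatrix_det_filter (hv : v₀ ∈ ρ) (hρ : ρ.Nonempty) {q : Q}
    (hf : ∀ v ∈ ρ, MDifferentiableAt (𝓡∂ n) 𝓘(ℝ, ℝ) (f v) q) (a : ℕ → TangentSpace (𝓡∂ n) q)
    (ha : ∀ j < codim (ρ.filter (v₀ ≤ ·)),
      der n (modelY f (ρ.filter (· ≤ v₀)) (filter_le_nonempty hv)) q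
        (a (codim (ρ.filter (· ≤ v₀)) + j)) = 0) :
    (frameMatrix (der n (modelY f ρ hρ) q).toLinearMap a).det =
      (frameMatrix (der n (modelY f (ρ.filter (· ≤ v₀)) (filter_le_nonempty hv)) q).toLinearMap
        a).det *
      (frameMatrix (der n (modelY f (ρ.filter (v₀ ≤ ·)) (filter_ge_nonempty hv)) q).toLinearMap
        fun j => a (codim (ρ.filter (· ≤ v₀)) + j)).det := by
  set k := codim (ρ.filter (· ≤ v₀)) with hk
  set k' := codim (ρ.filter (v₀ ≤ ·)) with hk'
  have hkk : k + k' = codim ρ := codim_filter_add hv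
  have hfle : ∀ v ∈ ρ.filter (· ≤ v₀), MDifferentiableAt (𝓡∂ n) 𝓘(ℝ, ℝ) (f v) q := fun v hv =>
    hf v (Finset.mem_filter.1 hv).1
  have hfge : ∀ v ∈ ρ.filter (v₀ ≤ ·), MDifferentiableAt (𝓡∂ n) 𝓘(ℝ, ℝ) (f v) q := fun v hv =>
    hf v (Finset.mem_filter.1 hv).1
  set e : Fin k ⊕ Fin k' ≃ Fin (codim ρ) := finSumFinEquiv.trans (finCongr hkk) with he
  set M := frameMatrix (der n (modelY f ρ hρ) q).toLinearMap a with hM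
  have hinl : ∀ i : Fin k, ((e (Sum.inl i) : Fin (codim ρ)) : ℕ) = i := fun i => by simp [he]
  have hinr : ∀ i : Fin k', ((e (Sum.inr i) : Fin (codim ρ)) : ℕ) = k + i := fun i => by simp [he]
  have hblock : M.submatrix e e = Matrix.fromBlocks
      (frameMatrix (der n (modelY f (ρ.filter (· ≤ v₀)) (filter_le_nonempty hv)) q).toLinearMap a) 0
      (Matrix.of fun i l => M (e (Sum.inr i)) (e (Sum.inl l)))
      (frameMatrix (der n (modelY f (ρ.filter (v₀ ≤ ·)) (filter_ge_nonempty hv)) q).toLinearMap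
        fun j => a (k + j)) := by
    ext (i | i) (l | l)
    · simp only [Matrix.submatrix_apply, Matrix.fromBlocks_apply₁₁, hM, frameMatrix, Matrix.of_apply,
        hinl]
      exact der_modelY_filter_le hv hρ hf _ i (hinl i)
    · simp only [Matrix.submatrix_apply, Matrix.fromBlocks_apply₁₂, hM, frameMatrix, Matrix.of_apply,
        hinr, Matrix.zero_apply]
      refine (der_modelY_filter_le hv hρ hf _ i (hinl i)).trans ?_
      rw [ha l l.2]
      rfl
    · simp
    · simp only [Matrix.submatrix_apply, Matrix.fromBlocks_apply₂₂, hM, frameMatrix, Matrix.of_apply,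
        hinr]
      refine (der_modelY hρ hf _ _).trans (Eq.trans ?_ (der_modelY _ hfge _ i).symm)
      -- The coordinates for `ρ` are differences with its first vertex, those for the back face are
      -- differences with `v₀`. The vectors of this block do not separate the functions on the front
      -- face, so the two base vertices give the same differences.
      have h1 := (mem_ker_der_modelY_iff (filter_le_nonempty hv) hfle _).1 (ha l l.2)
      rw [vtx_filter_ge hv hρ i.succ (l := (e (Sum.inr i)).succ)
          (by simp only [Fin.val_succ, hinr i, ← hk]; omega),
        vtx_filter_le hv hρ 0 (l := 0) rfl,
        h1 _ (vtx_mem _ 0) v₀ (Finset.mem_filter.2 ⟨hv, le_rfl⟩)]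
      have h2 : vtx (ρ.filter (v₀ ≤ ·)) (filter_ge_nonempty hv) 0 = v₀ := by
        refine vtx_eq_of_position _ (Finset.mem_filter.2 ⟨hv, le_rfl⟩) ?_
        rw [position, Fin.val_zero, Finset.card_eq_zero, Finset.filter_eq_empty_iff]
        exact fun x hx => not_lt.2 (Finset.mem_filter.1 hx).2
      rw [h2]
  rw [← Matrix.det_submatrix_equiv_self e M, hblock, Matrix.det_fromBlocks_zero₁₂]

/-- On `O`, the two subdivisions are modelled on translates of each other. -/
structure PairModel (n : ℕ) [NeZero n] [ChartedSpace (EuclideanHalfSpace n) Q] (D₀ D₁ : V → Set Q)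
    (κ : Finset V) (O : Set Q) (f : V → Q → ℝ) (g : V → ℝ) : Prop where
  left : HModel n D₀ κ O f
  right : HModel n D₁ κ O (fun v q => f v q - g v)
  anti : ∀ u ∈ κ, ∀ v ∈ κ, u < v → g v < g u
  interior : O ⊆ (𝓡∂ n).interior Q

variable {D D₀ D₁ : V → Set Q} {κ τ : Finset V} {O : Set Q} {g : V → ℝ}

/-- If `t < s`, then `f t ≤ f s` from the first subdivision and `f s - g s ≤ f t - g t` from the
second give `g t ≤ g s`, although `g` is strictly decreasing. This is the origin of the ordering in
the cup product. -/
theorem PairModel.le (h : PairModel n D₀ D₁ κ O f g) {p : Q} (hp : p ∈ O) (h₀ : p ∈ stratum D₀ σ)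
    (h₁ : p ∈ stratum D₁ τ) {s t : V} (hs : s ∈ σ) (ht : t ∈ τ) : s ≤ t := by
  by_contra hlt
  rw [not_le] at hlt
  have h2 := (h.left.model p hp s).1 ((h₀ s).2 hs)
  have h3 := (h.right.model p hp t).1 ((h₁ t).2 ht)
  have h4 := h2.2 t h3.1
  have h5 := h3.2 s h2.1
  have h6 := h.anti t h3.1 s h2.1 hlt
  linarith

theorem SimplicialChart.pairModel {P : SmoothTriangulation n Q V} (c : SimplicialChart n D D₀ D₁ κ)
    (hD : IsRegularSubdivision P D) (hκ : κ ∈ P.complex.faces) :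
    PairModel n D₀ D₁ κ (c.source ∩ (𝓡∂ n).interior Q) (fun v q => homog κ (c.coord q) v)
      (homog κ (modelShift (codim κ) c.r)) := by
  have hne := P.nonempty_of_mem hκ
  have hO := c.isOpen_source.inter (isOpen_interior_manifold (n := n) (Q := Q))
  have hsm := c.smooth_coord.mono (t := c.source ∩ (𝓡∂ n).interior Q) inter_subset_left
  have hsurj : ∀ q ∈ c.source ∩ (𝓡∂ n).interior Q, Function.Surjective (der n c.coord q) :=
    fun q hq => c.surjective_coord hD hκ hq.1 hq.2
  refine ⟨?_, ?_, fun u hu v hv huv => homog_modelShift_lt hne c.r_pos hu hv huv,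
    inter_subset_right⟩
  · have := hModel_of_surjective hne hO hsm (fun q hq => c.model₀ q hq.1) hsurj
    simpa only [modelShift_zero, sub_zero] using this
  · have := hModel_of_surjective hne hO hsm (fun q hq => c.model₁ q hq.1) hsurj
    simpa only [homog_sub] using this

theorem PairModel.subset (h : PairModel n D₀ D₁ κ O f g) {p : Q} (hp : p ∈ O)
    (hps : p ∈ openCell n D₀ (ρ.filter (· ≤ v₀)) ∩ openCell n D₁ (ρ.filter (v₀ ≤ ·))) : ρ ⊆ κ := by
  intro v hv
  rcases le_total v v₀ with h1 | h1
  · exact h.left.subset hp hps.1.1 (Finset.mem_filter.2 ⟨hv, h1⟩)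
  · exact h.right.subset hp hps.2.1 (Finset.mem_filter.2 ⟨hv, h1⟩)

/-- The tangent spaces of the intersection of two cells. -/
theorem PairModel.tangentAt_eq (h : PairModel n D₀ D₁ κ O f g) (hv : v₀ ∈ ρ) (hρ : ρ.Nonempty)
    {p : Q} (hp : p ∈ O)
    (hps : p ∈ openCell n D₀ (ρ.filter (· ≤ v₀)) ∩ openCell n D₁ (ρ.filter (v₀ ≤ ·))) :
    tangentAt n (dualCell D₀ (ρ.filter (· ≤ v₀)) ∩ dualCell D₁ (ρ.filter (v₀ ≤ ·))) p =
      LinearMap.ker (der n (modelY f ρ hρ) p).toLinearMap := by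
  have hsub := h.subset hp hps
  have hfd : ∀ v ∈ ρ, MDifferentiableAt (𝓡∂ n) 𝓘(ℝ, ℝ) (f v) p := fun v hv =>
    h.left.mdifferentiableAt hp (hsub hv)
  -- The intersection is the set where the `f v` agree on the front face and the `f v - g v` agree
  -- on the back face. Both contain `v₀`, so after this correction it is the common level set of all
  -- vertices of `ρ`.
  set g' : V → ℝ := fun v => if v ≤ v₀ then 0 else g v - g v₀ with hg'
  have hder := der_modelY_sub_const hρ hfd g'
  rw [← hder]
  obtain ⟨O₀, hO₀, hpO₀, hm₀⟩ := h.left.restrict (filter_le_nonempty hv) hp hps.1.1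
  obtain ⟨O₁, hO₁, hpO₁, hm₁⟩ := h.right.restrict (filter_ge_nonempty hv) hp hps.2.1
  have hsm : ∀ v ∈ ρ, ContMDiffOn (𝓡∂ n) 𝓘(ℝ, ℝ) ∞ (fun q => f v q - g' v) O := fun v hv =>
    (h.left.smooth v (hsub hv)).sub contMDiffOn_const
  refine tangentAt_eq_ker (h.interior hp)
    ((contMDiffOn_modelY hρ (f := fun v q => f v q - g' v) hsm).contMDiffAt
      (h.left.isOpen.mem_nhds hp)) ?_
    ⟨stratum_subset_dualCell hps.1.1, stratum_subset_dualCell hps.2.1⟩ ?_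
  · rw [hder]
    exact h.left.surjective_of_subset hρ hsub hp
  · filter_upwards [hm₀.isOpen.mem_nhds hpO₀, hm₁.isOpen.mem_nhds hpO₁] with q h0 h1
    rw [mem_inter_iff, hm₀.mem_dualCell_iff (filter_le_nonempty hv) h0,
      hm₁.mem_dualCell_iff (filter_ge_nonempty hv) h1, modelY_eq_zero_iff,
      modelY_eq_zero_iff, modelY_eq_zero_iff]
    have hlo : ∀ u ≤ v₀, g' u = 0 := fun u hu => if_pos hu
    have hhi : ∀ u, v₀ ≤ u → g' u = g u - g v₀ := by
      intro u hu
      rcases eq_or_lt_of_le hu with rfl | hu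
      · rw [hlo v₀ le_rfl, sub_self]
      · exact if_neg (not_le.2 hu)
    constructor
    · rintro ⟨e0, e1⟩
      have key : ∀ u ∈ ρ, f u q - g' u = f v₀ q := by
        intro u hu
        rcases le_total u v₀ with h2 | h2
        · rw [hlo u h2, e0 u (Finset.mem_filter.2 ⟨hu, h2⟩) v₀ (Finset.mem_filter.2 ⟨hv, le_rfl⟩),
            sub_zero]
        · have := e1 u (Finset.mem_filter.2 ⟨hu, h2⟩) v₀ (Finset.mem_filter.2 ⟨hv, le_rfl⟩)
          rw [hhi u h2]
          linarith
      intro u hu x hx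
      rw [key u hu, key x hx]
    · intro e
      refine ⟨fun u hu x hx => ?_, fun u hu x hx => ?_⟩
      · rw [Finset.mem_filter] at hu hx
        have := e u hu.1 x hx.1
        rw [hlo u hu.2, hlo x hx.2] at this
        linarith
      · rw [Finset.mem_filter] at hu hx
        have := e u hu.1 x hx.1
        rw [hhi u hu.2, hhi x hx.2] at this
        linarith

theorem exists_matrix_of_ker_le {T : Type*} [AddCommGroup T] [Module ℝ T] {k : ℕ}
    {A A' : T →ₗ[ℝ] Fin k → ℝ} {a : ℕ → T} (ha : ∀ i : Fin k, A (a i) = Pi.single i 1)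
    (hker : LinearMap.ker A ≤ LinearMap.ker A') (w : T) :
    A' w = (frameMatrix A' a).mulVec (A w) := by
  have h1 : w - ∑ i : Fin k, A w i • a i ∈ LinearMap.ker A := by
    rw [LinearMap.mem_ker, map_sub, map_sum, sub_eq_zero]
    simp only [map_smul, ha]
    funext l
    simp [Finset.sum_apply, Pi.single_apply]
  have h2 := hker h1
  rw [LinearMap.mem_ker, map_sub, map_sum, sub_eq_zero] at h2
  rw [h2]
  funext l
  simp only [map_smul, Finset.sum_apply, Pi.smul_apply, smul_eq_mul, Matrix.mulVec, dotProduct,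
    frameMatrix, Matrix.of_apply]
  exact Finset.sum_congr rfl fun i _ => mul_comm _ _

theorem frameMatrix_det_smul {T : Type*} [AddCommGroup T] [Module ℝ T] {k : ℕ}
    {A A' : T →ₗ[ℝ] Fin k → ℝ} {c : ℝ} (h : ∀ w, A' w = c • A w) (a : ℕ → T) :
    (frameMatrix A' a).det = c ^ k * (frameMatrix A a).det := by
  have : frameMatrix A' a = c • frameMatrix A a := by
    ext i j
    simp [frameMatrix, h]
  rw [this, Matrix.det_smul, Fintype.card_fin]

/-- Two models of the intersection of two cells agree to first order, up to a positive change of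
coordinates. -/
theorem PairModel.compare {κ' : Finset V} {O' : Set Q} {f' : V → Q → ℝ} {g' : V → ℝ}
    (h : PairModel n D₀ D₁ κ O f g) (h' : PairModel n D₀ D₁ κ' O' f' g') (hv : v₀ ∈ ρ)
    (hρ : ρ.Nonempty) {p : Q} (hp : p ∈ O) (hp' : p ∈ O')
    (hps : p ∈ openCell n D₀ (ρ.filter (· ≤ v₀)) ∩ openCell n D₁ (ρ.filter (v₀ ≤ ·))) :
    ∃ B : Matrix (Fin (codim ρ)) (Fin (codim ρ)) ℝ, 0 < B.det ∧
      ∀ w, der n (modelY f' ρ hρ) p w = B.mulVec (der n (modelY f ρ hρ) p w) := by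
  have hsub := h.subset hp hps
  have hsub' := h'.subset hp' hps
  have hfd : ∀ v ∈ ρ, MDifferentiableAt (𝓡∂ n) 𝓘(ℝ, ℝ) (f v) p := fun v hv =>
    h.left.mdifferentiableAt hp (hsub hv)
  have hfd' : ∀ v ∈ ρ, MDifferentiableAt (𝓡∂ n) 𝓘(ℝ, ℝ) (f' v) p := fun v hv =>
    h'.left.mdifferentiableAt hp' (hsub' hv)
  obtain ⟨a, ha⟩ := exists_dual_frame (A := (der n (modelY f ρ hρ) p).toLinearMap)
    (h.left.surjective_of_subset hρ hsub hp)
  have hker : LinearMap.ker (der n (modelY f ρ hρ) p).toLinearMap ≤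
      LinearMap.ker (der n (modelY f' ρ hρ) p).toLinearMap := by
    rw [← h.tangentAt_eq hv hρ hp hps, ← h'.tangentAt_eq hv hρ hp' hps]
  refine ⟨frameMatrix (der n (modelY f' ρ hρ) p).toLinearMap a, ?_,
    exists_matrix_of_ker_le ha hker⟩
  obtain ⟨O₀, -, hpO₀, hm₀⟩ := h.left.restrict (filter_le_nonempty hv) hp hps.1.1
  obtain ⟨O₁, -, hpO₁, hm₁⟩ := h.right.restrict (filter_ge_nonempty hv) hp hps.2.1
  obtain ⟨O₀', -, hpO₀', hm₀'⟩ := h'.left.restrict (filter_le_nonempty hv) hp' hps.1.1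
  obtain ⟨O₁', -, hpO₁', hm₁'⟩ := h'.right.restrict (filter_ge_nonempty hv) hp' hps.2.1
  obtain ⟨c, hc, hcA⟩ := hm₀.compare hm₀' (filter_le_nonempty hv) hpO₀ hpO₀'
    (stratum_subset_dualCell hps.1.1) hps.1.2
  obtain ⟨c', hc', hcA'⟩ := hm₁.compare hm₁' (filter_ge_nonempty hv) hpO₁ hpO₁'
    (stratum_subset_dualCell hps.2.1) hps.1.2
  rw [der_modelY_sub_const _ fun v hv => hfd v (Finset.mem_filter.1 hv).1,
    der_modelY_sub_const _ fun v hv => hfd' v (Finset.mem_filter.1 hv).1] at hcA'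
  have hlo : ∀ j < codim (ρ.filter (v₀ ≤ ·)),
      der n (modelY f (ρ.filter (· ≤ v₀)) (filter_le_nonempty hv)) p
        (a (codim (ρ.filter (· ≤ v₀)) + j)) = 0 := by
    intro j hj
    have hkk := codim_filter_add hv
    funext i
    rw [← der_modelY_filter_le hv hρ hfd _ i (l := ⟨i, by omega⟩) rfl]
    have h1 := congrFun (ha ⟨codim (ρ.filter (· ≤ v₀)) + j, by omega⟩) ⟨i, by omega⟩
    refine h1.trans ?_
    rw [Pi.single_apply, if_neg]
    · rfl
    · intro e
      have := congrArg Fin.val e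
      have := i.2
      simp only at *
      omega
  -- The determinants of both models factor over the front and the back face, and on each factor the
  -- change of model is multiplication by a positive number.
  have h1 := frameMatrix_det_filter hv hρ hfd a hlo
  rw [frameMatrix_eq_one ha, Matrix.det_one] at h1
  rw [frameMatrix_det_filter hv hρ hfd' a fun j hj => by rw [hcA, hlo j hj, smul_zero],
    frameMatrix_det_smul (A := (der n (modelY f (ρ.filter (· ≤ v₀))
      (filter_le_nonempty hv)) p).toLinearMap) hcA,
    frameMatrix_det_smul (A := (der n (modelY f (ρ.filter (v₀ ≤ ·))
      (filter_ge_nonempty hv)) p).toLinearMap) hcA', mul_mul_mul_comm, ← h1, mul_one]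
  positivity

end PairModels

end

/-! ### Orientations of intersections of cells and the intersection product. -/

noncomputable section

section Frames

/-- The permutation which exchanges the first two blocks of a frame. -/
def swapBlocks (k k' : ℕ) {n : ℕ} (h : k + k' ≤ n) : Equiv.Perm (Fin n) where
  toFun i := ⟨if (i : ℕ) < k then i + k' else if (i : ℕ) < k + k' then i - k else i, by
    have := i.2; split_ifs <;> omega⟩
  invFun i := ⟨if (i : ℕ) < k' then i + k else if (i : ℕ) < k + k' then i - k' else i, by
    have := i.2; split_ifs <;> omega⟩
  left_inv i := by
    have := i.2
    ext
    dsimp only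
    split_ifs <;> omega
  right_inv i := by
    have := i.2
    ext
    dsimp only
    split_ifs <;> omega

theorem catFrame_swapBlocks {T : Type*} {k k' n : ℕ} (h : k + k' ≤ n) (a b t : ℕ → T) (i : Fin n) :
    catFrame k' b (catFrame k a t) (swapBlocks k k' h i) = catFrame k a (catFrame k' b t) i := by
  simp only [swapBlocks, catFrame, Equiv.coe_fn_mk]
  split_ifs <;> first | omega | rfl | (congr 1; omega)

/-- Only non-vanishing has to be compared. The sign of the permutation of blocks is never computed,
because the sign of `(b, a, t)` is part of the rule which orients an intersection. -/
theorem form_catFrame_swap {T : Type*} [AddCommGroup T] [Module ℝ T] {k k' n : ℕ} (h : k + k' ≤ n)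
    (Ω : T [⋀^Fin n]→ₗ[ℝ] ℝ) (a b t : ℕ → T) :
    (Ω fun i => catFrame k a (catFrame k' b t) i) ≠ 0 ↔
      (Ω fun i => catFrame k' b (catFrame k a t) i) ≠ 0 := by
  have h1 := Ω.map_perm (fun i : Fin n => catFrame k' b (catFrame k a t) i) (swapBlocks k k' h)
  have h2 : ((fun i : Fin n => catFrame k' b (catFrame k a t) i) ∘ (swapBlocks k k' h)) =
      fun i : Fin n => catFrame k a (catFrame k' b t) i :=
    funext fun i => catFrame_swapBlocks h a b t i
  rw [h2] at h1
  rw [h1]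
  rcases Int.units_eq_one_or (Equiv.Perm.sign (swapBlocks k k' h)) with e | e <;> rw [e] <;> simp

theorem catFrame_catFrame {T : Type*} (k k' : ℕ) (a b t : ℕ → T) :
    catFrame (k + k') (catFrame k a b) t = catFrame k a (catFrame k' b t) := by
  funext i
  simp only [catFrame]
  split_ifs <;> first | omega | rfl | (congr 1; omega)

theorem frameMatrix_congr {T : Type*} [AddCommGroup T] [Module ℝ T] {k : ℕ}
    {A : T →ₗ[ℝ] Fin k → ℝ} {a b : ℕ → T} (h : ∀ i < k, a i = b i) :
    frameMatrix A a = frameMatrix A b := by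
  ext i j
  simp [frameMatrix, h j j.2]

end Frames

section Meet

variable {n : ℕ} [NeZero n] {Q : Type u} [MetricSpace Q] [ChartedSpace (EuclideanHalfSpace n) Q]
  [IsManifold (𝓡∂ n) ∞ Q] {V : Type v} [Fintype V] [LinearOrder V]
  {oQ : CellOrientation n (univ : Set Q) ((𝓡∂ n).interior Q) n}
  {P : SmoothTriangulation n Q V} {D D₀ D₁ : V → Set Q} {κ ρ : Finset V} {v₀ : V} {O : Set Q}
  {f : V → Q → ℝ} {g : V → ℝ}

/-- The orientations of the tangent spaces of an intersection of cells are those which correspond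
to the ordering of the vertices and the orientation of `Q`. -/
def MeetOriented (oQ : CellOrientation n (univ : Set Q) ((𝓡∂ n).interior Q) n) (hρ : ρ.Nonempty)
    (oM : MeetOrientation n D₀ D₁ (ρ.filter (· ≤ v₀)) (ρ.filter (v₀ ≤ ·))) : Prop :=
  ∀ (q : (openCell n D₀ (ρ.filter (· ≤ v₀)) ∩ openCell n D₁ (ρ.filter (v₀ ≤ ·)) : Set Q))
    (κ : Finset V) (O : Set Q) (f : V → Q → ℝ) (g : V → ℝ), PairModel n D₀ D₁ κ O f g → q.1 ∈ O →
    ∀ Ω : TangentSpace (𝓡∂ n) q.1 [⋀^Fin n]→ₗ[ℝ] ℝ, Represents (oQ.at' ⟨q.1, q.2.1.2⟩) Ω →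
      Cooriented (der n (modelY f ρ hρ) q.1).toLinearMap Ω (oM.at' q)

/-- By `PairModel.compare`, pair models chosen independently at the points of the intersection form
a normal family. -/
theorem exists_meetOriented (hcov : ∀ q ∈ (𝓡∂ n).interior Q, ∃ κ O f g, q ∈ O ∧
      PairModel n D₀ D₁ κ O f g) (hv : v₀ ∈ ρ) (hρ : ρ.Nonempty) (hle : codim ρ ≤ n)
    (oQ : CellOrientation n (univ : Set Q) ((𝓡∂ n).interior Q) n) :
    ∃ oM : MeetOrientation n D₀ D₁ (ρ.filter (· ≤ v₀)) (ρ.filter (v₀ ≤ ·)),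
      MeetOriented oQ hρ oM ∧ ∀ q ∈ openCell n D₀ (ρ.filter (· ≤ v₀)) ∩
        openCell n D₁ (ρ.filter (v₀ ≤ ·)), Module.finrank ℝ (tangentAt n
          (dualCell D₀ (ρ.filter (· ≤ v₀)) ∩ dualCell D₁ (ρ.filter (v₀ ≤ ·))) q) =
          n - (codim (ρ.filter (· ≤ v₀)) + codim (ρ.filter (v₀ ≤ ·))) := by
  classical
  choose! κ O f g hO hf using hcov
  have hA : NormalFamily (dualCell D₀ (ρ.filter (· ≤ v₀)) ∩ dualCell D₁ (ρ.filter (v₀ ≤ ·)))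
      (openCell n D₀ (ρ.filter (· ≤ v₀)) ∩ openCell n D₁ (ρ.filter (v₀ ≤ ·))) (codim ρ)
      (fun q => (der n (modelY (f q) ρ hρ) q).toLinearMap) := by
    refine ⟨fun q hq => hq.1.2, fun q hq => ?_, fun q hq => ?_, fun p hp => ?_⟩
    · exact ((hf q hq.1.2).tangentAt_eq hv hρ (hO q hq.1.2) hq).symm
    · exact (hf q hq.1.2).left.surjective_of_subset hρ
        ((hf q hq.1.2).subset (hO q hq.1.2) hq) (hO q hq.1.2)
    · have hp' := hf p hp.1.2
      have hsub := hp'.subset (hO p hp.1.2) hp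
      refine ⟨O p, modelY (f p) ρ hρ, hp'.left.isOpen, hO p hp.1.2,
        contMDiffOn_modelY hρ fun v hv => hp'.left.smooth v (hsub hv), fun q hq => ?_⟩
      exact hp'.compare (hf q hq.2.1.2) hv hρ hq.1 (hO q hq.2.1.2) hq.2
  have hkm : codim ρ + (n - (codim (ρ.filter (· ≤ v₀)) + codim (ρ.filter (v₀ ≤ ·)))) = n := by
    rw [codim_filter_add hv]
    omega
  obtain ⟨oM, hoM⟩ := hA.exists_orientation hkm oQ
  refine ⟨oM, fun q κ' O' f' g' hf' hq' Ω hΩ => ?_, fun q hq => hA.finrank hkm hq⟩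
  obtain ⟨B, hB, hBA⟩ := (hf q q.2.1.2).compare hf' hv hρ (hO q q.2.1.2) hq' q.2
  exact (hoM q q.2.1.2 Ω hΩ).matrix_mul B hB hBA

/-- The normal coordinates of an intersection of cells, in terms of those of the two cells. -/
theorem PairModel.cooriented (h : PairModel n D₀ D₁ κ O f g) (hv : v₀ ∈ ρ)
    {o : DualCellOrientation n D₀ (ρ.filter (· ≤ v₀))}
    (ho : DualOriented oQ (filter_le_nonempty hv) o)
    {o' : DualCellOrientation n D₁ (ρ.filter (v₀ ≤ ·))}
    (ho' : DualOriented oQ (filter_ge_nonempty hv) o') {p : Q} (hp : p ∈ O)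
    (hps : p ∈ openCell n D₀ (ρ.filter (· ≤ v₀)) ∩ openCell n D₁ (ρ.filter (v₀ ≤ ·)))
    {Ω : TangentSpace (𝓡∂ n) p [⋀^Fin n]→ₗ[ℝ] ℝ}
    (hΩ : Represents (oQ.at' ⟨p, hps.1.2⟩) Ω) :
    Cooriented (der n (modelY f _ (filter_le_nonempty hv)) p).toLinearMap Ω (o.at' ⟨p, hps.1⟩) ∧
    Cooriented (der n (modelY f _ (filter_ge_nonempty hv)) p).toLinearMap Ω (o'.at' ⟨p, hps.2⟩) ∧
    tangentAt n (dualCell D₀ (ρ.filter (· ≤ v₀))) p =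
      LinearMap.ker (der n (modelY f _ (filter_le_nonempty hv)) p).toLinearMap ∧
    tangentAt n (dualCell D₁ (ρ.filter (v₀ ≤ ·))) p =
      LinearMap.ker (der n (modelY f _ (filter_ge_nonempty hv)) p).toLinearMap := by
  have hsub := h.subset hp hps
  have hge : der n (modelY (fun v q => f v q - g v) _ (filter_ge_nonempty hv)) p =
      der n (modelY f _ (filter_ge_nonempty hv)) p :=
    der_modelY_sub_const _ (fun v hv => h.left.mdifferentiableAt hp
      (hsub (Finset.mem_filter.1 hv).1)) g
  refine ⟨ho.cooriented h.left ⟨p, hps.1⟩ hp hΩ, ?_,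
    h.left.tangentAt_eq_of_stratum _ hp hps.1, ?_⟩
  · rw [← hge]
    exact ho'.cooriented h.right ⟨p, hps.2⟩ hp hΩ
  · rw [← hge]
    exact h.right.tangentAt_eq_of_stratum _ hp hps.2

theorem ker_der_modelY_le {σ : Finset V} (hρ : ρ.Nonempty) (hσ : σ.Nonempty) (hs : σ ⊆ ρ) {q : Q}
    (hf : ∀ v ∈ ρ, MDifferentiableAt (𝓡∂ n) 𝓘(ℝ, ℝ) (f v) q) {w : TangentSpace (𝓡∂ n) q}
    (hw : der n (modelY f ρ hρ) q w = 0) : der n (modelY f σ hσ) q w = 0 :=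
  (mem_ker_der_modelY_iff hσ (fun v hv => hf v (hs hv)) w).2 fun u hu v hv =>
    (mem_ker_der_modelY_iff hρ hf w).1 hw u (hs hu) v (hs hv)

theorem ker_inf_ker_le (hv : v₀ ∈ ρ) (hρ : ρ.Nonempty) {q : Q}
    (hf : ∀ v ∈ ρ, MDifferentiableAt (𝓡∂ n) 𝓘(ℝ, ℝ) (f v) q) {w : TangentSpace (𝓡∂ n) q}
    (hw : der n (modelY f _ (filter_le_nonempty hv)) q w = 0)
    (hw' : der n (modelY f _ (filter_ge_nonempty hv)) q w = 0) :
    der n (modelY f ρ hρ) q w = 0 := by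
  have h1 := (mem_ker_der_modelY_iff _ (fun v hv => hf v (Finset.mem_filter.1 hv).1) w).1 hw
  have h2 := (mem_ker_der_modelY_iff _ (fun v hv => hf v (Finset.mem_filter.1 hv).1) w).1 hw'
  have key : ∀ u ∈ ρ, der n (f u) q w = der n (f v₀) q w := by
    intro u hu
    rcases le_total u v₀ with h | h
    · exact h1 u (Finset.mem_filter.2 ⟨hu, h⟩) v₀ (Finset.mem_filter.2 ⟨hv, le_rfl⟩)
    · exact h2 u (Finset.mem_filter.2 ⟨hu, h⟩) v₀ (Finset.mem_filter.2 ⟨hv, le_rfl⟩)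
  exact (mem_ker_der_modelY_iff hρ hf w).2 fun u hu v hv => (key u hu).trans (key v hv).symm

theorem frameMatrix_det_catFrame (hv : v₀ ∈ ρ) (hρ : ρ.Nonempty) {q : Q}
    (hf : ∀ v ∈ ρ, MDifferentiableAt (𝓡∂ n) 𝓘(ℝ, ℝ) (f v) q) (a b : ℕ → TangentSpace (𝓡∂ n) q)
    (hb : ∀ j < codim (ρ.filter (v₀ ≤ ·)),
      der n (modelY f _ (filter_le_nonempty hv)) q (b j) = 0) :
    (frameMatrix (der n (modelY f ρ hρ) q).toLinearMap
      (catFrame (codim (ρ.filter (· ≤ v₀))) a b)).det =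
      (frameMatrix (der n (modelY f _ (filter_le_nonempty hv)) q).toLinearMap a).det *
      (frameMatrix (der n (modelY f _ (filter_ge_nonempty hv)) q).toLinearMap b).det := by
  have h1 : ∀ j, catFrame (codim (ρ.filter (· ≤ v₀))) a b (codim (ρ.filter (· ≤ v₀)) + j) = b j :=
    fun j => by simp [catFrame]
  rw [frameMatrix_det_filter hv hρ hf _ fun j hj => by rw [h1]; exact hb j hj]
  rw [frameMatrix_congr (A := (der n (modelY f _ (filter_le_nonempty hv)) q).toLinearMap)
    (a := catFrame (codim (ρ.filter (· ≤ v₀))) a b) (b := a) fun i hi => if_pos hi]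
  simp only [h1]

/-- Multiply the three positivity statements, for `(b, t)`, `(a, t)` and `(b, a, t)`. The form on
`(b, a, t)` occurs squared, and there remains the positivity of `s * s' * sQ` times the determinants
of the two normal frames times the form on `(a, b, t)`. The product of the determinants is that of
the normal frame `(a, b)` of the intersection. -/
theorem IsMeetOrientation.eq (h₀ : IsRegularSubdivision P D₀)
    (hcov : ∀ q ∈ (𝓡∂ n).interior Q, ∃ κ O f g, q ∈ O ∧ PairModel n D₀ D₁ κ O f g)
    (hρP : ρ ∈ P.complex.faces) (hv : v₀ ∈ ρ) (hρ : ρ.Nonempty)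
    {o : DualCellOrientation n D₀ (ρ.filter (· ≤ v₀))}
    (ho : DualOriented oQ (filter_le_nonempty hv) o)
    {o' : DualCellOrientation n D₁ (ρ.filter (v₀ ≤ ·))}
    (ho' : DualOriented oQ (filter_ge_nonempty hv) o')
    {oM₀ oM : MeetOrientation n D₀ D₁ (ρ.filter (· ≤ v₀)) (ρ.filter (v₀ ≤ ·))}
    (hM₀ : MeetOriented oQ hρ oM₀) (hM : IsMeetOrientation oQ o o' oM) : oM = oM₀ := by
  refine CellOrientation.ext' fun p => ?_
  obtain ⟨a, b, t, s, s', sQ, h1, h2, h3, h4⟩ := hM p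
  obtain ⟨κ, O, f, g, hpO, hf⟩ := hcov p p.2.1.2
  obtain ⟨Ω, hΩ0, hΩ⟩ := exists_represents_at oQ p.2.1.2
  have hsub := hf.subset hpO p.2
  have hfd : ∀ v ∈ ρ, MDifferentiableAt (𝓡∂ n) 𝓘(ℝ, ℝ) (f v) p.1 := fun v hv =>
    hf.left.mdifferentiableAt hpO (hsub hv)
  obtain ⟨c1, c2, k1, k2⟩ := hf.cooriented hv ho ho' hpO p.2 hΩ
  have hkk := codim_filter_add hv
  have hle := h₀.codim_le hρP
  have hY : 0 < ((sQ : ℤ) : ℝ) * Ω fun i => catFrame (codim (ρ.filter (v₀ ≤ ·))) b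
      (catFrame (codim (ρ.filter (· ≤ v₀))) a t) i := (hΩ _ sQ).1 h3
  have hY0 := right_ne_zero_of_mul hY.ne'
  have hX0 := (form_catFrame_swap (by omega) Ω a b t).2 hY0
  have m1 : ∀ i < n - codim (ρ.filter (· ≤ v₀)), der n (modelY f _ (filter_le_nonempty hv)) p.1
      (catFrame (codim (ρ.filter (v₀ ≤ ·))) b t i) = 0 := fun i hi => by
    have := HasSign.mem h1 hi
    rw [k1] at this
    exact this
  have m2 : ∀ i < n - codim (ρ.filter (v₀ ≤ ·)), der n (modelY f _ (filter_ge_nonempty hv)) p.1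
      (catFrame (codim (ρ.filter (· ≤ v₀))) a t i) = 0 := fun i hi => by
    have := HasSign.mem h2 hi
    rw [k2] at this
    exact this
  have hs1 := hf.left.surjective_of_subset (filter_le_nonempty hv)
    ((Finset.filter_subset _ _).trans hsub) hpO
  have hs2 := hf.left.surjective_of_subset (filter_ge_nonempty hv)
    ((Finset.filter_subset _ _).trans hsub) hpO
  have hα := frameMatrix_det_ne_zero (finrank_tangentSpace p.1)
    (A := (der n (modelY f _ (filter_le_nonempty hv)) p.1).toLinearMap)
    (m := n - codim (ρ.filter (· ≤ v₀))) (by omega) hs1 m1 hX0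
  have hβ := frameMatrix_det_ne_zero (finrank_tangentSpace p.1)
    (A := (der n (modelY f _ (filter_ge_nonempty hv)) p.1).toLinearMap)
    (m := n - codim (ρ.filter (v₀ ≤ ·))) (by omega) hs2 m2 hY0
  have hb : ∀ j < codim (ρ.filter (v₀ ≤ ·)),
      der n (modelY f _ (filter_le_nonempty hv)) p.1 (b j) = 0 := fun j hj => by
    have := m1 j (by omega)
    rwa [show catFrame (codim (ρ.filter (v₀ ≤ ·))) b t j = b j from if_pos hj] at this
  have ht : ∀ i < n - (codim (ρ.filter (· ≤ v₀)) + codim (ρ.filter (v₀ ≤ ·))),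
      der n (modelY f ρ hρ) p.1 (t i) = 0 := fun i hi => by
    refine ker_inf_ker_le hv hρ hfd ?_ ?_
    · have := m1 (codim (ρ.filter (v₀ ≤ ·)) + i) (by omega)
      simpa [catFrame] using this
    · have := m2 (codim (ρ.filter (· ≤ v₀)) + i) (by omega)
      simpa [catFrame] using this
  have hdet := frameMatrix_det_catFrame hv hρ hfd a b hb
  have hX := ((c1 _ s a hα).1 h1).2
  have hY' := ((c2 _ s' b hβ).1 h2).2
  refine HasSign.orientation_eq h4 (((hM₀ p κ O f g hf hpO Ω hΩ) t _
    (catFrame (codim (ρ.filter (· ≤ v₀))) a b) (by rw [hdet]; exact mul_ne_zero hα hβ)).2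
    ⟨fun i hi => ?_, ?_⟩)
  · rw [hf.tangentAt_eq hv hρ hpO p.2]
    exact ht i hi
  · rw [hdet, ← hkk, catFrame_catFrame]
    push_cast
    have := mul_pos (mul_pos hX hY') hY
    have hsq := mul_self_pos.2 hY0
    refine pos_of_mul_pos_left (b := (Ω fun i => catFrame (codim (ρ.filter (v₀ ≤ ·))) b
      (catFrame (codim (ρ.filter (· ≤ v₀))) a t) i) * (Ω fun i => catFrame
      (codim (ρ.filter (v₀ ≤ ·))) b (catFrame (codim (ρ.filter (· ≤ v₀))) a t) i)) ?_ hsq.le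
    convert this using 1
    ring

/-- Normal frames of the two cells which are tangent to the other cell. -/
theorem PairModel.exists_frames (h : PairModel n D₀ D₁ κ O f g) (hv : v₀ ∈ ρ) (hsub : ρ ⊆ κ) {p : Q}
    (hp : p ∈ O) : ∃ a b : ℕ → TangentSpace (𝓡∂ n) p,
      (∀ i : Fin (codim (ρ.filter (· ≤ v₀))), der n (modelY f _ (filter_le_nonempty hv)) p (a i) =
        Pi.single i 1) ∧
      (∀ i : Fin (codim (ρ.filter (v₀ ≤ ·))), der n (modelY f _ (filter_ge_nonempty hv)) p (b i) =
        Pi.single i 1) ∧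
      (∀ i, der n (modelY f _ (filter_ge_nonempty hv)) p (a i) = 0) ∧
      (∀ i, der n (modelY f _ (filter_le_nonempty hv)) p (b i) = 0) := by
  have key : ∀ (σ τ : Finset V) (hσ : σ.Nonempty) (hτ : τ.Nonempty), σ ⊆ ρ → τ ⊆ ρ →
      (∀ u ∈ σ, u ∈ τ → u = v₀) → v₀ ∈ σ → v₀ ∈ τ → ∀ z : Fin (codim σ) → ℝ,
      ∃ w : TangentSpace (𝓡∂ n) p, der n (modelY f σ hσ) p w = z ∧
        der n (modelY f τ hτ) p w = 0 := by
    intro σ τ hσ hτ hσρ hτρ hστ hvσ hvτ z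
    -- The two faces share only the vertex `v₀`, so the values prescribed on `σ` can be continued to
    -- `τ` by the constant value at `v₀`.
    obtain ⟨w, hw⟩ := h.left.surj p hp fun u => if u ∈ σ then homog σ z u else homog σ z v₀
    refine ⟨w, ?_, ?_⟩
    · funext i
      rw [der_modelY hσ fun v hv => h.left.mdifferentiableAt hp (hsub (hσρ hv)),
        hw _ (hsub (hσρ (vtx_mem hσ 0))) _ (hsub (hσρ (vtx_mem hσ i.succ))), if_pos (vtx_mem hσ _),
        if_pos (vtx_mem hσ _), homog_vtx, homog_vtx, Fin.cons_succ, Fin.cons_zero, sub_zero]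
    · refine (mem_ker_der_modelY_iff hτ (fun v hv => h.left.mdifferentiableAt hp
        (hsub (hτρ hv))) w).2 fun u hu v hv => ?_
      have hc : ∀ u ∈ τ, (if u ∈ σ then homog σ z u else homog σ z v₀) = homog σ z v₀ := by
        intro u hu
        by_cases huσ : u ∈ σ
        · rw [if_pos huσ, hστ u huσ hu]
        · rw [if_neg huσ]
      have := hw v (hsub (hτρ hv)) u (hsub (hτρ hu))
      rw [hc u hu, hc v hv, sub_self] at this
      exact sub_eq_zero.1 this
  have hvlo : v₀ ∈ ρ.filter (· ≤ v₀) := Finset.mem_filter.2 ⟨hv, le_rfl⟩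
  have hvhi : v₀ ∈ ρ.filter (v₀ ≤ ·) := Finset.mem_filter.2 ⟨hv, le_rfl⟩
  choose a ha ha' using key _ _ (filter_le_nonempty hv) (filter_ge_nonempty hv)
    (Finset.filter_subset _ _) (Finset.filter_subset _ _) (fun u hu hu' =>
      le_antisymm (Finset.mem_filter.1 hu).2 (Finset.mem_filter.1 hu').2) hvlo hvhi
  choose b hb hb' using key _ _ (filter_ge_nonempty hv) (filter_le_nonempty hv)
    (Finset.filter_subset _ _) (Finset.filter_subset _ _) (fun u hu hu' =>
      le_antisymm (Finset.mem_filter.1 hu').2 (Finset.mem_filter.1 hu).2) hvhi hvlo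
  refine ⟨fun i => if hi : i < codim (ρ.filter (· ≤ v₀)) then a (Pi.single ⟨i, hi⟩ 1) else 0,
    fun i => if hi : i < codim (ρ.filter (v₀ ≤ ·)) then b (Pi.single ⟨i, hi⟩ 1) else 0,
    fun i => ?_, fun i => ?_, fun i => ?_, fun i => ?_⟩
  · beta_reduce
    rw [dif_pos i.2]
    exact ha _
  · beta_reduce
    rw [dif_pos i.2]
    exact hb _
  · beta_reduce
    split_ifs
    · exact ha' _
    · exact map_zero _
  · beta_reduce
    split_ifs
    · exact hb' _
    · exact map_zero _

theorem exists_unit_pos {x : ℝ} (hx : x ≠ 0) : ∃ s : ℤˣ, 0 < ((s : ℤ) : ℝ) * x := by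
  rcases lt_or_gt_of_ne hx with h | h
  · exact ⟨-1, by push_cast; linarith⟩
  · exact ⟨1, by push_cast; linarith⟩

/-- Take normal frames of the two cells which are dual to their coordinates and tangent to the other
cell. All determinants are then `1`. The sign of `(a, t)` equals that of `(b, a, t)`, so they cancel
and leave the sign of `(a, b, t)`, which is the orientation given by `MeetOriented`. -/
theorem MeetOriented.isMeetOrientation (h₀ : IsRegularSubdivision P D₀)
    (hcov : ∀ q ∈ (𝓡∂ n).interior Q, ∃ κ O f g, q ∈ O ∧ PairModel n D₀ D₁ κ O f g)
    (hρP : ρ ∈ P.complex.faces) (hv : v₀ ∈ ρ) (hρ : ρ.Nonempty)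
    {o : DualCellOrientation n D₀ (ρ.filter (· ≤ v₀))}
    (ho : DualOriented oQ (filter_le_nonempty hv) o)
    {o' : DualCellOrientation n D₁ (ρ.filter (v₀ ≤ ·))}
    (ho' : DualOriented oQ (filter_ge_nonempty hv) o')
    {oM : MeetOrientation n D₀ D₁ (ρ.filter (· ≤ v₀)) (ρ.filter (v₀ ≤ ·))}
    (hM : MeetOriented oQ hρ oM) (hrank : ∀ q ∈ openCell n D₀ (ρ.filter (· ≤ v₀)) ∩
        openCell n D₁ (ρ.filter (v₀ ≤ ·)), Module.finrank ℝ (tangentAt n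
          (dualCell D₀ (ρ.filter (· ≤ v₀)) ∩ dualCell D₁ (ρ.filter (v₀ ≤ ·))) q) =
          n - (codim (ρ.filter (· ≤ v₀)) + codim (ρ.filter (v₀ ≤ ·)))) :
    IsMeetOrientation oQ o o' oM := by
  intro p
  obtain ⟨κ, O, f, g, hpO, hf⟩ := hcov p p.2.1.2
  obtain ⟨Ω, hΩ0, hΩ⟩ := exists_represents_at oQ p.2.1.2
  have hsub := hf.subset hpO p.2
  have hfd : ∀ v ∈ ρ, MDifferentiableAt (𝓡∂ n) 𝓘(ℝ, ℝ) (f v) p.1 := fun v hv =>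
    hf.left.mdifferentiableAt hpO (hsub hv)
  obtain ⟨c1, c2, k1, k2⟩ := hf.cooriented hv ho ho' hpO p.2 hΩ
  have hkk := codim_filter_add hv
  have hle := h₀.codim_le hρP
  obtain ⟨t, s₀, hts⟩ := exists_hasSign (hrank p p.2) (oM.at' p)
  obtain ⟨a, b, ha, hb, ha', hb'⟩ := hf.exists_frames hv hsub hpO
  have hma := frameMatrix_eq_one
    (A := (der n (modelY f _ (filter_le_nonempty hv)) p.1).toLinearMap) ha
  have hmb := frameMatrix_eq_one
    (A := (der n (modelY f _ (filter_ge_nonempty hv)) p.1).toLinearMap) hb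
  have hdet := frameMatrix_det_catFrame hv hρ hfd a b fun j _ => hb' j
  rw [hma, hmb, Matrix.det_one, Matrix.det_one, mul_one] at hdet
  have ht : ∀ i < n - (codim (ρ.filter (· ≤ v₀)) + codim (ρ.filter (v₀ ≤ ·))),
      der n (modelY f ρ hρ) p.1 (t i) = 0 := fun i hi => by
    have := HasSign.mem hts hi
    rw [hf.tangentAt_eq hv hρ hpO p.2] at this
    exact this
  have hcM := hM p κ O f g hf hpO Ω hΩ
  have hX := ((hcM t s₀ (catFrame (codim (ρ.filter (· ≤ v₀))) a b)
    (by rw [hdet]; exact one_ne_zero)).1 hts).2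
  rw [hdet, one_mul, ← hkk, catFrame_catFrame] at hX
  have hX0 := right_ne_zero_of_mul hX.ne'
  have hY0 := (form_catFrame_swap (by omega) Ω a b t).1 hX0
  obtain ⟨s, hs⟩ := exists_unit_pos hX0
  obtain ⟨s', hs'⟩ := exists_unit_pos hY0
  refine ⟨a, b, t, s, s', s', ?_, ?_, (hΩ _ s').2 hs', ?_⟩
  · refine (c1 _ s a (by rw [hma]; simp)).2 ⟨fun i hi => ?_, by rwa [hma, Matrix.det_one, one_mul]⟩
    rw [k1]
    change der n _ p.1 _ = 0
    simp only [catFrame]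
    split_ifs
    · exact hb' _
    · exact ker_der_modelY_le hρ _ (Finset.filter_subset _ _) hfd (ht _ (by omega))
  · refine (c2 _ s' b (by rw [hmb]; simp)).2
      ⟨fun i hi => ?_, by rwa [hmb, Matrix.det_one, one_mul]⟩
    rw [k2]
    change der n _ p.1 _ = 0
    simp only [catFrame]
    split_ifs
    · exact ha' _
    · exact ker_der_modelY_le hρ _ (Finset.filter_subset _ _) hfd (ht _ (by omega))
  · refine (hcM t _ (catFrame (codim (ρ.filter (· ≤ v₀))) a b)
      (by rw [hdet]; exact one_ne_zero)).2 ⟨fun i hi => HasSign.mem hts hi, ?_⟩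
    rw [hdet, one_mul, ← hkk, catFrame_catFrame, mul_assoc s s' s', facetSign_sq, mul_one]
    exact hs

theorem IsMeetOrientation.neg_left {σ τ : Finset V} {o : DualCellOrientation n D₀ σ}
    {o' : DualCellOrientation n D₁ τ} {oM : MeetOrientation n D₀ D₁ σ τ}
    (h : IsMeetOrientation oQ o o' oM) : IsMeetOrientation oQ (-o) o' (-oM) := by
  intro p
  obtain ⟨a, b, t, s, s', sQ, h1, h2, h3, h4⟩ := h p
  refine ⟨a, b, t, -s, s', sQ, h1.neg, h2, h3, ?_⟩
  rw [neg_mul, neg_mul]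
  exact h4.neg

theorem intersectionProduct_of_nonempty {σ τ : P.complex.faces}
    (h : Nonempty (DualCellOrientation n D₀ σ.1)) (c : CellularChain P D₀) (c' : CellularChain P D₁)
    (oM : MeetOrientation n D₀ D₁ σ.1 τ.1) : (intersectionProduct oQ c c' σ τ).1 oM =
      (c σ).1 h.some * ∑ᶠ (o' : DualCellOrientation n D₁ τ.1)
        (_ : IsMeetOrientation oQ h.some o' oM), (c' τ).1 o' :=
  dif_pos h

/-- Replacing the orientation of the first cell by its opposite changes two signs, so the arbitrary
choice in `intersectionProduct` is harmless. The intersection of two cells is not assumed connected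
and may have more than two orientations; those other than `oM` and `-oM` carry the coefficient `0`.
-/
theorem intersectionProduct_eq {σ τ : P.complex.faces} {o : DualCellOrientation n D₀ σ.1}
    (hall : ∀ o₁, o₁ = o ∨ o₁ = -o) {o' : DualCellOrientation n D₁ τ.1}
    (hall' : ∀ o₂, o₂ = o' ∨ o₂ = -o') {oM : MeetOrientation n D₀ D₁ σ.1 τ.1}
    (hmeet : IsMeetOrientation oQ o o' oM)
    (heq : ∀ oM', IsMeetOrientation oQ o o' oM' → oM' = oM) (hne : oM ≠ -oM)
    (c : CellularChain P D₀) (c' : CellularChain P D₁) :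
    (intersectionProduct oQ c c' σ τ).1 oM = (c σ).1 o * (c' τ).1 o' ∧
      ∀ oM', oM' ≠ oM → oM' ≠ -oM → (intersectionProduct oQ c c' σ τ).1 oM' = 0 := by
  have hnl : ∀ {o₁ : DualCellOrientation n D₀ σ.1} {o₂ : DualCellOrientation n D₁ τ.1} {oM'},
      IsMeetOrientation oQ (-o₁) o₂ oM' → IsMeetOrientation oQ o₁ o₂ (-oM') := fun h => by
    have := h.neg_left
    rwa [neg_neg] at this
  have hnr : ∀ {o₁ : DualCellOrientation n D₀ σ.1} {o₂ : DualCellOrientation n D₁ τ.1} {oM'},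
      IsMeetOrientation oQ o₁ (-o₂) oM' → IsMeetOrientation oQ o₁ o₂ (-oM') := fun h => by
    have := h.neg
    rwa [neg_neg] at this
  have hnon : Nonempty (DualCellOrientation n D₀ σ.1) := ⟨o⟩
  have h1u : (1 : ℤˣ) ≠ -1 := by decide
  refine ⟨?_, fun oM' h1 h2 => ?_⟩
  · rw [intersectionProduct_of_nonempty hnon]
    rcases hall hnon.some with e | e
    · rw [e, finsum_orientation hall' (e := 1) ⟨fun _ => rfl, fun _ => hmeet⟩
        ⟨fun h => absurd (heq _ (hnr h)).symm hne, fun h => absurd h h1u⟩, Units.val_one, one_mul]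
    · have hmm : IsMeetOrientation oQ (-o) (-o') oM := by
        have := hmeet.neg_left.neg
        rwa [neg_neg] at this
      rw [e, finsum_orientation hall' (e := -1)
        ⟨fun h => absurd (heq _ (hnl h)).symm hne, fun h => absurd h.symm h1u⟩
        ⟨fun _ => rfl, fun _ => hmm⟩, (c σ).2 o, Units.val_neg, Units.val_one, neg_one_mul,
        neg_mul_neg]
  · rw [intersectionProduct_of_nonempty hnon]
    have hz : ∀ (o₁ : DualCellOrientation n D₀ σ.1) (o₂ : DualCellOrientation n D₁ τ.1),
        ¬IsMeetOrientation oQ o₁ o₂ oM' := by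
      intro o₁ o₂ h
      rcases hall o₁ with rfl | rfl <;> rcases hall' o₂ with rfl | rfl
      · exact h1 (heq _ h)
      · exact h2 (neg_eq_iff_eq_neg.1 (heq _ (hnr h)))
      · exact h2 (neg_eq_iff_eq_neg.1 (heq _ (hnl h)))
      · have := heq _ (hnr (hnl h))
        rw [neg_neg] at this
        exact h1 this
    rw [finsum_eq_zero_of_forall_eq_zero, mul_zero]
    intro o₂
    classical
    rw [finsum_eq_if, if_neg (hz _ _)]

/-- The value of the intersection product on a cell of the common subdivision. -/
theorem intersectionProduct_apply (h₀ : IsRegularSubdivision P D₀) (h₁ : IsRegularSubdivision P D₁)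
    (hcov : ∀ q ∈ (𝓡∂ n).interior Q, ∃ κ O f g, q ∈ O ∧ PairModel n D₀ D₁ κ O f g)
    (hρP : ρ ∈ P.complex.faces) (hv : v₀ ∈ ρ) (hlo : ρ.filter (· ≤ v₀) ∈ P.complex.faces)
    (hhi : ρ.filter (v₀ ≤ ·) ∈ P.complex.faces)
    (hM : (openCell n D₀ (ρ.filter (· ≤ v₀)) ∩ openCell n D₁ (ρ.filter (v₀ ≤ ·))).Nonempty)
    (c : CellularChain P D₀) (c' : CellularChain P D₁) :
    ∃ oM : MeetOrientation n D₀ D₁ (ρ.filter (· ≤ v₀)) (ρ.filter (v₀ ≤ ·)),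
      MeetOriented oQ (P.nonempty_of_mem hρP) oM ∧
      (∀ q ∈ openCell n D₀ (ρ.filter (· ≤ v₀)) ∩
        openCell n D₁ (ρ.filter (v₀ ≤ ·)), Module.finrank ℝ (tangentAt n
          (dualCell D₀ (ρ.filter (· ≤ v₀)) ∩ dualCell D₁ (ρ.filter (v₀ ≤ ·))) q) =
          n - (codim (ρ.filter (· ≤ v₀)) + codim (ρ.filter (v₀ ≤ ·)))) ∧
      (intersectionProduct oQ c c' ⟨_, hlo⟩ ⟨_, hhi⟩).1 oM =
        dualCochain oQ c ⟨_, hlo⟩ * dualCochain oQ c' ⟨_, hhi⟩ ∧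
      ∀ oM', oM' ≠ oM → oM' ≠ -oM →
        (intersectionProduct oQ c c' ⟨_, hlo⟩ ⟨_, hhi⟩).1 oM' = 0 := by
  have hρ := P.nonempty_of_mem hρP
  obtain ⟨oM, hoM, hrank⟩ := exists_meetOriented hcov hv hρ (h₀.codim_le hρP) oQ
  obtain ⟨o, ho, hall⟩ := h₀.exists_dualOriented hlo oQ
  obtain ⟨o', ho', hall'⟩ := h₁.exists_dualOriented hhi oQ
  have hmeet := MeetOriented.isMeetOrientation h₀ hcov hρP hv hρ ho ho' hoM hrank
  obtain ⟨h1, h2⟩ := intersectionProduct_eq (σ := ⟨_, hlo⟩) (τ := ⟨_, hhi⟩) hall hall' hmeet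
    (fun oM' h => IsMeetOrientation.eq h₀ hcov hρP hv hρ ho ho' hoM h) (oM.ne_neg hM) c c'
  exact ⟨oM, hoM, hrank, h1.trans (congrArg₂ (· * ·) (h₀.dualCochain_apply c ⟨_, hlo⟩ ho).symm
    (h₁.dualCochain_apply c' ⟨_, hhi⟩ ho').symm), h2⟩

end Meet

end

/-! ### The collapse of an intersection and the cup product. -/

noncomputable section

section Collapse

variable {n : ℕ} [NeZero n] {Q : Type u} [MetricSpace Q] [ChartedSpace (EuclideanHalfSpace n) Q]
  [IsManifold (𝓡∂ n) ∞ Q] {V : Type v} [Fintype V] [LinearOrder V]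
  {oQ : CellOrientation n (univ : Set Q) ((𝓡∂ n).interior Q) n}
  {P : SmoothTriangulation n Q V} {D D₀ D₁ : V → Set Q} {κ ρ : Finset V} {v₀ : V} {ε : ℝ}

theorem SimplicialPosition.exists_pairModel (h : SimplicialPosition P ε D D₀ D₁)
    (hD : IsRegularSubdivision P D) : ∀ q ∈ (𝓡∂ n).interior Q, ∃ κ O f g, q ∈ O ∧
      PairModel n D₀ D₁ κ O f g := by
  intro q hq
  obtain ⟨c, -, hc⟩ := h
  obtain ⟨κ, hκ⟩ := mem_iUnion.1 (hc.symm ▸ mem_univ q : q ∈ ⋃ κ, (c κ).source)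
  exact ⟨κ.1, (c κ).source ∩ (𝓡∂ n).interior Q, _, _, ⟨hκ, hq⟩, (c κ).pairModel hD κ.2⟩

theorem SimplicialChart.der_modelY_eq (c : SimplicialChart n D D₀ D₁ κ) (hκ : κ.Nonempty)
    (hρ : ρ.Nonempty) (hsub : ρ ⊆ κ) {p p' : Q} (hp : p ∈ c.source) (hp' : p' ∈ c.source)
    {w : TangentSpace (𝓡∂ n) p} {w' : TangentSpace (𝓡∂ n) p'}
    (h : der n c.coord p w = der n c.coord p' w') :
    der n (modelY (fun v q => homog κ (c.coord q) v) ρ hρ) p w =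
      der n (modelY (fun v q => homog κ (c.coord q) v) ρ hρ) p' w' := by
  have hd : ∀ q ∈ c.source, ∀ v ∈ ρ,
      MDifferentiableAt (𝓡∂ n) 𝓘(ℝ, ℝ) (fun q => homog κ (c.coord q) v) q := fun q hq v hv =>
    ((contMDiffOn_homog hκ c.smooth_coord (hsub hv)).contMDiffAt
      (c.isOpen_source.mem_nhds hq)).mdifferentiableAt (by simp)
  funext i
  rw [der_modelY hρ (hd p hp), der_modelY hρ (hd p' hp'),
    der_homog_sub hκ c.smooth_coord c.isOpen_source hp (hsub (vtx_mem hρ _)) (hsub (vtx_mem hρ _)),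
    der_homog_sub hκ c.smooth_coord c.isOpen_source hp' (hsub (vtx_mem hρ _))
      (hsub (vtx_mem hρ _)), h]

/-- Translations in a chart take the orientation of the intersection of two cells to the
orientation of the cell dual to the simplex which they span. -/
theorem MeetOriented.translate (hD : IsRegularSubdivision P D) (h₁ : IsRegularSubdivision P D₁)
    (hκ : κ ∈ P.complex.faces) (c : SimplicialChart n D D₀ D₁ κ) (hρP : ρ ∈ P.complex.faces)
    (hv : v₀ ∈ ρ) {oM : MeetOrientation n D₀ D₁ (ρ.filter (· ≤ v₀)) (ρ.filter (v₀ ≤ ·))}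
    (hM : MeetOriented oQ (P.nonempty_of_mem hρP) oM) {o : DualCellOrientation n D₁ ρ}
    (ho : DualOriented oQ (P.nonempty_of_mem hρP) o)
    (p : (openCell n D₀ (ρ.filter (· ≤ v₀)) ∩ openCell n D₁ (ρ.filter (v₀ ≤ ·)) : Set Q))
    (p' : openCell n D₁ ρ) (hp : p.1 ∈ c.source) (hp' : p'.1 ∈ c.source)
    (hb : c.base p = c.base p') {t : ℕ → TangentSpace (𝓡∂ n) p.1}
    {t' : ℕ → TangentSpace (𝓡∂ n) p'.1} {s : ℤˣ} (hts : HasSign (oM.at' p) t s)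
    (ht₁ : ∀ i < n - codim ρ, mder n c.base p (t i) = mder n c.base p' (t' i))
    (ht₂ : ∀ i < n - codim ρ, der n c.coord p (t i) = der n c.coord p' (t' i)) :
    HasSign (o.at' p') t' s := by
  have hρ := P.nonempty_of_mem hρP
  have hκ' := P.nonempty_of_mem hκ
  have hf := c.pairModel hD hκ
  have hpO : p.1 ∈ c.source ∩ (𝓡∂ n).interior Q := ⟨hp, p.2.1.2⟩
  have hpO' : p'.1 ∈ c.source ∩ (𝓡∂ n).interior Q := ⟨hp', p'.2.2⟩
  have hsub := hf.subset hpO p.2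
  obtain ⟨Ω, hΩ0, hΩ⟩ := exists_represents_at oQ p.2.1.2
  obtain ⟨Ω', hΩ0', hΩ'⟩ := exists_represents_at oQ p'.2.2
  have hkk := codim_filter_add hv
  have hle := h₁.codim_le hρP
  set f : V → Q → ℝ := fun v q => homog κ (c.coord q) v with hfdef
  obtain ⟨a, ha⟩ := exists_dual_frame (A := (der n (modelY f ρ hρ) p.1).toLinearMap)
    (hf.left.surjective_of_subset hρ hsub hpO)
  -- The normal frame is translated together with the tangent frame, so that the sign of the full
  -- frame in `Q` can be compared by `SimplicialChart.translate_sign`.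
  choose a' ha₁ ha₂ using fun i => c.exists_translate hD hκ hp hp' p'.2.2 hb (a i)
  have ha' : ∀ i : Fin (codim ρ), (der n (modelY f ρ hρ) p'.1).toLinearMap (a' i) = Pi.single i 1 :=
    fun i => (c.der_modelY_eq hκ' hρ hsub hp hp' (ha₂ i)).symm.trans (ha i)
  have hm := frameMatrix_eq_one ha
  have hm' := frameMatrix_eq_one ha'
  have hpos := ((hM p κ _ f _ hf hpO Ω hΩ t s a (by rw [hm]; simp)).1 hts).2
  rw [hm, Matrix.det_one, one_mul] at hpos
  have hco : Cooriented (der n (modelY f ρ hρ) p'.1).toLinearMap Ω' (o.at' p') := by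
    have := ho.cooriented hf.right p' hpO' hΩ'
    rwa [der_modelY_sub_const hρ (fun v hv => hf.left.mdifferentiableAt hpO' (hsub hv))] at this
  have hker : tangentAt n (dualCell D₁ ρ) p'.1 =
      LinearMap.ker (der n (modelY f ρ hρ) p'.1).toLinearMap := by
    have := hf.right.tangentAt_eq_of_stratum hρ hpO' p'.2
    rwa [der_modelY_sub_const hρ (fun v hv => hf.left.mdifferentiableAt hpO' (hsub hv))] at this
  refine (hco t' s a' (by rw [hm']; simp)).2 ⟨fun i hi => ?_, ?_⟩
  · rw [hker]
    refine (c.der_modelY_eq hκ' hρ hsub hp hp' (ht₂ i hi)).symm.trans ?_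
    have := HasSign.mem hts (i := i) (by omega)
    rw [hf.tangentAt_eq hv hρ hpO p.2] at this
    exact this
  · rw [hm', Matrix.det_one, one_mul]
    refine c.translate_sign oQ hD hκ hp hp' p.2.1.2 p'.2.2 hb (X := catFrame (codim ρ) a t)
      (X' := catFrame (codim ρ) a' t') (fun i hi => ?_) (fun i hi => ?_) hΩ hΩ' hpos
    · simp only [catFrame]
      split_ifs
      · exact ha₁ _
      · exact ht₁ _ (by omega)
    · simp only [catFrame]
      split_ifs
      · exact ha₂ _
      · exact ht₂ _ (by omega)

theorem MeetOriented.isCollapseOrientation (hD : IsRegularSubdivision P D)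
    (h₁ : IsRegularSubdivision P D₁) (hρP : ρ ∈ P.complex.faces)
    (hv : v₀ ∈ ρ) {oM : MeetOrientation n D₀ D₁ (ρ.filter (· ≤ v₀)) (ρ.filter (v₀ ≤ ·))}
    (hM : MeetOriented oQ (P.nonempty_of_mem hρP) oM)
    (hrank : ∀ q ∈ openCell n D₀ (ρ.filter (· ≤ v₀)) ∩
        openCell n D₁ (ρ.filter (v₀ ≤ ·)), Module.finrank ℝ (tangentAt n
          (dualCell D₀ (ρ.filter (· ≤ v₀)) ∩ dualCell D₁ (ρ.filter (v₀ ≤ ·))) q) =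
          n - (codim (ρ.filter (· ≤ v₀)) + codim (ρ.filter (v₀ ≤ ·))))
    {o : DualCellOrientation n D₁ ρ} (ho : DualOriented oQ (P.nonempty_of_mem hρP) o) :
    IsCollapseOrientation D (P := P) oM o := by
  intro κ hκ c p p' hp hp' hb
  obtain ⟨t, s, hts⟩ := exists_hasSign (hrank p p.2) (oM.at' p)
  choose t' ht₁ ht₂ using fun i => c.exists_translate hD hκ hp hp' p'.2.2 hb (t i)
  refine ⟨t, t', s, hts, hM.translate hD h₁ hκ c hρP hv ho p p' hp hp' hb hts (fun i _ => ht₁ i)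
    (fun i _ => ht₂ i), fun i _ => ⟨(tangentMap_eq_iff hb _ _).2 (ht₁ i), ht₂ i⟩⟩

theorem HasSign.ne_neg {p : Q} {T : Submodule ℝ (TangentSpace (𝓡∂ n) p)} {m : ℕ}
    {o : Orientation ℝ T (Fin m)} {X : ℕ → TangentSpace (𝓡∂ n) p} {s : ℤˣ} (h : HasSign o X s) :
    ¬HasSign o X (-s) := fun h' => by
  have h2 := h'.neg
  rw [neg_neg] at h2
  exact orientation_ne_neg o (h.orientation_eq h2)

/-- `IsCollapseOrientation` quantifies over pairs of points in the same fibre of a chart, so it can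
exclude the wrong orientation only if such a pair exists; hence the points `p` and `p'`. -/
theorem MeetOriented.not_isCollapseOrientation_neg (hD : IsRegularSubdivision P D)
    (h₁ : IsRegularSubdivision P D₁) (hρP : ρ ∈ P.complex.faces) (hv : v₀ ∈ ρ)
    {oM : MeetOrientation n D₀ D₁ (ρ.filter (· ≤ v₀)) (ρ.filter (v₀ ≤ ·))}
    (hM : MeetOriented oQ (P.nonempty_of_mem hρP) oM)
    {o : DualCellOrientation n D₁ ρ} (ho : DualOriented oQ (P.nonempty_of_mem hρP) o)
    (c : SimplicialChart n D D₀ D₁ ρ)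
    (p : (openCell n D₀ (ρ.filter (· ≤ v₀)) ∩ openCell n D₁ (ρ.filter (v₀ ≤ ·)) : Set Q))
    (p' : openCell n D₁ ρ) (hp : p.1 ∈ c.source) (hp' : p'.1 ∈ c.source)
    (hb : c.base p = c.base p') : ¬IsCollapseOrientation D (P := P) (-oM) o := by
  intro h
  obtain ⟨t, t', s, h1, h2, h3⟩ := h ρ hρP c p p' hp hp' hb
  have h4 : HasSign (oM.at' p) t (-s) := by
    have := h1.neg
    rw [CellOrientation.neg_at, orientation_neg_neg] at this
    exact this
  exact HasSign.ne_neg h2 (hM.translate hD h₁ hρP c hρP hv ho p p' hp hp' hb h4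
    (fun i hi => (tangentMap_eq_iff hb _ _).1 (h3 i hi).1) fun i hi => (h3 i hi).2)

/-- In a chart near the cell dual to `ρ`, there are points of all the intersections of cells which
collapse to it. -/
theorem SimplicialChart.exists_meet (c : SimplicialChart n D D₀ D₁ ρ)
    (hD : IsRegularSubdivision P D) (hρP : ρ ∈ P.complex.faces) (hv : v₀ ∈ ρ) {b : Q}
    (hb : b ∈ c.base '' c.source) (hbi : b ∈ (𝓡∂ n).interior Q) :
    ∃ (p : (openCell n D₀ (ρ.filter (· ≤ v₀)) ∩ openCell n D₁ (ρ.filter (v₀ ≤ ·)) : Set Q))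
      (p' : openCell n D₁ ρ), p.1 ∈ c.source ∧ p'.1 ∈ c.source ∧ c.base p = c.base p' := by
  have hρ := P.nonempty_of_mem hρP
  have hf := c.pairModel hD hρP
  set g := homog ρ (modelShift (codim ρ) c.r) with hg
  obtain ⟨j, -, hj⟩ := c.exists_fibre hb
  have hinter : ∀ z, j z ∈ (𝓡∂ n).interior Q := fun z => by
    rw [← c.base_mem_interior_iff (hj z).1, (hj z).2.1]
    exact hbi
  have hmem : ∀ z, j z ∈ c.source ∩ (𝓡∂ n).interior Q := fun z => ⟨(hj z).1, hinter z⟩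
  -- Values of the homogeneous coordinates for which `h` is maximal exactly on the front face and `h
  -- - g` exactly on the back face.
  set h : V → ℝ := fun u => if u ≤ v₀ then 0 else g u - g v₀ with hh
  set z : Fin (codim ρ) → ℝ := modelY (Q := Unit) (fun v _ => h v) ρ hρ () with hz
  have hhom : ∀ u ∈ ρ, homog ρ z u = h u - h (vtx ρ hρ 0) := fun u hu =>
    homog_modelY (Q := Unit) (f := fun v _ => h v) hρ () hu
  have hlo : ∀ u, u ≤ v₀ → h u = 0 := fun u hu => if_pos hu
  have hhi : ∀ u, v₀ < u → h u = g u - g v₀ := fun u hu => if_neg (not_le.2 hu)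
  have hant : ∀ u ∈ ρ, ∀ v ∈ ρ, u < v → g v < g u := hf.anti
  have hneg : ∀ u ∈ ρ, v₀ < u → h u < 0 := fun u hu huv => by
    rw [hhi u huv]
    linarith [hant v₀ hv u hu huv]
  have hle : ∀ u ∈ ρ, h u ≤ 0 := fun u hu => by
    rcases le_or_gt u v₀ with h1 | h1
    · rw [hlo u h1]
    · exact (hneg u hu h1).le
  have hge : ∀ u ∈ ρ, v₀ ≤ u → h u - g u = -g v₀ := fun u hu huv => by
    rcases eq_or_lt_of_le huv with rfl | h1
    · rw [hlo v₀ le_rfl]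
      ring
    · rw [hhi u h1]
      ring
  have hlt : ∀ u ∈ ρ, u < v₀ → h u - g u < -g v₀ := fun u hu huv => by
    rw [hlo u huv.le]
    linarith [hant u hu v₀ hv huv]
  have hle' : ∀ u ∈ ρ, h u - g u ≤ -g v₀ := fun u hu => by
    rcases le_or_gt v₀ u with h1 | h1
    · exact (hge u hu h1).le
    · exact (hlt u hu h1).le
  -- The second point lies over the centre of `Π^d(r)`, where all the shifted functions agree.
  refine ⟨⟨j z, ⟨fun u => ?_, hinter z⟩, fun u => ?_, hinter z⟩,
    ⟨j (modelShift (codim ρ) c.r), fun u => ?_, hinter _⟩, (hj _).1, (hj _).1,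
    (hj _).2.1.trans (hj _).2.1.symm⟩
  · rw [hf.left.model _ (hmem z), Finset.mem_filter, (hj z).2.2]
    refine and_congr_right fun hu => ⟨fun h1 => ?_, fun h1 w hw => ?_⟩
    · by_contra h2
      have h3 := h1 v₀ hv
      rw [hhom v₀ hv, hhom u hu, hlo v₀ le_rfl] at h3
      linarith [hneg u hu (not_le.1 h2)]
    · rw [hhom w hw, hhom u hu, hlo u h1]
      linarith [hle w hw]
  · rw [hf.right.model _ (hmem z), Finset.mem_filter, (hj z).2.2]
    refine and_congr_right fun hu => ⟨fun h1 => ?_, fun h1 w hw => ?_⟩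
    · by_contra h2
      have h3 := h1 v₀ hv
      rw [hhom v₀ hv, hhom u hu] at h3
      linarith [hlt u hu (not_le.1 h2), hge v₀ hv le_rfl]
    · rw [hhom w hw, hhom u hu]
      linarith [hle' w hw, hge u hu h1]
  · rw [hf.right.model _ (hmem _), (hj _).2.2]
    exact ⟨fun h1 => h1.1, fun h1 => ⟨h1, fun w hw => by simp [hg]⟩⟩

theorem essentialPart_subset_openCell (hε : 0 < ε) {σ : Finset V} :
    essentialPart n ε D σ ⊆ openCell n D σ := by
  intro x hx
  by_contra h
  have := hx.2 x ⟨hx.1, h⟩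
  rw [dist_self] at this
  linarith

/-- An orientation of an empty cell is its own opposite, so its coefficient is its own negative.
This disposes of pairs of cells which do not meet. -/
theorem OrientationLine.apply_eq_zero_of_isEmpty {S S' : Set Q} {m : ℕ} (h : ¬S'.Nonempty)
    (e : OrientationLine n S S' m) (o : CellOrientation n S S' m) : e.1 o = 0 := by
  have h1 : -o = o := CellOrientation.ext' fun p => absurd ⟨p.1, p.2⟩ h
  have h2 := e.2 o
  rw [h1] at h2
  omega

/-- Counting vertices, the codimensions add up only if `σ` and `τ` have exactly one vertex in
common; by the ordering it is the last one of `σ` and the first one of `τ`. -/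
theorem exists_filter_of_union {σ τ : Finset V} (hσ : σ.Nonempty) (hτ : τ.Nonempty)
    (hle : ∀ s ∈ σ, ∀ t ∈ τ, s ≤ t) (hc : codim σ + codim τ = codim (σ ∪ τ)) :
    ∃ v ∈ σ ∪ τ, σ = (σ ∪ τ).filter (· ≤ v) ∧ τ = (σ ∪ τ).filter (v ≤ ·) := by
  have h1 := Finset.card_union_add_card_inter σ τ
  have h2 := card_eq_codim_add_one hσ
  have h3 := card_eq_codim_add_one hτ
  have h4 := card_eq_codim_add_one (hσ.mono (Finset.subset_union_left (s₂ := τ)))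
  have h5 : (σ ∩ τ).card = 1 := by omega
  obtain ⟨v, hv⟩ := Finset.card_eq_one.1 h5
  have hvm : v ∈ σ ∩ τ := hv ▸ Finset.mem_singleton_self v
  rw [Finset.mem_inter] at hvm
  refine ⟨v, Finset.mem_union_left _ hvm.1, ?_, ?_⟩
  · ext u
    rw [Finset.mem_filter, Finset.mem_union]
    refine ⟨fun h => ⟨Or.inl h, hle u h v hvm.2⟩, fun h => h.1.elim id fun h' => ?_⟩
    rw [le_antisymm h.2 (hle v hvm.1 u h')]
    exact hvm.1
  · ext u
    rw [Finset.mem_filter, Finset.mem_union]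
    refine ⟨fun h => ⟨Or.inr h, hle v hvm.1 u h⟩, fun h => h.1.elim (fun h' => ?_) id⟩
    rw [le_antisymm (hle u h' v hvm.2) h.2]
    exact hvm.2

theorem filter_union_filter (ρ : Finset V) (v : V) :
    ρ.filter (· ≤ v) ∪ ρ.filter (v ≤ ·) = ρ := by
  rw [← Finset.filter_or]
  exact Finset.filter_true_of_mem fun x _ => le_total x v

/-- The contribution of a pair of faces to the collapse of an intersection product. -/
theorem finsum_collapse_filter (hpos : SimplicialPosition P ε D D₀ D₁)
    (hD : IsRegularSubdivision P D) (h₀ : IsRegularSubdivision P D₀)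
    (h₁ : IsRegularSubdivision P D₁) (hε : 0 < ε) (hess : (essentialPart n ε D ρ).Nonempty)
    (hρP : ρ ∈ P.complex.faces) (hv : v₀ ∈ ρ)
    (hlo : ρ.filter (· ≤ v₀) ∈ P.complex.faces) (hhi : ρ.filter (v₀ ≤ ·) ∈ P.complex.faces)
    {o : DualCellOrientation n D₁ ρ} (ho : DualOriented oQ (P.nonempty_of_mem hρP) o)
    (c : CellularChain P D₀) (c' : CellularChain P D₁) :
    ∑ᶠ (oM : MeetOrientation n D₀ D₁ (ρ.filter (· ≤ v₀)) (ρ.filter (v₀ ≤ ·)))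
      (_ : ρ.filter (· ≤ v₀) ∪ ρ.filter (v₀ ≤ ·) = ρ ∧
        codim (ρ.filter (· ≤ v₀)) + codim (ρ.filter (v₀ ≤ ·)) = codim ρ ∧
        IsCollapseOrientation D (P := P) oM o),
      (intersectionProduct oQ c c' ⟨_, hlo⟩ ⟨_, hhi⟩).1 oM =
      dualCochain oQ c ⟨_, hlo⟩ * dualCochain oQ c' ⟨_, hhi⟩ := by
  classical
  have hcov := hpos.exists_pairModel hD
  obtain ⟨ch, hch, -⟩ := hpos
  obtain ⟨b, hb⟩ := hess
  obtain ⟨p, p', hp, hp', hbb⟩ := (ch ⟨ρ, hρP⟩).exists_meet hD hρP hv (hch ⟨ρ, hρP⟩ hb).2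
    (essentialPart_subset_openCell hε hb).2
  obtain ⟨oM, hoM, hrank, hval, hz⟩ := intersectionProduct_apply (oQ := oQ) h₀ h₁ hcov hρP hv hlo hhi
    ⟨p.1, p.2⟩ c c'
  rw [← hval]
  -- Only `oM` contributes: its opposite does not collapse to `o`, and any other orientation has
  -- coefficient `0` in the intersection product.
  refine (finsum_eq_single _ oM fun oM' hne => ?_).trans ?_
  · rw [finsum_eq_if, ite_eq_right_iff]
    intro hcol
    refine hz oM' hne ?_
    rintro rfl
    exact hoM.not_isCollapseOrientation_neg hD h₁ hρP hv ho (ch ⟨ρ, hρP⟩) p p' hp hp' hbb hcol.2.2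
  · rw [finsum_eq_if, if_pos ⟨filter_union_filter ρ v₀, codim_filter_add hv,
      hoM.isCollapseOrientation hD h₁ hρP hv hrank ho⟩]

/-- Intersection followed by collapse corresponds to the cup product. -/
theorem SimplicialPosition.dualCochain_collapse (hpos : SimplicialPosition P ε D D₀ D₁)
    (hD : IsRegularSubdivision P D) (h₀ : IsRegularSubdivision P D₀)
    (h₁ : IsRegularSubdivision P D₁) (hε : 0 < ε)
    (hess : ∀ σ ∈ P.complex.faces, (essentialPart n ε D σ).Nonempty)
    (c : CellularChain P D₀) (c' : CellularChain P D₁) :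
    dualCochain oQ (P := P) (collapse D (intersectionProduct oQ c c')) =
      cup (dualCochain oQ c) (dualCochain oQ c') := by
  classical
  funext ρ
  have : Fintype P.complex.faces := Fintype.ofFinite _
  obtain ⟨o, ho, -⟩ := h₁.exists_dualOriented ρ.2 oQ
  rw [h₁.dualCochain_apply _ ρ ho]
  change ∑ᶠ (σ : P.complex.faces) (τ : P.complex.faces),
    ∑ᶠ (oM : MeetOrientation n D₀ D₁ σ.1 τ.1) (_ : σ.1 ∪ τ.1 = ρ.1 ∧
      codim σ.1 + codim τ.1 = codim ρ.1 ∧ IsCollapseOrientation D (P := P) oM o),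
      (intersectionProduct oQ c c' σ τ).1 oM = _
  have hcov := hpos.exists_pairModel hD
  have hlo : ∀ {v}, v ∈ ρ.1 → ρ.1.filter (· ≤ v) ∈ P.complex.faces := fun hv =>
    P.mem_of_subset ρ.2 (Finset.filter_subset _ _) (filter_le_nonempty hv)
  have hhi : ∀ {v}, v ∈ ρ.1 → ρ.1.filter (v ≤ ·) ∈ P.complex.faces := fun hv =>
    P.mem_of_subset ρ.2 (Finset.filter_subset _ _) (filter_ge_nonempty hv)
  -- Pairs which are not a front and a back face contribute nothing: they span the wrong simplex,
  -- lose dimension, or do not meet, by `PairModel.le`.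
  have hterm := fun (σ τ : P.complex.faces)
      (h : ¬∃ v ∈ ρ.1, σ.1 = ρ.1.filter (· ≤ v) ∧ τ.1 = ρ.1.filter (v ≤ ·)) =>
    show ∑ᶠ (oM : MeetOrientation n D₀ D₁ σ.1 τ.1) (_ : σ.1 ∪ τ.1 = ρ.1 ∧
      codim σ.1 + codim τ.1 = codim ρ.1 ∧ IsCollapseOrientation D (P := P) oM o),
      (intersectionProduct oQ c c' σ τ).1 oM = 0 by
    refine finsum_eq_zero_of_forall_eq_zero fun oM => ?_
    rw [finsum_eq_if, ite_eq_right_iff]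
    intro hcol
    refine OrientationLine.apply_eq_zero_of_isEmpty (fun hM => h ?_) _ _
    obtain ⟨p, hp⟩ := hM
    obtain ⟨κ, O, f, g, hpO, hf⟩ := hcov p hp.1.2
    have := exists_filter_of_union (P.nonempty_of_mem σ.2) (P.nonempty_of_mem τ.2)
      (fun s hs t ht => hf.le hpO hp.1.1 hp.2.1 hs ht) (by rw [hcol.1]; exact hcol.2.1)
    rwa [hcol.1] at this
  set F : P.complex.faces → P.complex.faces → ℤ := fun σ τ =>
    ∑ᶠ (oM : MeetOrientation n D₀ D₁ σ.1 τ.1) (_ : σ.1 ∪ τ.1 = ρ.1 ∧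
      codim σ.1 + codim τ.1 = codim ρ.1 ∧ IsCollapseOrientation D (P := P) oM o),
      (intersectionProduct oQ c c' σ τ).1 oM with hF
  change ∑ᶠ (σ : P.complex.faces) (τ : P.complex.faces), F σ τ = _
  simp only [finsum_eq_sum_of_fintype]
  rw [← Finset.sum_product']
  unfold cup
  rw [← Finset.sum_attach ρ.1]
  -- The terms of the cup product, indexed by the vertex at which `ρ` is split, are identified with
  -- the remaining pairs of faces.
  refine (Finset.sum_of_injOn
    (fun v : {x // x ∈ ρ.1} => ((⟨_, hlo v.2⟩, ⟨_, hhi v.2⟩) : P.complex.faces × P.complex.faces))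
    ?_ (fun _ _ => by simp) (fun i _ hi => ?_) fun v _ => ?_).symm
  · intro v _ w _ hvw
    have h1 := congrArg Subtype.val (congrArg Prod.fst hvw)
    dsimp only at h1
    refine Subtype.ext (le_antisymm ?_ ?_)
    · exact (Finset.mem_filter.1 (h1 ▸ Finset.mem_filter.2 ⟨v.2, le_rfl⟩ :
        v.1 ∈ ρ.1.filter (· ≤ w.1))).2
    · exact (Finset.mem_filter.1 (h1 ▸ Finset.mem_filter.2 ⟨w.2, le_rfl⟩ :
        w.1 ∈ ρ.1.filter (· ≤ v.1))).2
  · refine hterm i.1 i.2 ?_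
    rintro ⟨v, hv, e1, e2⟩
    exact hi ⟨⟨v, hv⟩, by simp, Prod.ext (Subtype.ext e1.symm) (Subtype.ext e2.symm)⟩
  · rw [Cochain.eval_of_mem _ (hlo v.2), Cochain.eval_of_mem _ (hhi v.2)]
    exact (finsum_collapse_filter hpos hD h₀ h₁ hε (hess _ ρ.2) ρ.2 v.2 (hlo v.2) (hhi v.2)
      ho c c').symm

end Collapse

end

/-! ### Curves in the boundary of `Q`. -/

noncomputable section

section Boundary

variable {n : ℕ} [NeZero n] {Q : Type u} [MetricSpace Q] [ChartedSpace (EuclideanHalfSpace n) Q]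
  {F : Type*} [NormedAddCommGroup F] [NormedSpace ℝ F]

/-- The hyperplane which bounds the Euclidean half space. -/
def boundaryHyperplane (n : ℕ) [NeZero n] : Submodule ℝ (EuclideanSpace ℝ (Fin n)) :=
  LinearMap.ker (EuclideanSpace.proj (0 : Fin n) : EuclideanSpace ℝ (Fin n) →L[ℝ] ℝ).toLinearMap

theorem mem_boundaryHyperplane {x : EuclideanSpace ℝ (Fin n)} :
    x ∈ boundaryHyperplane n ↔ x 0 = 0 := Iff.rfl

theorem extChartAt_boundary {q : Q} (hq : q ∈ (𝓡∂ n).boundary Q) : extChartAt (𝓡∂ n) q q 0 = 0 := by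
  have h : extChartAt (𝓡∂ n) q q ∈ frontier (range (𝓡∂ n)) := hq
  rw [frontier_range_modelWithCornersEuclideanHalfSpace] at h
  exact h.symm

/-- The restriction of a function to the boundary hyperplane of a chart at a boundary point. -/
def onHyperplane (q : Q) (g : Q → F) (x : boundaryHyperplane n) : F :=
  g ((extChartAt (𝓡∂ n) q).symm (extChartAt (𝓡∂ n) q q + x))

theorem mapsTo_hyperplane {q : Q} (hq : q ∈ (𝓡∂ n).boundary Q) :
    MapsTo (fun x : boundaryHyperplane n =>
      extChartAt (𝓡∂ n) q q + (x : EuclideanSpace ℝ (Fin n))) univ (range (𝓡∂ n)) := by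
  intro x _
  rw [range_modelWithCornersEuclideanHalfSpace]
  have h1 := extChartAt_boundary hq
  have h2 := mem_boundaryHyperplane.1 x.2
  change 0 ≤ extChartAt (𝓡∂ n) q q 0 + (x : EuclideanSpace ℝ (Fin n)) 0
  rw [h1, h2, add_zero]

/-- At a boundary point a chart gives derivatives only within a half space. The bounding hyperplane
is contained in it, so after restriction they become derivatives in the ordinary sense, to which the
inverse function theorem applies. -/
theorem hasFDerivAt_onHyperplane {q : Q} (hq : q ∈ (𝓡∂ n).boundary Q) {g : Q → F}
    (hg : MDifferentiableAt (𝓡∂ n) 𝓘(ℝ, F) g q) :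
    HasFDerivAt (onHyperplane q g)
      ((der n g q : EuclideanSpace ℝ (Fin n) →L[ℝ] F).comp (boundaryHyperplane n).subtypeL) 0 := by
  have h1 : HasFDerivWithinAt (g ∘ (extChartAt (𝓡∂ n) q).symm)
      (der n g q : EuclideanSpace ℝ (Fin n) →L[ℝ] F) (range (𝓡∂ n))
      (extChartAt (𝓡∂ n) q q + (0 : boundaryHyperplane n)) := by
    rw [ZeroMemClass.coe_zero, add_zero]
    exact (hasMFDerivAt_der hg).2
  have h2 : HasFDerivWithinAt (fun x : boundaryHyperplane n =>
      extChartAt (𝓡∂ n) q q + (x : EuclideanSpace ℝ (Fin n))) (boundaryHyperplane n).subtypeL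
      univ 0 := ((boundaryHyperplane n).subtypeL.hasFDerivAt.const_add _).hasFDerivWithinAt
  exact (HasFDerivWithinAt.comp (0 : boundaryHyperplane n) h1 h2
    (mapsTo_hyperplane hq)).hasFDerivAt univ_mem

theorem contDiffAt_onHyperplane {q : Q} (hq : q ∈ (𝓡∂ n).boundary Q) {g : Q → F}
    (hg : ContMDiffAt (𝓡∂ n) 𝓘(ℝ, F) ∞ g q) : ContDiffAt ℝ ∞ (onHyperplane (n := n) q g) 0 := by
  have h1 : ContDiffWithinAt ℝ ∞ (g ∘ (extChartAt (𝓡∂ n) q).symm) (range (𝓡∂ n))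
      (extChartAt (𝓡∂ n) q q + (0 : boundaryHyperplane n)) := by
    rw [ZeroMemClass.coe_zero, add_zero]
    exact (contMDiffAt_iff.1 hg).2
  have h2 : ContDiffWithinAt ℝ ∞ (fun x : boundaryHyperplane n =>
      extChartAt (𝓡∂ n) q q + (x : EuclideanSpace ℝ (Fin n))) univ 0 :=
    (contDiff_const.add (boundaryHyperplane n).subtypeL.contDiff).contDiffAt.contDiffWithinAt
  exact (ContDiffWithinAt.comp (0 : boundaryHyperplane n) h1 h2
    (mapsTo_hyperplane hq)).contDiffAt univ_mem

/-- At a boundary point, there is a curve in the boundary with given velocity along which a given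
submersion of the boundary is an affine function. -/
theorem exists_curve_boundary [FiniteDimensional ℝ F] {q : Q} (hq : q ∈ (𝓡∂ n).boundary Q)
    {y : Q → F} (hy : ContMDiffAt (𝓡∂ n) 𝓘(ℝ, F) ∞ y q)
    (hs : ∀ z, ∃ w ∈ boundaryHyperplane n, der n y q w = z)
    {w : EuclideanSpace ℝ (Fin n)} (hw : w ∈ boundaryHyperplane n) :
    ∃ γ : ℝ → Q, γ 0 = q ∧ ContinuousAt γ 0 ∧ (∀ᶠ t in 𝓝 (0 : ℝ), y (γ t) = y q + t • der n y q w) ∧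
      ∀ g : Q → ℝ, MDifferentiableAt (𝓡∂ n) 𝓘(ℝ, ℝ) g q → HasDerivAt (g ∘ γ) (der n g q w) 0 := by
  have hstr := (contDiffAt_onHyperplane hq hy).hasStrictFDerivAt'
    (hasFDerivAt_onHyperplane hq (hy.mdifferentiableAt (by simp))) (by simp)
  set L := (der n y q : EuclideanSpace ℝ (Fin n) →L[ℝ] F).comp (boundaryHyperplane n).subtypeL
    with hL
  have hLs : Function.Surjective (L : boundaryHyperplane n →ₗ[ℝ] F) := fun z => by
    obtain ⟨w, hw, e⟩ := hs z
    exact ⟨⟨w, hw⟩, e⟩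
  obtain ⟨R, hR⟩ := (L : boundaryHyperplane n →ₗ[ℝ] F).exists_rightInverse_of_surjective
    (LinearMap.range_eq_top.2 hLs)
  obtain ⟨γ, h0, h1, h2⟩ := hstr.exists_curve (LinearMap.toContinuousLinearMap R)
    (fun z => LinearMap.congr_fun hR z) ⟨w, hw⟩
  have hsymm : (extChartAt (𝓡∂ n) q).symm (extChartAt (𝓡∂ n) q q + (0 : boundaryHyperplane n)) = q := by
    rw [ZeroMemClass.coe_zero, add_zero]
    exact extChartAt_to_inv q
  refine ⟨fun t => (extChartAt (𝓡∂ n) q).symm (extChartAt (𝓡∂ n) q q + γ t), ?_, ?_, ?_, ?_⟩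
  · simp only [h0, hsymm]
  · refine ContinuousAt.comp (g := (extChartAt (𝓡∂ n) q).symm) ?_
      (continuousAt_const.add (continuous_subtype_val.continuousAt.comp h1.continuousAt))
    rw [h0, ZeroMemClass.coe_zero, add_zero]
    exact continuousAt_extChartAt_symm q
  · filter_upwards [h2] with t ht
    have : onHyperplane (n := n) q y 0 = y q := congrArg y hsymm
    rw [this] at ht
    exact ht
  · intro g hg
    have h3 := hasFDerivAt_onHyperplane hq hg
    rw [← h0] at h3
    exact h3.comp_hasDerivAt 0 h1

variable [IsManifold (𝓡∂ n) ∞ Q]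

/-- The first coordinate of the chart at `q`. -/
def boundaryCoord (n : ℕ) [NeZero n] [ChartedSpace (EuclideanHalfSpace n) Q] (q p : Q) : ℝ :=
  extChartAt (𝓡∂ n) q p 0

theorem contMDiffAt_boundaryCoord (q : Q) :
    ContMDiffAt (𝓡∂ n) 𝓘(ℝ, ℝ) ∞ (boundaryCoord n q) q :=
  (EuclideanSpace.proj (0 : Fin n) : EuclideanSpace ℝ (Fin n) →L[ℝ] ℝ).contMDiff.contMDiffAt.comp q
    (contMDiffAt_extChartAt (n := ∞))

theorem der_boundaryCoord (q : Q) (w : TangentSpace (𝓡∂ n) q) :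
    der n (boundaryCoord n q) q w = (EuclideanSpace.proj (0 : Fin n) : EuclideanSpace ℝ (Fin n) →L[ℝ] ℝ) w := by
  have h1 : HasMFDerivAt (𝓡∂ n) 𝓘(ℝ, EuclideanSpace ℝ (Fin n)) (fun x => extChartAt (𝓡∂ n) q x) q
      (ContinuousLinearMap.id ℝ (EuclideanSpace ℝ (Fin n))) := by
    have h := der_extChartAt_comp (n := n) (β := (id : Q → Q)) (q := q) (b := q) rfl
      mdifferentiableAt_id
    have h2 : mder n (id : Q → Q) q = ContinuousLinearMap.id ℝ (EuclideanSpace ℝ (Fin n)) :=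
      mfderiv_id
    rw [h2] at h
    exact h
  have h2 := der_clm_comp (n := n) (EuclideanSpace.proj (0 : Fin n) : _ →L[ℝ] ℝ)
    h1.mdifferentiableAt
  have h3 := der_eq h1
  rw [h3] at h2
  exact DFunLike.congr_fun h2 w

/-- A point where the first coordinate is positive is interior in this chart, hence interior, since
being interior can be tested in any chart of the atlas. -/
theorem eventually_boundaryCoord (q : Q) :
    ∀ᶠ p in 𝓝 q, p ∈ (𝓡∂ n).boundary Q → boundaryCoord n q p = 0 := by
  filter_upwards [(chartAt (EuclideanHalfSpace n) q).open_source.mem_nhds (mem_chart_source _ q)]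
    with p hp hpb
  by_contra hne
  refine absurd (((𝓡∂ n).isInteriorPoint_iff_of_mem_atlas (n := ∞) (by simp)
    (chart_mem_atlas (EuclideanHalfSpace n) q) hp).2 ?_)
    (((𝓡∂ n).isBoundaryPoint_iff_not_isInteriorPoint p).1 hpb)
  have hr : extChartAt (𝓡∂ n) q p ∈ range (𝓡∂ n) := mem_range_self _
  refine (chartAt (EuclideanHalfSpace n) q).mem_interior_extend_target
    ((chartAt (EuclideanHalfSpace n) q).map_source hp) ?_
  rw [interior_range_modelWithCornersEuclideanHalfSpace]
  rw [range_modelWithCornersEuclideanHalfSpace] at hr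
  exact lt_of_le_of_ne hr (Ne.symm hne)

/-- A vector tangent to the boundary, in the kernel of a submersion of the boundary, is tangent to
the level set of the submersion. -/
theorem mem_tangentAt_of_boundary {k : ℕ} {q : Q} (hq : q ∈ (𝓡∂ n).boundary Q)
    {y : Q → Fin k → ℝ} (hy : ContMDiffAt (𝓡∂ n) 𝓘(ℝ, Fin k → ℝ) ∞ y q) {S : Set Q}
    (hs : ∀ z, ∃ w ∈ tangentAt n ((𝓡∂ n).boundary Q) q, der n y q w = z)
    (hS : ∀ᶠ p in 𝓝 q, y p = y q → p ∈ S) {w : TangentSpace (𝓡∂ n) q}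
    (hw : der n (boundaryCoord n q) q w = 0) (hyw : der n y q w = 0) : w ∈ tangentAt n S q := by
  have hsub : ∀ w ∈ tangentAt n ((𝓡∂ n).boundary Q) q, w ∈ boundaryHyperplane n := by
    intro w hw
    have := mem_tangentAt.1 hw _ (contMDiffAt_boundaryCoord q)
      (eventually_nhdsWithin_iff.2 (eventually_boundaryCoord q))
    rw [der_boundaryCoord] at this
    exact this
  rw [der_boundaryCoord] at hw
  obtain ⟨γ, h0, h1, h2, h3⟩ := exists_curve_boundary hq hy
    (fun z => by obtain ⟨w, hw, e⟩ := hs z; exact ⟨w, hsub w hw, e⟩) (w := w) hw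
  refine mem_tangentAt.2 fun f hf hfS => ?_
  have h4 := h3 f (hf.mdifferentiableAt (by simp))
  have hγ : Tendsto γ (𝓝 0) (𝓝 q) := by
    have := h1.tendsto
    rwa [h0] at this
  have h5 : f ∘ γ =ᶠ[𝓝 0] fun _ => 0 := by
    filter_upwards [h2, hγ.eventually hS, hγ.eventually (eventually_nhdsWithin_iff.1 hfS)]
      with t ht1 ht2 ht3
    refine ht3 (ht2 ?_)
    have e : der n y q w = 0 := hyw
    rw [ht1]
    simp [e]
  exact h4.unique ((hasDerivAt_const (0 : ℝ) (0 : ℝ)).congr_of_eventuallyEq h5)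

end Boundary

end

/-! ### Transverse zeros persist under `C¹`-small diffeomorphisms. -/

noncomputable section

section Perturbation

variable {n : ℕ} [NeZero n] {Q : Type u} [MetricSpace Q] [ChartedSpace (EuclideanHalfSpace n) Q]
  [IsManifold (𝓡∂ n) ∞ Q]

/-- Local compactness makes evaluation continuous jointly in the map and the point, for the
compact-open topology on tangent maps. -/
theorem locallyCompactSpace_tangentBundle : LocallyCompactSpace (TangentBundle (𝓡∂ n) Q) := by
  have h1 : LocallyCompactSpace (EuclideanHalfSpace n) := (𝓡∂ n).locallyCompactSpace
  have h2 : LocallyCompactSpace (ModelProd (EuclideanHalfSpace n) (EuclideanSpace ℝ (Fin n))) :=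
    inferInstanceAs (LocallyCompactSpace (EuclideanHalfSpace n × EuclideanSpace ℝ (Fin n)))
  exact ChartedSpace.locallyCompactSpace
    (ModelProd (EuclideanHalfSpace n) (EuclideanSpace ℝ (Fin n))) _

theorem tendsto_tangentMap_symm (z : TangentBundle (𝓡∂ n) Q) :
    Tendsto (fun p : (Q ≃ₘ^∞⟮𝓡∂ n, 𝓡∂ n⟯ Q) × TangentBundle (𝓡∂ n) Q =>
      tangentMap (𝓡∂ n) (𝓡∂ n) p.1.symm p.2) (c1Nhds n Q ×ˢ 𝓝 z) (𝓝 z) := by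
  let := c1Topology n Q
  have := locallyCompactSpace_tangentBundle (n := n) (Q := Q)
  have h0 : Continuous fun φ : Q ≃ₘ^∞⟮𝓡∂ n, 𝓡∂ n⟯ Q =>
      ((⟨tangentMap (𝓡∂ n) (𝓡∂ n) φ, φ.contMDiff_toFun.continuous_tangentMap (by simp)⟩,
        ⟨tangentMap (𝓡∂ n) (𝓡∂ n) φ.symm,
          φ.symm.contMDiff_toFun.continuous_tangentMap (by simp)⟩) :
        C(TangentBundle (𝓡∂ n) Q, TangentBundle (𝓡∂ n) Q) ×
          C(TangentBundle (𝓡∂ n) Q, TangentBundle (𝓡∂ n) Q)) := continuous_induced_dom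
  have h1 : Continuous fun φ : Q ≃ₘ^∞⟮𝓡∂ n, 𝓡∂ n⟯ Q =>
      (⟨tangentMap (𝓡∂ n) (𝓡∂ n) φ.symm, φ.symm.contMDiff_toFun.continuous_tangentMap (by simp)⟩ :
        C(TangentBundle (𝓡∂ n) Q, TangentBundle (𝓡∂ n) Q)) :=
    continuous_snd.comp h0
  have h2 : Continuous fun p : (Q ≃ₘ^∞⟮𝓡∂ n, 𝓡∂ n⟯ Q) × TangentBundle (𝓡∂ n) Q =>
      tangentMap (𝓡∂ n) (𝓡∂ n) p.1.symm p.2 := (h1.comp continuous_fst).eval continuous_snd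
  have h3 := h2.tendsto (Diffeomorph.refl (𝓡∂ n) Q ∞, z)
  rw [nhds_prod_eq] at h3
  have h4 : tangentMap (𝓡∂ n) (𝓡∂ n) (Diffeomorph.refl (𝓡∂ n) Q ∞).symm z = z := by
    change tangentMap (𝓡∂ n) (𝓡∂ n) id z = z
    rw [tangentMap_id]
    rfl
  rw [h4] at h3
  exact h3

/-- Evaluate the tangent maps on the zero section and project to the base. -/
theorem tendsto_symm (q : Q) :
    Tendsto (fun p : (Q ≃ₘ^∞⟮𝓡∂ n, 𝓡∂ n⟯ Q) × Q => p.1.symm p.2) (c1Nhds n Q ×ˢ 𝓝 q) (𝓝 q) := by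
  have h1 : Tendsto (fun p : Q => (⟨p, 0⟩ : TangentBundle (𝓡∂ n) Q)) (𝓝 q)
      (𝓝 (⟨q, 0⟩ : TangentBundle (𝓡∂ n) Q)) :=
    (Bundle.contMDiff_zeroSection ℝ (TangentSpace (𝓡∂ n) : Q → Type _)
      (n := 0) (IB := 𝓡∂ n)).continuous.tendsto q
  have h2 := (tendsto_tangentMap_symm (n := n) (⟨q, 0⟩ : TangentBundle (𝓡∂ n) Q)).comp
    (tendsto_id.prodMap h1)
  exact ((FiberBundle.continuous_proj (EuclideanSpace ℝ (Fin n))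
    (TangentSpace (𝓡∂ n) : Q → Type _)).tendsto (⟨q, 0⟩ : TangentBundle (𝓡∂ n) Q)).comp h2

/-- Filter version of the tube lemma. -/
theorem IsCompact.eventually_forall_prod {α Y : Type*} [TopologicalSpace Y] {l : Filter α}
    {K : Set Y} (hK : IsCompact K) {p : α → Y → Prop}
    (h : ∀ y ∈ K, ∀ᶠ z : α × Y in l ×ˢ 𝓝 y, p z.1 z.2) : ∀ᶠ x in l, ∀ y ∈ K, p x y := by
  simp only [← eventually_iSup, ← hK.prod_nhdsSet_eq_biSup] at h
  exact h.curry.mono fun _ h => h.self_of_nhdsSet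

theorem continuousAt_der {F : Type*} [NormedAddCommGroup F] [NormedSpace ℝ F] {y : Q → F}
    {O : Set Q} (hO : IsOpen O) (hy : ContMDiffOn (𝓡∂ n) 𝓘(ℝ, F) ∞ y O)
    (z : TangentBundle (𝓡∂ n) Q) (hz : z.1 ∈ O) :
    ContinuousAt (fun z : TangentBundle (𝓡∂ n) Q => der n y z.1 z.2) z := by
  have hO' : IsOpen {z : TangentBundle (𝓡∂ n) Q | z.1 ∈ O} :=
    hO.preimage (FiberBundle.continuous_proj (EuclideanSpace ℝ (Fin n))
      (TangentSpace (𝓡∂ n) : Q → Type _))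
  have h1 := (hy.continuousOn_tangentMapWithin (by simp) hO.uniqueMDiffOn)
  have h3 : Continuous (fun v : TangentBundle 𝓘(ℝ, F) F => (v.2 : F)) :=
    (contMDiff_snd_tangentBundle_modelSpace (n := 0) F 𝓘(ℝ, F)).continuous
  have h4 : ContinuousOn (fun z : TangentBundle (𝓡∂ n) Q => der n y z.1 z.2)
      {z : TangentBundle (𝓡∂ n) Q | z.1 ∈ O} := by
    refine (h3.comp_continuousOn h1).congr fun w hw => ?_
    have : tangentMapWithin (𝓡∂ n) 𝓘(ℝ, F) y O w = tangentMap (𝓡∂ n) 𝓘(ℝ, F) y w :=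
      tangentMapWithin_eq_tangentMap (hO.uniqueMDiffOn _ hw)
        ((hy.contMDiffAt (hO.mem_nhds hw)).mdifferentiableAt (by simp))
    exact (congrArg (fun v : TangentBundle 𝓘(ℝ, F) F => (v.2 : F)) this).symm
  exact h4.continuousAt (hO'.mem_nhds hz)

theorem continuousAt_tangentMap {E : Type*} [NormedAddCommGroup E] [NormedSpace ℝ E] {j : E → Q}
    {U : Set E} (hU : IsOpen U) (hj : ContMDiffOn 𝓘(ℝ, E) (𝓡∂ n) ∞ j U) {x w : E} (hx : x ∈ U) :
    ContinuousAt (fun z : E × E => tangentMap 𝓘(ℝ, E) (𝓡∂ n) j (⟨z.1, z.2⟩ : TangentBundle 𝓘(ℝ, E) E))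
      (x, w) := by
  have h1 := (hj.continuousOn_tangentMapWithin (by simp) hU.uniqueMDiffOn)
  have h2 : Continuous fun z : E × E => (⟨z.1, z.2⟩ : TangentBundle 𝓘(ℝ, E) E) :=
    (tangentBundleModelSpaceHomeomorph 𝓘(ℝ, E)).symm.continuous
  have h4 : ContinuousOn (fun z : E × E =>
      tangentMap 𝓘(ℝ, E) (𝓡∂ n) j (⟨z.1, z.2⟩ : TangentBundle 𝓘(ℝ, E) E)) (Prod.fst ⁻¹' U) := by
    refine (h1.comp h2.continuousOn fun z hz => hz).congr fun z hz => ?_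
    exact (tangentMapWithin_eq_tangentMap (hU.uniqueMDiffOn _ hz)
      ((hj.contMDiffAt (hU.mem_nhds hz)).mdifferentiableAt (by simp))).symm
  exact h4.continuousAt ((hU.preimage continuous_fst).mem_nhds hx)

/-- A map whose derivative is close to an invertible one on a ball is approximately linear there, so
the image of the ball contains a ball around its value at the centre, of a radius known in advance.
The hypothesis `h0` says that this ball contains `0`. The derivative is tested on unit vectors, the
form in which a compactness argument provides the bound. -/
theorem exists_zero_of_fderiv_close {E : Type*} [NormedAddCommGroup E] [NormedSpace ℝ E]
    [CompleteSpace E] {A : E →L[ℝ] E} (R : A.NonlinearRightInverse) {g : E → E} {δ : ℝ} (hδ : 0 ≤ δ)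
    (hg : ∀ x ∈ Metric.closedBall (0 : E) δ, DifferentiableAt ℝ g x)
    (hA : ∀ x ∈ Metric.closedBall (0 : E) δ, ∀ w : E, ‖w‖ = 1 →
      ‖fderiv ℝ g x w - A w‖ ≤ (R.nnnorm⁻¹ / 2 : NNReal))
    (h0 : ‖g 0‖ ≤ (R.nnnorm : ℝ)⁻¹ / 2 * δ) : ∃ z ∈ Metric.closedBall (0 : E) δ, g z = 0 := by
  have happ : ApproximatesLinearOn g A (Metric.closedBall 0 δ) (R.nnnorm⁻¹ / 2) := by
    intro z hz z' hz'
    refine Convex.norm_image_sub_le_of_norm_hasFDerivWithin_le' (f' := fderiv ℝ g)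
      (fun x hx => (hg x hx).hasFDerivAt.hasFDerivWithinAt) (fun x hx => ?_)
      (convex_closedBall 0 δ) hz' hz
    exact ContinuousLinearMap.opNorm_le_of_unit_norm (NNReal.coe_nonneg _) fun w hw => hA x hx w hw
  obtain ⟨z, hz, hz0⟩ := happ.surjOn_closedBall_of_nonlinearRightInverse R hδ subset_rfl
    (show (0 : E) ∈ _ by
      rw [Metric.mem_closedBall, dist_zero_left]
      refine h0.trans (le_of_eq ?_)
      push_cast
      ring)
  exact ⟨z, hz, hz0⟩

/-- A transverse zero persists under `C¹`-small perturbations. -/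
theorem eventually_exists_zero {k : ℕ} {j : (Fin k → ℝ) → Q} {U : Set (Fin k → ℝ)} (hU : IsOpen U)
    (h0 : 0 ∈ U) (hj : ContMDiffOn 𝓘(ℝ, Fin k → ℝ) (𝓡∂ n) ∞ j U) {O : Set Q} (hO : IsOpen O)
    {y : Q → Fin k → ℝ} (hy : ContMDiffOn (𝓡∂ n) 𝓘(ℝ, Fin k → ℝ) ∞ y O) (hjO : j 0 ∈ O)
    (hy0 : y (j 0) = 0)
    (hinj : ∀ w : Fin k → ℝ, der n y (j 0) (mfderiv 𝓘(ℝ, Fin k → ℝ) (𝓡∂ n) j 0 w) = 0 → w = 0) :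
    ∀ᶠ φ in c1Nhds n Q, ∃ z ∈ U, φ.symm (j z) ∈ O ∧ y (φ.symm (j z)) = 0 := by
  have hjd : ∀ z ∈ U, MDifferentiableAt 𝓘(ℝ, Fin k → ℝ) (𝓡∂ n) j z := fun z hz =>
    (hj.contMDiffAt (hU.mem_nhds hz)).mdifferentiableAt (by simp)
  have hyd : ∀ q ∈ O, MDifferentiableAt (𝓡∂ n) 𝓘(ℝ, Fin k → ℝ) y q := fun q hq =>
    (hy.contMDiffAt (hO.mem_nhds hq)).mdifferentiableAt (by simp)
  set A : (Fin k → ℝ) →L[ℝ] Fin k → ℝ := fderiv ℝ (fun z => y (j z)) 0 with hA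
  have hAapp : ∀ w, A w = der n y (j 0) (mfderiv 𝓘(ℝ, Fin k → ℝ) (𝓡∂ n) j 0 w) := by
    intro w
    rw [hA, ← mfderiv_eq_fderiv]
    exact mfderiv_comp_apply 0 (hyd _ hjO) (hjd 0 h0) w
  have hder : ∀ (φ : Q ≃ₘ^∞⟮𝓡∂ n, 𝓡∂ n⟯ Q) (z : Fin k → ℝ), z ∈ U → φ.symm (j z) ∈ O →
      HasFDerivAt (fun z => y (φ.symm (j z))) (fderiv ℝ (fun z => y (φ.symm (j z))) z) z ∧
      ∀ w, fderiv ℝ (fun z => y (φ.symm (j z))) z w =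
        (fun v : TangentBundle (𝓡∂ n) Q => der n y v.1 v.2) (tangentMap (𝓡∂ n) (𝓡∂ n) φ.symm
          (tangentMap 𝓘(ℝ, Fin k → ℝ) (𝓡∂ n) j
            (⟨z, w⟩ : TangentBundle 𝓘(ℝ, Fin k → ℝ) (Fin k → ℝ)))) := by
    intro φ z hz hzO
    have hφ : MDifferentiableAt (𝓡∂ n) (𝓡∂ n) φ.symm (j z) :=
      φ.symm.contMDiff_toFun.mdifferentiable (by simp) _
    have h1 : MDifferentiableAt 𝓘(ℝ, Fin k → ℝ) (𝓡∂ n) (fun z => φ.symm (j z)) z :=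
      hφ.comp z (hjd z hz)
    refine ⟨((hyd _ hzO).comp z h1).differentiableAt.hasFDerivAt, fun w => ?_⟩
    rw [← mfderiv_eq_fderiv]
    refine (mfderiv_comp_apply z (hyd _ hzO) h1 w).trans ?_
    exact congrArg _ (mfderiv_comp_apply z hφ (hjd z hz) w)
  have hAinj : Function.Injective (A : (Fin k → ℝ) →ₗ[ℝ] Fin k → ℝ) :=
    (injective_iff_map_eq_zero _).2 fun w hw => hinj w ((hAapp w).symm.trans hw)
  set e : (Fin k → ℝ) ≃L[ℝ] (Fin k → ℝ) :=
    (LinearEquiv.ofInjectiveEndo (A : (Fin k → ℝ) →ₗ[ℝ] Fin k → ℝ) hAinj).toContinuousLinearEquiv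
    with he
  have heA : ∀ w, e w = A w := fun w => rfl
  -- The summand `1` keeps the constant positive also when `k = 0`, where the norm of the inverse is
  -- `0`.
  set M : NNReal := ‖(e.symm : (Fin k → ℝ) →L[ℝ] Fin k → ℝ)‖₊ + 1 with hM
  have hMpos : (0 : ℝ) < M := by rw [hM]; positivity
  let R : A.NonlinearRightInverse :=
    { toFun := e.symm
      nnnorm := M
      bound' := fun w => by
        refine ((e.symm : (Fin k → ℝ) →L[ℝ] Fin k → ℝ).le_opNorm w).trans ?_
        refine mul_le_mul_of_nonneg_right ?_ (norm_nonneg _)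
        rw [hM]
        push_cast
        linarith
      right_inv' := fun w => by rw [← heA]; exact e.apply_symm_apply w }
  set c : NNReal := M⁻¹ / 2 with hc
  have hcpos : (0 : ℝ) < c := by rw [hc]; positivity
  have hsymm : Tendsto (fun p : (Q ≃ₘ^∞⟮𝓡∂ n, 𝓡∂ n⟯ Q) × (Fin k → ℝ) => p.1.symm (j p.2))
      (c1Nhds n Q ×ˢ 𝓝 0) (𝓝 (j 0)) :=
    (tendsto_symm (j 0)).comp (tendsto_id.prodMap (hjd 0 h0).continuousAt)
  -- The derivative is close to `A` for `φ` near the identity and `z` near `0`, uniformly in `w` by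
  -- compactness of the unit ball. This is where `C¹` closeness is needed.
  have hev : ∀ᶠ p : (Q ≃ₘ^∞⟮𝓡∂ n, 𝓡∂ n⟯ Q) × (Fin k → ℝ) in c1Nhds n Q ×ˢ 𝓝 0,
      ∀ w ∈ Metric.closedBall (0 : Fin k → ℝ) 1,
        ‖(fun v : TangentBundle (𝓡∂ n) Q => der n y v.1 v.2) (tangentMap (𝓡∂ n) (𝓡∂ n) p.1.symm
          (tangentMap 𝓘(ℝ, Fin k → ℝ) (𝓡∂ n) j
            (⟨p.2, w⟩ : TangentBundle 𝓘(ℝ, Fin k → ℝ) (Fin k → ℝ)))) - A w‖ < c := by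
    refine (isCompact_closedBall (0 : Fin k → ℝ) 1).eventually_forall_prod fun w _ => ?_
    have t1 : Tendsto (fun p : ((Q ≃ₘ^∞⟮𝓡∂ n, 𝓡∂ n⟯ Q) × (Fin k → ℝ)) × (Fin k → ℝ) =>
        (p.1.1, (p.1.2, p.2))) ((c1Nhds n Q ×ˢ 𝓝 0) ×ˢ 𝓝 w) (c1Nhds n Q ×ˢ 𝓝 (0, w)) := by
      rw [nhds_prod_eq]
      exact (tendsto_fst.comp tendsto_fst).prodMk
        ((tendsto_snd.comp tendsto_fst).prodMk tendsto_snd)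
    have t2 := (tendsto_tangentMap_symm (n := n) (tangentMap 𝓘(ℝ, Fin k → ℝ) (𝓡∂ n) j
      (⟨0, w⟩ : TangentBundle 𝓘(ℝ, Fin k → ℝ) (Fin k → ℝ)))).comp
        (tendsto_id.prodMap (continuousAt_tangentMap hU hj (w := w) h0).tendsto)
    have t3 := ((continuousAt_der hO hy (tangentMap 𝓘(ℝ, Fin k → ℝ) (𝓡∂ n) j
      (⟨0, w⟩ : TangentBundle 𝓘(ℝ, Fin k → ℝ) (Fin k → ℝ))) hjO).tendsto.comp t2).comp t1
    have t4 := (t3.sub ((A.continuous.tendsto w).comp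
      (tendsto_snd (f := c1Nhds n Q ×ˢ 𝓝 (0 : Fin k → ℝ))))).norm
    refine t4.eventually_lt_const ?_
    have : (fun v : TangentBundle (𝓡∂ n) Q => der n y v.1 v.2)
        (tangentMap 𝓘(ℝ, Fin k → ℝ) (𝓡∂ n) j
          (⟨0, w⟩ : TangentBundle 𝓘(ℝ, Fin k → ℝ) (Fin k → ℝ))) = A w := (hAapp w).symm
    exact lt_of_eq_of_lt (norm_sub_eq_zero_iff.2 this) hcpos
  have hUev : ∀ᶠ z in 𝓝 (0 : Fin k → ℝ), z ∈ U := hU.mem_nhds h0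
  have hall := (hev.and (hsymm.eventually (hO.mem_nhds hjO))).and
    (hUev.prod_inr (c1Nhds n Q))
  obtain ⟨pa, hpa, pb, hpb, hab⟩ := eventually_prod_iff.1 hall
  obtain ⟨δ, hδ, hδb⟩ := Metric.nhds_basis_closedBall.eventually_iff.1 hpb
  -- The radius `δ` is fixed first, by the bound on the derivative; then `φ` is taken so close to
  -- the identity that the initial value is small compared with `δ`.
  have hsmall : ∀ᶠ φ in c1Nhds n Q, ‖y (φ.symm (j 0))‖ < (M : ℝ)⁻¹ / 2 * δ := by
    have t1 : Tendsto (fun φ : Q ≃ₘ^∞⟮𝓡∂ n, 𝓡∂ n⟯ Q => φ.symm (j 0)) (c1Nhds n Q) (𝓝 (j 0)) :=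
      (tendsto_symm (j 0)).comp (tendsto_id.prodMk tendsto_const_nhds)
    have t2 := ((hyd _ hjO).continuousAt.tendsto.comp t1).norm
    refine t2.eventually_lt_const ?_
    rw [hy0, norm_zero]
    positivity
  filter_upwards [hpa, hsmall] with φ hφ hφs
  have hb : ∀ z ∈ Metric.closedBall (0 : Fin k → ℝ) δ, _ := fun z hz => hab hφ (hδb hz)
  obtain ⟨z, hz, hz0⟩ := exists_zero_of_fderiv_close R hδ.le (g := fun z => y (φ.symm (j z)))
    (fun x hx => (hder φ x (hb x hx).2 (hb x hx).1.2).1.differentiableAt) (fun x hx w hw => by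
      rw [(hder φ x (hb x hx).2 (hb x hx).1.2).2 w]
      exact ((hb x hx).1.1 w (by simp [hw])).le) hφs.le
  exact ⟨z, (hb z hz).2, (hb z hz).1.2, hz0⟩

end Perturbation

end

/-! ### The cells of `∂⁺` for close subdivisions. -/

noncomputable section

section PlusCells

variable {n : ℕ} [NeZero n] {Q : Type u} [MetricSpace Q] [ChartedSpace (EuclideanHalfSpace n) Q]
  [IsManifold (𝓡∂ n) ∞ Q] {V : Type v} [Fintype V] [LinearOrder V]
  {P : SmoothTriangulation n Q V} {D : V → Set Q} {σ τ : Finset V}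

theorem isCompact_stdCell (σ : Finset V) : IsCompact (stdCell σ) := by
  refine (isCompact_Icc (a := (0 : V → ℝ)) (b := 1)).of_isClosed_subset ?_ ?_
  · have h1 : IsClosed {x : V → ℝ | ∀ v, 0 ≤ x v} := by
      simp only [ofPred_forall]
      exact isClosed_iInter fun v => isClosed_le continuous_const (continuous_apply v)
    have h2 : IsClosed {x : V → ℝ | ∑ v, x v = 1} :=
      isClosed_eq (continuous_finsetSum _ fun v _ => continuous_apply v) continuous_const
    have h3 : IsClosed {x : V → ℝ | ∀ v ∉ σ, x v = 0} := by
      simp only [ofPred_forall]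
      exact isClosed_iInter fun v => isClosed_iInter fun _ =>
        isClosed_eq (continuous_apply v) continuous_const
    exact h1.inter (h2.inter h3)
  · rintro x ⟨h1, h2, -⟩
    refine ⟨h1, fun v => ?_⟩
    rw [Pi.one_apply, ← h2]
    exact Finset.single_le_sum (fun u _ => h1 u) (Finset.mem_univ v)

theorem SmoothTriangulation.isCompact_cell (hσ : σ ∈ P.complex.faces) : IsCompact (P.cell σ) :=
  (isCompact_stdCell σ).image_of_continuousOn (P.smooth σ hσ).continuousOn

theorem SmoothTriangulation.cell_mono (h : τ ⊆ σ) : P.cell τ ⊆ P.cell σ :=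
  image_mono fun _ hx => ⟨hx.1, hx.2.1, fun v hv => hx.2.2 v fun h' => hv (h h')⟩

theorem IsDualSubdivision.isClosed_dualCell (hD : IsDualSubdivision P D) (τ : Finset V) :
    IsClosed (dualCell D τ) :=
  isClosed_biInter fun v _ => hD.isClosed v

/-- A compact simplex which is disjoint from a closed cell remains so under small perturbations, and
there are finitely many pairs to consider. -/
theorem IsDualSubdivision.eventually_subset_of_meets (hD : IsDualSubdivision P D) :
    ∀ᶠ φ : Q ≃ₘ^∞⟮𝓡∂ n, 𝓡∂ n⟯ Q in c1Nhds n Q, ∀ σ ∈ P.complex.faces, ∀ τ ∈ P.complex.faces,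
      (dualCell (fun v => φ '' D v) τ ∩ P.cell σ).Nonempty → τ ⊆ σ := by
  refine eventually_all.2 fun σ => eventually_imp_distrib_left.2 fun hσ =>
    eventually_all.2 fun τ => eventually_imp_distrib_left.2 fun hτ => ?_
  by_cases h : τ ⊆ σ
  · exact Eventually.of_forall fun _ _ => h
  have h1 : ∀ᶠ φ in c1Nhds n Q, ∀ q ∈ P.cell σ, φ.symm q ∉ dualCell D τ := by
    refine (P.isCompact_cell hσ).eventually_forall_prod fun q hq => ?_
    refine (tendsto_symm q).eventually ((hD.isClosed_dualCell τ).isOpen_compl.mem_nhds fun hq' => ?_)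
    exact h (hD.subset_of_meets σ hσ τ hτ ⟨q, hq', hq⟩)
  filter_upwards [h1] with φ hφ
  rintro ⟨q, hq, hq'⟩
  rw [dualCell_image, mem_image_diffeomorph_iff] at hq
  exact absurd hq (hφ q hq')

/-- The meeting point is interior to the simplex, because the dual cell does not meet proper faces.
-/
theorem IsDualSubdivision.pos_of_meets (hD : IsDualSubdivision P D) (hτ : τ ∈ P.complex.faces)
    {x : V → ℝ} (hx : x ∈ stdCell τ) (hxD : P.real x ∈ dualCell D τ) {v : V} (hv : v ∈ τ) :
    0 < x v := by
  refine lt_of_le_of_ne (hx.1 v) fun h0 => ?_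
  have hx' : x ∈ stdCell (τ.erase v) := by
    refine ⟨hx.1, hx.2.1, fun u hu => ?_⟩
    by_cases huv : u = v
    · rw [huv, ← h0]
    · exact hx.2.2 u fun h => hu (Finset.mem_erase.2 ⟨huv, h⟩)
  have hne : (τ.erase v).Nonempty := by
    by_contra he
    rw [Finset.not_nonempty_iff_eq_empty] at he
    have : ∑ u, x u = 0 := Finset.sum_eq_zero fun u _ => hx'.2.2 u (by simp [he])
    rw [hx.2.1] at this
    exact one_ne_zero this
  exact Finset.notMem_erase v τ (hD.subset_of_meets _
    (P.mem_of_subset hτ (Finset.erase_subset v τ) hne) τ hτ ⟨_, hxD, mem_image_of_mem _ hx'⟩ hv)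

theorem IsDualSubdivision.mem_stratum_of_meets (hD : IsDualSubdivision P D)
    (hτ : τ ∈ P.complex.faces) {q : Q} (hq : q ∈ P.cell τ) (hqD : q ∈ dualCell D τ) :
    q ∈ stratum D τ := by
  obtain ⟨κ, hκ, hqκ⟩ := hD.exists_stratum q
  have h1 : κ ⊆ τ := hD.subset_of_meets τ hτ κ hκ ⟨q, stratum_subset_dualCell hqκ, hq⟩
  have h2 : τ ⊆ κ := fun v hv => (hqκ v).1 (by simpa using mem_iInter₂.1 hqD v hv)
  rwa [h2.antisymm h1]

/-- The linear parametrization of the directions of the simplex `[v₀, …, v_k]` by the coordinates at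
`v₁, …, v_k`. -/
def simplexDir (σ : Finset V) (hσ : σ.Nonempty) : (Fin (codim σ) → ℝ) →L[ℝ] (V → ℝ) :=
  ∑ i : Fin (codim σ), (ContinuousLinearMap.proj (R := ℝ) (φ := fun _ => ℝ) i).smulRight
    (Pi.single (vtx σ hσ i.succ) 1 - Pi.single (vtx σ hσ 0) 1 : V → ℝ)

theorem simplexDir_apply (hσ : σ.Nonempty) (z : Fin (codim σ) → ℝ) (v : V) :
    simplexDir σ hσ z v = ∑ i : Fin (codim σ), z i *
      ((Pi.single (vtx σ hσ i.succ) 1 : V → ℝ) v - (Pi.single (vtx σ hσ 0) 1 : V → ℝ) v) := by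
  simp [simplexDir, Finset.sum_apply]

theorem sum_simplexDir (hσ : σ.Nonempty) (z : Fin (codim σ) → ℝ) :
    ∑ v, simplexDir σ hσ z v = 0 := by
  simp only [simplexDir_apply]
  rw [Finset.sum_comm]
  refine Finset.sum_eq_zero fun i _ => ?_
  rw [← Finset.mul_sum, Finset.sum_sub_distrib]
  simp

theorem simplexDir_of_notMem (hσ : σ.Nonempty) (z : Fin (codim σ) → ℝ) {v : V} (hv : v ∉ σ) :
    simplexDir σ hσ z v = 0 := by
  rw [simplexDir_apply]
  refine Finset.sum_eq_zero fun i _ => ?_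
  have h : ∀ j, v ≠ vtx σ hσ j := fun j h => hv (h ▸ vtx_mem hσ j)
  rw [Pi.single_eq_of_ne (h _), Pi.single_eq_of_ne (h _), sub_zero, mul_zero]

theorem simplexDir_injective (hσ : σ.Nonempty) {z : Fin (codim σ) → ℝ}
    (h : simplexDir σ hσ z = 0) : z = 0 := by
  funext j
  have h1 := congrFun h (vtx σ hσ j.succ)
  rw [simplexDir_apply, Finset.sum_eq_single j] at h1
  · rwa [Pi.single_eq_same, Pi.single_eq_of_ne (fun h => Fin.succ_ne_zero j ((vtx σ hσ).injective h)),
      sub_zero, mul_one] at h1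
  · intro i _ hij
    rw [Pi.single_eq_of_ne (fun h => hij (Fin.succ_injective _ ((vtx σ hσ).injective h)).symm),
      Pi.single_eq_of_ne (fun h => Fin.succ_ne_zero j ((vtx σ hσ).injective h)), sub_zero, mul_zero]
  · simp

theorem add_simplexDir_mem (hσ : σ.Nonempty) {x : V → ℝ} (hx : x ∈ stdCell σ)
    {z : Fin (codim σ) → ℝ} (hz : ∀ v ∈ σ, 0 < (x + simplexDir σ hσ z) v) :
    x + simplexDir σ hσ z ∈ stdCell σ := by
  have h0 : ∀ v ∉ σ, (x + simplexDir σ hσ z) v = 0 := fun v hv => by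
    rw [Pi.add_apply, hx.2.2 v hv, simplexDir_of_notMem hσ z hv, add_zero]
  refine ⟨fun v => ?_, ?_, h0⟩
  · by_cases hv : v ∈ σ
    · exact (hz v hv).le
    · exact (h0 v hv).ge
  · simp only [Pi.add_apply]
    rw [Finset.sum_add_distrib, hx.2.1, sum_simplexDir, add_zero]

/-- In the normal coordinates `y` of the dual cell, the parametrization `j` of the simplex has a
zero at the meeting point, and transversality makes the derivative of `y ∘ j` injective there. So
the zero persists. -/
theorem IsDualSubdivision.eventually_meets (hD : IsDualSubdivision P D) (hτ : τ ∈ P.complex.faces)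
    (hb : P.cell τ ⊆ (𝓡∂ n).boundary Q) :
    ∀ᶠ φ : Q ≃ₘ^∞⟮𝓡∂ n, 𝓡∂ n⟯ Q in c1Nhds n Q, (dualCell (fun v => φ '' D v) τ ∩ P.cell τ).Nonempty := by
  have hne : τ.Nonempty := P.nonempty_of_mem hτ
  obtain ⟨x₀, hx₀, hxq, hxt⟩ := hD.transverse τ hτ
  have hx₀D : P.real x₀ ∈ dualCell D τ := by
    have : P.real x₀ ∈ dualCell D τ ∩ P.cell τ := by rw [hxq]; rfl
    exact this.1
  set x : V → ℝ := x₀ + simplexDir τ hne 0 with hx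
  have hxx : x = x₀ := by rw [hx, map_zero, add_zero]
  -- The base point of the parametrization is `x₀ + 0`; transversality is restated so that it can be
  -- used there without rewriting in the tangent spaces.
  have hxt' : ∀ x₁ : V → ℝ, x₁ = x₀ →
      ∀ L : TangentSpace 𝓘(ℝ, V → ℝ) x₁ →L[ℝ] TangentSpace (𝓡∂ n) (P.real x₁),
      HasMFDerivWithinAt 𝓘(ℝ, V → ℝ) (𝓡∂ n) P.real (stdCell τ) x₁ L →
      ∀ w : V → ℝ, ∑ v, w v = 0 → (∀ v ∉ τ, w v = 0) →
        L w ∈ tangentAt n (dualCell D τ) (P.real x₁) → w = 0 := by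
    rintro _ rfl
    exact hxt
  have hxs : x ∈ stdCell τ := by rw [hxx]; exact hx₀
  have hxD : P.real x ∈ dualCell D τ := by rw [hxx]; exact hx₀D
  have hxc : P.real x ∈ P.cell τ := mem_image_of_mem _ hxs
  obtain ⟨O, y, hy, hyb⟩ := hD.localModel τ hτ _ (hD.mem_stratum_of_meets hτ hxc hxD)
  obtain ⟨O', hO', hxO', hm⟩ := hy.exists_hModel hne
  have hcell : ∀ q ∈ O', q ∈ dualCell D τ ↔ y q = 0 := fun q hq => by
    rw [hm.mem_dualCell_iff hne hq, modelY_homog]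
  set U : Set (Fin (codim τ) → ℝ) := {z | ∀ v ∈ τ, 0 < (x₀ + simplexDir τ hne z) v} with hU
  have hUo : IsOpen U := by
    rw [hU]
    simp only [ofPred_forall]
    exact isOpen_biInter_finset fun v _ => isOpen_lt continuous_const
      ((continuous_apply v).comp (continuous_const.add (simplexDir τ hne).continuous))
  have hU0 : (0 : Fin (codim τ) → ℝ) ∈ U := fun v hv => by
    rw [← hx, hxx]
    exact hD.pos_of_meets hτ hx₀ hx₀D hv
  have hUs : MapsTo (fun z => x₀ + simplexDir τ hne z) U (stdCell τ) := fun z hz =>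
    add_simplexDir_mem hne hx₀ hz
  set j : (Fin (codim τ) → ℝ) → Q := fun z => P.real (x₀ + simplexDir τ hne z) with hj
  have hjs : ContMDiffOn 𝓘(ℝ, Fin (codim τ) → ℝ) (𝓡∂ n) ∞ j U :=
    (P.smooth τ hτ).comp (ContDiff.contMDiff (contDiff_const.add
      (simplexDir τ hne).contDiff)).contMDiffOn hUs
  have hjc : ∀ z ∈ U, j z ∈ P.cell τ := fun z hz => mem_image_of_mem _ (hUs hz)
  have hL := ((P.smooth τ hτ).mdifferentiableOn (by simp) x hxs).hasMFDerivWithinAt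
  have hg : HasMFDerivAt 𝓘(ℝ, Fin (codim τ) → ℝ) 𝓘(ℝ, V → ℝ) (fun z => x₀ + simplexDir τ hne z) 0
      (simplexDir τ hne) :=
    ((simplexDir τ hne).hasFDerivAt.const_add x₀).hasMFDerivAt
  have hUs' : U ⊆ (fun z => x₀ + simplexDir τ hne z) ⁻¹' stdCell τ := hUs
  have hjd := (HasMFDerivWithinAt.comp (0 : Fin (codim τ) → ℝ) hL
    (hg.hasMFDerivWithinAt (s := U)) hUs').hasMFDerivAt (hUo.mem_nhds hU0)
  have hmf : ∀ w, mfderiv 𝓘(ℝ, Fin (codim τ) → ℝ) (𝓡∂ n) j 0 w =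
      mfderivWithin 𝓘(ℝ, V → ℝ) (𝓡∂ n) P.real (stdCell τ) x (simplexDir τ hne w) := fun w =>
    DFunLike.congr_fun hjd.mfderiv w
  have hj0 : j 0 = P.real x := rfl
  have hz := eventually_exists_zero hUo hU0 hjs hm.isOpen (hy.smooth.mono hO') hxO'
    ((hcell _ hxO').1 hxD) (fun w hw => by
      -- The simplex lies in `∂Q`, so its tangent vectors are killed by the boundary coordinate; if
      -- they are killed by `y` too, they are tangent to the dual cell, against transversality.
      have htan : mfderiv 𝓘(ℝ, Fin (codim τ) → ℝ) (𝓡∂ n) j 0 w ∈ tangentAt n (dualCell D τ) (j 0) := by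
        refine mem_tangentAt_of_boundary (hb hxc)
          (hy.smooth.contMDiffAt (hy.isOpen.mem_nhds hy.mem)) (hyb (hb hxc)) ?_ ?_ hw
        · filter_upwards [hm.isOpen.mem_nhds hxO'] with p hp hpy
          exact (hcell p hp).2 (hpy.trans ((hcell _ hxO').1 hxD))
        · have h1 : (fun z => boundaryCoord n (j 0) (j z)) =ᶠ[𝓝 0] fun _ => (0 : ℝ) := by
            have hc : ContinuousAt j 0 := (hjs.contMDiffAt (hUo.mem_nhds hU0)).continuousAt
            filter_upwards [hUo.mem_nhds hU0, hc.eventually (eventually_boundaryCoord (n := n) (j 0))]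
              with z hz1 hz2 using hz2 (hb (hjc z hz1))
          have h2 := mfderiv_comp_apply (0 : Fin (codim τ) → ℝ) (I := 𝓘(ℝ, Fin (codim τ) → ℝ))
            (I' := 𝓡∂ n) (I'' := 𝓘(ℝ, ℝ)) (g := boundaryCoord n (j 0)) (f := j)
            ((contMDiffAt_boundaryCoord (j 0)).mdifferentiableAt (by simp))
            ((hjs.contMDiffAt (hUo.mem_nhds hU0)).mdifferentiableAt (by simp)) w
          refine h2.symm.trans ?_
          have h3 := (h1.mfderiv_eq (I := 𝓘(ℝ, Fin (codim τ) → ℝ)) (I' := 𝓘(ℝ, ℝ))).trans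
            (mfderiv_const)
          exact DFunLike.congr_fun h3 w
      have htan' : mfderivWithin 𝓘(ℝ, V → ℝ) (𝓡∂ n) P.real (stdCell τ) x (simplexDir τ hne w) ∈
          tangentAt n (dualCell D τ) (P.real x) := (hmf w) ▸ htan
      exact simplexDir_injective hne (hxt' x hxx _ hL _ (sum_simplexDir hne w)
        (fun v hv => simplexDir_of_notMem hne w hv) htan'))
  filter_upwards [hz] with φ hφ
  obtain ⟨z, hzU, hzO, hz0⟩ := hφ
  refine ⟨j z, ?_, hjc z hzU⟩
  rw [dualCell_image, mem_image_diffeomorph_iff]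
  exact (hcell _ hzO).2 hz0

/-- A cell which meets a simplex of `∂⁺` has its own simplex as a face of it; conversely a simplex
of `∂⁺` lies in `∂Q` and meets its dual cell. The neighbourhood depends only on the finitely many
simplices, not on `H`. -/
theorem IsDualSubdivision.eventually_mem_plusCells (hD : IsDualSubdivision P D) :
    ∀ᶠ φ : Q ≃ₘ^∞⟮𝓡∂ n, 𝓡∂ n⟯ Q in c1Nhds n Q, ∀ H : (𝓡∂ n).boundary Q → ℝ, ∀ τ ∈ P.complex.faces,
      τ ∈ plusCells P (fun v => φ '' D v) H ↔ τ ∈ plusFaces P H := by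
  have h1 : ∀ᶠ φ : Q ≃ₘ^∞⟮𝓡∂ n, 𝓡∂ n⟯ Q in c1Nhds n Q, ∀ τ ∈ P.complex.faces,
      P.cell τ ⊆ (𝓡∂ n).boundary Q →
      (dualCell (fun v => φ '' D v) τ ∩ P.cell τ).Nonempty :=
    eventually_all.2 fun τ => eventually_imp_distrib_left.2 fun hτ =>
      eventually_imp_distrib_left.2 fun hb => hD.eventually_meets hτ hb
  filter_upwards [hD.eventually_subset_of_meets, h1] with φ h2 h3 H τ hτ
  constructor
  · rintro ⟨σ, hσ, hm⟩
    exact mem_plusFaces_of_subset hσ (h2 σ hσ.1 τ hτ hm) (P.nonempty_of_mem hτ)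
  · intro h
    obtain ⟨_, κ, hκ, hτκ, hb, _⟩ := id h
    exact ⟨τ, h, h3 τ hτ ((P.cell_mono hτκ).trans hb)⟩

end PlusCells

end

/-! ### Functors without higher components. -/

noncomputable section

section StrictFunctor

open Comp

/-- Some entry is zero. -/
def Comp.HasZero {A : AInftyHoms.{u, v}} : ∀ {X Y : A.Ob}, Comp A X Y → Prop
  | _, _, nil _ => False
  | _, _, cons f p => f = 0 ∨ p.HasZero

variable {A : AInftyData.{u, v}} {B : AInftyData.{u', v'}} {F : AInftyMap A B}

/-- A block of length at least two is mapped to zero. If there is none, all blocks have length one,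
and there are as many blocks as entries. -/
theorem AInftyMap.hasZero_or_length_of_mem_blocksFrom
    (higher : ∀ {X Y : A.Ob} (w : Comp A.toAInftyHoms X Y), 2 ≤ w.length → F.map w = 0) :
    ∀ {X Y Z : A.Ob} (acc : Comp A.toAInftyHoms X Y) (p : Comp A.toAInftyHoms Y Z),
      0 < acc.length → ∀ z ∈ F.blocksFrom acc p,
        z.HasZero ∨ acc.length + p.length = z.length
  | _, _, _, acc, .nil _, h0, z, hz => by
    simp only [AInftyMap.blocksFrom, List.mem_singleton] at hz
    subst hz
    by_cases h : 2 ≤ acc.length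
    · exact Or.inl (Or.inl (higher acc h))
    · right
      simp only [length]
      omega
  | _, _, _, acc, .cons f p, h0, z, hz => by
    simp only [AInftyMap.blocksFrom, List.mem_append, List.mem_map] at hz
    rcases hz with hz | ⟨z, hz, rfl⟩
    · refine (hasZero_or_length_of_mem_blocksFrom higher _ p (by rw [length_append]; omega) z
        hz).imp id fun h => ?_
      rw [← h, length_append]
      simp only [length]
      omega
    · by_cases h : 2 ≤ acc.length
      · exact Or.inl (Or.inl (higher acc h))
      · refine (hasZero_or_length_of_mem_blocksFrom higher _ p (by simp [length]) z
          hz).imp Or.inr fun h => ?_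
        simp only [length] at h ⊢
        omega

/-- A map which preserves the differentials and the products, and has no higher components, is
an A∞ functor if there are no higher products. -/
theorem AInftyMap.isFunctor_of_strict
    (transverse : ∀ l : List A.Ob, A.Transverse l → B.Transverse (l.map F.obj))
    (higher : ∀ {X Y : A.Ob} (w : Comp A.toAInftyHoms X Y), 2 ≤ w.length → F.map w = 0)
    (higherA : ∀ {X Y : A.Ob} (w : Comp A.toAInftyHoms X Y), 3 ≤ w.length → A.μ w = 0)
    (higherB : ∀ {X Y : B.Ob} (w : Comp B.toAInftyHoms X Y), 3 ≤ w.length → B.μ w = 0)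
    (zeroB : ∀ {X Y : B.Ob} (w : Comp B.toAInftyHoms X Y), w.HasZero → B.μ w = 0)
    (zero : ∀ X Y : A.Ob, F.map (cons (0 : A.Hom X Y) (nil Y)) = 0)
    (map_add : ∀ {X Y : A.Ob} (f g : A.Hom X Y),
      F.map (cons (f + g) (nil Y)) = F.map (cons f (nil Y)) + F.map (cons g (nil Y)))
    (degree : ∀ {X Y : A.Ob} (k : ℤ), ∀ a ∈ A.gr X Y k,
      F.map (cons a (nil Y)) ∈ B.gr (F.obj X) (F.obj Y) k)
    (map_d : ∀ {X Y : A.Ob} (a : A.Hom X Y),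
      B.μ (cons (F.map (cons a (nil Y))) (nil _)) = F.map (cons (A.μ (cons a (nil Y))) (nil Y)))
    (map_mul : ∀ {X Y Z : A.Ob}, A.Transverse [X, Y, Z] → ∀ (a : A.Hom X Y) (b : A.Hom Y Z),
      B.μ (cons (F.map (cons a (nil Y))) (cons (F.map (cons b (nil Z))) (nil _))) =
        F.map (cons (A.μ (cons a (cons b (nil Z)))) (nil Z))) : F.IsFunctor where
  transverse := transverse
  multilinear := by
    intro X Y Z W p f g q _ _ _
    by_cases h : 2 ≤ p.length + (q.length + 1)
    · rw [higher, higher, higher, add_zero] <;> simp only [length_append, length] <;> omega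
    · rcases p with _ | ⟨a, p⟩
      · rcases q with _ | ⟨b, q⟩
        · exact map_add f g
        · simp only [length] at h; omega
      · simp only [length] at h; omega
  degree := by
    intro X Y w ks _ h0 hks
    by_cases h : 2 ≤ w.length
    · rw [higher w h]
      exact zero_mem _
    · rcases w with _ | ⟨a, _ | ⟨b, w⟩⟩
      · simp [length] at h0
      · rcases ks with _ | ⟨k, ks⟩
        · exact hks.elim
        · obtain ⟨ha, hk⟩ := hks
          simp only [HasDegrees] at hk
          subst hk
          have := degree k a ha
          convert this using 2
          simp [length]
      · simp only [length] at h; omega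
  ainfty := by
    intro X Y w ks hT h0 hks
    rcases w with _ | ⟨a, _ | ⟨b, _ | ⟨c, w⟩⟩⟩
    · simp [length] at h0
    · rw [insertSum_one, ← map_d a]
      simp [AInftyMap.blocks, AInftyMap.blocksFrom]
    · rcases ks with _ | ⟨k, ks⟩
      · exact hks.elim
      · rw [insertSum_two, ← map_mul hT a b, higher _ (by simp [length]),
          higher (cons a (cons _ _)) (by simp [length]), smul_zero, add_zero, zero_add]
        have h1 : B.μ (cons (F.map (cons a (cons b (nil Y)))) (nil _)) = 0 :=
          zeroB _ (Or.inl (higher _ (by simp [length])))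
        simp [AInftyMap.blocks, AInftyMap.blocksFrom, append, h1]
    -- With three or more entries both sides vanish: on the left there is a zero entry or a higher
    -- product, and on the right an insertion leaves at least two entries or is itself a higher
    -- product.
    · rw [insertSum_eq_zero]
      · refine List.sum_eq_zero fun x hx => ?_
        obtain ⟨z, hz, rfl⟩ := List.mem_map.1 hx
        rcases AInftyMap.hasZero_or_length_of_mem_blocksFrom higher _ _ (by simp [length]) z hz with
          h | h
        · exact zeroB z h
        · refine higherB z ?_
          simp only [length] at h
          omega
      · intro Y₁ Y₂ p q r hq hl
        simp only [length] at hl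
        by_cases h : 2 ≤ p.length + (r.length + 1)
        · exact higher _ (by rw [length_append]; exact h)
        · rw [higherA q (by omega)]
          rcases p with _ | ⟨a', p⟩
          · rcases r with _ | ⟨b', r⟩
            · exact zero _ _
            · simp only [length] at h; omega
          · simp only [length] at h; omega

/-- A chain map which is bijective in every degree induces isomorphisms on homology. -/
theorem inducesIsoOnHomology_of_bijOn {X Y : A.Ob} {X' Y' : B.Ob} {f : A.Hom X Y → B.Hom X' Y'}
    (hf : ∀ k, BijOn f {a | a ∈ A.gr X Y k} {b | b ∈ B.gr X' Y' k}) (hinj : Function.Injective f)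
    (h0 : f 0 = 0) (hd : ∀ a, B.d (f a) = f (A.d a)) (hB : B.d (0 : B.Hom X' Y') = 0) :
    InducesIsoOnHomology A B f := by
  refine fun k => ⟨fun a _ _ ⟨b, hb, hba⟩ => ?_, fun b hb hb0 => ?_⟩
  · obtain ⟨c, hc, rfl⟩ := (hf (k - 1)).surjOn hb
    exact ⟨c, hc, hinj ((hd c).symm.trans hba)⟩
  · obtain ⟨a, ha, rfl⟩ := (hf k).surjOn hb
    refine ⟨a, ha, hinj ?_, 0, zero_mem _, ?_⟩
    · rw [← hd a, hb0, h0]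
    · rw [hB, sub_self]

end StrictFunctor

/-! ### Regularity of close subdivisions, and zero chains. -/

section Cell

variable {n : ℕ} [NeZero n] {Q : Type u} [MetricSpace Q] [ChartedSpace (EuclideanHalfSpace n) Q]
  [IsManifold (𝓡∂ n) ∞ Q] {V : Type v} [Fintype V] [LinearOrder V]
  {oQ : CellOrientation n (univ : Set Q) ((𝓡∂ n).interior Q) n}
  {P : SmoothTriangulation n Q V} {D : V → Set Q} {ε : ℝ} {𝒰 : Set (Q ≃ₘ^∞⟮𝓡∂ n, 𝓡∂ n⟯ Q)}

theorem CellOb.isRegular (hD : IsDualSubdivision P D) (X : CellOb D 𝒰) :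
    IsRegularSubdivision P X.sub := by
  obtain ⟨sub, ⟨φ, hφ, h⟩, fn⟩ := X
  obtain rfl : sub = fun v => φ '' D v := funext h
  exact hD.isRegular_image φ

theorem chainSign_zero {D' : V → Set Q} : chainSign (0 : CellularChain P D') = 0 := by
  funext σ
  simp [chainSign]

theorem intersectionProduct_zero_left {D₀ D₁ : V → Set Q} (c' : CellularChain P D₁) :
    intersectionProduct oQ (0 : CellularChain P D₀) c' = 0 := by
  funext σ τ
  refine Subtype.ext (funext fun oM => ?_)
  simp [intersectionProduct]

theorem intersectionProduct_zero_right {D₀ D₁ : V → Set Q} (c : CellularChain P D₀) :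
    intersectionProduct oQ c (0 : CellularChain P D₁) = 0 := by
  funext σ τ
  refine Subtype.ext (funext fun oM => ?_)
  simp [intersectionProduct]

theorem collapse_zero {D₀ D₁ : V → Set Q} : collapse D (0 : MeetChain P D₀ D₁) = 0 := by
  funext σ
  refine Subtype.ext (funext fun oM => ?_)
  simp [collapse]

theorem IsRegularSubdivision.dualCochain_zero {D' : V → Set Q} (h : IsRegularSubdivision P D') :
    dualCochain oQ (0 : CellularChain P D') = 0 :=
  funext fun σ => (h.dualCochain_apply_eq_zero_iff 0 σ).2 rfl

theorem IsRegularSubdivision.dualCochain_units_smul {D' : V → Set Q}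
    (h : IsRegularSubdivision P D') (s : ℤˣ) (c : CellularChain P D') :
    dualCochain oQ (s • c) = s • dualCochain oQ c := by
  rcases Int.units_eq_one_or s with rfl | rfl
  · simp
  · rw [Units.neg_smul, one_smul, Units.neg_smul, one_smul, h.dualCochain_neg]

end Cell

end

/-! ### The pre-category `Cell` and the functor to `Simp`. -/

noncomputable section

section CellCategory

open Comp

variable {n : ℕ} [NeZero n] {Q : Type u} [MetricSpace Q] [ChartedSpace (EuclideanHalfSpace n) Q]
  [IsManifold (𝓡∂ n) ∞ Q] {V : Type v} [Fintype V] [LinearOrder V]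
  {oQ : CellOrientation n (univ : Set Q) ((𝓡∂ n).interior Q) n}
  {P : SmoothTriangulation n Q V} {D : V → Set Q} {ε : ℝ} {𝒰 : Set (Q ≃ₘ^∞⟮𝓡∂ n, 𝓡∂ n⟯ Q)}

/-- The differential of `Cell(D)`. -/
def cellD {D' : V → Set Q} (a : CellularChain P D') : CellularChain P D' :=
  -cellBoundary (chainSign a)

/-- The product of `Cell(D)`. -/
def cellMul (oQ : CellOrientation n (univ : Set Q) ((𝓡∂ n).interior Q) n) (D : V → Set Q)
    {D₀ D₁ : V → Set Q} (a : CellularChain P D₀) (b : CellularChain P D₁) : CellularChain P D₁ :=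
  collapse D (intersectionProduct oQ (chainSign a) b)

theorem dualCochain_cellD (hD : IsDualSubdivision P D) (X : CellOb D 𝒰)
    (a : CellularChain P X.sub) : dualCochain oQ (cellD a) = coboundary (dualCochain oQ a) :=
  (X.isRegular hD).dualCochain_boundary a

theorem dualCochain_cellMul (hD : IsDualSubdivision P D) (hε : 0 < ε)
    (hess : ∀ σ ∈ P.complex.faces, (essentialPart n ε D σ).Nonempty) {X Y : CellOb D 𝒰}
    (hXY : SimplicialPosition P ε D X.sub Y.sub) (a : CellularChain P X.sub)
    (b : CellularChain P Y.sub) : dualCochain oQ (cellMul oQ D a b) =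
      cup (cochainSign (dualCochain oQ a)) (dualCochain oQ b) := by
  rw [← (X.isRegular hD).dualCochain_chainSign]
  exact hXY.dualCochain_collapse hD.isRegular (X.isRegular hD) (Y.isRegular hD) hε hess _ _

/-- The conclusion of `IsDualSubdivision.eventually_mem_plusCells`. -/
abbrev DetectsPlus (P : SmoothTriangulation n Q V) (D : V → Set Q)
    (𝒰 : Set (Q ≃ₘ^∞⟮𝓡∂ n, 𝓡∂ n⟯ Q)) : Prop :=
  ∀ φ ∈ 𝒰, ∀ H : (𝓡∂ n).boundary Q → ℝ, ∀ τ ∈ P.complex.faces,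
    τ ∈ plusCells P (fun v => φ '' D v) H ↔ τ ∈ plusFaces P H

theorem CellOb.mem_plusCells_iff (h𝒰 : DetectsPlus P D 𝒰) (X : CellOb D 𝒰)
    (H : (𝓡∂ n).boundary Q → ℝ) {τ : Finset V} (hτ : τ ∈ P.complex.faces) :
    τ ∈ plusCells P X.sub H ↔ τ ∈ plusFaces P H := by
  obtain ⟨sub, ⟨φ, hφ, h⟩, fn⟩ := X
  obtain rfl : sub = fun v => φ '' D v := funext h
  exact h𝒰 φ hφ H τ hτ

theorem mem_cell_gr_iff (hD : IsDualSubdivision P D) (h𝒰 : DetectsPlus P D 𝒰) {X Y : CellOb D 𝒰}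
    {k : ℤ} {a : CellularChain P Y.sub} :
    a ∈ (Cell oQ P D ε 𝒰).gr X Y k ↔ dualCochain oQ a ∈ (Simp P).gr X.fn Y.fn k := by
  refine Iff.trans (b := ∀ σ : P.complex.faces, (σ.1 ∈ plusCells P Y.sub (Y.fn - X.fn) ∨
    (codim σ.1 : ℤ) ≠ k) → a σ = 0) Iff.rfl ?_
  rw [mem_simp_gr]
  refine forall_congr' fun σ => ?_
  rw [Y.mem_plusCells_iff h𝒰 _ σ.2, (Y.isRegular hD).dualCochain_apply_eq_zero_iff]

theorem bijOn_dualCochain (hD : IsDualSubdivision P D) (h𝒰 : DetectsPlus P D 𝒰) (X Y : CellOb D 𝒰)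
    (k : ℤ) : BijOn (dualCochain oQ (P := P) (D := Y.sub)) {a | a ∈ (Cell oQ P D ε 𝒰).gr X Y k}
      {φ | φ ∈ (Simp P).gr X.fn Y.fn k} := by
  have hb := (Y.isRegular hD).dualCochain_bijective (oQ := oQ)
  refine ⟨fun a ha => (mem_cell_gr_iff (ε := ε) hD h𝒰).1 ha, hb.1.injOn, fun φ hφ => ?_⟩
  obtain ⟨a, rfl⟩ := hb.2 φ
  exact ⟨a, (mem_cell_gr_iff (ε := ε) hD h𝒰).2 hφ, rfl⟩

theorem cell_higher {X Y : (Cell oQ P D ε 𝒰).Ob} (w : Comp (cellHoms P D ε 𝒰) X Y) (h : 3 ≤ w.length) :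
    (Cell oQ P D ε 𝒰).μ w = 0 := by
  rcases w with _ | ⟨a, _ | ⟨b, _ | ⟨c, w⟩⟩⟩
  · simp [Comp.length] at h
  · simp [Comp.length] at h
  · simp [Comp.length] at h
  · rfl

theorem simp_higher {X Y : (Simp P).Ob} (w : Comp (simpHoms P) X Y) (h : 3 ≤ w.length) :
    (Simp P).μ w = 0 := by
  rcases w with _ | ⟨a, _ | ⟨b, _ | ⟨c, w⟩⟩⟩
  · simp [Comp.length] at h
  · simp [Comp.length] at h
  · simp [Comp.length] at h
  · rfl

theorem simp_hasZero {X Y : (Simp P).Ob} (w : Comp (simpHoms P) X Y) (h : w.HasZero) :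
    (Simp P).μ w = 0 := by
  rcases w with _ | ⟨a, _ | ⟨b, _ | ⟨c, w⟩⟩⟩
  · exact h.elim
  · rcases h with rfl | h
    · exact coboundary_zero
    · exact h.elim
  · rcases h with rfl | rfl | h
    · exact signed_zero_cup (P := P) b
    · exact cup_zero (P := P) _
    · exact h.elim
  · rfl

/-- Both the products and the differentials correspond under `dualCochain`, which is injective, so
the relation is that of `Simp`. The other identities for `cellD` and for sums are transferred in the
same way. -/
theorem cellMul_leibniz (hD : IsDualSubdivision P D) (hε : 0 < ε)
    (hess : ∀ σ ∈ P.complex.faces, (essentialPart n ε D σ).Nonempty) {X Y : CellOb D 𝒰}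
    (hXY : SimplicialPosition P ε D X.sub Y.sub) (a : CellularChain P X.sub)
    (b : CellularChain P Y.sub) {k : ℤ}
    (ha : cochainSign (dualCochain oQ a) = (k.negOnePow : ℤˣ) • dualCochain oQ a) :
    cellMul oQ D (cellD a) b + cellD (cellMul oQ D a b) +
      ((k + 1).negOnePow : ℤˣ) • cellMul oQ D a (cellD b) = 0 := by
  have hr := Y.isRegular hD
  refine (hr.dualCochain_bijective (oQ := oQ)).1 ?_
  rw [hr.dualCochain_add, hr.dualCochain_add, hr.dualCochain_units_smul, hr.dualCochain_zero,
    dualCochain_cellMul hD hε hess hXY, dualCochain_cellMul hD hε hess hXY,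
    dualCochain_cellD hD, dualCochain_cellD hD, dualCochain_cellMul hD hε hess hXY,
    dualCochain_cellD hD]
  exact signed_leibniz ha _

/-- The intermediate products live on the last of the subdivisions involved: `(a b) c` uses the
pairs `(X, Y)` and `(Y, Z)`, and `a (b c)` uses `(Y, Z)` and `(X, Z)`. -/
theorem cellMul_assoc (hD : IsDualSubdivision P D) (hε : 0 < ε)
    (hess : ∀ σ ∈ P.complex.faces, (essentialPart n ε D σ).Nonempty) {X Y Z : CellOb D 𝒰}
    (hXY : SimplicialPosition P ε D X.sub Y.sub) (hYZ : SimplicialPosition P ε D Y.sub Z.sub)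
    (hXZ : SimplicialPosition P ε D X.sub Z.sub) (a : CellularChain P X.sub)
    (b : CellularChain P Y.sub) (c : CellularChain P Z.sub) {k : ℤ}
    (ha : cochainSign (dualCochain oQ a) = (k.negOnePow : ℤˣ) • dualCochain oQ a) :
    cellMul oQ D (cellMul oQ D a b) c +
      ((k + 1).negOnePow : ℤˣ) • cellMul oQ D a (cellMul oQ D b c) = 0 := by
  have hr := Z.isRegular hD
  refine (hr.dualCochain_bijective (oQ := oQ)).1 ?_
  rw [hr.dualCochain_add, hr.dualCochain_units_smul, hr.dualCochain_zero,
    dualCochain_cellMul hD hε hess hYZ, dualCochain_cellMul hD hε hess hXY,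
    dualCochain_cellMul hD hε hess hXZ, dualCochain_cellMul hD hε hess hYZ]
  exact signed_assoc ha _ _

theorem cellD_add (hD : IsDualSubdivision P D)
    (oQ : CellOrientation n (univ : Set Q) ((𝓡∂ n).interior Q) n) (X : CellOb D 𝒰)
    (f g : CellularChain P X.sub) : cellD (f + g) = cellD f + cellD g := by
  have hr := X.isRegular hD
  refine (hr.dualCochain_bijective (oQ := oQ)).1 ?_
  rw [hr.dualCochain_add, dualCochain_cellD hD, dualCochain_cellD hD, dualCochain_cellD hD,
    hr.dualCochain_add, coboundary_add]

theorem cellD_zero (hD : IsDualSubdivision P D)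
    (oQ : CellOrientation n (univ : Set Q) ((𝓡∂ n).interior Q) n) (X : CellOb D 𝒰) :
    cellD (0 : CellularChain P X.sub) = 0 := by
  have hr := X.isRegular hD
  refine (hr.dualCochain_bijective (oQ := oQ)).1 ?_
  rw [dualCochain_cellD hD, hr.dualCochain_zero, coboundary_zero]

theorem cellD_cellD (hD : IsDualSubdivision P D)
    (oQ : CellOrientation n (univ : Set Q) ((𝓡∂ n).interior Q) n) (X : CellOb D 𝒰)
    (a : CellularChain P X.sub) : cellD (cellD a) = 0 := by
  have hr := X.isRegular hD
  refine (hr.dualCochain_bijective (oQ := oQ)).1 ?_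
  rw [dualCochain_cellD hD, dualCochain_cellD hD, hr.dualCochain_zero, coboundary_coboundary]

theorem cellMul_add_left (hD : IsDualSubdivision P D) (hε : 0 < ε)
    (hess : ∀ σ ∈ P.complex.faces, (essentialPart n ε D σ).Nonempty) {X Y : CellOb D 𝒰}
    (hXY : SimplicialPosition P ε D X.sub Y.sub) (f g : CellularChain P X.sub)
    (b : CellularChain P Y.sub) :
    cellMul oQ D (f + g) b = cellMul oQ D f b + cellMul oQ D g b := by
  have hr := Y.isRegular hD
  refine (hr.dualCochain_bijective (oQ := oQ)).1 ?_
  rw [hr.dualCochain_add, dualCochain_cellMul hD hε hess hXY, dualCochain_cellMul hD hε hess hXY,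
    dualCochain_cellMul hD hε hess hXY, (X.isRegular hD).dualCochain_add, signed_add_cup]

theorem cellMul_add_right (hD : IsDualSubdivision P D) (hε : 0 < ε)
    (hess : ∀ σ ∈ P.complex.faces, (essentialPart n ε D σ).Nonempty) {X Y : CellOb D 𝒰}
    (hXY : SimplicialPosition P ε D X.sub Y.sub) (a : CellularChain P X.sub)
    (f g : CellularChain P Y.sub) :
    cellMul oQ D a (f + g) = cellMul oQ D a f + cellMul oQ D a g := by
  have hr := Y.isRegular hD
  refine (hr.dualCochain_bijective (oQ := oQ)).1 ?_
  rw [hr.dualCochain_add, dualCochain_cellMul hD hε hess hXY, dualCochain_cellMul hD hε hess hXY,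
    dualCochain_cellMul hD hε hess hXY, hr.dualCochain_add, cup_add]

/-- Morphisms are chains of the target subdivision, so the product of `X ⟶ Y` and `Y ⟶ Z` only
involves the subdivisions of `Y` and `Z`. -/
theorem cell_position {X Y Z : CellOb D 𝒰} (hT : (Cell oQ P D ε 𝒰).Transverse [X, Y, Z]) :
    SimplicialPosition P ε D Y.sub Z.sub :=
  (List.pairwise_cons.1 (List.pairwise_cons.1 hT.1).2).1 Z (List.mem_singleton_self Z)

theorem cellD_mem_gr (hD : IsDualSubdivision P D) (h𝒰 : DetectsPlus P D 𝒰) {X Y : CellOb D 𝒰}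
    {k : ℤ} {a : CellularChain P Y.sub} (ha : a ∈ (Cell oQ P D ε 𝒰).gr X Y k) :
    (cellD a : CellularChain P Y.sub) ∈ (Cell oQ P D ε 𝒰).gr X Y (k + 1) := by
  refine (mem_cell_gr_iff hD h𝒰).2 ?_
  rw [dualCochain_cellD hD]
  exact coboundary_mem_gr ((mem_cell_gr_iff hD h𝒰).1 ha)

theorem cellMul_mem_gr (hD : IsDualSubdivision P D) (hε : 0 < ε)
    (hess : ∀ σ ∈ P.complex.faces, (essentialPart n ε D σ).Nonempty) (h𝒰 : DetectsPlus P D 𝒰)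
    {X Y Z : CellOb D 𝒰} (hYZ : SimplicialPosition P ε D Y.sub Z.sub) {k l : ℤ}
    {a : CellularChain P Y.sub} {b : CellularChain P Z.sub} (ha : a ∈ (Cell oQ P D ε 𝒰).gr X Y k)
    (hb : b ∈ (Cell oQ P D ε 𝒰).gr Y Z l) :
    (cellMul oQ D a b : CellularChain P Z.sub) ∈ (Cell oQ P D ε 𝒰).gr X Z (k + l) := by
  refine (mem_cell_gr_iff hD h𝒰).2 ?_
  rw [dualCochain_cellMul hD hε hess hYZ]
  exact signed_cup_mem_gr ((mem_cell_gr_iff hD h𝒰).1 ha) ((mem_cell_gr_iff hD h𝒰).1 hb)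

theorem cellMul_zero_left {D₀ D₁ : V → Set Q} (b : CellularChain P D₁) :
    cellMul oQ D (0 : CellularChain P D₀) b = 0 := by
  rw [cellMul, chainSign_zero, intersectionProduct_zero_left, collapse_zero]

theorem cellMul_zero_right {D₀ D₁ : V → Set Q} (a : CellularChain P D₀) :
    cellMul oQ D a (0 : CellularChain P D₁) = 0 := by
  rw [cellMul, intersectionProduct_zero_right, collapse_zero]

theorem cell_isPrecategory (hD : IsDualSubdivision P D) (hε : 0 < ε)
    (hess : ∀ σ ∈ P.complex.faces, (essentialPart n ε D σ).Nonempty) (h𝒰 : DetectsPlus P D 𝒰) :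
    (Cell oQ P D ε 𝒰).IsPrecategory := by
  refine AInftyData.isPrecategory_of_dg _ ?_ ?_ ?_ ?_ ?_ ?_ ?_ ?_ ?_ ?_ ?_ ?_ ?_ ?_
  · intro l l' h hs
    exact ⟨List.Pairwise.sublist hs h.1, List.Pairwise.sublist (hs.map _) h.2⟩
  · intro X Y _
    exact iSupIndep_of_grading (fun σ : P.complex.faces => (codim σ.1 : ℤ)) _
      fun k f hf i hi => hf i (Or.inr hi)
  · intro X Y w hw
    exact cell_higher w hw
  · intro X Y
    exact cellD_zero hD oQ Y
  · intro X Y Z b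
    exact cellMul_zero_left b
  · intro X Y Z a
    exact cellMul_zero_right a
  · intro X Y _ f g
    exact cellD_add hD oQ Y f g
  · intro X Y Z hT f g b
    exact cellMul_add_left hD hε hess (cell_position hT) f g b
  · intro X Y Z hT a f g
    exact cellMul_add_right hD hε hess (cell_position hT) a f g
  · intro X Y _ k a ha
    exact cellD_mem_gr hD h𝒰 ha
  · intro X Y Z hT k l a ha b hb
    exact cellMul_mem_gr hD hε hess h𝒰 (cell_position hT) ha hb
  · intro X Y _ k a ha
    exact cellD_cellD hD oQ Y a
  · intro X Y Z hT k l a ha b hb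
    exact cellMul_leibniz hD hε hess (cell_position hT) a b
      (cochainSign_of_mem_gr ((mem_cell_gr_iff hD h𝒰).1 ha))
  · intro X Y Z W hT k l m a ha b hb c hc
    obtain ⟨-, h⟩ := List.pairwise_cons.1 hT.1
    obtain ⟨h1, h2⟩ := List.pairwise_cons.1 h
    exact cellMul_assoc hD hε hess (h1 Z List.mem_cons_self)
      ((List.pairwise_cons.1 h2).1 W (List.mem_singleton_self W))
      (h1 W (List.mem_cons_of_mem _ (List.mem_singleton_self W))) a b c
      (cochainSign_of_mem_gr ((mem_cell_gr_iff hD h𝒰).1 ha))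

/-- The functor which takes a cellular chain to the dual cochain. -/
def cellToSimp (oQ : CellOrientation n (univ : Set Q) ((𝓡∂ n).interior Q) n)
    (P : SmoothTriangulation n Q V) (D : V → Set Q) (ε : ℝ) (𝒰 : Set (Q ≃ₘ^∞⟮𝓡∂ n, 𝓡∂ n⟯ Q)) :
    AInftyFunctorData (Cell oQ P D ε 𝒰) (Simp P) where
  dom := univ
  toMap :=
    { obj := fun X => CellOb.fn X.1
      map := fun {X Y} w =>
        match X, Y, w with
        | _, _, .nil _ => (0 : Cochain P)
        | _, Y, .cons a (.nil _) =>
            (dualCochain oQ (a : CellularChain P (CellOb.sub Y.1)) : Cochain P)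
        | _, _, .cons _ (.cons _ _) => (0 : Cochain P) }

theorem cellToSimp_higher {X Y : ((Cell oQ P D ε 𝒰).full univ).Ob}
    (w : Comp ((Cell oQ P D ε 𝒰).full univ).toAInftyHoms X Y) (h : 2 ≤ w.length) :
    (cellToSimp oQ P D ε 𝒰).toMap.map w = 0 := by
  rcases w with _ | ⟨a, _ | ⟨b, w⟩⟩
  · simp [Comp.length] at h
  · simp [Comp.length] at h
  · rfl

theorem length_forget {A : AInftyHoms.{u, v}} {S : Set A.Ob} :
    ∀ {X Y : (A.full S).Ob} (w : Comp (A.full S) X Y), w.forget.length = w.length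
  | _, _, .nil _ => rfl
  | _, _, .cons _ p => congrArg (· + 1) (length_forget p)

theorem cellToSimp_isFunctor (hD : IsDualSubdivision P D) (hε : 0 < ε)
    (hess : ∀ σ ∈ P.complex.faces, (essentialPart n ε D σ).Nonempty) (h𝒰 : DetectsPlus P D 𝒰) :
    (cellToSimp oQ P D ε 𝒰).toMap.IsFunctor := by
  refine AInftyMap.isFunctor_of_strict ?_ ?_ ?_ ?_ ?_ ?_ ?_ ?_ ?_ ?_
  · intro l hl
    exact (List.map_map (f := Subtype.val) (g := CellOb.fn) (l := l)) ▸ hl.2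
  · intro X Y w hw
    exact cellToSimp_higher w hw
  · intro X Y w hw
    exact cell_higher w.forget (hw.trans_eq (length_forget w).symm)
  · intro X Y w hw
    exact simp_higher w hw
  · intro X Y w hw
    exact simp_hasZero w hw
  · intro X Y
    exact (CellOb.isRegular hD Y.1).dualCochain_zero
  · intro X Y f g
    exact (CellOb.isRegular hD Y.1).dualCochain_add f g
  · intro X Y k a ha
    exact (mem_cell_gr_iff (ε := ε) hD h𝒰).1 ha
  · intro X Y a
    exact (dualCochain_cellD hD Y.1 a).symm
  · intro X Y Z hT a b
    exact (dualCochain_cellMul hD hε hess (cell_position hT) a b).symm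

theorem cellToSimp_isQuasiEquivalence (hD : IsDualSubdivision P D) (hε : 0 < ε)
    (hess : ∀ σ ∈ P.complex.faces, (essentialPart n ε D σ).Nonempty) (h𝒰 : DetectsPlus P D 𝒰)
    (hrefl : Diffeomorph.refl (𝓡∂ n) Q ∞ ∈ 𝒰) : (cellToSimp oQ P D ε 𝒰).IsQuasiEquivalence where
  essSurj_dom X := ⟨X, mem_univ X, Relation.EqvGen.refl X⟩
  isFunctor := cellToSimp_isFunctor hD hε hess h𝒰
  quasiIso X Y _ := inducesIsoOnHomology_of_bijOn 
    (fun k => bijOn_dualCochain (ε := ε) hD h𝒰 X.1 Y.1 k)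
    ((CellOb.isRegular hD Y.1).dualCochain_bijective).1
    ((CellOb.isRegular hD Y.1).dualCochain_zero) (fun a => (dualCochain_cellD hD Y.1 a).symm)
    coboundary_zero
  -- The identity belongs to `𝒰`, so `D` itself with the function `H` is an object over `H`.
  essSurj H := ⟨⟨⟨D, ⟨_, hrefl, fun v => by simp⟩, H⟩, mem_univ _⟩, Relation.EqvGen.refl H⟩

end CellCategory

end

/-! ### The main theorem. -/

theorem mainTheorem11 {n : ℕ} [NeZero n] {Q : Type*} [MetricSpace Q] [CompactSpace Q]
    [ChartedSpace (EuclideanHalfSpace n) Q] [IsManifold (𝓡∂ n) ∞ Q]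
    (oQ : CellOrientation n (univ : Set Q) ((𝓡∂ n).interior Q) n)
    {V : Type*} [Fintype V] [LinearOrder V] (P : SmoothTriangulation n Q V)
    (D : V → Set Q) (hD : IsDualSubdivision P D) :
    ∃ ε₀ > (0 : ℝ), ∃ 𝒰₀ ∈ c1Nhds n Q, ∀ ε, 0 < ε → ε < ε₀ → ∀ 𝒰 ∈ c1Nhds n Q, 𝒰 ⊆ 𝒰₀ →
      (Simp P).IsPrecategory ∧ (Cell oQ P D ε 𝒰).IsPrecategory ∧
      (∃ F : AInftyFunctorData (Cell oQ P D ε 𝒰) (Simp P),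
        F.IsQuasiEquivalence ∧
        -- the functor is the forgetful map on objects, and is defined on all of them
        F.dom = univ ∧ (∀ X, F.toMap.obj X = CellOb.fn X.1) ∧
        -- on morphisms, it identifies cellular chains with the dual cochains
        (∀ X Y, ((Cell oQ P D ε 𝒰).full F.dom).Transverse [X, Y] →
          ∀ a : CellularChain P (CellOb.sub Y.1),
            F.toMap.map (X := X) (Y := Y) (.cons a (.nil Y)) = dualCochain oQ a) ∧
        ∀ X Y (w : Comp ((Cell oQ P D ε 𝒰).full F.dom).toAInftyHoms X Y),
          2 ≤ w.length → F.toMap.map w = 0) ∧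
      -- this identification is bijective in each degree
      (∀ X Y : CellOb D 𝒰, (Cell oQ P D ε 𝒰).Transverse [X, Y] → ∀ k : ℤ,
        BijOn (dualCochain oQ (P := P) (D := Y.sub)) {a | a ∈ (Cell oQ P D ε 𝒰).gr X Y k}
          {φ | φ ∈ (Simp P).gr X.fn Y.fn k}) ∧
      -- and intersection followed by collapse corresponds to the cup product
      ∀ X₀ X₁ X₂ : CellOb D 𝒰, (Cell oQ P D ε 𝒰).Transverse [X₀, X₁, X₂] →
        ∀ (k l : ℤ), ∀ a ∈ (Cell oQ P D ε 𝒰).gr X₀ X₁ k, ∀ b ∈ (Cell oQ P D ε 𝒰).gr X₁ X₂ l,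
          dualCochain oQ (P := P) (collapse D (intersectionProduct oQ a b)) =
            cup (dualCochain oQ (P := P) a) (dualCochain oQ (P := P) b) := by
  obtain ⟨ε₀, hε₀, hess⟩ := hD.exists_essentialPart
  -- The neighbourhood `𝒰₀` is the set of diffeomorphisms for which the cells of `∂⁺` are exactly
  -- those dual to the simplices of `∂⁺`, for all functions on `∂Q` at once.
  refine ⟨ε₀, hε₀, _, hD.eventually_mem_plusCells, fun ε hε hεε₀ 𝒰 h𝒰 hsub => ?_⟩
  have hplus : DetectsPlus P D 𝒰 := fun φ hφ => hsub hφ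
  have hrefl : Diffeomorph.refl (𝓡∂ n) Q ∞ ∈ 𝒰 := by
    let := c1Topology n Q
    exact mem_of_mem_nhds h𝒰
  refine ⟨simp_isPrecategory, cell_isPrecategory hD hε (hess ε hεε₀) hplus,
    ⟨cellToSimp oQ P D ε 𝒰, cellToSimp_isQuasiEquivalence hD hε (hess ε hεε₀) hplus hrefl, rfl,
      fun X => rfl, fun X Y _ a => rfl, fun X Y w hw => cellToSimp_higher w hw⟩,
    fun X Y _ k => bijOn_dualCochain hD hplus X Y k, fun X₀ X₁ X₂ hT k l a _ b _ => ?_⟩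
  exact (cell_position hT).dualCochain_collapse hD.isRegular (X₁.isRegular hD) (X₂.isRegular hD) hε
    (hess ε hεε₀) a b
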